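/- **Conventions.** Algorithms are programs for a word RAM with unit-cost operations on words of $O(\log N)$ bits ($N$ a measure of the input, polynomially related to its length and to the magnitude of its words); a randomized algorithm also has polynomially many fair random bits, and "solves with error probability at most $1/3$" means that on every fixed input sequence all its answers are correct with probability at least $2/3$, while the time bounds hold for all random bits. A *dynamic problem* $\mathcal P$ has initial data structures $D$ of size $|D|$ (bounded by a polynomial in the measure of the encoding of $D$), a set $\mathcal X$ of updates and a set $\mathcal Q$ of queries for each $D$, each request and each answer being one word; a *request sequence* is a sequence in $\mathcal X\cup\mathcal Q$, revealed one request at a time, and each query must be answered correctly (for the current data structure) before the next request is revealed. The algorithm preprocesses $D$ first; it has *update time $U$ and query time $Q$* if, after preprocessing in polynomial time, any sequence with $a$ updates and $b$ queries takes total time at most $a\,U(|D|)+b\,Q(|D|)$ (amortized bounds; worst-case bounds are a special case). *OuMv conjecture.* For no $\varepsilon>0$ is there an algorithm that preprocesses a Boolean $n\times n$ matrix $M$ in polynomial time, then receives online $n$ pairs $(\vec u_k,\vec v_k)$ of Boolean vectors, and outputs each Boolean product $\vec u_k^{\top}M\vec v_k$ before the next pair arrives, with total time $O(n^{3-\varepsilon})$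 for all pairs and error probability at most $1/3$. In *$\gamma$-OuMv* the matrix has size $n_1\times n_2$ with $n_1=\lfloor n_2^{\gamma}\rfloor$, and there are $n_3$ pairs; here $n_2,n_3\ge 1$. *Delayed predictions.* A sequence $\hat\rho=(\hat\rho_1,\dots,\hat\rho_T)$ is a *$d$-delayed prediction* for a set $\mathcal S$ of request sequences of length $T$ if for every $\rho\in\mathcal S$ there is a permutation $\pi$ of $\{1,\dots,T\}$ with $\hat\rho_t=\rho_{\pi(t)}$ and $|\pi^{-1}(t)-t|\le d$ for all $t$. An algorithm *solves $\mathcal P$ with $d$-delayed predictions* if, given in preprocessing $D$, $d$ and a $d$-delayed prediction for $\mathcal S$, it answers all queries of every $\rho\in\mathcal S$, with error probability at most $1/3$. *Cyclic updates.* An update $x$ has *cyclic order* $m\ge 1$ if inserting or removing exactly $m$ copies of $x$, at arbitrary places inside a segment of a request sequence, never changes the correct answers to queries outside that segment. *Local reducibility.* Let $u,q,n:\mathbb N\times\mathbb N\to\mathbb N$. The problem $\mathcal P$ is *$(u,q)$-locally reducible from $\gamma$-OuMv* (with instances of size $n(n_1,n_2)$) if there is a sequence $B=B(n_1,n_2)$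 of $u(n_1,n_2)$ updates and $q(n_1,n_2)$ queries such that 1. $n_1=\lfloor n_2^\gamma\rfloor$, $B$, and for each update $x$ in $B$ a number $\mathrm{ord}(x)$ are computed from $n_2$ in time polynomial in $n_2$; 2. for every $\gamma$-OuMv instance $M,(\vec u_k,\vec v_k)_{k\le n_3}$ there are an initial data structure $D_0$ of size $n(n_1,n_2)$, computed from $(n_1,n_2,n_3,M)$ in polynomial time, for which all requests in $B$ are possible, and blocks $B'_1,\dots,B'_{n_3}$, each an ordering of some sub-multiset of $B$; $B'_k$ is computed online in time $O(n_1+n_2+u(n_1,n_2)+q(n_1,n_2)+1)$ when $(\vec u_k,\vec v_k)$ arrives and does not depend on the answers to queries; and if the request sequence $B'_1\circ\dots\circ B'_{n_3}$ is applied to $D_0$, then each $\vec u_k^{\top}M\vec v_k$ is computed in time $O(q(n_1,n_2)+1)$ from correct answers to the queries in $B'_1\circ\dots\circ B'_k$; 3. every update $x$ in $B$ has cyclic order $\mathrm{ord}(x)$ for $D_0$. (The procedures in 1 and 2 are deterministic, and the time bounds in 2 hold whatever words are supplied as answers. The *universal request sequence* is the concatenation of $n_3$ copies of $B$.) For $f:\mathbb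 N^3\to\mathbb N$ write $f(n_1,n_2,n_3)=\tilde{\tilde o}(n_1n_2n_3)$ if there are $\varepsilon,N,K>0$ with $f(n_1,n_2,n_3)\le K\,(n_1^{1-\varepsilon}n_2n_3+n_1n_2^{1-\varepsilon}n_3+n_1n_2n_3^{1-\varepsilon})$ for all $n_1,n_2,n_3>N$ with $n_1=\lfloor n_2^{\gamma}\rfloor$. **Theorem.** Let $\gamma>0$ be a constant, let $\mathcal P$ be a dynamic problem that is $(u,q)$-locally reducible from $\gamma$-OuMv with instances of size $n=n(n_1,n_2)$, and let $C$ be a constant with $\mathrm{ord}(x)\le C$ for all updates $x$ in $B(n_1,n_2)$ and all $n_2\ge1$, $n_1=\lfloor n_2^\gamma\rfloor$. If the OuMv conjecture is true, then there is no algorithm that, for all $n_2\ge 1$ and $n_1=\lfloor n_2^\gamma\rfloor$, solves $\mathcal P$ on initial data structures of size $n(n_1,n_2)$ with $(1+C)\,(u(n_1,n_2)+q(n_1,n_2))$-delayed predictions, with error probability at most $1/3$, polynomial preprocessing time, and update time $U(n)$ and query time $Q(n)$ satisfying $$n_3\bigl(u(n_1,n_2)\,U(n)+q(n_1,n_2)\,Q(n)\bigr)=\tilde{\tilde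 o}(n_1n_2n_3).$$ -/

import Mathlib

open Asymptotics Filter

namespace DelayedPredictions

/-! ## Word RAM with named arrays and unit-cost operations on words -/

/-- Memory: finitely many of the countably many arrays are mentioned by a program;
every cell holds a natural number and is `0` unless something was written to it. -/
abbrev Mem := ℕ → ℕ → ℕ

/-- An array that holds the list `l` has the length in cell `0` and `l` in cells `1, 2, …`. -/
def cell (l : List ℕ) (i : ℕ) : ℕ := if i = 0 then l.length else l.getD (i - 1) 0

/-- Write the list `l` to array `a`; the cells beyond the list keep their contents. -/
def Mem.load (m : Mem) (a : ℕ) (l : List ℕ) : Mem :=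
  fun b i => if b = a ∧ i ≤ l.length then cell l i else m b i

/-- Write a word to one cell. -/
def Mem.set (m : Mem) (a i x : ℕ) : Mem :=
  fun b j => if b = a ∧ j = i then x else m b j

/-- Initial memory: array `0` (messages) and array `1` (output) are zero,
the input lists stand in the arrays `2, 3, …`. -/
def Mem.init (inputs : List (List ℕ)) : Mem :=
  fun a i => if a < 2 then 0 else if a - 2 < inputs.length then cell (inputs.getD (a - 2) []) i
    else 0

/-- The output list: array `1`, with its length in cell `0`. -/
def Mem.output (m : Mem) : List ℕ := (List.range (m 1 0)).map fun i => m 1 (i + 1)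

inductive BinOp
  | add | sub | mul | div | mod | and | or | xor | shl | shr | lt | eq

def BinOp.eval : BinOp → ℕ → ℕ → ℕ
  | .add, x, y => x + y
  | .sub, x, y => x - y
  | .mul, x, y => x * y
  | .div, x, y => x / y
  | .mod, x, y => x % y
  | .and, x, y => x &&& y
  | .or, x, y => x ||| y
  | .xor, x, y => x ^^^ y
  | .shl, x, y => x <<< y
  | .shr, x, y => x >>> y
  | .lt, x, y => if x < y then 1 else 0
  | .eq, x, y => if x = y then 1 else 0

/-- Expressions: constants, array reads (with computed index), binary operations. -/
inductive Expr
  | lit (k : ℕ)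
  | get (a : ℕ) (e : Expr)
  | op (o : BinOp) (e f : Expr)

/-- A value fits in a word if it is smaller than `W`. -/
def fit (W x : ℕ) : Option ℕ := if x < W then some x else none

/-- Evaluation; undefined as soon as some value does not fit in a word. -/
def Expr.eval (W : ℕ) (m : Mem) : Expr → Option ℕ
  | .lit k => fit W k
  | .get a e => (e.eval W m).bind fun i => fit W (m a i)
  | .op o e f => (e.eval W m).bind fun x => (f.eval W m).bind fun y => fit W (o.eval x y)

/-- One step for every constant, read and operation. -/
def Expr.cost : Expr → ℕ
  | .lit _ => 1
  | .get _ e => e.cost + 1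
  | .op _ e f => e.cost + f.cost + 1

/-- Programs. `put a e f` writes the value of `f` to cell `e` of array `a`;
`loop e s` repeats `s` while `e` is nonzero. -/
inductive Prog
  | skip
  | put (a : ℕ) (e f : Expr)
  | seq (s t : Prog)
  | ite (e : Expr) (s t : Prog)
  | loop (e : Expr) (s : Prog)

/-- `Exec W s m m' t`: with word bound `W`, program `s` started in memory `m` halts in memory
`m'` after `t` steps. A program that loops forever, or that meets a value not fitting in a word,
has no such `m'` and `t`. -/
inductive Exec (W : ℕ) : Prog → Mem → Mem → ℕ → Prop
  | skip (m : Mem) : Exec W .skip m m 1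
  | put {m : Mem} {a : ℕ} {e f : Expr} {i x : ℕ} (hi : e.eval W m = some i)
      (hx : f.eval W m = some x) : Exec W (.put a e f) m (m.set a i x) (e.cost + f.cost + 1)
  | seq {s s' : Prog} {m m₁ m₂ : Mem} {t t' : ℕ} (h : Exec W s m m₁ t)
      (h' : Exec W s' m₁ m₂ t') : Exec W (.seq s s') m m₂ (t + t')
  | iteTrue {e : Expr} {s s' : Prog} {m m₁ : Mem} {x t : ℕ} (he : e.eval W m = some x)
      (hx : x ≠ 0) (h : Exec W s m m₁ t) : Exec W (.ite e s s') m m₁ (e.cost + t + 1)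
  | iteFalse {e : Expr} {s s' : Prog} {m m₁ : Mem} {t : ℕ} (he : e.eval W m = some 0)
      (h : Exec W s' m m₁ t) : Exec W (.ite e s s') m m₁ (e.cost + t + 1)
  | loopStop {e : Expr} {s : Prog} {m : Mem} (he : e.eval W m = some 0) :
      Exec W (.loop e s) m m (e.cost + 1)
  | loopStep {e : Expr} {s : Prog} {m m₁ m₂ : Mem} {x t t' : ℕ} (he : e.eval W m = some x)
      (hx : x ≠ 0) (h : Exec W s m m₁ t) (h' : Exec W (.loop e s) m₁ m₂ t') :
      Exec W (.loop e s) m m₂ (e.cost + t + t' + 1)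

/-- Online phase: the messages arrive one after the other in array `0`, each is handled by one
run of `s` on the memory left by the previous run, and the output is read off before the next
message arrives. The last argument is the total number of steps. -/
inductive Serve (W : ℕ) (s : Prog) : Mem → List (List ℕ) → List (List ℕ) → ℕ → Prop
  | nil (m : Mem) : Serve W s m [] [] 0
  | cons {m m₁ : Mem} {x : List ℕ} {xs ys : List (List ℕ)} {t t' : ℕ}
      (h : Exec W s (m.load 0 x) m₁ t) (h' : Serve W s m₁ xs ys t') :
      Serve W s m (x :: xs) (m₁.output :: ys) (t + t')

/-- A randomized online algorithm. For parameter `N` its words are smaller than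
`(N + 2) ^ wordExp`, that is, they have `O(log N)` bits, and it is given
`(N + 2) ^ coinExp` independent fair random bits at the start. -/
structure Algorithm where
  prep : Prog
  step : Prog
  wordExp : ℕ
  coinExp : ℕ

def Algorithm.wordBound (A : Algorithm) (N : ℕ) : ℕ := (N + 2) ^ A.wordExp

def Algorithm.coins (A : Algorithm) (N : ℕ) : ℕ := (N + 2) ^ A.coinExp

def bitWords {R : ℕ} (ω : Fin R → Bool) : List ℕ := List.ofFn fun i => (ω i).toNat

/-- With random bits `ω` the algorithm spends `t₀` steps on preprocessing `inputs`, and then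
`t₁` steps in total on answering the messages `xs` by `ys`. -/
def Algorithm.Run (A : Algorithm) (N : ℕ) (inputs : List (List ℕ))
    (ω : Fin (A.coins N) → Bool) (xs ys : List (List ℕ)) (t₀ t₁ : ℕ) : Prop :=
  ∃ m : Mem, Exec (A.wordBound N) A.prep (Mem.init (inputs ++ [bitWords ω])) m t₀ ∧
    Serve (A.wordBound N) A.step m xs ys t₁

/-- The probability, over `R` independent fair random bits, that `good` fails. -/
noncomputable def failureProbability (R : ℕ) (good : (Fin R → Bool) → Prop) : ℝ :=
  ({ω : Fin R → Bool | ¬ good ω}.ncard : ℝ) / 2 ^ R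

/-! ## The OuMv problem and the OuMv conjecture -/

/-- Rows one after the other. -/
def matrixWords {n₁ n₂ : ℕ} (M : Matrix (Fin n₁) (Fin n₂) Bool) : List ℕ :=
  (List.ofFn fun i => bitWords (M i)).flatten

/-- The Boolean product `uᵀ M v`, the disjunction over all `i, j` of `u i ∧ M i j ∧ v j`. -/
def boolForm {n₁ n₂ : ℕ} (u : Fin n₁ → Bool) (M : Matrix (Fin n₁) (Fin n₂) Bool)
    (v : Fin n₂ → Bool) : Bool :=
  (List.finRange n₁).any fun i => (List.finRange n₂).any fun j => u i && M i j && v j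

/-- The messages of the `n₃` rounds: one vector pair each. -/
def vectorMessages {n₁ n₂ n₃ : ℕ} (uv : Fin n₃ → (Fin n₁ → Bool) × (Fin n₂ → Bool)) :
    List (List ℕ) :=
  List.ofFn fun k => bitWords (uv k).1 ++ bitWords (uv k).2

/-- The correct output, one bit per round. -/
def productBits {n₁ n₂ n₃ : ℕ} (M : Matrix (Fin n₁) (Fin n₂) Bool)
    (uv : Fin n₃ → (Fin n₁ → Bool) × (Fin n₂ → Bool)) : List (List ℕ) :=
  List.ofFn fun k => [(boolForm (uv k).1 M (uv k).2).toNat]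

/-- `A` solves OuMv with error probability at most `1/3`, after polynomial preprocessing of the
matrix, and in total time at most `t n` for all `n` rounds. -/
def SolvesOuMv (A : Algorithm) (t : ℕ → ℕ) : Prop :=
  ∃ c : ℕ, ∀ (n : ℕ) (M : Matrix (Fin n) (Fin n) Bool)
    (uv : Fin n → (Fin n → Bool) × (Fin n → Bool)),
    (∀ ω : Fin (A.coins n) → Bool, ∃ (ys : List (List ℕ)) (t₀ t₁ : ℕ),
      A.Run n [[n], matrixWords M] ω (vectorMessages uv) ys t₀ t₁ ∧
        t₀ ≤ (n + 2) ^ c ∧ t₁ ≤ t n) ∧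
    failureProbability (A.coins n) (fun ω => ∃ t₀ t₁ : ℕ,
      A.Run n [[n], matrixWords M] ω (vectorMessages uv) (productBits M uv) t₀ t₁) ≤ 1 / 3

/-- The OuMv conjecture: no `ε > 0` admits an algorithm with polynomial preprocessing time and
total time `O(n ^ (3 - ε))` that solves OuMv with error probability at most `1/3`. -/
def OuMvConjecture : Prop :=
  ∀ ε : ℝ, 0 < ε → ¬ ∃ (A : Algorithm) (t : ℕ → ℕ), SolvesOuMv A t ∧
    (fun n : ℕ => (t n : ℝ)) =O[atTop] fun n : ℕ => (n : ℝ) ^ (3 - ε)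

/-- `f = õõ(n₁ ^ c₁ n₂ ^ c₂ n₃ ^ c₃)` on the parameters that satisfy `S`. -/
def IsPolyLower (S : ℕ → ℕ → ℕ → Prop) (f : ℕ → ℕ → ℕ → ℕ) (c₁ c₂ c₃ : ℝ) : Prop :=
  ∃ ε N K : ℝ, 0 < ε ∧ 0 < N ∧ 0 < K ∧ ∀ n₁ n₂ n₃ : ℕ, S n₁ n₂ n₃ →
    N < n₁ → N < n₂ → N < n₃ →
    (f n₁ n₂ n₃ : ℝ) ≤ K * ((n₁ : ℝ) ^ (c₁ - ε) * (n₂ : ℝ) ^ c₂ * (n₃ : ℝ) ^ c₃ +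
      (n₁ : ℝ) ^ c₁ * (n₂ : ℝ) ^ (c₂ - ε) * (n₃ : ℝ) ^ c₃ +
      (n₁ : ℝ) ^ c₁ * (n₂ : ℝ) ^ c₂ * (n₃ : ℝ) ^ (c₃ - ε))

/-! ## Dynamic problems -/

/-- A request, coded by one word. -/
inductive Request
  | update (x : ℕ)
  | query (y : ℕ)

def Request.isUpdate : Request → Bool
  | .update _ => true
  | .query _ => false

def Request.isQuery : Request → Bool
  | .update _ => false
  | .query _ => true

def Request.words : Request → List ℕ
  | .update x => [0, x]
  | .query y => [1, y]

/-- The measure of an input list in which running times are polynomial. -/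
def weight (l : List ℕ) : ℕ := l.length + l.sum

/-- A dynamic problem. `IsUpdate D` and `IsQuery D` are the sets of possible updates and queries
when `D` is the initial data structure; `apply D x` is the data structure after update `x`;
`Correct D y a` says that the word `a` is a correct answer to query `y` on `D`
(several answers may be correct, as in approximation problems). -/
structure DynamicProblem where
  Inst : Type
  size : Inst → ℕ
  IsUpdate : Inst → ℕ → Prop
  IsQuery : Inst → ℕ → Prop
  apply : Inst → ℕ → Inst
  Correct : Inst → ℕ → ℕ → Prop
  encode : Inst → List ℕ
  size_le : ∃ c : ℕ, ∀ D : Inst, size D ≤ (weight (encode D) + 2) ^ c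

namespace DynamicProblem

variable (P : DynamicProblem)

def Allowed (D : P.Inst) : Request → Prop
  | .update x => P.IsUpdate D x
  | .query y => P.IsQuery D y

def next (D : P.Inst) : Request → P.Inst
  | .update x => P.apply D x
  | .query _ => D

def run (D : P.Inst) (ρ : List Request) : P.Inst := ρ.foldl P.next D

/-- `as` lists correct answers to the queries of `ρ`, in order, when `ρ` is applied to `D`. -/
def CorrectAnswers : P.Inst → List Request → List ℕ → Prop
  | _, [], as => as = []
  | D, .update x :: ρ, as => CorrectAnswers (P.apply D x) ρ as
  | _, .query _ :: _, [] => False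
  | D, .query y :: ρ, a :: as => P.Correct D y a ∧ CorrectAnswers D ρ as

/-- Update `x` has cyclic order `m` (for initial data structure `D`): inserting, or removing,
exactly `m` copies of `x` at arbitrary places inside a segment of a request sequence
does not change the correct answers to queries outside that segment. Here `β` is the segment
without, and `β'` the segment with, the `m` copies. -/
def HasCyclicOrder (D : P.Inst) (x m : ℕ) : Prop :=
  1 ≤ m ∧ ∀ α β β' δ : List Request, (∀ r ∈ α ++ β ++ δ, P.Allowed D r) →
    β.Sublist β' → β'.Perm (β ++ List.replicate m (.update x)) →
    ∀ y a : ℕ, P.IsQuery D y →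
      (P.Correct (P.run D (α ++ β ++ δ)) y a ↔ P.Correct (P.run D (α ++ β' ++ δ)) y a)

end DynamicProblem

/-! ## Delayed predictions -/

/-- Permutations `π` and `σ` are `d`-close. -/
def DClose {T : ℕ} (d : ℕ) (π σ : Equiv.Perm (Fin T)) : Prop :=
  ∀ t : Fin T, |((π⁻¹ t : Fin T) : ℤ) - ((σ⁻¹ t : Fin T) : ℤ)| ≤ d

/-- `ρhat` is a `d`-delayed prediction for the set `S` of request sequences. -/
def IsDelayedPrediction {T : ℕ} (d : ℕ) (ρhat : Fin T → Request)
    (S : Set (Fin T → Request)) : Prop :=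
  ∀ ρ ∈ S, ∃ π : Equiv.Perm (Fin T), (∀ t, ρ (π t) = ρhat t) ∧ DClose d π 1

def requestMessages {T : ℕ} (ρ : Fin T → Request) : List (List ℕ) :=
  List.ofFn fun t => (ρ t).words

/-- The outputs given at the queries of `ρ`. -/
def queryOutputs (ρ : List Request) (ys : List (List ℕ)) : List (List ℕ) :=
  ((ρ.zip ys).filter fun p => p.1.isQuery).map Prod.snd

/-- Algorithm `A`, given `d`-delayed predictions, solves `P` on all initial data structures `D`
with `I D d`, with error probability at most `1/3`, with polynomial preprocessing time, and with
(amortized) update time `U` and query time `Q`. During preprocessing it receives `d`, the initial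
data structure and the prediction; then the requests arrive online. -/
def SolvesWithDelayedPredictions (P : DynamicProblem) (I : P.Inst → ℕ → Prop) (A : Algorithm)
    (U Q : ℕ → ℕ) : Prop :=
  ∃ c : ℕ, ∀ (D : P.Inst) (d : ℕ), I D d →
    ∀ (T : ℕ) (S : Set (Fin T → Request)) (ρhat : Fin T → Request),
    (∀ ρ ∈ S, ∀ t, P.Allowed D (ρ t)) → IsDelayedPrediction d ρhat S → ∀ ρ ∈ S,
    let inputs : List (List ℕ) := [[d], P.encode D, (requestMessages ρhat).flatten]
    let N : ℕ := (inputs.map weight).sum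
    (∀ ω : Fin (A.coins N) → Bool, ∃ (ys : List (List ℕ)) (t₀ t₁ : ℕ),
      A.Run N inputs ω (requestMessages ρ) ys t₀ t₁ ∧ t₀ ≤ (N + 2) ^ c ∧
        t₁ ≤ (List.ofFn ρ).countP Request.isUpdate * U (P.size D) +
          (List.ofFn ρ).countP Request.isQuery * Q (P.size D)) ∧
    failureProbability (A.coins N) (fun ω => ∃ (ys : List (List ℕ)) (as : List ℕ) (t₀ t₁ : ℕ),
      A.Run N inputs ω (requestMessages ρ) ys t₀ t₁ ∧
        P.CorrectAnswers D (List.ofFn ρ) as ∧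
        queryOutputs (List.ofFn ρ) ys = as.map fun a => [a]) ≤ 1 / 3

/-! ## Local reductions from `γ`-OuMv -/

/-- The number of rows `n₁ = ⌊n₂ ^ γ⌋` of a `γ`-OuMv instance. -/
noncomputable def rows (γ : ℝ) (n₂ : ℕ) : ℕ := ⌊(n₂ : ℝ) ^ γ⌋₊

/-- The rounds of a reduction. In each round, program `sel` receives the vector pair and outputs
which requests to issue, in at most `tSel` steps; then `dec` receives the answers to the queries
among them and outputs the result of the round, in at most `tDec` steps. The list arguments are
the vector pairs, the outputs of `sel`, the answers, and the outputs of `dec`. -/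
inductive ReductionRounds (W tSel tDec : ℕ) (sel dec : Prog) :
    Mem → List (List ℕ) → List (List ℕ) → List (List ℕ) → List (List ℕ) → Prop
  | nil (m : Mem) : ReductionRounds W tSel tDec sel dec m [] [] [] []
  | cons {m m₁ m₂ : Mem} {x a : List ℕ} {xs bs as rs : List (List ℕ)} {t₁ t₂ : ℕ}
      (h₁ : Exec W sel (m.load 0 x) m₁ t₁) (ht₁ : t₁ ≤ tSel)
      (h₂ : Exec W dec (m₁.load 0 a) m₂ t₂) (ht₂ : t₂ ≤ tDec)
      (h : ReductionRounds W tSel tDec sel dec m₂ xs bs as rs) :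
      ReductionRounds W tSel tDec sel dec m (x :: xs) (m₁.output :: bs) (a :: as)
        (m₂.output :: rs)

/-- The sequence of the entries of the block `B` at the positions `is`. -/
def pick (B : List Request) (is : List ℕ) : List Request := is.filterMap fun i => B[i]?

/-- A local reduction from `γ`-OuMv to `P`, with instances of `P` of size `n(n₁, n₂)`, and with
`u` updates and `q` queries per block: this witnesses that `P` is `(u, q)`-locally reducible. -/
structure LocalReduction (P : DynamicProblem) (γ : ℝ) (u q n : ℕ → ℕ → ℕ) where
  /-- `B(n₁, n₂)`; the universal request sequence is the concatenation of `n₃` copies of it. -/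
  block : ℕ → ℕ → List Request
  /-- The cyclic orders of the updates in the block. -/
  order : ℕ → ℕ → ℕ → ℕ
  /-- The initial data structure `D₀`. -/
  start : (n₁ n₂ n₃ : ℕ) → Matrix (Fin n₁) (Fin n₂) Bool → P.Inst
  universal : Prog
  prep : Prog
  select : Prog
  decode : Prog
  /-- The constant in the time bounds and in the word length. -/
  c : ℕ
  /-- The block consists of `u` updates and `q` queries. -/
  block_updates : ∀ n₂ : ℕ, 0 < n₂ →
    (block (rows γ n₂) n₂).countP Request.isUpdate = u (rows γ n₂) n₂
  block_queries : ∀ n₂ : ℕ, 0 < n₂ →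
    (block (rows γ n₂) n₂).countP Request.isQuery = q (rows γ n₂) n₂
  /-- From `n₂`, the number `n₁`, the block and the orders are computed in polynomial time. -/
  universal_spec : ∀ n₂ : ℕ, 0 < n₂ → ∃ (m : Mem) (t : ℕ),
    Exec ((n₂ + 2) ^ c) universal (Mem.init [[n₂]]) m t ∧ t ≤ (n₂ + 2) ^ c ∧
      m.output = rows γ n₂ :: (block (rows γ n₂) n₂).flatMap fun r => match r with
        | .update x => [0, x, order (rows γ n₂) n₂ x]
        | .query y => [1, y, 0]
  start_size : ∀ (n₂ n₃ : ℕ), 0 < n₂ → 0 < n₃ →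
    ∀ M : Matrix (Fin (rows γ n₂)) (Fin n₂) Bool,
      P.size (start (rows γ n₂) n₂ n₃ M) = n (rows γ n₂) n₂
  start_allowed : ∀ (n₂ n₃ : ℕ), 0 < n₂ → 0 < n₃ →
    ∀ M : Matrix (Fin (rows γ n₂)) (Fin n₂) Bool,
      ∀ r ∈ block (rows γ n₂) n₂, P.Allowed (start (rows γ n₂) n₂ n₃ M) r
  /-- Every update in the block is cyclic. -/
  cyclic : ∀ (n₂ n₃ : ℕ), 0 < n₂ → 0 < n₃ →
    ∀ M : Matrix (Fin (rows γ n₂)) (Fin n₂) Bool,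
      ∀ x : ℕ, Request.update x ∈ block (rows γ n₂) n₂ →
        P.HasCyclicOrder (start (rows γ n₂) n₂ n₃ M) x (order (rows γ n₂) n₂ x)
  /-- For every instance, with `blk k` the positions in `B` of the requests of the block `B'ₖ`, in
  the order in which they are issued: the initial data structure is constructed in polynomial time;
  each `B'ₖ` is found online, in time linear in `n₁ + n₂ + u + q`, and does not depend on
  the answers; and, in time `O(q)`, the answers are turned into a bit, which is the product
  of round `k` if the answers are correct. -/
  simulates : ∀ (n₂ n₃ : ℕ), 0 < n₂ → 0 < n₃ →
    ∀ (M : Matrix (Fin (rows γ n₂)) (Fin n₂) Bool)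
      (uv : Fin n₃ → (Fin (rows γ n₂) → Bool) × (Fin n₂ → Bool)),
    ∃ blk : Fin n₃ → List ℕ,
      (∀ k, (blk k).Nodup ∧ ∀ i ∈ blk k, i < (block (rows γ n₂) n₂).length) ∧
      ∀ (V : ℕ) (ans : Fin n₃ → List ℕ),
        (∀ k, (ans k).length =
          (pick (block (rows γ n₂) n₂) (blk k)).countP Request.isQuery ∧ ∀ a ∈ ans k, a ≤ V) →
        ∃ (m : Mem) (t : ℕ) (rs : List (List ℕ)),
          Exec ((rows γ n₂ + n₂ + n₃ + V + 2) ^ c) prep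
            (Mem.init [[rows γ n₂, n₂, n₃], matrixWords M]) m t ∧
          t ≤ (rows γ n₂ + n₂ + n₃ + 2) ^ c ∧
          m.output = P.encode (start (rows γ n₂) n₂ n₃ M) ∧
          ReductionRounds ((rows γ n₂ + n₂ + n₃ + V + 2) ^ c)
            (c * (rows γ n₂ + n₂ + u (rows γ n₂) n₂ + q (rows γ n₂) n₂ + 1))
            (c * (q (rows γ n₂) n₂ + 1)) select decode m
            (vectorMessages uv) (List.ofFn blk) (List.ofFn ans) rs ∧
          (P.CorrectAnswers (start (rows γ n₂) n₂ n₃ M)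
              (List.ofFn fun k => pick (block (rows γ n₂) n₂) (blk k)).flatten
              (List.ofFn ans).flatten →
            rs = productBits M uv)

end DelayedPredictions

/-!
An algorithm with delayed predictions for `P` is turned into an algorithm for `γ`-OuMv, and this
one into an algorithm for OuMv that is too fast for the conjecture.

*From predictions to `γ`-OuMv* (`exists_solvesGammaOuMv`). Fix a `γ`-OuMv instance. The local
reduction asks in each of the `n₃` rounds for some of the requests of one and the same block `B` of
`u + q` requests, and the prediction handed to the algorithm is the sequence of `n₃` copies of `B`,
which does not depend on the vectors. In a round, the requests that the reduction asks for are
issued at once, each of them in the role of its oldest copy not yet issued. A query not asked for is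
issued at the end of the round, and its answer is ignored. An update `x` not asked for is postponed,
until `ord x` copies of it are pending; these are then issued together. By cyclicity such a group
has no effect on the answers to other queries (`DynamicProblem.HasCyclicOrder.neutral`), so that
the reduction sees correct answers to the requests it asked for
(`DynamicProblem.correctAnswers_real`). At any time fewer than `ord x ≤ C` copies of each request
are pending, hence at most `C * (u + q)` requests in total, and every request is issued at most
`(1 + C) * (u + q)` places away from its place in the prediction (`schedule_perm`,
`schedule_delay`). All requests left at the end are appended to the sequence for the sake of the
definition of a prediction, but they need not be issued.

*From `γ`-OuMv to OuMv* (`exists_solvesOuMv`). Let `k = ⌈γ⌉`. An `n × n` matrix is cut into blocks of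
`n₂ ≈ n ^ (1 / k)` columns and `n₁ = ⌊n₂ ^ γ⌋ ≤ n` rows, padded with zeros. The product is `1` if and
only if it is `1` for one of the blocks (`exists_boolForm_block`). Error probability `1/3` for each
of up to `n ^ 2` blocks is too much, and so `O(log n)` independent instances of the `γ`-OuMv
algorithm run on each block, all of them with `n` pairs of vectors, and their majority is taken.
A majority is wrong in some round only if half of the instances fail; an estimate of exponential
moments (`card_half_bad_le`) and a union bound show that the probability of this for some block is
at most `1/3` (`failureProbability_majorities_le`).

*Time.* Each request costs at least one step, so `u + q ≤ u * U + q * Q`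
(`LocalReduction.add_le_time`), and the overhead of all the bookkeeping is a constant factor and
`n₁ + n₂` steps per round and instance. Both `n₁` and `n₂` are at least a positive power of `n`, up
to a constant, so that a saving polynomial in any one of `n₁`, `n₂`, `n₃ = n` is polynomial in `n`,
which makes up for the logarithmic number of copies (`exists_isBigO_of_isPolyLower`).

Both algorithms are explicit word RAM programs. The correctness and the running time of straight
code and counting loops are derived with the relation `Runs`. Programs that are only known to exist
run inside a part of the memory: their arrays are renamed and their indices transformed
(`Prog.embed`), and `IsHost.exec_embed` says that such a simulation is faithful and costs a constant
factor. In this way the memories of many instances are interleaved in one (`interleave`). The bounds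
on the word length come from the hypothesis `(Y + 2) ^ D ≤ W` that recurs below: all numbers in the
memory are smaller than `Y`, expressions have degree at most `D`, and therefore no intermediate
result reaches the word bound `W`.
-/

namespace DelayedPredictions

/-! ### Execution of word RAM programs -/

theorem fit_of_lt {W x : ℕ} (h : x < W) : fit W x = some x := if_pos h

theorem lt_of_fit {W x y : ℕ} (h : fit W x = some y) : x = y ∧ y < W := by
  unfold fit at h
  split at h
  · cases h; exact ⟨rfl, by assumption⟩
  · cases h

theorem Expr.eval_lt {W : ℕ} {m : Mem} {e : Expr} {v : ℕ} (h : e.eval W m = some v) : v < W := by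
  cases e with
  | lit k => exact (lt_of_fit h).2
  | get a e =>
    simp only [Expr.eval, Option.bind_eq_some_iff] at h
    obtain ⟨i, _, hi⟩ := h
    exact (lt_of_fit hi).2
  | op o e f =>
    simp only [Expr.eval, Option.bind_eq_some_iff] at h
    obtain ⟨i, _, j, _, hi⟩ := h
    exact (lt_of_fit hi).2

/-- Programs are deterministic: the run that is known to be correct is the one that is known to be
fast, and the one that is simulated. -/
theorem Exec.det {W : ℕ} {p : Prog} {m m₁ m₂ : Mem} {t₁ t₂ : ℕ} (h₁ : Exec W p m m₁ t₁)
    (h₂ : Exec W p m m₂ t₂) : m₁ = m₂ ∧ t₁ = t₂ := by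
  induction h₁ generalizing m₂ t₂ with
  | skip m => cases h₂; exact ⟨rfl, rfl⟩
  | put hi hx =>
    cases h₂ with
    | put hi' hx' =>
      rw [hi] at hi'; rw [hx] at hx'; cases hi'; cases hx'; exact ⟨rfl, rfl⟩
  | seq _ _ ih ih' =>
    cases h₂ with
    | seq g g' =>
      obtain ⟨rfl, rfl⟩ := ih g
      obtain ⟨rfl, rfl⟩ := ih' g'
      exact ⟨rfl, rfl⟩
  | iteTrue he hx _ ih =>
    cases h₂ with
    | iteTrue he' hx' g => obtain ⟨rfl, rfl⟩ := ih g; exact ⟨rfl, rfl⟩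
    | iteFalse he' g => rw [he] at he'; cases he'; exact absurd rfl hx
  | iteFalse he _ ih =>
    cases h₂ with
    | iteTrue he' hx' g => rw [he] at he'; cases he'; exact absurd rfl hx'
    | iteFalse he' g => obtain ⟨rfl, rfl⟩ := ih g; exact ⟨rfl, rfl⟩
  | loopStop he =>
    cases h₂ with
    | loopStop => exact ⟨rfl, rfl⟩
    | loopStep he' hx' => rw [he] at he'; cases he'; exact absurd rfl hx'
  | loopStep he hx _ _ ih ih' =>
    cases h₂ with
    | loopStop he' => rw [he] at he'; cases he'; exact absurd rfl hx
    | loopStep he' hx' g g' =>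
      obtain ⟨rfl, rfl⟩ := ih g
      obtain ⟨rfl, rfl⟩ := ih' g'
      exact ⟨rfl, rfl⟩

theorem Serve.det {W : ℕ} {s : Prog} {m : Mem} {xs ys ys' : List (List ℕ)} {t t' : ℕ}
    (h : Serve W s m xs ys t) (h' : Serve W s m xs ys' t') : ys = ys' ∧ t = t' := by
  induction h generalizing ys' t' with
  | nil m => cases h'; exact ⟨rfl, rfl⟩
  | cons h _ ih =>
    cases h' with
    | cons g g' =>
      obtain ⟨rfl, rfl⟩ := h.det g
      obtain ⟨rfl, rfl⟩ := ih g'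
      exact ⟨rfl, rfl⟩

theorem Algorithm.Run.det {A : Algorithm} {N : ℕ} {inputs : List (List ℕ)}
    {ω : Fin (A.coins N) → Bool} {xs ys ys' : List (List ℕ)} {t₀ t₁ t₀' t₁' : ℕ}
    (h : A.Run N inputs ω xs ys t₀ t₁) (h' : A.Run N inputs ω xs ys' t₀' t₁') :
    ys = ys' ∧ t₀ = t₀' ∧ t₁ = t₁' := by
  obtain ⟨m, hm, hs⟩ := h
  obtain ⟨m', hm', hs'⟩ := h'
  obtain ⟨rfl, rfl⟩ := hm.det hm'
  obtain ⟨rfl, rfl⟩ := hs.det hs'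
  exact ⟨rfl, rfl, rfl⟩

theorem Exec.time_pos {W : ℕ} {p : Prog} {m m' : Mem} {t : ℕ} (h : Exec W p m m' t) : 0 < t := by
  induction h <;> omega

/-- A program only writes words. -/
theorem Exec.cell_lt {W : ℕ} {p : Prog} {m m' : Mem} {t : ℕ} (h : Exec W p m m' t) (a i : ℕ) :
    m' a i = m a i ∨ m' a i < W := by
  induction h with
  | skip m => exact Or.inl rfl
  | put hi hx =>
    unfold Mem.set
    split
    · exact Or.inr (Expr.eval_lt hx)
    · exact Or.inl rfl
  | seq _ _ ih ih' => rcases ih' with h | h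
                      · rw [h]; exact ih
                      · exact Or.inr h
  | iteTrue _ _ _ ih => exact ih
  | iteFalse _ _ ih => exact ih
  | loopStop _ => exact Or.inl rfl
  | loopStep _ _ _ _ ih ih' => rcases ih' with h | h
                               · rw [h]; exact ih
                               · exact Or.inr h

theorem Exec.cell_lt_of_lt {W : ℕ} {p : Prog} {m m' : Mem} {t : ℕ} (h : Exec W p m m' t) {a i Y : ℕ}
    (hW : W ≤ Y) (hm : m a i < Y) : m' a i < Y := by
  rcases h.cell_lt a i with h | h <;> omega

theorem Mem.load_of_ne (m : Mem) {a b : ℕ} (l : List ℕ) (h : b ≠ a) : m.load a l b = m b := by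
  funext i
  simp [Mem.load, h]

theorem Mem.output_length (m : Mem) : m.output.length = m 1 0 := by simp [Mem.output]

theorem Mem.output_getElem (m : Mem) (i : ℕ) (h : i < m.output.length) :
    m.output[i] = m 1 (i + 1) := by simp [Mem.output]

theorem Mem.of_output {m : Mem} {l : List ℕ} (h : m.output = l) :
    ∀ i ≤ l.length, m 1 i = cell l i := by
  subst h
  intro i hi
  unfold cell
  split
  · subst_vars; exact (Mem.output_length m).symm
  · rw [List.getD_eq_getElem _ _ (by omega), Mem.output_getElem]
    congr 1; omega

theorem cell_eq_zero {l : List ℕ} {i : ℕ} (h : l.length < i) : cell l i = 0 := by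
  unfold cell
  rw [if_neg (by omega), List.getD_eq_default _ _ (by omega)]

theorem cell_zero (l : List ℕ) : cell l 0 = l.length := rfl

theorem cell_succ (l : List ℕ) (i : ℕ) (h : i < l.length) : cell l (i + 1) = l[i] := by
  simp [cell, h]

theorem cell_lt {l : List ℕ} {Y : ℕ} (h₁ : l.length < Y) (h₂ : ∀ x ∈ l, x < Y) (i : ℕ) :
    cell l i < Y := by
  unfold cell
  split
  · exact h₁
  · by_cases h : i - 1 < l.length
    · rw [List.getD_eq_getElem _ _ h]; exact h₂ _ (List.getElem_mem _)
    · rw [List.getD_eq_default _ _ (by omega)]; omega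

/-- The values of array `1` in the memories `mem (k + 1)` are the outputs, when `mem k` is the
memory before message `k`, and `ts k` the number of steps spent on it. -/
theorem Serve.exists_trace {W : ℕ} {s : Prog} {m : Mem} {xs ys : List (List ℕ)} {t : ℕ}
    (h : Serve W s m xs ys t) : ∃ (mem : ℕ → Mem) (ts : ℕ → ℕ), mem 0 = m ∧
      (∀ k (hk : k < xs.length), Exec W s ((mem k).load 0 xs[k]) (mem (k + 1)) (ts k)) ∧
      ys = (List.range xs.length).map (fun k => (mem (k + 1)).output) ∧
      t = ∑ k ∈ Finset.range xs.length, ts k := by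
  induction h with
  | nil m => exact ⟨fun _ => m, fun _ => 0, rfl, by simp, by simp, by simp⟩
  | @cons m m₁ x xs ys t t' h _ ih =>
    obtain ⟨mem, ts, h0, h1, h2, h3⟩ := ih
    refine ⟨fun k => k.casesOn m mem, fun k => k.casesOn t ts, rfl, ?_, ?_, ?_⟩
    · intro k hk
      cases k with
      | zero => simpa [h0] using h
      | succ k => simpa using h1 k (by simpa using hk)
    · simp [List.range_succ_eq_map, h0, h2, Function.comp_def]
    · rw [List.length_cons, Finset.sum_range_succ', h3]
      simp [add_comm]

/-- The converse of `Serve.exists_trace`. -/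
theorem Serve.of_trace {W : ℕ} {s : Prog} (xs : List (List ℕ)) (mem : ℕ → Mem) (ts : ℕ → ℕ)
    (h : ∀ k (hk : k < xs.length), Exec W s ((mem k).load 0 xs[k]) (mem (k + 1)) (ts k)) :
    Serve W s (mem 0) xs ((List.range xs.length).map (fun k => (mem (k + 1)).output))
      (∑ k ∈ Finset.range xs.length, ts k) := by
  induction xs generalizing mem ts with
  | nil => simpa using Serve.nil _
  | cons x xs ih =>
    have h0 := h 0 (by simp)
    have h1 := ih (fun k => mem (k + 1)) (fun k => ts (k + 1)) (fun k hk =>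
      h (k + 1) (Nat.succ_lt_succ hk))
    have := Serve.cons h0 h1
    rw [List.length_cons, Finset.sum_range_succ', Nat.add_comm _ (ts 0)]
    simpa [List.range_succ_eq_map, Function.comp_def] using this

/-- The memory is `R k` before round `k`, and `S k` between `select` and `decode`. -/
theorem ReductionRounds.exists_trace {W tSel tDec : ℕ} {sel dec : Prog} {m : Mem}
    {xs bs as rs : List (List ℕ)} (h : ReductionRounds W tSel tDec sel dec m xs bs as rs) :
    ∃ (R S : ℕ → Mem), R 0 = m ∧
      (∀ k (hk : k < xs.length) (hk' : k < as.length),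
        (∃ t ≤ tSel, Exec W sel ((R k).load 0 xs[k]) (S k) t) ∧
        (∃ t ≤ tDec, Exec W dec ((S k).load 0 as[k]) (R (k + 1)) t)) ∧
      bs = (List.range xs.length).map (fun k => (S k).output) ∧
      rs = (List.range xs.length).map (fun k => (R (k + 1)).output) := by
  induction h with
  | nil m => exact ⟨fun _ => m, fun _ => m, rfl, by simp, by simp, by simp⟩
  | @cons m m₁ m₂ x a xs bs as rs t₁ t₂ h₁ ht₁ h₂ ht₂ _ ih =>
    obtain ⟨R, S, h0, h1, h2, h3⟩ := ih
    refine ⟨fun k => k.casesOn m R, fun k => k.casesOn m₁ S, rfl, ?_, ?_, ?_⟩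
    · intro k hk hk'
      cases k with
      | zero => exact ⟨⟨t₁, ht₁, by simpa using h₁⟩, ⟨t₂, ht₂, by simpa [h0] using h₂⟩⟩
      | succ k => simpa using h1 k (by simpa using hk) (by simpa using hk')
    · simp [List.range_succ_eq_map, h2, Function.comp_def]
    · simp [List.range_succ_eq_map, h0, h3, Function.comp_def]

/-! ### A calculus for time-bounded executions -/

/-- With word bound `W`, program `p` takes memory `m` to memory `m'` in at most `T` steps. -/
def Runs (W : ℕ) (p : Prog) (m m' : Mem) (T : ℕ) : Prop := ∃ t ≤ T, Exec W p m m' t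

theorem Runs.mono {W : ℕ} {p : Prog} {m m' : Mem} {T T' : ℕ} (h : Runs W p m m' T) (hT : T ≤ T') :
    Runs W p m m' T' := by
  obtain ⟨t, ht, h⟩ := h
  exact ⟨t, ht.trans hT, h⟩

theorem Runs.seq {W : ℕ} {p p' : Prog} {m m₁ m₂ : Mem} {T T' : ℕ} (h : Runs W p m m₁ T)
    (h' : Runs W p' m₁ m₂ T') : Runs W (.seq p p') m m₂ (T + T') := by
  obtain ⟨t, ht, h⟩ := h
  obtain ⟨t', ht', h'⟩ := h'
  exact ⟨t + t', by omega, .seq h h'⟩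

theorem Runs.skip {W : ℕ} (m : Mem) : Runs W .skip m m 1 := ⟨1, le_rfl, .skip m⟩

/-- The value of an expression when no word bound is imposed. -/
def Expr.val (m : Mem) : Expr → ℕ
  | .lit k => k
  | .get a e => m a (e.val m)
  | .op o e f => o.eval (e.val m) (f.val m)

/-- All cells read during the evaluation hold numbers smaller than `Y`. -/
def Expr.ReadsLt (Y : ℕ) (m : Mem) : Expr → Prop
  | .lit _ => True
  | .get a e => e.ReadsLt Y m ∧ m a (e.val m) < Y
  | .op _ e f => e.ReadsLt Y m ∧ f.ReadsLt Y m

/-- An exponent that bounds the growth of an arithmetical expression (see `Expr.val_lt`); `k + 1` is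
generous for a literal `k < 2 ^ (k + 1)`, and saves separate bounds on literals. -/
def Expr.deg : Expr → ℕ
  | .lit k => k + 1
  | .get _ e => e.deg + 1
  | .op _ e f => e.deg + f.deg + 1

/-- Operations whose value is bounded by a product of their arguments. -/
def BinOp.arith : BinOp → Bool
  | .add | .sub | .mul | .div | .mod | .lt | .eq => true
  | _ => false

/-- Only operations as in `BinOp.arith` occur. -/
def Expr.arith : Expr → Bool
  | .lit _ => true
  | .get _ e => e.arith
  | .op o e f => o.arith && e.arith && f.arith

theorem BinOp.eval_lt {o : BinOp} (ho : o.arith = true) {x y A B : ℕ} (hx : x < A) (hy : y < B) :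
    o.eval x y < 2 * (A * B) := by
  have hA : 1 ≤ A := by omega
  have hB : 1 ≤ B := by omega
  have h1 : A ≤ A * B := Nat.le_mul_of_pos_right _ hB
  have h2 : B ≤ A * B := Nat.le_mul_of_pos_left _ hA
  cases o <;> simp only [BinOp.arith, Bool.false_eq_true] at ho <;> simp only [BinOp.eval]
  · omega
  · omega
  · have := Nat.mul_lt_mul'' hx hy; omega
  · have := Nat.div_le_self x y; omega
  · have := Nat.mod_le x y; omega
  · split <;> omega
  · split <;> omega

theorem Expr.val_lt {Y : ℕ} {m : Mem} {e : Expr} (hr : e.ReadsLt Y m) (ha : e.arith = true) :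
    e.val m < (Y + 2) ^ e.deg := by
  induction e with
  | lit k =>
    exact (Nat.lt_two_pow_self.trans (Nat.pow_lt_pow_right (by norm_num) (Nat.lt_succ_self k))).trans_le
      (Nat.pow_le_pow_left (by omega) _)
  | get a e ih =>
    calc m a (e.val m) < Y := hr.2
      _ ≤ (Y + 2) ^ 1 := by rw [pow_one]; omega
      _ ≤ _ := Nat.pow_le_pow_right (by omega) (by simp [Expr.deg])
  | op o e f ihe ihf =>
    simp only [Expr.arith, Bool.and_eq_true] at ha
    have := BinOp.eval_lt ha.1.1 (ihe hr.1 ha.1.2) (ihf hr.2 ha.2)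
    calc _ < _ := this
      _ ≤ (Y + 2) * ((Y + 2) ^ e.deg * (Y + 2) ^ f.deg) := Nat.mul_le_mul_right _ (by omega)
      _ = _ := by rw [Expr.deg]; ring

/-- When all cells read are smaller than `Y` and `(Y + 2) ^ D` is at most the word bound, an
arithmetical expression of degree at most `D` is evaluated without overflow. -/
theorem Expr.eval_eq {W Y D : ℕ} (hW : (Y + 2) ^ D ≤ W) {m : Mem} {e : Expr}
    (hr : e.ReadsLt Y m) (hs : e.arith = true ∧ e.deg ≤ D) :
    e.eval W m = some (e.val m) := by
  have key : ∀ e : Expr, e.ReadsLt Y m → e.arith = true → e.deg ≤ D → e.val m < W :=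
    fun e hr ha hd => (Expr.val_lt hr ha).trans_le
      ((Nat.pow_le_pow_right (by omega) hd).trans hW)
  obtain ⟨ha, hd⟩ := hs
  induction e with
  | lit k => exact fit_of_lt (key _ hr ha hd)
  | get a e ih =>
    rw [Expr.eval, ih hr.1 ha (by simp [Expr.deg] at hd; omega)]
    exact fit_of_lt (key _ hr ha hd)
  | op o e f ihe ihf =>
    have ha' := ha
    simp only [Expr.arith, Bool.and_eq_true] at ha'
    rw [Expr.eval, ihe hr.1 ha'.1.2 (by simp [Expr.deg] at hd; omega),
      ihf hr.2 ha'.2 (by simp [Expr.deg] at hd; omega)]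
    exact fit_of_lt (key _ hr ha hd)

theorem Runs.put {W Y D : ℕ} (hW : (Y + 2) ^ D ≤ W) {m m' : Mem} {a : ℕ} {e f : Expr} {T : ℕ}
    (h : m.set a (e.val m) (f.val m) = m') (hr : e.ReadsLt Y m ∧ f.ReadsLt Y m)
    (hs : (e.arith = true ∧ e.deg ≤ D) ∧ (f.arith = true ∧ f.deg ≤ D))
    (hc : e.cost + f.cost + 1 ≤ T) : Runs W (.put a e f) m m' T :=
  ⟨_, hc, h ▸ .put (Expr.eval_eq hW hr.1 hs.1) (Expr.eval_eq hW hr.2 hs.2)⟩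

theorem Runs.iteTrue {W Y D : ℕ} (hW : (Y + 2) ^ D ≤ W) {m m' : Mem} {e : Expr} {p p' : Prog}
    {T : ℕ} (hr : e.ReadsLt Y m) (hs : e.arith = true ∧ e.deg ≤ D) (hx : e.val m ≠ 0)
    (h : Runs W p m m' T) : Runs W (.ite e p p') m m' (e.cost + T + 1) := by
  obtain ⟨t, ht, h⟩ := h
  exact ⟨_, by omega, .iteTrue (Expr.eval_eq hW hr hs) hx h⟩

theorem Runs.iteFalse {W Y D : ℕ} (hW : (Y + 2) ^ D ≤ W) {m m' : Mem} {e : Expr} {p p' : Prog}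
    {T : ℕ} (hr : e.ReadsLt Y m) (hs : e.arith = true ∧ e.deg ≤ D) (hx : e.val m = 0)
    (h : Runs W p' m m' T) : Runs W (.ite e p p') m m' (e.cost + T + 1) := by
  obtain ⟨t, ht, h⟩ := h
  exact ⟨_, by omega, .iteFalse (hx ▸ Expr.eval_eq hW hr hs) h⟩

/-- A loop that passes through the memories `S 0, …, S len`; here `Φ k` bounds the time from
`S 0` to `S k`. -/
theorem Runs.loop {W Y D : ℕ} (hW : (Y + 2) ^ D ≤ W) {e : Expr} {p : Prog} (S : ℕ → Mem)
    (len : ℕ) (T Φ : ℕ → ℕ) (hs : e.arith = true ∧ e.deg ≤ D)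
    (hr : ∀ k ≤ len, e.ReadsLt Y (S k))
    (hne : ∀ k < len, e.val (S k) ≠ 0) (heq : e.val (S len) = 0)
    (hbody : ∀ k < len, Runs W p (S k) (S (k + 1)) (T k))
    (hΦ : ∀ k < len, Φ k + T k + e.cost + 1 ≤ Φ (k + 1)) {T' : ℕ}
    (hT : Φ len + e.cost + 1 ≤ Φ 0 + T') : Runs W (.loop e p) (S 0) (S len) T' := by
  have hmono : ∀ j ≤ len, ∀ i ≤ j, Φ i ≤ Φ j := by
    intro j hj i hij
    induction j, hij using Nat.le_induction with
    | base => exact le_rfl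
    | succ j hij ih => have := ih (by omega); have := hΦ j (by omega); omega
  have key : ∀ d ≤ len, Runs W (.loop e p) (S (len - d)) (S len)
      (Φ len - Φ (len - d) + e.cost + 1) := by
    intro d
    induction d with
    | zero =>
      intro _
      have h0 := Expr.eval_eq hW (hr len le_rfl) hs
      rw [heq] at h0
      exact ⟨_, by omega, .loopStop h0⟩
    | succ d ih =>
      intro hd
      obtain ⟨t', ht', h'⟩ := ih (by omega)
      obtain ⟨t, ht, h⟩ := hbody (len - (d + 1)) (by omega)
      have e1 : len - (d + 1) + 1 = len - d := by omega
      have hΦ' := hΦ (len - (d + 1)) (by omega)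
      have h2 := hmono len le_rfl (len - d) (by omega)
      rw [e1] at h hΦ'
      refine ⟨_, ?_, .loopStep (Expr.eval_eq hW (hr _ (by omega)) hs) (hne _ (by omega)) h h'⟩
      omega
  have h := key len le_rfl
  have h2 := hmono len le_rfl 0 (by omega)
  rw [Nat.sub_self] at h
  exact h.mono (by omega)

/-- The register kept in cell `0` of array `r`. -/
abbrev reg (r : ℕ) : Expr := .get r (.lit 0)

/-- Increment a register. -/
abbrev incr (r : ℕ) : Prog := .put r (.lit 0) (.op .add (reg r) (.lit 1))

/-- `for r < cnt do body`. -/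
abbrev forLoop (r : ℕ) (cnt : Expr) (body : Prog) : Prog :=
  .seq (.put r (.lit 0) (.lit 0)) (.loop (.op .lt (reg r) cnt) (.seq body (incr r)))

/-- `for r < cnt do dst[idx] := val`. -/
abbrev fill (r dst : ℕ) (cnt idx val : Expr) : Prog := forLoop r cnt (.put dst idx val)

/-- A counting loop. `S k` is the memory at the beginning of iteration `k`, and `S' k` that at the
end of the body of iteration `k`, before the counter is incremented. -/
theorem Runs.forLoop {W Y D : ℕ} (hW : (Y + 2) ^ D ≤ W) {r : ℕ} {cnt : Expr} {p : Prog}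
    {m : Mem} (S S' : ℕ → Mem) (len : ℕ) (T Φ : ℕ → ℕ)
    (hs : cnt.arith = true ∧ cnt.deg + 7 ≤ D)
    (h0 : m.set r 0 0 = S 0) (hlen : len < Y)
    (hreg : ∀ k ≤ len, S k r 0 = k) (hreg' : ∀ k < len, S' k r 0 = k)
    (hr : ∀ k ≤ len, cnt.ReadsLt Y (S k)) (hv : ∀ k ≤ len, cnt.val (S k) = len)
    (hbody : ∀ k < len, Runs W p (S k) (S' k) (T k))
    (hS : ∀ k < len, (S' k).set r 0 (k + 1) = S (k + 1))
    (hΦ : ∀ k < len, Φ k + T k + cnt.cost + 10 ≤ Φ (k + 1)) {T' : ℕ}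
    (hT : Φ len + cnt.cost + 10 ≤ Φ 0 + T') : Runs W (forLoop r cnt p) m (S len) T' := by
  have hz : Runs W (.put r (.lit 0) (.lit 0)) m (S 0) 3 :=
    Runs.put (Y := Y) (D := D) hW h0 ⟨trivial, trivial⟩
      ⟨⟨rfl, by simp [Expr.deg]; omega⟩, ⟨rfl, by simp [Expr.deg]; omega⟩⟩ (by simp [Expr.cost])
  have hl : Runs W (.loop (.op .lt (reg r) cnt) (.seq p (incr r))) (S 0) (S len) (T' - 3) := by
    refine Runs.loop hW S len (fun k => T k + 6) Φ
      ⟨by simp [Expr.arith, BinOp.arith, hs.1], by simp [Expr.deg]; omega⟩ ?_ ?_ ?_ ?_ ?_ ?_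
    · intro k hk
      refine ⟨⟨trivial, ?_⟩, hr k hk⟩
      change S k r 0 < Y
      rw [hreg k hk]; omega
    · intro k hk
      change (if S k r 0 < cnt.val (S k) then 1 else 0) ≠ 0
      rw [hreg k hk.le, hv k hk.le, if_pos hk]; simp
    · change (if S len r 0 < cnt.val (S len) then 1 else 0) = 0
      rw [hreg len le_rfl, hv len le_rfl, if_neg (by omega)]
    · intro k hk
      refine (hbody k hk).seq (Runs.put (Y := Y) (D := D) hW ?_ ⟨trivial, ⟨trivial, ?_⟩, trivial⟩
        ⟨⟨rfl, by simp [Expr.deg]; omega⟩, ⟨rfl, by simp [Expr.deg]; omega⟩⟩ (by simp [Expr.cost]))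
      · rw [← hS k hk]
        change (S' k).set r 0 (S' k r 0 + 1) = _
        rw [hreg' k hk]
      · change S' k r 0 < Y
        rw [hreg' k hk]; omega
    · intro k hk
      have := hΦ k hk
      simp only [Expr.cost]; omega
    · simp only [Expr.cost]; omega
  have hmono : Φ 0 ≤ Φ len := by
    have : ∀ j ≤ len, Φ 0 ≤ Φ j := by
      intro j hj
      induction j with
      | zero => exact le_rfl
      | succ j ih => have := ih (by omega); have := hΦ j (by omega); omega
    exact this len le_rfl
  exact (hz.seq hl).mono (by omega)

/-- The array `arr` with `g 0, …, g (len - 1)` written to the cells `off, off + 1, …`. -/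
def fillArr (arr : ℕ → ℕ) (off : ℕ) (g : ℕ → ℕ) (len : ℕ) : ℕ → ℕ :=
  fun i => if off ≤ i ∧ i < off + len then g (i - off) else arr i

theorem fillArr_zero (arr : ℕ → ℕ) (off : ℕ) (g : ℕ → ℕ) : fillArr arr off g 0 = arr := by
  funext i
  unfold fillArr
  rw [if_neg (by omega)]

theorem fillArr_succ (arr : ℕ → ℕ) (off : ℕ) (g : ℕ → ℕ) (len : ℕ) :
    Function.update (fillArr arr off g len) (off + len) (g len) = fillArr arr off g (len + 1) := by
  funext i
  unfold fillArr
  by_cases h : i = off + len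
  · subst h
    rw [Function.update_self, if_pos (by omega)]
    congr; omega
  · rw [Function.update_of_ne h]
    by_cases h2 : off ≤ i ∧ i < off + len
    · rw [if_pos h2, if_pos (by omega)]
    · rw [if_neg h2, if_neg (by omega)]

/-- A loop that fills a part of one array. `H k arr` is the memory with counter `k` and contents
`arr` of the array, whose cell `i` stands in cell `pos i` of array `dst` of the memory. -/
theorem Runs.fill {W Y D : ℕ} (hW : (Y + 2) ^ D ≤ W) {r dst : ℕ} {cnt idx val : Expr} {m : Mem}
    (H : ℕ → (ℕ → ℕ) → Mem) (pos : ℕ → ℕ) (arr : ℕ → ℕ) (off : ℕ) (g : ℕ → ℕ) (len : ℕ)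
    (h0 : m.set r 0 0 = H 0 arr) (hlen : len < Y)
    (hreg : ∀ k arr, H k arr r 0 = k)
    (hsetr : ∀ k arr x, (H k arr).set r 0 x = H x arr)
    (hset : ∀ k arr i x, (H k arr).set dst (pos i) x = H k (Function.update arr i x))
    (hs : cnt.arith = true ∧ cnt.deg + 7 ≤ D)
    (hcnt : ∀ k arr, cnt.ReadsLt Y (H k arr) ∧ cnt.val (H k arr) = len)
    (hsi : idx.arith = true ∧ idx.deg ≤ D)
    (hidx : ∀ k arr, k < len → idx.ReadsLt Y (H k arr) ∧ idx.val (H k arr) = pos (off + k))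
    (hsv : val.arith = true ∧ val.deg ≤ D)
    (hval : ∀ k arr, k < len → val.ReadsLt Y (H k arr) ∧ val.val (H k arr) = g k)
    {T : ℕ} (hT : (idx.cost + val.cost + cnt.cost + 11) * (len + 1) ≤ T) :
    Runs W (fill r dst cnt idx val) m (H len (fillArr arr off g len)) T := by
  refine Runs.forLoop hW (fun k => H k (fillArr arr off g k))
    (fun k => H k (fillArr arr off g (k + 1))) len (fun _ => idx.cost + val.cost + 1)
    (fun k => k * (idx.cost + val.cost + cnt.cost + 11)) hs ?_ hlen ?_ ?_ ?_ ?_ ?_ ?_ ?_ ?_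
  · rw [fillArr_zero, h0]
  · intro k _; exact hreg _ _
  · intro k _; exact hreg _ _
  · intro k _; exact (hcnt _ _).1
  · intro k _; exact (hcnt _ _).2
  · intro k hk
    refine Runs.put hW ?_ ⟨(hidx _ _ hk).1, (hval _ _ hk).1⟩ ⟨hsi, hsv⟩ le_rfl
    rw [(hidx _ _ hk).2, (hval _ _ hk).2, hset, fillArr_succ]
  · intro k _; exact hsetr _ _ _
  · intro k _
    rw [Nat.add_mul, Nat.one_mul]; omega
  · rw [Nat.zero_mul, Nat.zero_add]
    refine le_trans ?_ hT
    rw [Nat.mul_comm len, Nat.mul_add]; omega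

/-! ### Running a program inside a part of the memory -/

/-- Rename the arrays by `f`, and change the index expressions by `ι`. -/
def Expr.embed (f : ℕ → ℕ) (ι : Expr → Expr) : Expr → Expr
  | .lit k => .lit k
  | .get a e => .get (f a) (ι (e.embed f ι))
  | .op o e e' => .op o (e.embed f ι) (e'.embed f ι)

/-- Rename the arrays by `f`, and change the index expressions by `ι`. -/
def Prog.embed (f : ℕ → ℕ) (ι : Expr → Expr) : Prog → Prog
  | .skip => .skip
  | .put a e e' => .put (f a) (ι (e.embed f ι)) (e'.embed f ι)
  | .seq s t => .seq (s.embed f ι) (t.embed f ι)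
  | .ite e s t => .ite (e.embed f ι) (s.embed f ι) (t.embed f ι)
  | .loop e s => .loop (e.embed f ι) (s.embed f ι)

/-- `host v` is a memory that has the memory `v` as a part: cell `i` of array `a` of `v` is
cell `idx i` of array `f a` of `host v`, and `ι` computes `idx`. Index computations cost at most
`κ` further steps. -/
structure IsHost (W W' κ : ℕ) (f : ℕ → ℕ) (ι : Expr → Expr) (idx : ℕ → ℕ) (host : Mem → Mem) :
    Prop where
  le : W ≤ W'
  get : ∀ v a i, host v (f a) (idx i) = v a i
  set : ∀ v a i x, (host v).set (f a) (idx i) x = host (v.set a i x)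
  eval : ∀ v e i, i < W → e.eval W' (host v) = some i → (ι e).eval W' (host v) = some (idx i)
  cost : ∀ e, (ι e).cost ≤ e.cost + κ

section Embed

variable {W W' κ : ℕ} {f : ℕ → ℕ} {ι : Expr → Expr} {idx : ℕ → ℕ} {host : Mem → Mem}

theorem IsHost.eval_embed (H : IsHost W W' κ f ι idx host) {v : Mem} {e : Expr} {x : ℕ}
    (h : e.eval W v = some x) : (e.embed f ι).eval W' (host v) = some x := by
  induction e generalizing x with
  | lit k =>
    obtain ⟨rfl, hx⟩ := lt_of_fit h
    exact fit_of_lt (hx.trans_le H.le)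
  | get a e ih =>
    simp only [Expr.eval, Option.bind_eq_some_iff] at h
    obtain ⟨i, hi, hx⟩ := h
    obtain ⟨rfl, hx⟩ := lt_of_fit hx
    rw [Expr.embed, Expr.eval, H.eval v _ i (Expr.eval_lt hi) (ih hi), Option.bind_some, H.get]
    exact fit_of_lt (hx.trans_le H.le)
  | op o e e' ih ih' =>
    simp only [Expr.eval, Option.bind_eq_some_iff] at h
    obtain ⟨i, hi, j, hj, hx⟩ := h
    obtain ⟨rfl, hx⟩ := lt_of_fit hx
    rw [Expr.embed, Expr.eval, ih hi, Option.bind_some, ih' hj]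
    exact fit_of_lt (hx.trans_le H.le)

theorem IsHost.cost_embed (H : IsHost W W' κ f ι idx host) (e : Expr) :
    (e.embed f ι).cost ≤ (κ + 1) * e.cost := by
  induction e with
  | lit k => simp [Expr.embed, Expr.cost]
  | get a e ih =>
    simp only [Expr.embed, Expr.cost]
    have := H.cost (e.embed f ι)
    rw [Nat.mul_add]; omega
  | op o e e' ih ih' =>
    simp only [Expr.embed, Expr.cost]
    rw [Nat.mul_add, Nat.mul_add]; omega

/-- A program that runs inside a part of a larger memory does there what it does on its own, and
takes at most `κ + 1` times as long. -/
theorem IsHost.exec_embed (H : IsHost W W' κ f ι idx host) {p : Prog} {v v' : Mem} {t : ℕ}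
    (h : Exec W p v v' t) : Runs W' (p.embed f ι) (host v) (host v') ((κ + 1) * t) := by
  induction h with
  | skip m => exact ⟨1, by omega, .skip _⟩
  | @put m a e e' i x hi hx =>
    rw [← H.set]
    refine ⟨_, ?_, .put (H.eval _ _ i (Expr.eval_lt hi) (H.eval_embed hi)) (H.eval_embed hx)⟩
    have := H.cost (e.embed f ι)
    have := H.cost_embed e
    have := H.cost_embed e'
    rw [Nat.mul_add, Nat.mul_add]; omega
  | seq _ _ ih ih' => exact (ih.seq ih').mono (by rw [Nat.mul_add])
  | @iteTrue e s s' m m₁ x t he hx _ ih =>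
    obtain ⟨t', ht, h⟩ := ih
    refine ⟨_, ?_, .iteTrue (H.eval_embed he) hx h⟩
    have := H.cost_embed e
    rw [Nat.mul_add, Nat.mul_add]; omega
  | @iteFalse e s s' m m₁ t he _ ih =>
    obtain ⟨t', ht, h⟩ := ih
    refine ⟨_, ?_, .iteFalse (H.eval_embed he) h⟩
    have := H.cost_embed e
    rw [Nat.mul_add, Nat.mul_add]; omega
  | @loopStop e s m he =>
    refine ⟨_, ?_, .loopStop (H.eval_embed he)⟩
    have := H.cost_embed e
    rw [Nat.mul_add]; omega
  | @loopStep e s m m₁ m₂ x t t' he hx _ _ ih ih' =>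
    obtain ⟨t₁, ht₁, h₁⟩ := ih
    obtain ⟨t₂, ht₂, h₂⟩ := ih'
    refine ⟨_, ?_, .loopStep (H.eval_embed he) hx h₁ h₂⟩
    have := H.cost_embed e
    rw [Nat.mul_add, Nat.mul_add, Nat.mul_add]; omega

end Embed

/-! ### The memory of the solvers -/

/-- An array that is zero except for cell `0`. -/
def single (x : ℕ) : ℕ → ℕ := fun i => if i = 0 then x else 0

/-- The contents of the memory of a solver: messages, outputs, three inputs, six registers, two
arrays, and three memories in which given programs run.

In the `γ`-OuMv solver, `used` and `pend` say for each position of the block whether it was used in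
the current round and how many copies of it are pending, and `vU`, `vR` and `vA` are the memories of
the procedure that computes the block, of the other procedures of the reduction and of the algorithm
with predictions. In the OuMv solver, `pend` holds the parameters of the layout, `vA` the interleaved
memories of all `γ`-OuMv instances, and `used` and `vR` are idle. -/
structure GState where
  msg : ℕ → ℕ
  out : ℕ → ℕ
  in2 : ℕ → ℕ
  in3 : ℕ → ℕ
  in4 : ℕ → ℕ
  r : ℕ
  i : ℕ
  s : ℕ
  cnt : ℕ
  len : ℕ
  acc : ℕ
  used : ℕ → ℕ
  pend : ℕ → ℕ
  vU : Mem
  vR : Mem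
  vA : Mem

/-- The memory with the contents `σ`. Arrays `0` to `4` are dictated by the conventions for messages
and inputs; the arrays from `13` on are dealt out to `vU`, `vR` and `vA` in turn. -/
def GState.mem (σ : GState) : Mem
  | 0 => σ.msg
  | 1 => σ.out
  | 2 => σ.in2
  | 3 => σ.in3
  | 4 => σ.in4
  | 5 => single σ.r
  | 6 => single σ.i
  | 7 => single σ.s
  | 8 => single σ.cnt
  | 9 => single σ.len
  | 10 => single σ.acc
  | 11 => σ.used
  | 12 => σ.pend
  | b + 13 => match b % 3 with
    | 0 => σ.vU (b / 3)
    | 1 => σ.vR (b / 3)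
    | _ => σ.vA (b / 3)

/-- The arrays of `vU`. -/
def fU (a : ℕ) : ℕ := 3 * a + 13
/-- The arrays of `vR`. -/
def fR (a : ℕ) : ℕ := 3 * a + 14
/-- The arrays of `vA`. -/
def fA (a : ℕ) : ℕ := 3 * a + 15

namespace GState

variable (σ : GState)

@[simp] theorem mem_fU (a : ℕ) : σ.mem (fU a) = σ.vU a := by
  simp [fU, mem, Nat.mul_mod_right]

@[simp] theorem mem_fR (a : ℕ) : σ.mem (fR a) = σ.vR a := by
  have h1 : (3 * a + 1) % 3 = 1 := by omega
  have h2 : (3 * a + 1) / 3 = a := by omega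
  change (match (3 * a + 1) % 3 with
    | 0 => σ.vU ((3 * a + 1) / 3)
    | 1 => σ.vR ((3 * a + 1) / 3)
    | _ => σ.vA ((3 * a + 1) / 3)) = _
  rw [h1, h2]
  rfl

@[simp] theorem mem_fA (a : ℕ) : σ.mem (fA a) = σ.vA a := by
  have h1 : (3 * a + 2) % 3 = 2 := by omega
  have h2 : (3 * a + 2) / 3 = a := by omega
  change (match (3 * a + 2) % 3 with
    | 0 => σ.vU ((3 * a + 2) / 3)
    | 1 => σ.vR ((3 * a + 2) / 3)
    | _ => σ.vA ((3 * a + 2) / 3)) = _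
  rw [h1, h2]
  rfl

/-- Two memories agree if they agree on the arrays `0` to `12` and on those of `vU`, `vR` and `vA`. -/
theorem ext_mem {m m' : Mem} (h : ∀ b < 13, m b = m' b) (hU : ∀ a, m (fU a) = m' (fU a))
    (hR : ∀ a, m (fR a) = m' (fR a)) (hA : ∀ a, m (fA a) = m' (fA a)) : m = m' := by
  funext b
  by_cases hb : b < 13
  · exact h b hb
  · have : b = fU ((b - 13) / 3) ∨ b = fR ((b - 13) / 3) ∨ b = fA ((b - 13) / 3) := by
      unfold fU fR fA; omega
    rcases this with e | e | e <;> rw [e]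
    · exact hU _
    · exact hR _
    · exact hA _

theorem set_same (m : Mem) (a i x : ℕ) : m.set a i x a = Function.update (m a) i x := by
  funext j
  simp [Mem.set, Function.update_apply]

theorem set_other (m : Mem) {a b : ℕ} (i x : ℕ) (h : b ≠ a) : m.set a i x b = m b := by
  funext j
  simp [Mem.set, h]

theorem update_single (x y : ℕ) : Function.update (single x) 0 y = single y := by
  funext j
  unfold single Function.update
  by_cases h : j = 0 <;> simp [h]

/-- Writing to one of the first arrays. -/
theorem set_low {σ σ' : GState} {a i x : ℕ} (ha : a < 13)
    (h : σ'.mem a = Function.update (σ.mem a) i x) (hne : ∀ b < 13, b ≠ a → σ'.mem b = σ.mem b)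
    (hU : σ'.vU = σ.vU) (hR : σ'.vR = σ.vR) (hA : σ'.vA = σ.vA) :
    σ.mem.set a i x = σ'.mem := by
  apply ext_mem
  · intro b hb
    by_cases hba : b = a
    · subst hba; rw [set_same, h]
    · rw [set_other _ _ _ hba, hne b hb hba]
  · intro b
    rw [set_other _ _ _ (by unfold fU; omega), mem_fU, mem_fU, hU]
  · intro b
    rw [set_other _ _ _ (by unfold fR; omega), mem_fR, mem_fR, hR]
  · intro b
    rw [set_other _ _ _ (by unfold fA; omega), mem_fA, mem_fA, hA]

theorem forall_lt_13 {p : ℕ → Prop} (h : p 0 ∧ p 1 ∧ p 2 ∧ p 3 ∧ p 4 ∧ p 5 ∧ p 6 ∧ p 7 ∧ p 8 ∧ p 9 ∧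
    p 10 ∧ p 11 ∧ p 12) : ∀ b < 13, p b := by
  intro b hb
  obtain ⟨h0, h1, h2, h3, h4, h5, h6, h7, h8, h9, h10, h11, h12⟩ := h
  interval_cases b <;> assumption

theorem set_out (i x : ℕ) :
    σ.mem.set 1 i x = mem { σ with out := Function.update σ.out i x } :=
  set_low (by norm_num) rfl (forall_lt_13 (by simp [mem])) rfl rfl rfl
theorem set_r (x : ℕ) : σ.mem.set 5 0 x = mem { σ with r := x } :=
  set_low (by norm_num) (update_single _ _).symm (forall_lt_13 (by simp [mem])) rfl rfl rfl
theorem set_i (x : ℕ) : σ.mem.set 6 0 x = mem { σ with i := x } :=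
  set_low (by norm_num) (update_single _ _).symm (forall_lt_13 (by simp [mem])) rfl rfl rfl
theorem set_s (x : ℕ) : σ.mem.set 7 0 x = mem { σ with s := x } :=
  set_low (by norm_num) (update_single _ _).symm (forall_lt_13 (by simp [mem])) rfl rfl rfl
theorem set_cnt (x : ℕ) : σ.mem.set 8 0 x = mem { σ with cnt := x } :=
  set_low (by norm_num) (update_single _ _).symm (forall_lt_13 (by simp [mem])) rfl rfl rfl
theorem set_len (x : ℕ) : σ.mem.set 9 0 x = mem { σ with len := x } :=
  set_low (by norm_num) (update_single _ _).symm (forall_lt_13 (by simp [mem])) rfl rfl rfl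
theorem set_acc (x : ℕ) : σ.mem.set 10 0 x = mem { σ with acc := x } :=
  set_low (by norm_num) (update_single _ _).symm (forall_lt_13 (by simp [mem])) rfl rfl rfl
theorem set_used (i x : ℕ) :
    σ.mem.set 11 i x = mem { σ with used := Function.update σ.used i x } :=
  set_low (by norm_num) rfl (forall_lt_13 (by simp [mem])) rfl rfl rfl
theorem set_pend (i x : ℕ) :
    σ.mem.set 12 i x = mem { σ with pend := Function.update σ.pend i x } :=
  set_low (by norm_num) rfl (forall_lt_13 (by simp [mem])) rfl rfl rfl

theorem set_fU (a i x : ℕ) : σ.mem.set (fU a) i x = mem { σ with vU := σ.vU.set a i x } := by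
  apply ext_mem
  · intro b hb
    rw [set_other _ _ _ (by unfold fU; omega)]
    revert b
    exact forall_lt_13 (by simp [mem])
  · intro b
    rw [mem_fU]
    by_cases h : b = a
    · subst h; simp only [set_same, mem_fU]
    · rw [set_other _ _ _ (by unfold fU; omega), mem_fU]
      exact (set_other _ _ _ h).symm
  · intro b
    rw [set_other _ _ _ (by unfold fU fR; omega), mem_fR, mem_fR]
  · intro b
    rw [set_other _ _ _ (by unfold fU fA; omega), mem_fA, mem_fA]

theorem set_fR (a i x : ℕ) : σ.mem.set (fR a) i x = mem { σ with vR := σ.vR.set a i x } := by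
  apply ext_mem
  · intro b hb
    rw [set_other _ _ _ (by unfold fR; omega)]
    revert b
    exact forall_lt_13 (by simp [mem])
  · intro b
    rw [set_other _ _ _ (by unfold fU fR; omega), mem_fU, mem_fU]
  · intro b
    rw [mem_fR]
    by_cases h : b = a
    · subst h; simp only [set_same, mem_fR]
    · rw [set_other _ _ _ (by unfold fR; omega), mem_fR]
      exact (set_other _ _ _ h).symm
  · intro b
    rw [set_other _ _ _ (by unfold fR fA; omega), mem_fA, mem_fA]

theorem set_fA (a i x : ℕ) : σ.mem.set (fA a) i x = mem { σ with vA := σ.vA.set a i x } := by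
  apply ext_mem
  · intro b hb
    rw [set_other _ _ _ (by unfold fA; omega)]
    revert b
    exact forall_lt_13 (by simp [mem])
  · intro b
    rw [set_other _ _ _ (by unfold fU fA; omega), mem_fU, mem_fU]
  · intro b
    rw [set_other _ _ _ (by unfold fR fA; omega), mem_fR, mem_fR]
  · intro b
    rw [mem_fA]
    by_cases h : b = a
    · subst h; simp only [set_same, mem_fA]
    · rw [set_other _ _ _ (by unfold fA; omega), mem_fA]
      exact (set_other _ _ _ h).symm

@[simp] theorem mem_0 : σ.mem 0 = σ.msg := rfl
@[simp] theorem mem_1 : σ.mem 1 = σ.out := rfl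
@[simp] theorem mem_2 : σ.mem 2 = σ.in2 := rfl
@[simp] theorem mem_3 : σ.mem 3 = σ.in3 := rfl
@[simp] theorem mem_4 : σ.mem 4 = σ.in4 := rfl
@[simp] theorem mem_r : σ.mem 5 0 = σ.r := rfl
@[simp] theorem mem_i : σ.mem 6 0 = σ.i := rfl
@[simp] theorem mem_s : σ.mem 7 0 = σ.s := rfl
@[simp] theorem mem_cnt : σ.mem 8 0 = σ.cnt := rfl
@[simp] theorem mem_len : σ.mem 9 0 = σ.len := rfl
@[simp] theorem mem_acc : σ.mem 10 0 = σ.acc := rfl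
@[simp] theorem mem_used : σ.mem 11 = σ.used := rfl
@[simp] theorem mem_pend : σ.mem 12 = σ.pend := rfl

theorem isHost_U {W W' : ℕ} (h : W ≤ W') :
    IsHost W W' 0 fU id id (fun v => mem { σ with vU := v }) where
  le := h
  get v a i := by simp
  set v a i x := set_fU _ _ _ _
  eval v e i _ h := h
  cost e := le_rfl

theorem isHost_R {W W' : ℕ} (h : W ≤ W') :
    IsHost W W' 0 fR id id (fun v => mem { σ with vR := v }) where
  le := h
  get v a i := by simp
  set v a i x := set_fR _ _ _ _
  eval v e i _ h := h
  cost e := le_rfl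

theorem isHost_A {W W' : ℕ} (h : W ≤ W') :
    IsHost W W' 0 fA id id (fun v => mem { σ with vA := v }) where
  le := h
  get v a i := by simp
  set v a i x := set_fA _ _ _ _
  eval v e i _ h := h
  cost e := le_rfl

theorem runs_U {W W' : ℕ} (h : W ≤ W') {p : Prog} {v : Mem} {t : ℕ} (he : Exec W p σ.vU v t) :
    Runs W' (p.embed fU id) σ.mem (mem { σ with vU := v }) t := by
  simpa using (σ.isHost_U h).exec_embed he

theorem runs_R {W W' : ℕ} (h : W ≤ W') {p : Prog} {v : Mem} {t : ℕ} (he : Exec W p σ.vR v t) :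
    Runs W' (p.embed fR id) σ.mem (mem { σ with vR := v }) t := by
  simpa using (σ.isHost_R h).exec_embed he

theorem runs_A {W W' : ℕ} (h : W ≤ W') {p : Prog} {v : Mem} {t : ℕ} (he : Exec W p σ.vA v t) :
    Runs W' (p.embed fA id) σ.mem (mem { σ with vA := v }) t := by
  simpa using (σ.isHost_A h).exec_embed he

end GState

theorem Mem.load_eq_update (m : Mem) (a : ℕ) (l : List ℕ) :
    m.load a l = Function.update m a (fillArr (m a) 0 (cell l) (l.length + 1)) := by
  funext b i
  by_cases h : b = a
  · subst h
    by_cases hi : i ≤ l.length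
    · simp [Mem.load, fillArr, hi, Nat.lt_succ_of_le hi]
    · simp [Mem.load, fillArr, hi]
  · simp [Mem.load, h]

/-- The list `l` in the cells `1, 2, …` of array `a`. -/
def Mem.write (m : Mem) (a : ℕ) (l : List ℕ) : Mem :=
  fun b i => if b = a ∧ 1 ≤ i ∧ i ≤ l.length then l.getD (i - 1) 0 else m b i

theorem Mem.write_nil (m : Mem) (a : ℕ) : m.write a [] = m := by
  funext b i
  unfold Mem.write
  rw [if_neg]
  rintro ⟨_, h1, h2⟩
  simp at h2; omega

theorem Mem.write_append (m : Mem) (a : ℕ) (l : List ℕ) (x : ℕ) :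
    m.write a (l ++ [x]) = (m.write a l).set a (l.length + 1) x := by
  funext b i
  simp only [Mem.write, Mem.set, List.length_append, List.length_singleton]
  by_cases hb : b = a
  · by_cases hi : i = l.length + 1
    · subst hi; simp [hb]
    · by_cases h : 1 ≤ i ∧ i ≤ l.length
      · rw [if_pos ⟨hb, by omega⟩, if_neg (by tauto), if_pos ⟨hb, h⟩]
        simp only [List.getD_eq_getElem?_getD]
        rw [List.getElem?_append_left (by omega)]
      · rw [if_neg (by omega), if_neg (by tauto), if_neg (by tauto)]
  · simp [hb]

theorem Mem.write_set_zero (m : Mem) (a : ℕ) (l : List ℕ) :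
    (m.write a l).set a 0 l.length = m.load a l := by
  funext b i
  simp only [Mem.write, Mem.set, Mem.load, cell]
  by_cases hb : b = a
  · by_cases hi : i = 0
    · simp [hb, hi]
    · have : 1 ≤ i := by omega
      simp [hb, hi, this]
  · simp [hb]

/-! ### One round of the `γ`-OuMv solver -/

infixr:60 " ;; " => Prog.seq

/-- Entry `k` (type, word, cyclic order for `k = 2, 3, 4`) of the description of the request at
the position of the block that stands in register `i`. -/
abbrev entry (k : ℕ) : Expr := .get (fU 1) (.op .add (.lit k) (.op .mul (.lit 3) (reg 6)))

/-- Issue the request at position `i` of the block to the algorithm with predictions. -/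
def issueProg (astep : Prog) : Prog :=
  .put (fA 0) (.lit 0) (.lit 2) ;; .put (fA 0) (.lit 1) (entry 2) ;;
    .put (fA 0) (.lit 2) (entry 3) ;; astep.embed fA id

/-- Issue the requests selected by the reduction and collect the answers. -/
def answerProg (astep : Prog) : Prog :=
  .put 8 (.lit 0) (.lit 0) ;;
  forLoop 5 (.get (fR 1) (.lit 0))
    (.put 6 (.lit 0) (.get (fR 1) (.op .add (reg 5) (.lit 1))) ;;
      .put 11 (reg 6) (.lit 1) ;; issueProg astep ;;
      .ite (entry 2) (incr 8 ;; .put (fR 0) (reg 8) (.get (fA 1) (.lit 1))) .skip) ;;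
  .put (fR 0) (.lit 0) (reg 8)

/-- Postpone the unused requests of the block; as soon as the number of postponed copies of
a request reaches its cyclic order, issue them all. -/
def flushProg (astep : Prog) : Prog :=
  forLoop 6 (reg 9)
    (.ite (.get 11 (reg 6)) (.put 11 (reg 6) (.lit 0))
      (.ite (.op .lt (.op .add (.get 12 (reg 6)) (.lit 1)) (entry 4))
        (.put 12 (reg 6) (.op .add (.get 12 (reg 6)) (.lit 1)))
        (forLoop 7 (.op .add (.get 12 (reg 6)) (.lit 1)) (issueProg astep) ;;
          .put 12 (reg 6) (.lit 0))))

/-- The program for one round. -/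
def gammaStep (select decode astep : Prog) : Prog :=
  fill 5 (fR 0) (.op .add (.get 0 (.lit 0)) (.lit 1)) (reg 5) (.get 0 (reg 5)) ;;
  select.embed fR id ;; answerProg astep ;; flushProg astep ;; decode.embed fR id ;;
  .put 1 (.lit 0) (.lit 1) ;; .put 1 (.lit 1) (.get (fR 1) (.lit 1))

open GState in
theorem runs_issueProg {W WA Y : ℕ} (hW : (Y + 2) ^ 40 ≤ W) (hA : WA ≤ W) {astep : Prog}
    (σ : GState) (hi : σ.i < Y) (hU : ∀ c, σ.vU 1 c < Y) {v : Mem} {t : ℕ}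
    (he : Exec WA astep (σ.vA.load 0 [σ.vU 1 (2 + 3 * σ.i), σ.vU 1 (3 + 3 * σ.i)]) v t) :
    Runs W (issueProg astep) σ.mem (mem { σ with vA := v }) (t + 30) := by
  have hload : σ.vA.load 0 [σ.vU 1 (2 + 3 * σ.i), σ.vU 1 (3 + 3 * σ.i)] =
      ((σ.vA.set 0 0 2).set 0 1 (σ.vU 1 (2 + 3 * σ.i))).set 0 2 (σ.vU 1 (3 + 3 * σ.i)) := by
    funext b c
    by_cases hb : b = 0
    · rcases c with _ | _ | _ | c <;> simp [Mem.load, Mem.set, cell, hb]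
    · simp [Mem.load, Mem.set, hb]
  rw [hload] at he
  have h1 : Runs W (.put (fA 0) (.lit 0) (.lit 2)) σ.mem
      (mem { σ with vA := σ.vA.set 0 0 2 }) 3 :=
    Runs.put hW (set_fA _ _ _ _) (by simp [Expr.ReadsLt]) (by decide) (by decide)
  have h2 : Runs W (.put (fA 0) (.lit 1) (entry 2)) (mem { σ with vA := σ.vA.set 0 0 2 })
      (mem { σ with vA := (σ.vA.set 0 0 2).set 0 1 (σ.vU 1 (2 + 3 * σ.i)) }) 9 :=
    Runs.put hW (by simp [Expr.val, BinOp.eval, set_fA]) (by simp [Expr.ReadsLt, hi, hU, Expr.val])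
      (by decide) (by decide)
  have h3 : Runs W (.put (fA 0) (.lit 2) (entry 3))
      (mem { σ with vA := (σ.vA.set 0 0 2).set 0 1 (σ.vU 1 (2 + 3 * σ.i)) })
      (mem { σ with vA := (((σ.vA.set 0 0 2).set 0 1 (σ.vU 1 (2 + 3 * σ.i))).set 0 2
        (σ.vU 1 (3 + 3 * σ.i))) }) 9 :=
    Runs.put hW (by simp [Expr.val, BinOp.eval, set_fA]) (by simp [Expr.ReadsLt, hi, hU, Expr.val])
      (by decide) (by decide)
  exact (h1.seq (h2.seq (h3.seq (runs_A _ hA he)))).mono (by omega)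

/-- The outputs `o t` at those times `t < k` at which the request `pos t` is a query. -/
def answersUpTo (isq : ℕ → Prop) [DecidablePred isq] (pos o : ℕ → ℕ) (k : ℕ) : List ℕ :=
  ((List.range k).filter fun t => isq (pos t)).map o

theorem answersUpTo_succ (isq : ℕ → Prop) [DecidablePred isq] (pos o : ℕ → ℕ) (k : ℕ) :
    answersUpTo isq pos o (k + 1) =
      if isq (pos k) then answersUpTo isq pos o k ++ [o k] else answersUpTo isq pos o k := by
  unfold answersUpTo
  rw [List.range_succ, List.filter_append]
  by_cases h : isq (pos k) <;> simp [h]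

theorem answersUpTo_length_le (isq : ℕ → Prop) [DecidablePred isq] (pos o : ℕ → ℕ) (k : ℕ) :
    (answersUpTo isq pos o k).length ≤ k := by
  unfold answersUpTo
  rw [List.length_map]
  exact (List.length_filter_le _ _).trans (by simp)

open GState in
/-- Here `blk` lists the positions selected, `pos t` is the position of the `t`-th request of the
round, `mems t` is the memory of the algorithm with predictions before that request, `ts t` the time
it takes, and `TS` the partial sums of `ts`. -/
theorem runs_answerProg {W WA Y L : ℕ} (hW : (Y + 2) ^ 40 ≤ W) (hA : WA ≤ W) {astep : Prog}
    (σ : GState) (hU : ∀ c, σ.vU 1 c < Y) (hLY : L < Y) (hr1 : ∀ c, σ.vR 1 c < Y)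
    (hused : σ.used = fun _ => 0) (blk : List ℕ) (hblk : σ.vR.output = blk)
    (hlt : ∀ i ∈ blk, i < L) (hlen : blk.length ≤ L)
    (mems : ℕ → Mem) (ts TS : ℕ → ℕ) (hTS : ∀ t, TS (t + 1) = TS t + ts t) (hm0 : mems 0 = σ.vA)
    (pos : ℕ → ℕ) (hpos : ∀ r (hr : r < blk.length), pos r = blk[r])
    (hex : ∀ t < blk.length, Exec WA astep
      ((mems t).load 0 [σ.vU 1 (2 + 3 * pos t), σ.vU 1 (3 + 3 * pos t)]) (mems (t + 1)) (ts t))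
    (ho : ∀ t < blk.length, mems (t + 1) 1 1 < Y) :
    ∃ r i, Runs W (answerProg astep) σ.mem (mem { σ with
      r := r, i := i
      cnt := (answersUpTo (fun j => σ.vU 1 (2 + 3 * j) ≠ 0) pos (fun t => mems (t + 1) 1 1)
        blk.length).length
      used := fun j => if j ∈ blk then 1 else 0
      vR := σ.vR.load 0 (answersUpTo (fun j => σ.vU 1 (2 + 3 * j) ≠ 0) pos
        (fun t => mems (t + 1) 1 1) blk.length)
      vA := mems blk.length }) (100 * (blk.length + 1) + (TS blk.length - TS 0)) := by
  set ans := answersUpTo (fun j => σ.vU 1 (2 + 3 * j) ≠ 0) pos (fun t => mems (t + 1) 1 1)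
    with hans
  have hR1 : ∀ (l : List ℕ), (σ.vR.write 0 l) 1 = σ.vR 1 := by
    intro l; funext c; simp [Mem.write]
  have hcnt : σ.vR 1 0 = blk.length := by rw [← hblk, Mem.output_length]
  have hcell : ∀ r (hr : r < blk.length), σ.vR 1 (r + 1) = pos r := by
    intro r hr
    rw [hpos r hr]
    subst hblk
    exact (Mem.output_getElem _ _ hr).symm
  have hposL : ∀ r < blk.length, pos r < L := by
    intro r hr
    rw [hpos r hr]; exact hlt _ (List.getElem_mem _)
  have hTSm : ∀ r, TS 0 ≤ TS r := by
    intro r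
    induction r with
    | zero => exact le_rfl
    | succ r ih => have := hTS r; omega
  let S : ℕ → GState := fun r => { σ with
    r := r
    i := r.casesOn σ.i pos
    cnt := (ans r).length
    used := fun j => if j ∈ blk.take r then 1 else 0
    vR := σ.vR.write 0 (ans r)
    vA := mems r }
  have h1 : Runs W (.put 8 (.lit 0) (.lit 0)) σ.mem (mem { σ with cnt := 0 }) 3 :=
    Runs.put hW (set_cnt _ _) (by simp [Expr.ReadsLt]) (by decide) (by decide)
  have h2 := Runs.forLoop hW (r := 5) (cnt := .get (fR 1) (.lit 0))
    (p := .put 6 (.lit 0) (.get (fR 1) (.op .add (reg 5) (.lit 1))) ;;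
      .put 11 (reg 6) (.lit 1) ;; issueProg astep ;;
      .ite (entry 2) (incr 8 ;; .put (fR 0) (reg 8) (.get (fA 1) (.lit 1))) .skip)
    (m := mem { σ with cnt := 0 }) (fun r => (S r).mem)
    (fun r => mem { S (r + 1) with r := r }) blk.length (fun r => ts r + 80)
    (fun r => 92 * r + TS r) (by decide) ?_ (by omega) (fun _ _ => rfl) (fun _ _ => rfl)
    ?_ ?_ ?_ (fun r _ => set_r _ _) ?_ (T' := 100 * blk.length + 20 + (TS blk.length - TS 0)) ?_
  rotate_left
  · rw [set_r]
    congr 1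
    simp [S, hans, answersUpTo, Mem.write_nil, hused, hm0]
  · intro k _
    simp [Expr.ReadsLt, Expr.val, S, hR1, hr1]
  · intro k _
    simp [Expr.val, S, hR1, hcnt]
  · intro r hr
    have hp := hposL r hr
    have e1 : Runs W (.put 6 (.lit 0) (.get (fR 1) (.op .add (reg 5) (.lit 1)))) (S r).mem
        (mem { S r with i := pos r }) 7 := by
      refine Runs.put hW ?_ ?_ (by decide) (by decide)
      · simp [Expr.val, BinOp.eval, S, set_i, hR1, hcell r hr]
      · simp [Expr.ReadsLt, Expr.val, BinOp.eval, S, hR1, hr1]; omega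
    have e2 : Runs W (.put 11 (reg 6) (.lit 1)) (mem { S r with i := pos r })
        (mem { S r with i := pos r, used := (S (r + 1)).used }) 4 := by
      refine Runs.put hW ?_ ?_ (by decide) (by decide)
      · simp only [Expr.val, mem_i, set_used]
        congr 2
        funext j
        rw [Function.update_apply]
        simp only [S, hpos r hr, List.take_add_one, List.getElem?_eq_getElem hr, Option.toList_some,
          List.mem_append, List.mem_singleton]
        by_cases h : j = blk[r] <;> simp [h]
      · simp [Expr.ReadsLt, Expr.val]; omega
    have e3 : Runs W (issueProg astep) (mem { S r with i := pos r, used := (S (r + 1)).used })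
        (mem { S r with i := pos r, used := (S (r + 1)).used, vA := mems (r + 1) }) (ts r + 30) :=
      runs_issueProg hW hA { S r with i := pos r, used := (S (r + 1)).used } (by simp; omega) hU
        (hex r hr)
    have e4 : Runs W (.ite (entry 2) (incr 8 ;; .put (fR 0) (reg 8) (.get (fA 1) (.lit 1))) .skip)
        (mem { S r with i := pos r, used := (S (r + 1)).used, vA := mems (r + 1) })
        (mem { S (r + 1) with r := r }) 30 := by
      have hent : Expr.ReadsLt Y
          (mem { S r with i := pos r, used := (S (r + 1)).used, vA := mems (r + 1) }) (entry 2) := by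
        simp [Expr.ReadsLt, Expr.val, S, hU]; omega
      have hal : (ans r).length < Y := (answersUpTo_length_le _ _ _ _).trans_lt (by omega)
      have hal' : (ans r).length + 1 < Y := by
        have := answersUpTo_length_le (fun j => σ.vU 1 (2 + 3 * j) ≠ 0) pos
          (fun t => mems (t + 1) 1 1) r
        rw [hans]; omega
      by_cases hq : σ.vU 1 (2 + 3 * pos r) ≠ 0
      · have hs : ans (r + 1) = ans r ++ [mems (r + 1) 1 1] := by
          rw [hans, answersUpTo_succ, if_pos hq]
        have f1 : Runs W (incr 8)
            (mem { S r with i := pos r, used := (S (r + 1)).used, vA := mems (r + 1) })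
            (mem { S r with i := pos r, used := (S (r + 1)).used, vA := mems (r + 1),
                            cnt := (ans r).length + 1 }) 6 :=
          Runs.put hW (set_cnt _ _) (by simp [Expr.ReadsLt, Expr.val, S, hal])
            (by decide) (by decide)
        have f2 : Runs W (.put (fR 0) (reg 8) (.get (fA 1) (.lit 1)))
            (mem { S r with i := pos r, used := (S (r + 1)).used, vA := mems (r + 1),
                            cnt := (ans r).length + 1 })
            (mem { S (r + 1) with r := r }) 5 := by
          refine Runs.put hW ?_ ?_ (by decide) (by decide)
          · simp only [Expr.val, mem_cnt, mem_fA, set_fR]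
            congr 1
            simp only [S, hs, Mem.write_append]
            simp
          · simp [Expr.ReadsLt, Expr.val, S, hal', ho r hr]
        refine (Runs.iteTrue hW hent (by decide) ?_ (f1.seq f2)).mono (by decide)
        simpa [Expr.val, BinOp.eval, S] using hq
      · have hs : ans (r + 1) = ans r := by
          rw [hans, answersUpTo_succ, if_neg hq]
        have : (mem { S r with i := pos r, used := (S (r + 1)).used, vA := mems (r + 1) }) =
            (mem { S (r + 1) with r := r }) := by
          congr 1
          simp [S, hs]
        rw [← this]
        refine (Runs.iteFalse hW hent (by decide) ?_ (Runs.skip _)).mono (by decide)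
        simpa [Expr.val, BinOp.eval, S] using hq
    exact (e1.seq (e2.seq (e3.seq e4))).mono (by omega)
  · intro r hr
    have := hTS r
    simp only [Expr.cost]; omega
  · have := hTSm blk.length
    simp only [Expr.cost]; omega
  have h3 : Runs W (.put (fR 0) (.lit 0) (reg 8)) (S blk.length).mem (mem { S blk.length with
      vR := σ.vR.load 0 (ans blk.length) }) 5 := by
    refine Runs.put hW ?_ ?_ (by decide) (by decide)
    · simp only [Expr.val, mem_cnt, set_fR]
      congr 2
      exact Mem.write_set_zero _ _ _
    · have : (ans blk.length).length < Y :=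
        (answersUpTo_length_le _ _ _ _).trans_lt (hlen.trans_lt hLY)
      simpa [Expr.ReadsLt, Expr.val, S] using this
  refine ⟨blk.length, (S blk.length).i, ?_⟩
  have := (h1.seq (h2.seq h3)).mono (T' := 100 * (blk.length + 1) + (TS blk.length - TS 0))
    (by omega)
  simpa [S, answerProg] using this

/-- How many copies of the request at position `i` are issued at the end of a round in which
the positions `blk` are used, when `p i` copies are pending; `od` gives the cyclic orders. -/
def flushCount (od : ℕ → ℕ) (blk : List ℕ) (p : ℕ → ℕ) (i : ℕ) : ℕ :=
  if i ∈ blk then 0 else if p i + 1 < od i then 0 else p i + 1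

/-- The number of pending copies after the round. -/
def nextPend (od : ℕ → ℕ) (blk : List ℕ) (p : ℕ → ℕ) (i : ℕ) : ℕ :=
  if i ∈ blk then p i else if p i + 1 < od i then p i + 1 else 0

theorem le_of_step {f g : ℕ → ℕ} (h : ∀ t, f (t + 1) = f t + g t) {a b : ℕ} (hab : a ≤ b) :
    f a ≤ f b := by
  induction b, hab using Nat.le_induction with
  | base => exact le_rfl
  | succ b _ ih => rw [h]; omega

open GState in
/-- Notation as in `runs_answerProg`; `off i` requests of the round are issued before the copies of
the request at position `i`. The overhead for a request is charged to its time, which is positive. -/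
theorem runs_flushProg {W WA Y : ℕ} (hW : (Y + 2) ^ 40 ≤ W) (hA : WA ≤ W) {astep : Prog}
    (σ : GState) (hU : ∀ c, σ.vU 1 c < Y) (hLY : σ.len < Y) (blk : List ℕ)
    (hused : σ.used = fun j => if j ∈ blk then 1 else 0)
    (hlt : ∀ i ∈ blk, i < σ.len) (hp : ∀ i, σ.pend i + 1 < Y)
    (mems : ℕ → Mem) (ts TS : ℕ → ℕ) (hTS : ∀ t, TS (t + 1) = TS t + ts t)
    (hts : ∀ t, 0 < ts t) (off pos : ℕ → ℕ) (hm0 : mems (off 0) = σ.vA)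
    (hoff : ∀ i, off (i + 1) = off i + flushCount (fun j => σ.vU 1 (4 + 3 * j)) blk σ.pend i)
    (hpos : ∀ i < σ.len, ∀ s < flushCount (fun j => σ.vU 1 (4 + 3 * j)) blk σ.pend i,
      pos (off i + s) = i)
    (hex : ∀ t < off σ.len, Exec WA astep
      ((mems t).load 0 [σ.vU 1 (2 + 3 * pos t), σ.vU 1 (3 + 3 * pos t)]) (mems (t + 1)) (ts t)) :
    ∃ s, Runs W (flushProg astep) σ.mem (mem { σ with
      i := σ.len, s := s
      used := fun _ => 0
      pend := fun j => if j < σ.len then nextPend (fun j => σ.vU 1 (4 + 3 * j)) blk σ.pend j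
        else σ.pend j
      vA := mems (off σ.len) }) (120 * (σ.len + 1) + 100 * (TS (off σ.len) - TS (off 0))) := by
  set od : ℕ → ℕ := fun j => σ.vU 1 (4 + 3 * j) with hod
  set p := σ.pend with hpd
  let sv : ℕ → ℕ := fun i => Nat.rec σ.s (fun i s => if i ∈ blk then s else
    if p i + 1 < od i then s else p i + 1) i
  have hsv : ∀ i, sv (i + 1) = if i ∈ blk then sv i else
    if p i + 1 < od i then sv i else p i + 1 := fun i => rfl
  have hmono : ∀ {a b}, a ≤ b → TS a ≤ TS b := fun h => le_of_step hTS h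
  let S : ℕ → GState := fun i => { σ with
    i := i
    s := sv i
    used := fun j => if i ≤ j ∧ j ∈ blk then 1 else 0
    pend := fun j => if j < i then nextPend od blk p j else p j
    vA := mems (off i) }
  have hpS : ∀ i j, (S i).pend j + 1 < Y := by
    intro i j
    simp only [S, nextPend]
    have := hp j
    split
    · split
      · exact hp j
      · split
        · rename_i h
          have := hU (4 + 3 * j)
          simp only [hod] at h; omega
        · omega
    · exact hp j
  have hentry : ∀ i < σ.len, ∀ σ' : GState, σ'.i = i → σ'.vU = σ.vU →
      (entry 4).ReadsLt Y σ'.mem ∧ (entry 4).val σ'.mem = od i := by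
    intro i hi σ' h1 h2
    have h3 : i < Y := by omega
    constructor
    · simp [Expr.ReadsLt, Expr.val, h1, h2, hU, h3]
    · simp [Expr.val, BinOp.eval, h1, h2, hod]
  have h2 := Runs.forLoop hW (r := 6) (cnt := reg 9)
    (p := .ite (.get 11 (reg 6)) (.put 11 (reg 6) (.lit 0))
      (.ite (.op .lt (.op .add (.get 12 (reg 6)) (.lit 1)) (entry 4))
        (.put 12 (reg 6) (.op .add (.get 12 (reg 6)) (.lit 1)))
        (forLoop 7 (.op .add (.get 12 (reg 6)) (.lit 1)) (issueProg astep) ;;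
          .put 12 (reg 6) (.lit 0))))
    (m := σ.mem) (fun i => (S i).mem)
    (fun i => mem { S (i + 1) with i := i }) σ.len
    (fun i => 100 + 100 * (TS (off (i + 1)) - TS (off i)))
    (fun i => 112 * i + 100 * TS (off i)) (by decide) ?_ (by omega) (fun _ _ => rfl) (fun _ _ => rfl)
    ?_ ?_ ?_ (fun r _ => set_i _ _) ?_
    (T' := 120 * (σ.len + 1) + 100 * (TS (off σ.len) - TS (off 0))) ?_
  rotate_left
  · rw [set_i]
    congr 1
    simp [S, hused, hm0, hpd, sv]
  · intro k _
    simpa [Expr.ReadsLt, Expr.val, S] using hLY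
  · intro k _
    simp [Expr.val, S]
  · intro i hi
    have hiY : i < Y := by omega
    have ho := hoff i
    have hreads : Expr.ReadsLt Y (S i).mem (.get 11 (reg 6)) := by
      simp only [Expr.ReadsLt, Expr.val, S, mem_used, mem_i]
      refine ⟨⟨trivial, hiY⟩, ?_⟩
      split <;> omega
    by_cases hb : i ∈ blk
    · simp only [flushCount, hb, if_true] at ho
      refine (Runs.iteTrue hW (T := 4) hreads (by decide) ?_ (Runs.put hW ?_ ?_
        (by decide) (by decide))).mono (by simp only [Expr.cost]; omega)
      · simp [Expr.val, S, hb]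
      · simp only [Expr.val, mem_i, set_used]
        congr 1
        simp only [S, hsv, hb, if_true, ho, Nat.add_zero, GState.mk.injEq, true_and, and_true]
        constructor
        · funext j
          rw [Function.update_apply]
          by_cases h : j = i
          · subst h; simp
          · have : i ≤ j ↔ i + 1 ≤ j := by omega
            simp [h, this]
        · funext j
          by_cases h : j = i
          · subst h; simp [nextPend, hb, hpd]
          · have : j < i ↔ j < i + 1 := by omega
            simp [this]
      · simp [Expr.ReadsLt, Expr.val, S, hiY]
    · have hu : (S i).used = (S (i + 1)).used := by
        funext j
        by_cases h : j = i
        · subst h; simp [S, hb]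
        · have : i ≤ j ↔ i + 1 ≤ j := by omega
          simp [S, this]
      have hpi : (S i).pend i = p i := by simp [S, hpd]
      have hpY := hpS i i
      rw [hpi] at hpY
      have hreads2 : ∀ σ' : GState, σ'.i = i → σ'.vU = σ.vU → σ'.pend = (S i).pend →
          Expr.ReadsLt Y σ'.mem (.op .add (.get 12 (reg 6)) (.lit 1)) ∧
          Expr.val σ'.mem (.op .add (.get 12 (reg 6)) (.lit 1)) = p i + 1 := by
        intro σ' h1 h2 h3
        have : p i < Y := by omega
        simp [Expr.ReadsLt, Expr.val, BinOp.eval, h1, h3, hpi, hiY, this]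
      have hpu : ∀ x, nextPend od blk p i = x →
          Function.update (S i).pend i x = (S (i + 1)).pend := by
        intro x hx
        funext j
        rw [Function.update_apply]
        by_cases h : j = i
        · subst h; simp [S, ← hx]
        · have : j < i ↔ j < i + 1 := by omega
          simp [S, h, this]
      refine (Runs.iteFalse hW (T := 95 + 100 * (TS (off (i + 1)) - TS (off i))) hreads
        (by decide) ?_ ?_).mono (by simp only [Expr.cost]; omega)
      · simp [Expr.val, S, hb]
      have hcond := hentry i hi (S i) rfl rfl
      have hc2 := hreads2 (S i) rfl rfl rfl
      have hc3 : Expr.ReadsLt Y (S i).mem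
          (.op .lt (.op .add (.get 12 (reg 6)) (.lit 1)) (entry 4)) := ⟨hc2.1, hcond.1⟩
      by_cases hlt2 : p i + 1 < od i
      · simp only [flushCount, hb, hlt2, if_false, if_true] at ho
        refine (Runs.iteTrue hW (m := (S i).mem) (T := 20) hc3 (by decide) ?_ (Runs.put hW ?_ ?_
          (by decide) (by decide))).mono (by simp only [Expr.cost]; omega)
        · change (if Expr.val (S i).mem _ < Expr.val (S i).mem _ then 1 else 0) ≠ 0
          rw [hc2.2, hcond.2, if_pos hlt2]; simp
        · rw [hc2.2]
          simp only [Expr.val, mem_i, set_pend]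
          congr 1
          have e := hpu (p i + 1) (by simp [nextPend, hb, hlt2])
          change { S i with pend := Function.update (S i).pend i (p i + 1) } = _
          rw [e]
          have e2 : (S (i + 1)).s = (S i).s := by simp [S, hsv, hb, hlt2]
          have e3 : (S (i + 1)).vA = (S i).vA := by simp [S, ho]
          rw [e2, e3, ← hu]
        · exact ⟨by simp [Expr.ReadsLt, Expr.val, S, hiY], hc2.1⟩
      · have hfc : flushCount od blk p i = p i + 1 := by simp [flushCount, hb, hlt2]
        rw [hfc] at ho
        refine (Runs.iteFalse hW (T := 70 + 100 * (TS (off (i + 1)) - TS (off i)))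
          (m := (S i).mem) hc3 (by decide) ?_ ?_).mono (by simp only [Expr.cost]; omega)
        · change (if Expr.val (S i).mem _ < Expr.val (S i).mem _ then 1 else 0) = 0
          rw [hc2.2, hcond.2, if_neg hlt2]
        have hl := Runs.forLoop hW (r := 7) (cnt := .op .add (.get 12 (reg 6)) (.lit 1))
          (p := issueProg astep) (m := (S i).mem)
          (fun s => mem { S i with s := s, vA := mems (off i + s) })
          (fun s => mem { S i with s := s, vA := mems (off i + s + 1) }) (p i + 1)
          (fun s => ts (off i + s) + 30)
          (fun s => 100 * TS (off i + s)) (by decide) ?_ (by omega) (fun _ _ => rfl)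
          (fun _ _ => rfl) (fun s _ => (hreads2 { S i with s := s, vA := mems (off i + s) } rfl rfl rfl).1)
          (fun s _ => (hreads2 { S i with s := s, vA := mems (off i + s) } rfl rfl rfl).2) ?_ (fun r _ => set_s _ _) ?_
          (T' := 20 + 100 * (TS (off (i + 1)) - TS (off i))) ?_
        rotate_left
        · rw [set_s]; rfl
        · intro s hs
          have hps := hpos i hi s (by rw [hfc]; exact hs)
          have hlt' : off i + s < off σ.len := by
            have := le_of_step hoff (show i + 1 ≤ σ.len by omega)
            omega
          have := hex (off i + s) hlt'
          rw [hps] at this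
          exact runs_issueProg hW hA { S i with s := s, vA := mems (off i + s) }
            (by simpa [S] using hiY) hU this
        · intro s _
          have := hTS (off i + s)
          have := hts (off i + s)
          simp only [Expr.cost, ← Nat.add_assoc] at *; omega
        · have := hmono (show off i ≤ off i + (p i + 1) by omega)
          simp only [Expr.cost, ho, Nat.add_zero] at *; omega
        refine (hl.seq (Runs.put hW (T := 10) ?_ ?_ (by decide) (by decide))).mono (by omega)
        · simp only [Expr.val, mem_i, set_pend]
          congr 1
          change { S i with s := p i + 1, vA := mems (off i + (p i + 1)),
                              pend := Function.update (S i).pend i 0 } = _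
          rw [hpu 0 (by simp [nextPend, hb, hlt2])]
          have e2 : (S (i + 1)).s = p i + 1 := by simp [S, hsv, hb, hlt2]
          have e3 : (S (i + 1)).vA = mems (off i + (p i + 1)) := by simp [S, ho]
          rw [e2, e3, ← hu]
        · simp [Expr.ReadsLt, Expr.val, S, hiY]
  · intro i hi
    have := hmono (le_of_step hoff (show i ≤ i + 1 by omega))
    simp only [Expr.cost]; omega
  · have := hmono (le_of_step hoff (Nat.zero_le σ.len))
    simp only [Expr.cost]; omega
  refine ⟨sv σ.len, ?_⟩
  have hfin : (S σ.len).used = fun _ => 0 := by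
    funext j
    simp only [S]
    rw [if_neg]
    rintro ⟨h1, h2⟩
    have := hlt j h2; omega
  have : S σ.len = { S σ.len with used := fun _ => 0 } := by rw [← hfin]
  have h3 : Runs W (flushProg astep) σ.mem (S σ.len).mem _ := h2
  rw [this] at h3
  exact h3

open GState in
theorem GState.load_msg (σ : GState) (x : List ℕ) :
    σ.mem.load 0 x = mem { σ with msg := fillArr σ.msg 0 (cell x) (x.length + 1) } := by
  apply ext_mem
  · rw [Mem.load_eq_update]
    exact forall_lt_13 (by simp [mem])
  · intro a; rw [Mem.load_of_ne _ _ (by unfold fU; omega), mem_fU, mem_fU]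
  · intro a; rw [Mem.load_of_ne _ _ (by unfold fR; omega), mem_fR, mem_fR]
  · intro a; rw [Mem.load_of_ne _ _ (by unfold fA; omega), mem_fA, mem_fA]

theorem Mem.output_of_single {m : Mem} {x : ℕ} (h0 : m 1 0 = 1) (h1 : m 1 1 = x) :
    m.output = [x] := by
  simp [Mem.output, h0, h1]

theorem Mem.update_set (v : Mem) (a : ℕ) (arr : ℕ → ℕ) (i x : ℕ) :
    Mem.set (Function.update v a arr) a i x = Function.update v a (Function.update arr i x) := by
  funext b j
  by_cases h : b = a
  · subst h; simp [Mem.set, Function.update_apply]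
  · simp [Mem.set, h]

section Fill

variable {W Y D : ℕ} {cnt idx val : Expr} {T : ℕ}

open GState in
theorem runs_fill_R (hW : (Y + 2) ^ D ≤ W) (σ : GState) (a off : ℕ) (g : ℕ → ℕ) (len : ℕ)
    (hlen : len < Y) (hs : cnt.arith = true ∧ cnt.deg + 7 ≤ D)
    (hsi : idx.arith = true ∧ idx.deg ≤ D) (hsv : val.arith = true ∧ val.deg ≤ D)
    (hcnt : ∀ k arr, cnt.ReadsLt Y (mem { σ with r := k, vR := Function.update σ.vR a arr }) ∧
      cnt.val (mem { σ with r := k, vR := Function.update σ.vR a arr }) = len)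
    (hidx : ∀ k arr, k < len →
      idx.ReadsLt Y (mem { σ with r := k, vR := Function.update σ.vR a arr }) ∧
      idx.val (mem { σ with r := k, vR := Function.update σ.vR a arr }) = off + k)
    (hval : ∀ k arr, k < len →
      val.ReadsLt Y (mem { σ with r := k, vR := Function.update σ.vR a arr }) ∧
      val.val (mem { σ with r := k, vR := Function.update σ.vR a arr }) = g k)
    (hT : (idx.cost + val.cost + cnt.cost + 11) * (len + 1) ≤ T) :
    Runs W (fill 5 (fR a) cnt idx val) σ.mem (mem { σ with
      r := len, vR := Function.update σ.vR a (fillArr (σ.vR a) off g len) }) T :=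
  Runs.fill hW (fun k arr => mem { σ with r := k, vR := Function.update σ.vR a arr }) id (σ.vR a)
    off g len (by rw [set_r, Function.update_eq_self]) hlen (fun _ _ => rfl) (fun _ _ _ => set_r _ _)
    (fun k arr i x => by simp only [id, set_fR, Mem.update_set]) hs hcnt hsi hidx hsv hval hT

open GState in
theorem runs_fill_A (hW : (Y + 2) ^ D ≤ W) (σ : GState) (a off : ℕ) (g : ℕ → ℕ) (len : ℕ)
    (hlen : len < Y) (hs : cnt.arith = true ∧ cnt.deg + 7 ≤ D)
    (hsi : idx.arith = true ∧ idx.deg ≤ D) (hsv : val.arith = true ∧ val.deg ≤ D)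
    (hcnt : ∀ k arr, cnt.ReadsLt Y (mem { σ with r := k, vA := Function.update σ.vA a arr }) ∧
      cnt.val (mem { σ with r := k, vA := Function.update σ.vA a arr }) = len)
    (hidx : ∀ k arr, k < len →
      idx.ReadsLt Y (mem { σ with r := k, vA := Function.update σ.vA a arr }) ∧
      idx.val (mem { σ with r := k, vA := Function.update σ.vA a arr }) = off + k)
    (hval : ∀ k arr, k < len →
      val.ReadsLt Y (mem { σ with r := k, vA := Function.update σ.vA a arr }) ∧
      val.val (mem { σ with r := k, vA := Function.update σ.vA a arr }) = g k)
    (hT : (idx.cost + val.cost + cnt.cost + 11) * (len + 1) ≤ T) :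
    Runs W (fill 5 (fA a) cnt idx val) σ.mem (mem { σ with
      r := len, vA := Function.update σ.vA a (fillArr (σ.vA a) off g len) }) T :=
  Runs.fill hW (fun k arr => mem { σ with r := k, vA := Function.update σ.vA a arr }) id (σ.vA a)
    off g len (by rw [set_r, Function.update_eq_self]) hlen (fun _ _ => rfl) (fun _ _ _ => set_r _ _)
    (fun k arr i x => by simp only [id, set_fA, Mem.update_set]) hs hcnt hsi hidx hsv hval hT

end Fill

open GState in
/-- One round: message `x` is passed on to the reduction, which selects the positions `blk`; the
algorithm with predictions receives the requests at the positions `pos 0, pos 1, …`, those with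
numbers from `off i` to `off (i + 1)` being the copies of position `i` issued by `flushProg`. -/
theorem runs_gammaStep {W WA WR Y : ℕ} (hW : (Y + 2) ^ 40 ≤ W) (hA : WA ≤ W) (hR : WR ≤ W)
    {select decode astep : Prog} (σ : GState) (hU : ∀ c, σ.vU 1 c < Y) (hLY : σ.len < Y)
    (hused : σ.used = fun _ => 0) (hp : ∀ i, σ.pend i + 1 < Y)
    (x : List ℕ) (hx : x.length + 1 < Y) (hxY : ∀ y ∈ x, y < Y)
    {S R' : Mem} {tS tD : ℕ} (hsel : Exec WR select (σ.vR.load 0 x) S tS) (hS1 : ∀ c, S 1 c < Y)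
    (blk : List ℕ) (hblk : S.output = blk) (hlt : ∀ i ∈ blk, i < σ.len)
    (hlen : blk.length ≤ σ.len)
    (mems : ℕ → Mem) (ts TS : ℕ → ℕ) (hTS : ∀ t, TS (t + 1) = TS t + ts t)
    (hts : ∀ t, 0 < ts t) (off pos : ℕ → ℕ) (hm0 : mems 0 = σ.vA) (hoff0 : off 0 = blk.length)
    (hoff : ∀ i, off (i + 1) = off i + flushCount (fun j => σ.vU 1 (4 + 3 * j)) blk σ.pend i)
    (hpos0 : ∀ r (hr : r < blk.length), pos r = blk[r])
    (hpos : ∀ i < σ.len, ∀ s < flushCount (fun j => σ.vU 1 (4 + 3 * j)) blk σ.pend i,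
      pos (off i + s) = i)
    (hex : ∀ t < off σ.len, Exec WA astep
      ((mems t).load 0 [σ.vU 1 (2 + 3 * pos t), σ.vU 1 (3 + 3 * pos t)]) (mems (t + 1)) (ts t))
    (ho : ∀ t < blk.length, mems (t + 1) 1 1 < Y)
    (hdec : Exec WR decode (S.load 0 (answersUpTo (fun j => σ.vU 1 (2 + 3 * j) ≠ 0) pos
        (fun t => mems (t + 1) 1 1) blk.length)) R' tD) (hR' : R' 1 1 < Y) :
    ∃ σ' : GState, Runs W (gammaStep select decode astep) (σ.mem.load 0 x) σ'.mem
        (400 * (x.length + σ.len + 1) + tS + tD + 100 * (TS (off σ.len) - TS 0)) ∧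
      σ'.mem.output = [R' 1 1] ∧ σ'.len = σ.len ∧ (σ'.used = fun _ => 0) ∧
      (σ'.pend = fun j => if j < σ.len then nextPend (fun j => σ.vU 1 (4 + 3 * j)) blk σ.pend j
        else σ.pend j) ∧ σ'.vU = σ.vU ∧ σ'.vR = R' ∧ σ'.vA = mems (off σ.len) := by
  have hoffm : ∀ {a b}, a ≤ b → off a ≤ off b := fun h => le_of_step hoff h
  have hTSm : ∀ {a b}, a ≤ b → TS a ≤ TS b := fun h => le_of_step hTS h
  rw [load_msg]
  let σ1 : GState := { σ with msg := fillArr σ.msg 0 (cell x) (x.length + 1) }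
  have hm : ∀ k < x.length + 1, σ1.msg k = cell x k := by
    intro k hk
    simp [σ1, fillArr, hk]
  have hcell : ∀ k, cell x k < Y := cell_lt (by omega) hxY
  have h1 : Runs W (fill 5 (fR 0) (.op .add (.get 0 (.lit 0)) (.lit 1)) (reg 5) (.get 0 (reg 5)))
      σ1.mem (mem { σ1 with r := x.length + 1, vR := σ.vR.load 0 x })
      (30 * (x.length + 2)) := by
    have := runs_fill_R hW σ1 0 0 (cell x) (x.length + 1) hx
      (cnt := .op .add (.get 0 (.lit 0)) (.lit 1)) (idx := reg 5) (val := .get 0 (reg 5))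
      (T := 30 * (x.length + 2)) (by decide) (by decide) (by decide) ?_ ?_ ?_ ?_
    · rwa [← Mem.load_eq_update] at this
    · intro k arr
      have e : σ1.msg 0 = x.length := hm 0 (by omega)
      simp [Expr.ReadsLt, Expr.val, BinOp.eval, e]; omega
    · intro k arr hk
      simp [Expr.ReadsLt, Expr.val]; omega
    · intro k arr hk
      have := hcell k
      simp [Expr.ReadsLt, Expr.val, hm k hk, this]; omega
    · exact Nat.mul_le_mul_right _ (by decide)
  let σ2 : GState := { σ1 with r := x.length + 1, vR := S }
  have h2 : Runs W (select.embed fR id) (mem { σ1 with r := x.length + 1, vR := σ.vR.load 0 x })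
      σ2.mem tS := runs_R { σ1 with r := x.length + 1, vR := σ.vR.load 0 x } hR hsel
  obtain ⟨r3, i3, h3⟩ := runs_answerProg (L := σ.len) hW hA σ2 hU hLY hS1 hused blk hblk hlt hlen
    mems ts TS hTS hm0 pos hpos0
    (fun t ht => hex t (ht.trans_le (hoff0 ▸ hoffm (Nat.zero_le _)))) ho
  obtain ⟨s4, h4⟩ := runs_flushProg (astep := astep) hW hA (σ := { σ2 with
      r := r3, i := i3
      cnt := (answersUpTo (fun j => σ.vU 1 (2 + 3 * j) ≠ 0) pos (fun t => mems (t + 1) 1 1)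
        blk.length).length
      used := fun j => if j ∈ blk then 1 else 0
      vR := S.load 0 (answersUpTo (fun j => σ.vU 1 (2 + 3 * j) ≠ 0) pos
        (fun t => mems (t + 1) 1 1) blk.length)
      vA := mems blk.length }) hU hLY blk rfl hlt hp mems ts TS hTS hts off pos (by rw [hoff0])
      hoff hpos hex
  have h5 := runs_R (W' := W) (p := decode) { σ2 with
      r := r3, i := σ2.len, s := s4
      cnt := (answersUpTo (fun j => σ.vU 1 (2 + 3 * j) ≠ 0) pos (fun t => mems (t + 1) 1 1)
        blk.length).length
      used := fun _ => 0
      pend := fun j => if j < σ.len then nextPend (fun j => σ.vU 1 (4 + 3 * j)) blk σ.pend j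
        else σ.pend j
      vR := S.load 0 (answersUpTo (fun j => σ.vU 1 (2 + 3 * j) ≠ 0) pos
        (fun t => mems (t + 1) 1 1) blk.length)
      vA := mems (off σ.len) } hR hdec
  let σ5 : GState := { σ2 with
      r := r3, i := σ2.len, s := s4
      cnt := (answersUpTo (fun j => σ.vU 1 (2 + 3 * j) ≠ 0) pos (fun t => mems (t + 1) 1 1)
        blk.length).length
      used := fun _ => 0
      pend := fun j => if j < σ.len then nextPend (fun j => σ.vU 1 (4 + 3 * j)) blk σ.pend j
        else σ.pend j
      vR := R'
      vA := mems (off σ.len) }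
  have h6 : Runs W (.put 1 (.lit 0) (.lit 1)) σ5.mem
      (mem { σ5 with out := Function.update σ5.out 0 1 }) 3 :=
    Runs.put hW (set_out _ _ _) (by simp [Expr.ReadsLt]) (by decide) (by decide)
  have h7 : Runs W (.put 1 (.lit 1) (.get (fR 1) (.lit 1)))
      (mem { σ5 with out := Function.update σ5.out 0 1 })
      (mem { σ5 with out := Function.update (Function.update σ5.out 0 1) 1 (R' 1 1) }) 4 := by
    refine Runs.put hW ?_ ?_ (by decide) (by decide)
    · simp only [Expr.val, mem_fR]; exact set_out _ _ _
    · simpa [Expr.ReadsLt, Expr.val, σ5] using hR'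
  refine ⟨_, ((h1.seq (h2.seq (h3.seq (h4.seq (h5.seq (h6.seq h7)))))).mono ?_),
    Mem.output_of_single ?_ ?_, rfl, rfl, rfl, rfl, rfl, rfl⟩
  · have e1 := hTSm (Nat.zero_le blk.length)
    have e2 := hTSm (hoffm (Nat.zero_le σ.len))
    rw [hoff0] at e2
    have e3 : σ2.len = σ.len := rfl
    simp only [hoff0, e3]
    omega
  · simp
  · simp

/-! ### Preprocessing of the `γ`-OuMv solver -/

/-- The power `e ^ k`, as a product. -/
def powE (e : Expr) : ℕ → Expr
  | 0 => .lit 1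
  | k + 1 => .op .mul (powE e k) e

theorem powE_val (m : Mem) (e : Expr) (k : ℕ) : (powE e k).val m = e.val m ^ k := by
  induction k with
  | zero => rfl
  | succ k ih => simp [powE, Expr.val, BinOp.eval, ih, pow_succ]

theorem powE_readsLt {Y : ℕ} {m : Mem} {e : Expr} (h : e.ReadsLt Y m) (k : ℕ) :
    (powE e k).ReadsLt Y m := by
  induction k with
  | zero => trivial
  | succ k ih => exact ⟨ih, h⟩

theorem powE_arith {e : Expr} (h : e.arith = true) (k : ℕ) : (powE e k).arith = true := by
  induction k with
  | zero => rfl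
  | succ k ih => simp [powE, Expr.arith, BinOp.arith, ih, h]

theorem powE_deg (e : Expr) (k : ℕ) : (powE e k).deg = (e.deg + 1) * k + 2 := by
  induction k with
  | zero => rfl
  | succ k ih => simp only [powE, Expr.deg, ih]; ring

theorem powE_cost (e : Expr) (k : ℕ) : (powE e k).cost = (e.cost + 1) * k + 1 := by
  induction k with
  | zero => rfl
  | succ k ih => simp only [powE, Expr.cost, ih]; ring

/-- The word at place `r` of the prediction, where `3 * k + 2` is the place at which the description
of the request at position `k` begins, and the requests take two words each. -/
abbrev predictionWord : Expr :=
  .get (fU 1) (.op .add (.op .add (.lit 2)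
    (.op .mul (.lit 3) (.op .mod (.op .div (reg 5) (.lit 2)) (reg 9)))) (.op .mod (reg 5) (.lit 2)))

/-- Add up the list in array `src`. -/
abbrev sumProg (src : ℕ) : Prog :=
  forLoop 5 (.get src (.lit 0)) (.put 10 (.lit 0)
    (.op .add (reg 10) (.get src (.op .add (reg 5) (.lit 1)))))

/-- The length of the prediction, as a list of words. -/
abbrev predictionLength : Expr := .op .mul (.op .mul (.lit 2) (reg 9)) (.get 2 (.lit 3))

/-- Compute the block and the initial data structure. -/
def gammaPrepRed (univ rprep : Prog) : Prog :=
  .put (fU 2) (.lit 0) (.lit 1) ;; .put (fU 2) (.lit 1) (.get 2 (.lit 2)) ;; univ.embed fU id ;;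
  .put 9 (.lit 0) (.op .div (.op .sub (.get (fU 1) (.lit 0)) (.lit 1)) (.lit 3)) ;;
  fill 5 (fR 2) (.lit 4) (reg 5) (.get 2 (reg 5)) ;;
  fill 5 (fR 3) (.op .add (.get 3 (.lit 0)) (.lit 1)) (reg 5) (.get 3 (reg 5)) ;;
  rprep.embed fR id

/-- Hand the initial data structure, the prediction, its quality and the random bits to the
algorithm with predictions, and run its preprocessing. -/
def gammaPrepAlg (aprep : Prog) (C coinExp : ℕ) : Prog :=
  fill 5 (fA 3) (.op .add (.get (fR 1) (.lit 0)) (.lit 1)) (reg 5) (.get (fR 1) (reg 5)) ;;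
  .put (fA 2) (.lit 0) (.lit 1) ;; .put (fA 2) (.lit 1) (.op .mul (.lit (1 + C)) (reg 9)) ;;
  fill 5 (fA 4) predictionLength (.op .add (.lit 1) (reg 5)) predictionWord ;;
  .put (fA 4) (.lit 0) predictionLength ;;
  .put 10 (.lit 0) (.op .add (.op .add (.op .add (.lit 1) (.get (fA 2) (.lit 1)))
    (.get (fA 3) (.lit 0))) (.get (fA 4) (.lit 0))) ;;
  sumProg (fA 3) ;; sumProg (fA 4) ;;
  .put 8 (.lit 0) (powE (.op .add (reg 10) (.lit 2)) coinExp) ;;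
  fill 5 (fA 5) (reg 8) (.op .add (.lit 1) (reg 5)) (.get 4 (.op .add (.lit 1) (reg 5))) ;;
  .put (fA 5) (.lit 0) (reg 8) ;;
  aprep.embed fA id

/-- The preprocessing program. -/
def gammaPrep (univ rprep aprep : Prog) (C coinExp : ℕ) : Prog :=
  gammaPrepRed univ rprep ;; gammaPrepAlg aprep C coinExp

theorem fillArr_cell (l : List ℕ) :
    fillArr (fun _ => 0) 0 (cell l) (l.length + 1) = cell l := by
  funext i
  unfold fillArr
  split
  · simp
  · exact (cell_eq_zero (by omega)).symm

theorem update_fillArr_cell (l : List ℕ) (g : ℕ → ℕ) (hg : ∀ k < l.length, g k = cell l (k + 1)) :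
    Function.update (fillArr (fun _ => 0) 1 g l.length) 0 l.length = cell l := by
  funext i
  rcases i with _ | i
  · rfl
  · rw [Function.update_of_ne (by omega)]
    unfold fillArr
    split
    · rw [hg _ (by omega)]; congr 1
    · exact (cell_eq_zero (by omega)).symm

/-- The memory of the solver when it starts. -/
def GState.start (in2 in3 in4 : List ℕ) : GState where
  msg := fun _ => 0
  out := fun _ => 0
  in2 := cell in2
  in3 := cell in3
  in4 := cell in4
  r := 0
  i := 0
  s := 0
  cnt := 0
  len := 0
  acc := 0
  used := fun _ => 0
  pend := fun _ => 0
  vU := fun _ _ => 0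
  vR := fun _ _ => 0
  vA := fun _ _ => 0

theorem Mem.init_apply (inputs : List (List ℕ)) (a : ℕ) :
    Mem.init inputs (a + 2) = if h : a < inputs.length then cell inputs[a] else fun _ => 0 := by
  funext i
  simp only [Mem.init]
  rw [if_neg (by omega)]
  simp only [Nat.add_sub_cancel]
  split <;> simp_all

theorem Mem.init_zero (inputs : List (List ℕ)) (a : ℕ) (h : a < 2) :
    Mem.init inputs a = fun _ => 0 := by
  funext i
  simp [Mem.init, h]

theorem Mem.init_of_le (inputs : List (List ℕ)) (a : ℕ) (h : inputs.length + 2 ≤ a) :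
    Mem.init inputs a = fun _ => 0 := by
  obtain ⟨b, rfl⟩ := Nat.exists_eq_add_of_le' (show 2 ≤ a by omega)
  rw [Mem.init_apply, dif_neg (by omega)]

open GState in
theorem GState.init_eq (l2 l3 l4 : List ℕ) : Mem.init [l2, l3, l4] = (start l2 l3 l4).mem := by
  have hs : single 0 = fun _ => 0 := by funext i; simp [single]
  apply ext_mem
  · refine forall_lt_13 ⟨?_, ?_, ?_, ?_, ?_, ?_, ?_, ?_, ?_, ?_, ?_, ?_, ?_⟩
    · exact Mem.init_zero _ _ (by norm_num)
    · exact Mem.init_zero _ _ (by norm_num)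
    · exact Mem.init_apply _ 0
    · exact Mem.init_apply _ 1
    · exact Mem.init_apply _ 2
    all_goals
      rw [Mem.init_of_le _ _ (by simp)]
      first | exact hs.symm | rfl
  · intro a; rw [Mem.init_of_le _ _ (by simp [fU]), mem_fU]; rfl
  · intro a; rw [Mem.init_of_le _ _ (by simp [fR]), mem_fR]; rfl
  · intro a; rw [Mem.init_of_le _ _ (by simp [fA]), mem_fA]; rfl

open GState in
/-- Afterwards `vU` holds the description of the block, which has length `L`, and `vR` the initial
data structure. -/
theorem runs_gammaPrepRed {W WU WR Y : ℕ} (hW : (Y + 2) ^ 40 ≤ W) (hU : WU ≤ W) (hR : WR ≤ W)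
    {univ rprep : Prog} (n₁ n₂ n₃ L : ℕ) (mw bits : List ℕ)
    (hn₁ : n₁ < Y) (hn₂ : n₂ < Y) (hn₃ : n₃ < Y) (hY : 4 < Y)
    (hmw : mw.length + 1 < Y) (hmwY : ∀ y ∈ mw, y < Y)
    {mU mR : Mem} {tU tR : ℕ} (hunivE : Exec WU univ (Mem.init [[n₂]]) mU tU)
    (hmU : mU 1 0 = 1 + 3 * L) (hUY : mU 1 0 < Y)
    (hrE : Exec WR rprep (Mem.init [[n₁, n₂, n₃], mw]) mR tR) :
    ∃ r, Runs W (gammaPrepRed univ rprep) (start [n₁, n₂, n₃] mw bits).mem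
      (mem { start [n₁, n₂, n₃] mw bits with r := r, len := L, vU := mU, vR := mR })
      (100 * Y + tU + tR) := by
  set σ := start [n₁, n₂, n₃] mw bits with hσ
  have h1 : Runs W (.put (fU 2) (.lit 0) (.lit 1)) σ.mem
      (mem { σ with vU := σ.vU.set 2 0 1 }) 3 :=
    Runs.put hW (set_fU _ _ _ _) (by simp [Expr.ReadsLt]) (by decide) (by decide)
  have h2 : Runs W (.put (fU 2) (.lit 1) (.get 2 (.lit 2))) (mem { σ with vU := σ.vU.set 2 0 1 })
      (mem { σ with vU := Mem.init [[n₂]] }) 4 := by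
    refine Runs.put hW ?_ ?_ (by decide) (by decide)
    · rw [set_fU]
      congr 2
      funext a i
      by_cases ha : a = 2
      · subst ha
        rw [Mem.init_apply _ 0]
        rcases i with _ | _ | i <;> simp [Mem.set, Expr.val, cell, σ, start]
      · have : Mem.init [[n₂]] a = fun _ => 0 := by
          by_cases h : a < 2
          · exact Mem.init_zero _ _ h
          · exact Mem.init_of_le _ _ (by simp; omega)
        simp [Mem.set, ha, this, σ, start]
    · simpa [Expr.ReadsLt, Expr.val, σ, start, cell] using hn₂
  have h3 : Runs W (univ.embed fU id) (mem { σ with vU := Mem.init [[n₂]] })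
      (mem { σ with vU := mU }) tU := runs_U { σ with vU := Mem.init [[n₂]] } hU hunivE
  have h4 : Runs W (.put 9 (.lit 0) (.op .div (.op .sub (.get (fU 1) (.lit 0)) (.lit 1)) (.lit 3)))
      (mem { σ with vU := mU }) (mem { σ with vU := mU, len := L }) 8 := by
    refine Runs.put hW ?_ ?_ (by decide) (by decide)
    · simp only [Expr.val, BinOp.eval, mem_fU, set_len, hmU]
      congr 2
      omega
    · simpa [Expr.ReadsLt, Expr.val] using hUY
  let σ4 : GState := { σ with vU := mU, len := L }
  have h5 : Runs W (fill 5 (fR 2) (.lit 4) (reg 5) (.get 2 (reg 5))) σ4.mem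
      (mem { σ4 with r := 4, vR := Function.update σ.vR 2 (cell [n₁, n₂, n₃]) }) 100 := by
    have := runs_fill_R hW σ4 2 0 (cell [n₁, n₂, n₃]) 4 hY
      (cnt := .lit 4) (idx := reg 5) (val := .get 2 (reg 5))
      (T := 100) (by decide) (by decide) (by decide) ?_ ?_ ?_ (by decide)
    · have e := fillArr_cell [n₁, n₂, n₃]
      simp only [List.length_cons, List.length_nil] at e
      rwa [show fillArr (σ4.vR 2) 0 (cell [n₁, n₂, n₃]) 4 = cell [n₁, n₂, n₃] from e] at this
    · intro k arr
      simp [Expr.ReadsLt, Expr.val]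
    · intro k arr hk
      simp [Expr.ReadsLt, Expr.val]; omega
    · intro k arr hk
      have : cell [n₁, n₂, n₃] k < Y := cell_lt (by simp; omega) (by simp; omega) k
      simp [Expr.ReadsLt, Expr.val, σ4, σ, start, this]; omega
  let σ5 : GState := { σ4 with r := 4, vR := Function.update σ.vR 2 (cell [n₁, n₂, n₃]) }
  have h6 : Runs W (fill 5 (fR 3) (.op .add (.get 3 (.lit 0)) (.lit 1)) (reg 5) (.get 3 (reg 5)))
      σ5.mem (mem { σ5 with r := mw.length + 1, vR := Mem.init [[n₁, n₂, n₃], mw] })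
      (30 * Y) := by
    have hcell : ∀ k, cell mw k < Y := cell_lt (by omega) hmwY
    have := runs_fill_R hW σ5 3 0 (cell mw) (mw.length + 1) hmw
      (cnt := .op .add (.get 3 (.lit 0)) (.lit 1)) (idx := reg 5) (val := .get 3 (reg 5))
      (T := 30 * Y) (by decide) (by decide) (by decide) ?_ ?_ ?_ ?_
    · have e := fillArr_cell mw
      rw [show fillArr (σ5.vR 3) 0 (cell mw) (mw.length + 1) = cell mw from e] at this
      convert this using 3
      funext a
      by_cases h2 : a = 2
      · subst h2; rw [Mem.init_apply _ 0]; simp [σ5]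
      · by_cases h3 : a = 3
        · subst h3; rw [Mem.init_apply _ 1]; simp
        · simp only [σ5]
          rw [Function.update_of_ne h3, Function.update_of_ne h2]
          by_cases h : a < 2
          · exact Mem.init_zero _ _ h
          · exact Mem.init_of_le _ _ (by simp; omega)
    · intro k arr
      have e : σ5.in3 0 = mw.length := rfl
      simp [Expr.ReadsLt, Expr.val, BinOp.eval, e]; omega
    · intro k arr hk
      simp [Expr.ReadsLt, Expr.val]; omega
    · intro k arr hk
      have e : σ5.in3 = cell mw := rfl
      simp [Expr.ReadsLt, Expr.val, e, hcell k]; omega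
    · exact Nat.mul_le_mul (by decide) hmw
  have h7 : Runs W (rprep.embed fR id)
      (mem { σ5 with r := mw.length + 1, vR := Mem.init [[n₁, n₂, n₃], mw] })
      (mem { σ5 with r := mw.length + 1, vR := mR }) tR :=
    runs_R { σ5 with r := mw.length + 1, vR := Mem.init [[n₁, n₂, n₃], mw] } hR hrE
  exact ⟨mw.length + 1, (h1.seq (h2.seq (h3.seq (h4.seq (h5.seq (h6.seq h7)))))).mono (by omega)⟩

open GState in
theorem runs_sumProg_A {W Y : ℕ} (hW : (Y + 2) ^ 40 ≤ W) (σ : GState) (a : ℕ) (l : List ℕ)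
    (hl : σ.vA a = cell l) (hlen : l.length < Y) (hlY : ∀ y ∈ l, y < Y)
    (hacc : σ.acc + l.sum < Y) :
    Runs W (sumProg (fA a)) σ.mem (mem { σ with r := l.length, acc := σ.acc + l.sum })
      (100 * Y) := by
  have hcell : ∀ k, cell l k < Y := cell_lt hlen hlY
  have hsum : ∀ k, (l.take k).sum ≤ l.sum := by
    intro k
    conv_rhs => rw [← List.take_append_drop k l, List.sum_append]
    omega
  have := Runs.forLoop hW (r := 5) (cnt := .get (fA a) (.lit 0))
    (p := .put 10 (.lit 0) (.op .add (reg 10) (.get (fA a) (.op .add (reg 5) (.lit 1)))))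
    (m := σ.mem) (fun k => mem { σ with r := k, acc := σ.acc + (l.take k).sum })
    (fun k => mem { σ with r := k, acc := σ.acc + (l.take (k + 1)).sum }) l.length
    (fun _ => 20) (fun k => 40 * k) ⟨rfl, by simp [Expr.deg]⟩ ?_ hlen (fun _ _ => rfl) (fun _ _ => rfl)
    ?_ ?_ ?_ (fun r _ => set_r _ _) ?_ (T' := 100 * Y) ?_
  rotate_left
  · rw [set_r]; simp
  · intro k _
    simpa [Expr.ReadsLt, Expr.val, hl] using hcell 0
  · intro k _
    simp [Expr.val, hl, cell_zero]
  · intro k hk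
    have := hsum k
    refine Runs.put hW ?_ ?_ ⟨⟨rfl, by simp [Expr.deg]⟩, rfl, by simp [Expr.deg]⟩
      (by simp [Expr.cost])
    · simp only [Expr.val, BinOp.eval, mem_acc, mem_fA, mem_r, hl, set_acc, cell_succ _ _ hk]
      congr 2
      rw [List.sum_take_succ _ _ hk]; omega
    · simp [Expr.ReadsLt, Expr.val, BinOp.eval, hl, hcell]; omega
  · intro k _
    simp only [Expr.cost]; omega
  · simp only [Expr.cost]; omega
  simpa using this

open GState in
/-- Afterwards the algorithm with predictions has preprocessed its input: the code `enc` of the initial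
data structure, the prediction `reqs`, and as many of the random bits as it needs. -/
theorem runs_gammaPrepAlg {W WA Y D C coinExp : ℕ} (hW : (Y + 2) ^ 40 ≤ W)
    (hWD : (Y + 2) ^ D ≤ W) (hCD : C + 10 ≤ D) (hcD : 8 * coinExp + 2 ≤ D)
    (hA : WA ≤ W) {aprep : Prog} (σ : GState) (n₃ : ℕ) (enc reqs bits : List ℕ)
    (hin2 : σ.in2 3 = n₃) (hn₃ : n₃ < Y) (hvA : σ.vA = fun _ _ => 0) (hLY : σ.len < Y)
    (hR : σ.vR.output = enc) (hencY : ∀ y ∈ enc, y < Y)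
    (henc : enc.length + 1 < Y)
    (hreqs : reqs.length = 2 * σ.len * n₃) (hreqY : ∀ y ∈ reqs, y < Y)
    (hreq : ∀ k < reqs.length,
      σ.vU 1 (2 + 3 * ((k / 2) % σ.len) + k % 2) = cell reqs (k + 1))
    (hN : (([[(1 + C) * σ.len], enc, reqs] : List (List ℕ)).map weight).sum < Y)
    (hin4 : σ.in4 = cell bits) (hbY : ∀ y ∈ bits, y < Y) (hbl : bits.length < Y)
    (hcoins : ((([[(1 + C) * σ.len], enc, reqs] : List (List ℕ)).map weight).sum + 2) ^ coinExp
      ≤ bits.length)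
    {mA : Mem} {tA : ℕ}
    (hE : Exec WA aprep (Mem.init ([[(1 + C) * σ.len], enc, reqs] ++ [bits.take
      (((([[(1 + C) * σ.len], enc, reqs] : List (List ℕ)).map weight).sum + 2) ^ coinExp)]))
      mA tA) :
    ∃ r cnt acc, Runs W (gammaPrepAlg aprep C coinExp) σ.mem
      (mem { σ with r := r, cnt := cnt, acc := acc, vA := mA })
      (1000 * Y + 10 * coinExp + tA) := by
  set N := (([[(1 + C) * σ.len], enc, reqs] : List (List ℕ)).map weight).sum with hNdef
  have hNval : N = 1 + (1 + C) * σ.len + enc.length + reqs.length + enc.sum + reqs.sum := by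
    simp [hNdef, weight]; ring
  set coins := (N + 2) ^ coinExp with hcoinsdef
  set d := (1 + C) * σ.len with hd
  have hreqlen : reqs.length < Y := by omega
  have hout : ∀ i ≤ enc.length, σ.vR 1 i = cell enc i := Mem.of_output hR
  have hcenc : ∀ k, cell enc k < Y := cell_lt (by omega) hencY
  have hcreq : ∀ k, cell reqs k < Y := cell_lt (by omega) hreqY
  have hcbits : ∀ k, cell bits k < Y := cell_lt (by omega) hbY
  have hcoinsY : coins < Y := by omega
  let V1 : Mem := Function.update (fun _ _ => 0) 3 (cell enc)
  have h1 : Runs W (fill 5 (fA 3) (.op .add (.get (fR 1) (.lit 0)) (.lit 1)) (reg 5)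
      (.get (fR 1) (reg 5))) σ.mem (mem { σ with r := enc.length + 1, vA := V1 }) (30 * Y) := by
    have := runs_fill_A hW σ 3 0 (cell enc) (enc.length + 1) henc
      (cnt := .op .add (.get (fR 1) (.lit 0)) (.lit 1)) (idx := reg 5) (val := .get (fR 1) (reg 5))
      (T := 30 * Y) (by decide) (by decide) (by decide) ?_ ?_ ?_ ?_
    · rwa [hvA, fillArr_cell] at this
    · intro k arr
      simp [Expr.ReadsLt, Expr.val, BinOp.eval, hout 0, cell_zero]; omega
    · intro k arr hk
      simp [Expr.ReadsLt, Expr.val]; omega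
    · intro k arr hk
      simp [Expr.ReadsLt, Expr.val, hout k (by omega), hcenc k]; omega
    · exact Nat.mul_le_mul (by decide) henc
  have h2 : Runs W (.put (fA 2) (.lit 0) (.lit 1)) (mem { σ with r := enc.length + 1, vA := V1 })
      (mem { σ with r := enc.length + 1, vA := V1.set 2 0 1 }) 3 :=
    Runs.put hW (set_fA _ _ _ _) (by simp [Expr.ReadsLt]) (by decide) (by decide)
  let V3 : Mem := Function.update V1 2 (cell [d])
  have h3 : Runs W (.put (fA 2) (.lit 1) (.op .mul (.lit (1 + C)) (reg 9)))
      (mem { σ with r := enc.length + 1, vA := V1.set 2 0 1 })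
      (mem { σ with r := enc.length + 1, vA := V3 }) 6 := by
    refine Runs.put hWD ?_ ?_ ⟨⟨rfl, by simp [Expr.deg]; omega⟩, ⟨rfl, by simp [Expr.deg]; omega⟩⟩
      (by simp [Expr.cost])
    · simp only [Expr.val, BinOp.eval, mem_len, set_fA, ← hd]
      congr 2
      funext a i
      by_cases ha : a = 2
      · subst ha
        rcases i with _ | _ | i <;> simp [Mem.set, cell, V3, V1]
      · simp [Mem.set, ha, V3]
    · simpa [Expr.ReadsLt, Expr.val] using hLY
  let σ3 : GState := { σ with r := enc.length + 1, vA := V3 }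
  have hpl : ∀ σ' : GState, σ'.len = σ.len → σ'.in2 = σ.in2 →
      predictionLength.ReadsLt Y σ'.mem ∧ predictionLength.val σ'.mem = reqs.length := by
    intro σ' e1 e2
    constructor
    · simp [Expr.ReadsLt, Expr.val, e1, e2, hin2, hn₃, hLY]
    · simp [Expr.val, BinOp.eval, e1, e2, hin2, hreqs]
  let gq : ℕ → ℕ := fun k => cell reqs (k + 1)
  let V4 : Mem := Function.update V3 4 (fillArr (fun _ => 0) 1 gq reqs.length)
  have h4 : Runs W (fill 5 (fA 4) predictionLength (.op .add (.lit 1) (reg 5)) predictionWord)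
      σ3.mem (mem { σ3 with r := reqs.length, vA := V4 }) (50 * Y) := by
    have := runs_fill_A hW σ3 4 1 gq reqs.length hreqlen
      (cnt := predictionLength) (idx := .op .add (.lit 1) (reg 5)) (val := predictionWord)
      (T := 50 * Y) (by decide) (by decide) (by decide) ?_ ?_ ?_ ?_
    · exact this
    · intro k arr
      exact hpl _ rfl rfl
    · intro k arr hk
      simp [Expr.ReadsLt, Expr.val, BinOp.eval]; omega
    · intro k arr hk
      have e : ∀ x, σ3.vU 1 x = σ.vU 1 x := fun _ => rfl
      have e' : σ3.len = σ.len := rfl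
      simp [Expr.ReadsLt, Expr.val, BinOp.eval, e, e', hreq k hk, hcreq, gq, hLY]; omega
    · exact Nat.mul_le_mul (by decide) hreqlen
  let V5 : Mem := Function.update V3 4 (cell reqs)
  have h5 : Runs W (.put (fA 4) (.lit 0) predictionLength)
      (mem { σ3 with r := reqs.length, vA := V4 }) (mem { σ3 with r := reqs.length, vA := V5 })
      20 := by
    have := hpl { σ3 with r := reqs.length, vA := V4 } rfl rfl
    refine Runs.put hW ?_ ⟨trivial, this.1⟩ (by decide) (by decide)
    rw [this.2, set_fA]
    congr 2
    simp only [V4, V5, Expr.val, Mem.update_set, update_fillArr_cell _ gq (fun _ _ => rfl)]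
  let σ5 : GState := { σ3 with r := reqs.length, vA := V5 }
  have h52 : σ5.vA 2 = cell [d] := by simp [σ5, V5, V3]
  have h53 : σ5.vA 3 = cell enc := by simp [σ5, V5, V3, V1]
  have h54 : σ5.vA 4 = cell reqs := by simp [σ5, V5]
  let acc0 := 1 + d + enc.length + reqs.length
  have h6 : Runs W (.put 10 (.lit 0) (.op .add (.op .add (.op .add (.lit 1) (.get (fA 2) (.lit 1)))
      (.get (fA 3) (.lit 0))) (.get (fA 4) (.lit 0)))) σ5.mem (mem { σ5 with acc := acc0 }) 20 := by
    refine Runs.put hW ?_ ?_ (by decide) (by decide)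
    · simp only [Expr.val, BinOp.eval, mem_fA, set_acc, h52, h53, h54, cell_zero, acc0]
      rfl
    · have e : cell [d] 1 = d := rfl
      simp [Expr.ReadsLt, Expr.val, h52, h53, h54, cell_zero, e]; omega
  have h7 : Runs W (sumProg (fA 3)) (mem { σ5 with acc := acc0 })
      (mem { σ5 with acc := acc0 + enc.sum, r := enc.length }) (100 * Y) :=
    runs_sumProg_A hW { σ5 with acc := acc0 } 3 enc h53 (by omega) hencY
      (by simp only [acc0]; omega)
  have hNacc : acc0 + enc.sum + reqs.sum = N := by simp only [acc0]; omega
  have h8 : Runs W (sumProg (fA 4)) (mem { σ5 with acc := acc0 + enc.sum, r := enc.length })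
      (mem { σ5 with acc := N, r := reqs.length }) (100 * Y) := by
    rw [← hNacc]
    exact runs_sumProg_A hW { σ5 with acc := acc0 + enc.sum, r := enc.length } 4 reqs h54
      (by omega) hreqY (by simp only [acc0]; omega)
  let σ8 : GState := { σ5 with acc := N, r := reqs.length }
  have h9 : Runs W (.put 8 (.lit 0) (powE (.op .add (reg 10) (.lit 2)) coinExp)) σ8.mem
      (mem { σ8 with cnt := coins }) (10 + 10 * coinExp) := by
    refine Runs.put hWD ?_ ⟨trivial, powE_readsLt ?_ _⟩ ⟨⟨rfl, by simp [Expr.deg]; omega⟩,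
      ⟨powE_arith rfl _, ?_⟩⟩ ?_
    · rw [powE_val]; exact set_cnt _ _
    · simp [Expr.ReadsLt, Expr.val, σ8]; omega
    · rw [powE_deg]; simp [Expr.deg]; omega
    · rw [powE_cost]; simp [Expr.cost]; omega
  let gb : ℕ → ℕ := fun k => cell bits (k + 1)
  let σ9 : GState := { σ8 with cnt := coins }
  let V10 : Mem := Function.update V5 5 (fillArr (fun _ => 0) 1 gb coins)
  have h10 : Runs W (fill 5 (fA 5) (reg 8) (.op .add (.lit 1) (reg 5))
      (.get 4 (.op .add (.lit 1) (reg 5)))) σ9.mem (mem { σ9 with r := coins, vA := V10 })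
      (50 * Y) := by
    have := runs_fill_A hW σ9 5 1 gb coins hcoinsY
      (cnt := reg 8) (idx := .op .add (.lit 1) (reg 5)) (val := .get 4 (.op .add (.lit 1) (reg 5)))
      (T := 50 * Y) (by decide) (by decide) (by decide) ?_ ?_ ?_ ?_
    · exact this
    · intro k arr
      simp [Expr.ReadsLt, Expr.val, σ9]; omega
    · intro k arr hk
      simp [Expr.ReadsLt, Expr.val, BinOp.eval]; omega
    · intro k arr hk
      have e : σ9.in4 = cell bits := hin4
      simp [Expr.ReadsLt, Expr.val, BinOp.eval, e, gb, hcbits, Nat.add_comm 1 k]; omega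
    · exact Nat.mul_le_mul (by decide) hcoinsY
  let V11 : Mem := Mem.init ([[d], enc, reqs] ++ [bits.take coins])
  have h11 : Runs W (.put (fA 5) (.lit 0) (reg 8)) (mem { σ9 with r := coins, vA := V10 })
      (mem { σ9 with r := coins, vA := V11 }) 10 := by
    refine Runs.put hW ?_ ?_ (by decide) (by decide)
    · simp only [Expr.val, mem_cnt, set_fA]
      congr 2
      have hlen : (bits.take coins).length = coins := by simp; omega
      have e : Function.update (fillArr (fun _ => 0) 1 gb coins) 0 coins
          = cell (bits.take coins) := by
        have := update_fillArr_cell (bits.take coins) gb ?_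
        · rwa [hlen] at this
        · intro k hk
          rw [hlen] at hk
          simp only [gb]
          rw [cell_succ _ _ (by omega), cell_succ _ _ (by omega)]
          simp
      simp only [V10, Mem.update_set, V11, σ9]
      rw [e]
      funext a
      by_cases h5 : a = 5
      · subst h5; rw [Mem.init_apply _ 3]; simp
      rw [Function.update_of_ne h5]
      by_cases h4 : a = 4
      · subst h4; rw [Mem.init_apply _ 2]; simp [V5]
      simp only [V5]
      rw [Function.update_of_ne h4]
      by_cases h2 : a = 2
      · subst h2; rw [Mem.init_apply _ 0]; simp [V3]
      simp only [V3]
      rw [Function.update_of_ne h2]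
      by_cases h3 : a = 3
      · subst h3; rw [Mem.init_apply _ 1]; simp [V1]
      simp only [V1]
      rw [Function.update_of_ne h3]
      by_cases h : a < 2
      · exact (Mem.init_zero _ _ h).symm
      · exact (Mem.init_of_le _ _ (by simp; omega)).symm
    · simpa [Expr.ReadsLt, Expr.val, σ9] using hcoinsY
  have h12 : Runs W (aprep.embed fA id) (mem { σ9 with r := coins, vA := V11 })
      (mem { σ9 with r := coins, vA := mA }) tA :=
    runs_A { σ9 with r := coins, vA := V11 } hA hE
  exact ⟨coins, coins, N, (h1.seq (h2.seq (h3.seq (h4.seq (h5.seq (h6.seq (h7.seq (h8.seq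
    (h9.seq (h10.seq (h11.seq h12))))))))))).mono (by omega)⟩

/-! ### The order in which the requests are issued -/

theorem getElem?_flatMap_range {α : Type*} (f : ℕ → List α) (L i s : ℕ) (hi : i < L)
    (hs : s < (f i).length) :
    ((List.range L).flatMap f)[(∑ j ∈ Finset.range i, (f j).length) + s]? = (f i)[s]? := by
  have hlen : ∀ i, ((List.range i).flatMap f).length = ∑ j ∈ Finset.range i, (f j).length := by
    intro i
    induction i with
    | zero => rfl
    | succ i ih =>
      rw [List.range_succ, List.flatMap_append, List.length_append, ih, Finset.sum_range_succ]
      simp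
  obtain ⟨c, rfl⟩ := Nat.exists_eq_add_of_le (show i + 1 ≤ L by omega)
  rw [List.range_add, List.flatMap_append, List.getElem?_append_left, List.range_succ,
    List.flatMap_append, List.getElem?_append_right, hlen, Nat.add_sub_cancel_left]
  · simp
  · rw [hlen]; omega
  · rw [hlen, Finset.sum_range_succ]; omega

theorem length_flatMap_range {α : Type*} (f : ℕ → List α) (L : ℕ) :
    ((List.range L).flatMap f).length = ∑ j ∈ Finset.range L, (f j).length := by
  induction L with
  | zero => rfl
  | succ i ih =>
    rw [List.range_succ, List.flatMap_append, List.length_append, ih, Finset.sum_range_succ]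
    simp

theorem getElem?_flatMap_of_length {α β : Type*} (f : α → List β) (c : ℕ)
    (hf : ∀ a, (f a).length = c) (l : List α) (i j : ℕ) (hi : i < l.length) (hj : j < c) :
    (l.flatMap f)[c * i + j]? = (f l[i])[j]? := by
  induction l generalizing i with
  | nil => simp at hi
  | cons a l ih =>
    rw [List.flatMap_cons]
    cases i with
    | zero =>
      rw [List.getElem?_append_left (by rw [hf]; omega)]
      simp
    | succ i =>
      rw [List.getElem?_append_right (by rw [hf, Nat.mul_succ]; omega), hf,
        show c * (i + 1) + j - c = c * i + j by rw [Nat.mul_succ]; omega,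
        ih i (by simpa using hi)]
      simp

section Schedule

variable (L : ℕ) (od : ℕ → ℕ) (blk : ℕ → List ℕ)

/-- The number of pending copies of the requests before round `k`. -/
def pending : ℕ → ℕ → ℕ
  | 0 => fun _ => 0
  | k + 1 => fun j => if j < L then nextPend od (blk k) (pending k) j else pending k j

/-- The places in the prediction of the pending copies of the request at position `i` before
round `k`: the copies from the most recent rounds are pending. -/
def pendingTags (k i : ℕ) : List ℕ :=
  (List.range (pending L od blk k i)).map fun s => (k - pending L od blk k i + s) * L + i

/-- The places in the prediction of the copies of the request at position `i` that are issued at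
the end of round `k`. -/
def flushTags (k i : ℕ) : List ℕ :=
  (List.range (flushCount od (blk k) (pending L od blk k) i)).map
    fun s => (k - pending L od blk k i + s) * L + i

/-- The places in the prediction of the requests of the block of round `k`; each position is
served by its oldest copy. -/
def blockTags (k : ℕ) : List ℕ :=
  (blk k).map fun i => (k - pending L od blk k i) * L + i

/-- The places in the prediction of the requests issued in round `k`. -/
def roundTags (k : ℕ) : List ℕ :=
  blockTags L od blk k ++ (List.range L).flatMap (flushTags L od blk k)

/-- The places in the prediction of all requests, in the order in which these are issued in the
first `k` rounds. -/
def issuedTags (k : ℕ) : List ℕ := (List.range k).flatMap (roundTags L od blk)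

/-- The same followed by the copies that are then pending. -/
def schedule (k : ℕ) : List ℕ :=
  issuedTags L od blk k ++ (List.range L).flatMap (pendingTags L od blk k)

variable {L od blk}

theorem pending_succ {k j : ℕ} (hj : j < L) :
    pending L od blk (k + 1) j = nextPend od (blk k) (pending L od blk k) j := by
  simp [pending, hj]

theorem pending_of_le {k j : ℕ} (hj : L ≤ j) : pending L od blk k j = 0 := by
  induction k with
  | zero => rfl
  | succ k ih => simp [pending, Nat.not_lt.2 hj, ih]

theorem pending_le_self (k j : ℕ) : pending L od blk k j ≤ k := by
  induction k with
  | zero => exact le_rfl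
  | succ k ih =>
    simp only [pending, nextPend]
    split_ifs <;> omega

theorem pending_eq_zero_or_lt (k j : ℕ) :
    pending L od blk k j = 0 ∨ pending L od blk k j < od j := by
  induction k with
  | zero => exact Or.inl rfl
  | succ k ih =>
    simp only [pending, nextPend]
    split_ifs with h1 h2 h3
    · exact ih
    · exact Or.inr h3
    · exact Or.inl rfl
    · exact ih

/-- Requests are issued at the end of a round in groups of the size of their cyclic order; the order
`0` stands for a query, of which one copy is issued. -/
theorem flushCount_pending (k j : ℕ) :
    flushCount od (blk k) (pending L od blk k) j = 0 ∨
      flushCount od (blk k) (pending L od blk k) j = max 1 (od j) := by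
  have := pending_eq_zero_or_lt (L := L) (od := od) (blk := blk) k j
  unfold flushCount
  split_ifs <;> omega

theorem blockTags_perm {k : ℕ} (hnd : (blk k).Nodup) (hlt : ∀ i ∈ blk k, i < L) :
    (blockTags L od blk k).Perm ((List.range L).flatMap fun i =>
      if i ∈ blk k then [(k - pending L od blk k i) * L + i] else []) := by
  have h1 : (blk k).Perm ((List.range L).filter (· ∈ blk k)) := by
    refine (List.perm_ext_iff_of_nodup hnd (List.nodup_range.filter _)).2 fun i => ?_
    simp only [List.mem_filter, List.mem_range, decide_eq_true_eq]
    exact ⟨fun h => ⟨hlt i h, h⟩, fun h => h.2⟩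
  refine (h1.map _).trans (List.Perm.of_eq ?_)
  generalize List.range L = l
  induction l with
  | nil => rfl
  | cons a l ih =>
    rw [List.filter_cons, List.flatMap_cons, ← ih]
    by_cases h : a ∈ blk k <;> simp [h]

/-- One round conserves copies: those issued, with those pending afterwards, are those that were
pending before, with one new copy of each position. -/
theorem round_tags_perm {k : ℕ} (hnd : (blk k).Nodup) (hlt : ∀ i ∈ blk k, i < L) :
    (roundTags L od blk k ++ (List.range L).flatMap (pendingTags L od blk (k + 1))).Perm
      ((List.range L).flatMap (pendingTags L od blk k) ++
        (List.range L).map fun i => k * L + i) := by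
  have e1 : (roundTags L od blk k ++ (List.range L).flatMap (pendingTags L od blk (k + 1))).Perm
      ((List.range L).flatMap fun i =>
        ((if i ∈ blk k then [(k - pending L od blk k i) * L + i] else []) ++
          flushTags L od blk k i) ++ pendingTags L od blk (k + 1) i) := by
    refine List.Perm.trans (List.Perm.append_right _ ?_) (List.flatMap_append_perm _ _ _)
    exact ((blockTags_perm hnd hlt).append_right _).trans (List.flatMap_append_perm _ _ _)
  have e2 : ((List.range L).flatMap (pendingTags L od blk k) ++
      (List.range L).map fun i => k * L + i).Perm
      ((List.range L).flatMap fun i => pendingTags L od blk k i ++ [k * L + i]) := by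
    rw [List.map_eq_flatMap]
    exact List.flatMap_append_perm _ _ _
  refine e1.trans (List.Perm.trans (List.Perm.of_eq ?_) e2.symm)
  refine List.flatMap_congr fun i hi => ?_
  have hi : i < L := List.mem_range.1 hi
  set p := pending L od blk k i with hp
  have hpk : p ≤ k := pending_le_self _ _
  have hrhs : pendingTags L od blk k i ++ [k * L + i] =
      (List.range (p + 1)).map fun s => (k - p + s) * L + i := by
    rw [List.range_succ, List.map_append]
    simp only [pendingTags, ← hp, List.map_cons, List.map_nil]
    rw [Nat.sub_add_cancel hpk]
  -- There are three cases: the oldest copy is used and the new one becomes pending in its place, the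
  -- new copy is postponed, or the new copy completes a group that is issued.
  rw [hrhs]
  by_cases h1 : i ∈ blk k
  · have hf : flushTags L od blk k i = [] := by simp [flushTags, flushCount, h1]
    have hn : pending L od blk (k + 1) i = p := by simp [pending_succ hi, nextPend, h1, hp]
    rw [hf, if_pos h1, List.range_succ_eq_map]
    simp only [pendingTags, hn, List.append_nil, List.map_cons, List.map_map, Nat.add_zero,
      List.singleton_append, List.cons.injEq, true_and]
    refine List.map_congr_left fun s _ => ?_
    simp only [Function.comp]
    congr 2; omega
  · by_cases h2 : p + 1 < od i
    · have hf : flushTags L od blk k i = [] := by simp [flushTags, flushCount, h1, ← hp, h2]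
      have hn : pending L od blk (k + 1) i = p + 1 := by
        simp [pending_succ hi, nextPend, h1, ← hp, h2]
      rw [hf, if_neg h1]
      simp only [pendingTags, hn, List.nil_append, Nat.add_sub_add_right]
    · have hn : pending L od blk (k + 1) i = 0 := by
        simp [pending_succ hi, nextPend, h1, ← hp, h2]
      have hf : flushCount od (blk k) (pending L od blk k) i = p + 1 := by
        simp [flushCount, h1, ← hp, h2]
      rw [if_neg h1]
      simp [pendingTags, hn, flushTags, hf, ← hp]

/-- The requests issued, together with those pending, are those predicted. -/
theorem schedule_perm {K : ℕ} (hnd : ∀ k < K, (blk k).Nodup) (hlt : ∀ k < K, ∀ i ∈ blk k, i < L) :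
    (schedule L od blk K).Perm (List.range (K * L)) := by
  induction K with
  | zero => simp [schedule, issuedTags, pendingTags, pending]
  | succ K ih =>
    have ih := ih (fun k hk => hnd k (by omega)) (fun k hk => hlt k (by omega))
    have h1 := round_tags_perm (od := od) (hnd K (by omega)) (hlt K (by omega))
    have h2 : issuedTags L od blk (K + 1) = issuedTags L od blk K ++ roundTags L od blk K := by
      simp [issuedTags, List.range_succ]
    rw [schedule, h2, List.append_assoc, Nat.succ_mul, List.range_add]
    exact (h1.append_left _).trans ((List.append_assoc _ _ _) ▸ ih.append_right _)

theorem length_pendingTags_le {C k : ℕ} (hod : ∀ i < L, od i ≤ C) :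
    ((List.range L).flatMap (pendingTags L od blk k)).length ≤ C * L := by
  rw [length_flatMap_range, Nat.mul_comm]
  refine (Finset.sum_le_card_nsmul _ _ C fun i hi => ?_).trans (by simp)
  have := pending_eq_zero_or_lt (L := L) (od := od) (blk := blk) k i
  have := hod i (Finset.mem_range.1 hi)
  simp only [pendingTags, List.length_map, List.length_range]
  omega

/-- A copy pending in round `k`, or added in it, belongs to one of the last `C + 1` rounds. -/
theorem tag_bounds {C k i s : ℕ} (hi : i < L) (hod : od i ≤ C)
    (hs : s ≤ pending L od blk k i) :
    (k - pending L od blk k i + s) * L + i < (k + 1) * L ∧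
      k * L ≤ (k - pending L od blk k i + s) * L + i + C * L := by
  have h1 := pending_eq_zero_or_lt (L := L) (od := od) (blk := blk) k i
  have h2 := pending_le_self (L := L) (od := od) (blk := blk) k i
  constructor
  · have : (k - pending L od blk k i + s) * L ≤ k * L := Nat.mul_le_mul_right _ (by omega)
    rw [Nat.succ_mul]; omega
  · have : k * L ≤ (k - pending L od blk k i + s + C) * L := Nat.mul_le_mul_right _ (by omega)
    rw [Nat.add_mul] at this; omega

theorem roundTags_bounds {C k x : ℕ} (hlt : ∀ i ∈ blk k, i < L) (hod : ∀ i < L, od i ≤ C)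
    (hx : x ∈ roundTags L od blk k) : x < (k + 1) * L ∧ k * L ≤ x + C * L := by
  simp only [roundTags, List.mem_append, blockTags, List.mem_map, List.mem_flatMap, List.mem_range,
    flushTags] at hx
  rcases hx with ⟨i, hi, rfl⟩ | ⟨i, hi, s, hs, rfl⟩
  · exact tag_bounds (s := 0) (hlt i hi) (hod i (hlt i hi)) (Nat.zero_le _)
  · refine tag_bounds hi (hod i hi) ?_
    unfold flushCount at hs
    split_ifs at hs <;> omega

theorem pendingTags_bounds {C k x : ℕ} (hod : ∀ i < L, od i ≤ C)
    (hx : x ∈ (List.range L).flatMap (pendingTags L od blk k)) :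
    x < (k + 1) * L ∧ k * L ≤ x + C * L := by
  simp only [pendingTags, List.mem_map, List.mem_flatMap, List.mem_range] at hx
  obtain ⟨i, hi, s, hs, rfl⟩ := hx
  exact tag_bounds hi (hod i hi) hs.le

/-- No request is issued more than `(1 + C) * L` places before or after its predicted place. -/
theorem schedule_delay {C K : ℕ} (hnd : ∀ k < K, (blk k).Nodup)
    (hlt : ∀ k < K, ∀ i ∈ blk k, i < L) (hod : ∀ i < L, od i ≤ C) (t x : ℕ)
    (h : (schedule L od blk K)[t]? = some x) :
    t ≤ x + (1 + C) * L ∧ x ≤ t + (1 + C) * L := by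
  have hlen : ∀ k ≤ K, (issuedTags L od blk k).length ≤ k * L ∧
      k * L ≤ (issuedTags L od blk k).length + C * L := by
    intro k hk
    have h1 := (schedule_perm (od := od) (fun j hj => hnd j (hj.trans_le hk))
      (fun j hj => hlt j (hj.trans_le hk))).length_eq
    have h2 := length_pendingTags_le (blk := blk) (k := k) hod
    rw [schedule, List.length_append, List.length_range] at h1
    omega
  have key : ∀ k ≤ K, ∀ t x, (issuedTags L od blk k)[t]? = some x →
      t ≤ x + (1 + C) * L ∧ x ≤ t + (1 + C) * L := by
    intro k
    induction k with
    | zero => intro _ t x h; simp [issuedTags] at h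
    | succ k ih =>
      intro hk t x h
      have h1 := hlen k (by omega)
      have h2 := hlen (k + 1) hk
      have e : issuedTags L od blk (k + 1) = issuedTags L od blk k ++ roundTags L od blk k := by
        simp [issuedTags, List.range_succ]
      have ht : t < (issuedTags L od blk (k + 1)).length := by
        by_contra hc
        rw [List.getElem?_eq_none (by omega)] at h
        cases h
      by_cases hlt' : t < (issuedTags L od blk k).length
      · rw [e, List.getElem?_append_left hlt'] at h
        exact ih (by omega) t x h
      · rw [e, List.getElem?_append_right (by omega)] at h
        have := roundTags_bounds (hlt k (by omega)) hod (List.mem_of_getElem? h)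
        rw [Nat.add_mul, Nat.one_mul] at *
        omega
  by_cases hlt' : t < (issuedTags L od blk K).length
  · rw [schedule, List.getElem?_append_left hlt'] at h
    exact key K le_rfl t x h
  · have ht : t < K * L := by
      by_contra hc
      rw [List.getElem?_eq_none] at h
      · cases h
      · rw [(schedule_perm hnd hlt).length_eq, List.length_range]; omega
    rw [schedule, List.getElem?_append_right (by omega)] at h
    have := pendingTags_bounds hod (List.mem_of_getElem? h)
    have h1 := hlen K le_rfl
    rw [Nat.add_mul, Nat.one_mul] at *
    omega

/-- The number of requests issued before round `k`. -/
def roundStart (L : ℕ) (od : ℕ → ℕ) (blk : ℕ → List ℕ) (k : ℕ) : ℕ := (issuedTags L od blk k).length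

/-- The number of requests issued before the copies of the request at position `i` are issued at
the end of round `k`, counted from the beginning of the round. -/
def offset (L : ℕ) (od : ℕ → ℕ) (blk : ℕ → List ℕ) (k i : ℕ) : ℕ :=
  (blk k).length + ∑ j ∈ Finset.range i, flushCount od (blk k) (pending L od blk k) j

theorem roundStart_succ (k : ℕ) :
    roundStart L od blk (k + 1) = roundStart L od blk k + offset L od blk k L := by
  have e : issuedTags L od blk (k + 1) = issuedTags L od blk k ++ roundTags L od blk k := by
    simp [issuedTags, List.range_succ]
  rw [roundStart, e, List.length_append, roundTags, List.length_append, length_flatMap_range]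
  simp [roundStart, offset, blockTags, flushTags]

theorem roundStart_le {k K : ℕ} (hk : k ≤ K) : roundStart L od blk k ≤ roundStart L od blk K :=
  le_of_step (fun k => roundStart_succ k) hk

theorem roundStart_le_mul {K : ℕ} (hnd : ∀ k < K, (blk k).Nodup) (hlt : ∀ k < K, ∀ i ∈ blk k, i < L) :
    roundStart L od blk K ≤ K * L := by
  have := (schedule_perm (od := od) hnd hlt).length_eq
  rw [schedule, List.length_append, List.length_range] at this
  unfold roundStart; omega

theorem schedule_getElem?_round {K k t : ℕ} (hk : k < K) (ht : t < (roundTags L od blk k).length) :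
    (schedule L od blk K)[roundStart L od blk k + t]? = (roundTags L od blk k)[t]? := by
  have h1 := getElem?_flatMap_range (roundTags L od blk) K k t hk ht
  rw [← length_flatMap_range] at h1
  rw [schedule, List.getElem?_append_left]
  · exact h1
  · have := roundStart_le (L := L) (od := od) (blk := blk) (show k + 1 ≤ K from hk)
    have e : issuedTags L od blk (k + 1) = issuedTags L od blk k ++ roundTags L od blk k := by
      simp [issuedTags, List.range_succ]
    unfold roundStart at *
    rw [e, List.length_append] at this
    omega

theorem schedule_getElem?_block {K k r : ℕ} (hk : k < K) (hr : r < (blk k).length) :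
    (schedule L od blk K)[roundStart L od blk k + r]? =
      some ((k - pending L od blk k (blk k)[r]) * L + (blk k)[r]) := by
  rw [schedule_getElem?_round hk (by simp [roundTags, blockTags]; omega), roundTags,
    List.getElem?_append_left (by simpa [blockTags] using hr)]
  simp [blockTags, hr]

theorem schedule_getElem?_flush {K k i s : ℕ} (hk : k < K) (hi : i < L)
    (hs : s < flushCount od (blk k) (pending L od blk k) i) :
    (schedule L od blk K)[roundStart L od blk k + (offset L od blk k i + s)]? =
      some ((k - pending L od blk k i + s) * L + i) := by
  have hs' : s < (flushTags L od blk k i).length := by simpa [flushTags] using hs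
  have h1 := getElem?_flatMap_range (flushTags L od blk k) L i s hi hs'
  have hl : ∀ j, (flushTags L od blk k j).length = flushCount od (blk k) (pending L od blk k) j := by
    simp [flushTags]
  have hb : (blockTags L od blk k).length = (blk k).length := by simp [blockTags]
  have h2 : (roundTags L od blk k)[offset L od blk k i + s]? =
      some ((k - pending L od blk k i + s) * L + i) := by
    rw [roundTags, List.getElem?_append_right (by rw [hb, offset]; omega), hb, offset,
      Nat.add_assoc, Nat.add_sub_cancel_left]
    simp only [hl] at h1
    rw [h1]
    simp [flushTags, hs]
  rw [schedule_getElem?_round hk, h2]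
  by_contra hc
  rw [List.getElem?_eq_none (by omega)] at h2
  cases h2

end Schedule

/-! ### Correct answers and cyclic updates -/

/-- The outputs `o b, o (b + 1), …` at the queries of a sequence of requests whose first request
has number `b`. -/
def answersFrom (o : ℕ → ℕ) : ℕ → List Request → List ℕ
  | _, [] => []
  | b, .update _ :: ρ => answersFrom o (b + 1) ρ
  | b, .query _ :: ρ => o b :: answersFrom o (b + 1) ρ

theorem answersFrom_append (o : ℕ → ℕ) (b : ℕ) (l l' : List Request) :
    answersFrom o b (l ++ l') = answersFrom o b l ++ answersFrom o (b + l.length) l' := by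
  induction l generalizing b with
  | nil => rfl
  | cons r l ih =>
    have e : b + 1 + l.length = b + (l.length + 1) := by omega
    cases r <;> simp [answersFrom, ih, e]

theorem answersFrom_length (o : ℕ → ℕ) (b : ℕ) (l : List Request) :
    (answersFrom o b l).length = l.countP Request.isQuery := by
  induction l generalizing b with
  | nil => rfl
  | cons r l ih => cases r <;> simp [answersFrom, ih, Request.isQuery, List.countP_cons]

theorem mem_answersFrom {o : ℕ → ℕ} {b a : ℕ} {l : List Request} (h : a ∈ answersFrom o b l) :
    ∃ t < l.length, a = o (b + t) := by
  induction l generalizing b with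
  | nil => simp [answersFrom] at h
  | cons r l ih =>
    have : a ∈ answersFrom o (b + 1) l → ∃ t < (r :: l).length, a = o (b + t) := by
      intro h
      obtain ⟨t, ht, e⟩ := ih h
      exact ⟨t + 1, by simpa using ht, by rw [e]; congr 1; omega⟩
    cases r with
    | update x => exact this h
    | query y =>
      rcases List.mem_cons.1 h with h | h
      · exact ⟨0, by simp, h⟩
      · exact this h

/-- The answers collected in a round, in terms of the requests at the positions selected. -/
theorem answersUpTo_eq (isq : ℕ → Prop) [DecidablePred isq] (pos o : ℕ → ℕ) (b : ℕ)
    (req : ℕ → Request) (blk : List ℕ) (hpos : ∀ r (hr : r < blk.length), pos r = blk[r])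
    (hq : ∀ i ∈ blk, (isq i ↔ (req i).isQuery = true)) :
    answersUpTo isq pos (fun t => o (b + t)) blk.length = answersFrom o b (blk.map req) := by
  have key : ∀ r ≤ blk.length, answersUpTo isq pos (fun t => o (b + t)) r =
      answersFrom o b ((blk.take r).map req) := by
    intro r
    induction r with
    | zero => intro _; simp [answersUpTo, answersFrom]
    | succ r ih =>
      intro hr
      have hr' : r < blk.length := hr
      have hq' := hq blk[r] (List.getElem_mem _)
      rw [answersUpTo_succ, ih (by omega), List.take_add_one, List.getElem?_eq_getElem hr',
        hpos r hr', List.map_append, answersFrom_append]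
      have hlen : ((blk.take r).map req).length = r := by simp; omega
      rw [hlen]
      cases h : req blk[r] with
      | update x =>
        rw [h] at hq'
        rw [if_neg (by rw [hq']; simp [Request.isQuery])]
        simp [h, answersFrom]
      | query y =>
        rw [h] at hq'
        rw [if_pos (by rw [hq']; simp [Request.isQuery])]
        simp [h, answersFrom]
  simpa using key blk.length le_rfl

/-- Outputs `f t` of length one at the queries are determined by their entries `o t`. -/
theorem eq_answersFrom_of_queryOutputs {o : ℕ → ℕ} {f : ℕ → List ℕ}
    (hf : ∀ t a, f t = [a] → o t = a) (b : ℕ) (ρ : List Request) (as : List ℕ)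
    (h : queryOutputs ρ ((List.range' b ρ.length).map f) = as.map fun a => [a]) :
    as = answersFrom o b ρ := by
  induction ρ generalizing b as with
  | nil =>
    cases as with
    | nil => rfl
    | cons a as => simp [queryOutputs] at h
  | cons r ρ ih =>
    rw [List.length_cons, List.range'_succ, List.map_cons] at h
    cases r with
    | update x =>
      refine ih (b + 1) as ?_
      simpa [queryOutputs, Request.isQuery] using h
    | query y =>
      cases as with
      | nil => simp [queryOutputs, Request.isQuery] at h
      | cons a as =>
        simp only [queryOutputs, List.zip_cons_cons, Request.isQuery, List.filter_cons_of_pos,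
          List.map_cons, List.cons.injEq] at h
        rw [answersFrom, hf b a h.1, ← ih (b + 1) as h.2]

namespace DynamicProblem

variable {P : DynamicProblem}

theorem run_append (D : P.Inst) (l l' : List Request) :
    P.run D (l ++ l') = P.run (P.run D l) l' := by
  simp [run, List.foldl_append]

theorem correctAnswers_of_append {o : ℕ → ℕ} {b : ℕ} {D : P.Inst} {l l' : List Request}
    (h : P.CorrectAnswers D (l ++ l') (answersFrom o b (l ++ l'))) :
    P.CorrectAnswers D l (answersFrom o b l) ∧
      P.CorrectAnswers (P.run D l) l' (answersFrom o (b + l.length) l') := by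
  induction l generalizing D b with
  | nil => exact ⟨rfl, h⟩
  | cons r l ih =>
    have e : b + 1 + l.length = b + (l.length + 1) := by omega
    cases r with
    | update x =>
      obtain ⟨h1, h2⟩ := ih (b := b + 1) (D := P.apply D x) h
      exact ⟨h1, by rw [List.length_cons, ← e]; exact h2⟩
    | query y =>
      obtain ⟨h1, h2⟩ := ih (b := b + 1) (D := D) h.2
      exact ⟨⟨h.1, h1⟩, by rw [List.length_cons, ← e]; exact h2⟩

theorem CorrectAnswers.append {D : P.Inst} {l l' : List Request} {as as' : List ℕ}
    (h : P.CorrectAnswers D l as) (h' : P.CorrectAnswers (P.run D l) l' as') :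
    P.CorrectAnswers D (l ++ l') (as ++ as') := by
  induction l generalizing D as with
  | nil =>
    have : as = [] := h
    subst this; exact h'
  | cons r l ih =>
    cases r with
    | update x => exact ih (D := P.apply D x) h h'
    | query y =>
      cases as with
      | nil => exact h.elim
      | cons a as => exact ⟨h.1, ih (D := D) h.2 h'⟩

/-- The data structures `E` and `E'` cannot be told apart by requests that are possible for `D`. -/
def Indist (D E E' : P.Inst) : Prop :=
  ∀ δ : List Request, (∀ r ∈ δ, P.Allowed D r) → ∀ y a : ℕ, P.IsQuery D y →
    (P.Correct (P.run E δ) y a ↔ P.Correct (P.run E' δ) y a)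

theorem Indist.refl (D E : P.Inst) : Indist D E E := fun _ _ _ _ _ => Iff.rfl

theorem Indist.trans {D E E' E'' : P.Inst} (h : Indist D E E') (h' : Indist D E' E'') :
    Indist D E E'' := fun δ hδ y a hy => (h δ hδ y a hy).trans (h' δ hδ y a hy)

theorem Indist.run {D E E' : P.Inst} (h : Indist D E E') {l : List Request}
    (hl : ∀ r ∈ l, P.Allowed D r) : Indist D (P.run E l) (P.run E' l) := by
  intro δ hδ y a hy
  rw [← run_append, ← run_append]
  refine h _ (fun r hr => ?_) y a hy
  rcases List.mem_append.1 hr with hr | hr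
  · exact hl r hr
  · exact hδ r hr

theorem Indist.correctAnswers {D E E' : P.Inst} (h : Indist D E E') {l : List Request}
    {as : List ℕ} (hl : ∀ r ∈ l, P.Allowed D r) (hc : P.CorrectAnswers E l as) :
    P.CorrectAnswers E' l as := by
  induction l generalizing E E' as with
  | nil => exact hc
  | cons r l ih =>
    have hl' : ∀ r ∈ l, P.Allowed D r := fun r hr => hl r (List.mem_cons_of_mem _ hr)
    cases r with
    | update x =>
      exact ih (E := P.apply E x) (E' := P.apply E' x)
        (h.run (l := [.update x]) (by simpa using hl _ List.mem_cons_self)) hl' hc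
    | query y =>
      cases as with
      | nil => exact hc.elim
      | cons a as =>
        exact ⟨(h [] (by simp) y a (hl _ List.mem_cons_self)).1 hc.1, ih h hl' hc.2⟩

/-- Inserting `l` anywhere in a sequence of possible requests does not change the answers to later
queries. -/
def Neutral (D : P.Inst) (l : List Request) : Prop :=
  ∀ α : List Request, (∀ r ∈ α, P.Allowed D r) → Indist D (P.run D (α ++ l)) (P.run D α)

theorem neutral_nil (D : P.Inst) : Neutral D [] := fun α _ => by
  rw [List.append_nil]; exact Indist.refl _ _

theorem Neutral.append {D : P.Inst} {l l' : List Request} (hl : ∀ r ∈ l, P.Allowed D r)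
    (h : Neutral D l) (h' : Neutral D l') : Neutral D (l ++ l') := by
  intro α hα
  rw [← List.append_assoc]
  refine (h' _ fun r hr => ?_).trans (h α hα)
  rcases List.mem_append.1 hr with hr | hr
  · exact hα r hr
  · exact hl r hr

theorem neutral_query (D : P.Inst) (y : ℕ) : Neutral D [.query y] := by
  intro α _
  rw [run_append]
  exact Indist.refl _ _

/-- A group of as many copies of an update as its cyclic order has no effect. -/
theorem HasCyclicOrder.neutral {D : P.Inst} {x m : ℕ} (h : P.HasCyclicOrder D x m) :
    Neutral D (List.replicate m (.update x)) := by
  intro α hα δ hδ y a hy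
  rw [← run_append, ← run_append]
  have := (h.2 α [] (List.replicate m (.update x)) δ (fun r hr => ?_) (List.nil_sublist _)
    (List.Perm.refl _) y a hy).symm
  · simpa using this
  · rw [List.append_nil] at hr
    rcases List.mem_append.1 hr with hr | hr
    · exact hα r hr
    · exact hδ r hr

theorem neutral_flatMap {D : P.Inst} {f : ℕ → List Request} {l : List ℕ}
    (hl : ∀ i ∈ l, ∀ r ∈ f i, P.Allowed D r) (h : ∀ i ∈ l, Neutral D (f i)) :
    Neutral D (l.flatMap f) := by
  induction l with
  | nil => exact neutral_nil D
  | cons i l ih =>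
    rw [List.flatMap_cons]
    exact (h i List.mem_cons_self).append (hl i List.mem_cons_self)
      (ih (fun j hj => hl j (List.mem_cons_of_mem _ hj)) fun j hj => h j (List.mem_cons_of_mem _ hj))

/-- Correct answers to a sequence of rounds `real k ++ junk k` with neutral `junk k` yield correct
answers to the sequence of the `real k`. -/
theorem correctAnswers_real {D : P.Inst} {o : ℕ → ℕ} {real junk : ℕ → List Request} {K : ℕ}
    (hreal : ∀ k < K, ∀ r ∈ real k, P.Allowed D r) (hjunk : ∀ k < K, ∀ r ∈ junk k, P.Allowed D r)
    (hn : ∀ k < K, Neutral D (junk k))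
    (hc : P.CorrectAnswers D ((List.range K).flatMap fun k => real k ++ junk k)
      (answersFrom o 0 ((List.range K).flatMap fun k => real k ++ junk k))) :
    P.CorrectAnswers D ((List.range K).flatMap real) ((List.range K).flatMap fun k =>
      answersFrom o ((List.range k).flatMap fun k => real k ++ junk k).length (real k)) := by
  have hall : ∀ k ≤ K, ∀ r ∈ (List.range k).flatMap (fun k => real k ++ junk k),
      P.Allowed D r := by
    intro k hk r hr
    simp only [List.mem_flatMap, List.mem_range, List.mem_append] at hr
    obtain ⟨j, hj, h | h⟩ := hr
    · exact hreal j (by omega) r h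
    · exact hjunk j (by omega) r h
  -- The answers carry over because the two data structures remain indistinguishable.
  have key : ∀ k ≤ K, P.CorrectAnswers D ((List.range k).flatMap fun k => real k ++ junk k)
      (answersFrom o 0 ((List.range k).flatMap fun k => real k ++ junk k)) →
    P.CorrectAnswers D ((List.range k).flatMap real) ((List.range k).flatMap fun k =>
      answersFrom o ((List.range k).flatMap fun k => real k ++ junk k).length (real k)) ∧
    Indist D (P.run D ((List.range k).flatMap fun k => real k ++ junk k))
      (P.run D ((List.range k).flatMap real)) := by
    intro k
    induction k with
    | zero => intro _ _; exact ⟨rfl, Indist.refl _ _⟩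
    | succ k ih =>
      intro hk hc
      simp only [List.range_succ, List.flatMap_append, List.flatMap_cons, List.flatMap_nil,
        List.append_nil] at hc ⊢
      rw [← List.append_assoc] at hc ⊢
      obtain ⟨hc1, -⟩ := correctAnswers_of_append hc
      obtain ⟨hc2, hc3⟩ := correctAnswers_of_append hc1
      obtain ⟨ih1, ih2⟩ := ih (by omega) hc2
      rw [Nat.zero_add] at hc3
      have h1 := hall k (by omega)
      constructor
      · exact ih1.append (ih2.correctAnswers (hreal k hk) hc3)
      · refine (hn k hk _ fun r hr => ?_).trans ?_
        · rcases List.mem_append.1 hr with hr | hr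
          · exact h1 r hr
          · exact hreal k hk r hr
        · rw [run_append, run_append]
          exact ih2.run (hreal k hk)
  exact (key K le_rfl hc).1

end DynamicProblem

/-! ### Random bits -/

theorem ncard_comp_injective {α β : Type*} [Fintype α] [Fintype β] (f : α → β)
    (hf : Function.Injective f) (p : (α → Bool) → Prop) :
    {ω : β → Bool | p (ω ∘ f)}.ncard * 2 ^ Fintype.card α =
      {ω : α → Bool | p ω}.ncard * 2 ^ Fintype.card β := by
  classical
  let e : (β → Bool) ≃ (α → Bool) × ({b // ¬ b ∈ Set.range f} → Bool) :=
    (Equiv.piEquivPiSubtypeProd (fun b => b ∈ Set.range f) fun _ => Bool).trans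
      (Equiv.prodCongr (Equiv.arrowCongr (Equiv.ofInjective f hf).symm (Equiv.refl _))
        (Equiv.refl _))
  have he : ∀ ω, (e ω).1 = ω ∘ f := by
    intro ω; funext a; rfl
  have h1 : {ω : β → Bool | p (ω ∘ f)} = e ⁻¹' ({ω : α → Bool | p ω} ×ˢ Set.univ) := by
    ext ω
    simp [he]
  have h2 : {ω : β → Bool | p (ω ∘ f)}.ncard =
      {ω : α → Bool | p ω}.ncard * 2 ^ Fintype.card {b // ¬ b ∈ Set.range f} := by
    rw [h1, Set.ncard_preimage_of_injective_subset_range e.injective (by simp [e.surjective.range_eq]),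
      Set.ncard_prod, Set.ncard_univ, Nat.card_eq_fintype_card, Fintype.card_fun, Fintype.card_bool]
  have h3 : Fintype.card β = Fintype.card {b // ¬ b ∈ Set.range f} + Fintype.card α := by
    have h4 : Fintype.card {b // b ∈ Set.range f} = Fintype.card α :=
      (Fintype.card_congr (Equiv.ofInjective f hf)).symm
    have h5 := Fintype.card_subtype_compl (fun b => b ∈ Set.range f)
    have h6 := Fintype.card_subtype_le (fun b => b ∈ Set.range f)
    omega
  rw [h2, h3, pow_add, mul_assoc]

theorem failureProbability_mono {R : ℕ} {p p' : (Fin R → Bool) → Prop} (h : ∀ ω, p ω → p' ω) :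
    failureProbability R p' ≤ failureProbability R p := by
  unfold failureProbability
  have : {ω : Fin R → Bool | ¬ p' ω}.ncard ≤ {ω : Fin R → Bool | ¬ p ω}.ncard :=
    Set.ncard_le_ncard (fun ω hω hp => hω (h ω hp)) (Set.toFinite _)
  gcongr

/-- The probability of an event that depends on a part of the random bits only. -/
theorem failureProbability_comp {R R' : ℕ} (f : Fin R → Fin R') (hf : Function.Injective f)
    (p : (Fin R → Bool) → Prop) :
    failureProbability R' (fun ω => p (ω ∘ f)) = failureProbability R p := by
  unfold failureProbability
  have := ncard_comp_injective f hf (fun ω => ¬ p ω)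
  simp only [Fintype.card_fin] at this
  rw [div_eq_div_iff (by positivity) (by positivity)]
  exact_mod_cast this

/-! ### Polynomial bounds -/

/-- `f` is bounded by a power of `X`. -/
def PolyBounded {ι : Type} (X f : ι → ℕ) : Prop := ∃ e : ℕ, ∀ i, f i ≤ X i ^ e

namespace PolyBounded

variable {ι : Type} {X f g : ι → ℕ}

theorem of_le (h : PolyBounded X g) (hfg : ∀ i, f i ≤ g i) : PolyBounded X f := by
  obtain ⟨e, he⟩ := h
  exact ⟨e, fun i => (hfg i).trans (he i)⟩

theorem self : PolyBounded X X := ⟨1, fun i => by simp⟩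

theorem const (hX : ∀ i, 2 ≤ X i) (c : ℕ) : PolyBounded X fun _ => c :=
  ⟨c, fun i => (Nat.lt_pow_self (hX i)).le⟩

theorem mul (hf : PolyBounded X f) (hg : PolyBounded X g) : PolyBounded X fun i => f i * g i := by
  obtain ⟨a, ha⟩ := hf
  obtain ⟨b, hb⟩ := hg
  exact ⟨a + b, fun i => by rw [pow_add]; exact Nat.mul_le_mul (ha i) (hb i)⟩

theorem add (hX : ∀ i, 2 ≤ X i) (hf : PolyBounded X f) (hg : PolyBounded X g) :
    PolyBounded X fun i => f i + g i := by
  obtain ⟨a, ha⟩ := hf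
  obtain ⟨b, hb⟩ := hg
  refine ⟨1 + (a + b), fun i => ?_⟩
  have h1 : X i ^ a ≤ X i ^ (a + b) := Nat.pow_le_pow_right (by have := hX i; omega) (by omega)
  have h2 : X i ^ b ≤ X i ^ (a + b) := Nat.pow_le_pow_right (by have := hX i; omega) (by omega)
  calc f i + g i ≤ 2 * X i ^ (a + b) := by have := ha i; have := hb i; omega
    _ ≤ X i * X i ^ (a + b) := Nat.mul_le_mul_right _ (hX i)
    _ = _ := by rw [pow_add _ 1, pow_one]

theorem pow (hf : PolyBounded X f) (k : ℕ) : PolyBounded X fun i => f i ^ k := by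
  obtain ⟨a, ha⟩ := hf
  exact ⟨a * k, fun i => by rw [pow_mul]; exact Nat.pow_le_pow_left (ha i) k⟩

end PolyBounded

/-! ### The inputs of the algorithm with predictions -/

/-- A `γ`-OuMv instance, with all of its pairs of vectors. -/
structure GammaInstance (γ : ℝ) where
  n₂ : ℕ
  n₃ : ℕ
  pos₂ : 0 < n₂
  pos₃ : 0 < n₃
  M : Matrix (Fin (rows γ n₂)) (Fin n₂) Bool
  uv : Fin n₃ → (Fin (rows γ n₂) → Bool) × (Fin n₂ → Bool)

namespace GammaInstance

variable {γ : ℝ} (I : GammaInstance γ)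

/-- The number of rows. -/
noncomputable def n₁ : ℕ := rows γ I.n₂

/-- The measure of the instance. -/
noncomputable def size : ℕ := I.n₁ + I.n₂ + I.n₃

end GammaInstance

/-- `A` solves `γ`-OuMv with error probability at most `1/3`, after polynomial preprocessing, in
time at most `τ n₂ n₃`. -/
def SolvesGammaOuMv (γ : ℝ) (A : Algorithm) (τ : ℕ → ℕ → ℕ) : Prop :=
  ∃ c : ℕ, ∀ I : GammaInstance γ,
    (∀ ω : Fin (A.coins I.size) → Bool, ∃ (ys : List (List ℕ)) (t₀ t₁ : ℕ),
      A.Run I.size [[I.n₁, I.n₂, I.n₃], matrixWords I.M] ω (vectorMessages I.uv) ys t₀ t₁ ∧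
        t₀ ≤ (I.size + 2) ^ c ∧ t₁ ≤ τ I.n₂ I.n₃) ∧
    failureProbability (A.coins I.size) (fun ω => ∃ t₀ t₁ : ℕ,
      A.Run I.size [[I.n₁, I.n₂, I.n₃], matrixWords I.M] ω (vectorMessages I.uv)
        (productBits I.M I.uv) t₀ t₁) ≤ 1 / 3

/-- The request at position `i` of the block `B`. -/
def reqAt (B : List Request) (i : ℕ) : Request := B.getD i (.query 0)

theorem reqAt_eq {B : List Request} {i : ℕ} (h : i < B.length) : reqAt B i = B[i] :=
  List.getD_eq_getElem _ _ h

theorem reqAt_mem {B : List Request} {i : ℕ} (h : i < B.length) : reqAt B i ∈ B := by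
  rw [reqAt_eq h]; exact List.getElem_mem _

theorem pick_eq_map {B : List Request} {is : List ℕ} (h : ∀ i ∈ is, i < B.length) :
    pick B is = is.map (reqAt B) := by
  induction is with
  | nil => rfl
  | cons i is ih =>
    have hi := h i List.mem_cons_self
    have ih := ih fun j hj => h j (List.mem_cons_of_mem _ hj)
    unfold pick at *
    rw [List.filterMap_cons, List.getElem?_eq_getElem hi, List.map_cons, reqAt_eq hi, ih]

theorem length_eq_countP (B : List Request) :
    B.length = B.countP Request.isUpdate + B.countP Request.isQuery := by
  induction B with
  | nil => rfl
  | cons r B ih =>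
    cases r <;> simp [List.countP_cons, Request.isUpdate, Request.isQuery, ih] <;> omega

/-- The universal request sequence: `n₃` copies of the block. -/
def universalRequests (B : List Request) (n₃ : ℕ) : Fin (n₃ * B.length) → Request :=
  fun t => reqAt B (t % B.length)

theorem countP_universal (B : List Request) (p : Request → Bool) (n₃ : ℕ) :
    ((List.range (n₃ * B.length)).map fun t => reqAt B (t % B.length)).countP p =
      n₃ * B.countP p := by
  induction n₃ with
  | zero => simp
  | succ n ih =>
    rw [Nat.succ_mul, List.range_add, List.map_append, List.countP_append, ih, Nat.succ_mul,
      List.map_map]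
    congr 2
    apply List.ext_getElem
    · simp
    · intro i h1 h2
      simp [Nat.mul_add_mod_self_right, Nat.mod_eq_of_lt h2, reqAt_eq h2]

theorem ofFn_eq_map_range {α : Type*} {n : ℕ} (f : ℕ → α) :
    (List.ofFn fun k : Fin n => f k) = (List.range n).map f := by
  apply List.ext_getElem <;> simp

theorem cell_reqs (B : List Request) (n₃ k : ℕ) (hk : k < 2 * B.length * n₃) :
    cell (requestMessages (universalRequests B n₃)).flatten (k + 1) =
      ((reqAt B ((k / 2) % B.length)).words[k % 2]?).getD 0 := by
  have h1 : (requestMessages (universalRequests B n₃)).flatten =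
      (List.range (n₃ * B.length)).flatMap fun t => (reqAt B (t % B.length)).words := by
    unfold requestMessages universalRequests
    rw [ofFn_eq_map_range (fun t => (reqAt B (t % B.length)).words), List.flatMap_def]
  have h2 := getElem?_flatMap_of_length (fun t => (reqAt B (t % B.length)).words) 2
    (fun t => by cases reqAt B (t % B.length) <;> rfl) (List.range (n₃ * B.length)) (k / 2) (k % 2)
    (by rw [List.length_range, Nat.div_lt_iff_lt_mul (by norm_num)]; linarith)
    (Nat.mod_lt _ (by norm_num))
  rw [Nat.div_add_mod, ← h1] at h2
  simp only [cell, Nat.add_sub_cancel, Nat.succ_ne_zero, if_false, List.getD_eq_getElem?_getD, h2,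
    List.getElem_range]

theorem length_reqs (B : List Request) (n₃ : ℕ) :
    (requestMessages (universalRequests B n₃)).flatten.length = 2 * B.length * n₃ := by
  have : ∀ r : Request, r.words.length = 2 := by intro r; cases r <;> rfl
  simp [requestMessages, List.length_flatten, List.map_ofFn, Function.comp_def, this]
  ring

section Data

variable {P : DynamicProblem} {γ : ℝ} {u q n : ℕ → ℕ → ℕ} (red : LocalReduction P γ u q n)
  (C : ℕ) (I : GammaInstance γ)

namespace LocalReduction

/-- The block for the instance. -/
noncomputable def blockOf : List Request := red.block I.n₁ I.n₂

/-- The initial data structure for the instance. -/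
noncomputable def startOf : P.Inst := red.start I.n₁ I.n₂ I.n₃ I.M

/-- The prediction, coded in words. -/
noncomputable def reqsOf : List ℕ := (requestMessages (universalRequests (red.blockOf I) I.n₃)).flatten

/-- The inputs of the algorithm with predictions. -/
noncomputable def inputsOf : List (List ℕ) :=
  [[(1 + C) * (red.blockOf I).length], P.encode (red.startOf I), red.reqsOf I]

/-- The measure of the inputs of the algorithm with predictions. -/
noncomputable def measureOf : ℕ := ((red.inputsOf C I).map weight).sum

theorem length_blockOf : (red.blockOf I).length = u I.n₁ I.n₂ + q I.n₁ I.n₂ := by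
  rw [length_eq_countP]
  exact congrArg₂ _ (red.block_updates I.n₂ I.pos₂) (red.block_queries I.n₂ I.pos₂)

/-- The description of the block in the memory that `universal` leaves behind. -/
theorem exists_table : ∃ (m : Mem) (t : ℕ),
    Exec ((I.n₂ + 2) ^ red.c) red.universal (Mem.init [[I.n₂]]) m t ∧ t ≤ (I.n₂ + 2) ^ red.c ∧
    m 1 0 = 1 + 3 * (red.blockOf I).length ∧ (∀ c, m 1 c < (I.n₂ + 2) ^ red.c) ∧
    ∀ i < (red.blockOf I).length,
      (reqAt (red.blockOf I) i).words = [m 1 (2 + 3 * i), m 1 (3 + 3 * i)] ∧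
      m 1 (4 + 3 * i) = match reqAt (red.blockOf I) i with
        | .update x => red.order I.n₁ I.n₂ x
        | .query _ => 0 := by
  obtain ⟨m, t, hE, ht, hout⟩ := red.universal_spec I.n₂ I.pos₂
  set f : Request → List ℕ := fun r => match r with
    | .update x => [0, x, red.order (rows γ I.n₂) I.n₂ x]
    | .query y => [1, y, 0] with hf
  have hlen : ∀ r, (f r).length = 3 := by intro r; cases r <;> rfl
  change m.output = rows γ I.n₂ :: (red.blockOf I).flatMap f at hout
  have hcell := Mem.of_output hout
  have hl : (rows γ I.n₂ :: (red.blockOf I).flatMap f).length =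
      1 + 3 * (red.blockOf I).length := by
    rw [List.length_cons, List.length_flatMap]
    simp [hlen]; ring
  refine ⟨m, t, hE, ht, ?_, ?_, ?_⟩
  · rw [hcell 0 (Nat.zero_le _), cell_zero, hl]
  · intro c
    refine hE.cell_lt_of_lt le_rfl ?_
    rw [Mem.init_zero _ _ (by norm_num)]
    positivity
  · intro i hi
    have h3 : ∀ j < 3, m 1 (2 + 3 * i + j) = ((f (red.blockOf I)[i])[j]?).getD 0 := by
      intro j hj
      have h := getElem?_flatMap_of_length f 3 hlen (red.blockOf I) i j hi hj
      rw [hcell _ (by rw [hl]; omega), show 2 + 3 * i + j = (3 * i + j + 1) + 1 by omega]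
      simp only [cell, Nat.succ_ne_zero, if_false, Nat.add_sub_cancel, List.getD_cons_succ]
      rw [List.getD_eq_getElem?_getD, h]
    have e0 := h3 0 (by norm_num)
    have e1 := h3 1 (by norm_num)
    have e2 := h3 2 (by norm_num)
    rw [show 2 + 3 * i + 1 = 3 + 3 * i by omega] at e1
    rw [show 2 + 3 * i + 2 = 4 + 3 * i by omega] at e2
    rw [Nat.add_zero] at e0
    rw [reqAt_eq hi, e0, e1, e2]
    cases (red.blockOf I)[i] <;> exact ⟨rfl, rfl⟩

theorem lt_of_mem_reqsOf {y : ℕ} (h : y ∈ red.reqsOf I) : y < (I.n₂ + 2) ^ red.c := by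
  obtain ⟨m, t, _, _, _, h1, h2⟩ := red.exists_table I
  simp only [reqsOf, requestMessages, List.mem_flatten, List.mem_ofFn] at h
  obtain ⟨l, ⟨⟨k, hk⟩, rfl⟩, hy⟩ := h
  have hL : 0 < (red.blockOf I).length := by
    by_contra h0
    rw [Nat.eq_zero_of_not_pos h0] at hk; omega
  simp only [universalRequests] at hy
  rw [(h2 _ (Nat.mod_lt k hL)).1] at hy
  simp only [List.mem_cons, List.not_mem_nil, or_false] at hy
  rcases hy with rfl | rfl <;> exact h1 _

/-- The code of the initial data structure is short and consists of small numbers: it is the output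
of a program of the reduction, and the output of any program consists of words. -/
theorem encode_bounds : (P.encode (red.startOf I)).length < (I.size + 2) ^ red.c ∧
    ∀ y ∈ P.encode (red.startOf I), y < (I.size + 2) ^ red.c := by
  obtain ⟨blk, _, h⟩ := red.simulates I.n₂ I.n₃ I.pos₂ I.pos₃ I.M I.uv
  obtain ⟨m, t, rs, hE, _, hout, _⟩ := h 0 (fun k => List.replicate
    ((pick (red.block (rows γ I.n₂) I.n₂) (blk k)).countP Request.isQuery) 0)
    (fun k => ⟨by simp, fun a ha => (List.eq_of_mem_replicate ha).le⟩)
  have hm : ∀ i, m 1 i < (I.size + 2) ^ red.c := by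
    intro i
    refine hE.cell_lt_of_lt le_rfl ?_
    rw [Mem.init_zero _ _ (by norm_num)]
    exact Nat.pow_pos (by omega)
  have hout : m.output = P.encode (red.startOf I) := hout
  constructor
  · rw [← hout, Mem.output_length]; exact hm 0
  · intro y hy
    rw [← hout] at hy
    simp only [Mem.output, List.mem_map] at hy
    obtain ⟨i, _, rfl⟩ := hy
    exact hm _

/-- Since the measure is polynomial in that of the `γ`-OuMv instance, so are the preprocessing time,
the number of random bits and the word bound of the algorithm with predictions. -/
theorem polyBounded_measureOf :
    PolyBounded (fun I : GammaInstance γ => I.size + 2) fun I => red.measureOf C I := by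
  have hX : ∀ I : GammaInstance γ, 2 ≤ I.size + 2 := fun I => by omega
  have hZ : PolyBounded (fun I : GammaInstance γ => I.size + 2) fun I => (I.size + 2) ^ red.c :=
    PolyBounded.self.pow _
  have hc : ∀ k, PolyBounded (fun I : GammaInstance γ => I.size + 2) fun _ => k :=
    PolyBounded.const hX
  have h1 := ((hc (1 + C)).mul hZ).add hX (hc 1)
  have h2 := hZ.add hX (hZ.mul hZ)
  have h3 := (((hc 2).mul hZ).mul PolyBounded.self).add hX
    ((((hc 2).mul hZ).mul PolyBounded.self).mul hZ)
  refine PolyBounded.of_le ((h1.add hX h2).add hX h3) fun I => ?_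
  obtain ⟨m, t, _, _, h0, hlt, _⟩ := red.exists_table I
  have hnX : I.n₂ + 2 ≤ I.size + 2 := by unfold GammaInstance.size; omega
  have hn3 : I.n₃ ≤ I.size + 2 := by unfold GammaInstance.size; omega
  have hZ' : (I.n₂ + 2) ^ red.c ≤ (I.size + 2) ^ red.c := Nat.pow_le_pow_left hnX _
  have hL : (red.blockOf I).length ≤ (I.size + 2) ^ red.c := by
    have := hlt 0; omega
  obtain ⟨he1, he2⟩ := red.encode_bounds I
  have hsum : ∀ (l : List ℕ) (a b : ℕ), l.length ≤ a → (∀ y ∈ l, y ≤ b) → l.sum ≤ a * b := by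
    intro l a b ha hb
    have := List.sum_le_card_nsmul l b hb
    simp only [smul_eq_mul] at this
    exact this.trans (Nat.mul_le_mul_right _ ha)
  have hr := length_reqs (red.blockOf I) I.n₃
  have hr' : (red.reqsOf I).length ≤ 2 * (I.size + 2) ^ red.c * (I.size + 2) := by
    unfold reqsOf
    rw [hr]
    exact Nat.mul_le_mul (Nat.mul_le_mul_left _ hL) hn3
  have s1 := hsum _ _ _ he1.le (fun y hy => (he2 y hy).le)
  have s2 := hsum _ _ _ hr' (fun y hy => ((red.lt_of_mem_reqsOf I hy).trans_le hZ').le)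
  have s3 : (1 + C) * (red.blockOf I).length ≤ (1 + C) * (I.size + 2) ^ red.c :=
    Nat.mul_le_mul_left _ hL
  simp only [measureOf, inputsOf, List.map_cons, List.map_nil, List.sum_cons, List.sum_nil, weight,
    List.length_cons, List.length_nil]
  omega

end LocalReduction

end Data

/-! ### The sequence of the requests issued -/

/-- A sequence with request `f (τ t)` at time `t` is predicted by `f 0, f 1, …` if `τ` is a permutation
that moves nothing by more than `d` places. -/
theorem isDelayedPrediction_of_perm {T d : ℕ} (τ : List ℕ) (hp : τ.Perm (List.range T))
    (hd : ∀ t x, τ[t]? = some x → t ≤ x + d ∧ x ≤ t + d) (f : ℕ → Request) :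
    IsDelayedPrediction d (fun t : Fin T => f t) {fun t : Fin T => f (τ.getD t 0)} := by
  have hlen : τ.length = T := by rw [hp.length_eq, List.length_range]
  have hnd : τ.Nodup := hp.nodup_iff.2 List.nodup_range
  have hget : ∀ t : Fin T, τ.getD t 0 = τ[(t : ℕ)]'(hlen.symm ▸ t.2) := fun t =>
    List.getD_eq_getElem _ _ _
  have hlt : ∀ t : Fin T, τ.getD t 0 < T := by
    intro t
    rw [hget]
    exact List.mem_range.1 (hp.subset (List.getElem_mem _))
  let σ : Fin T → Fin T := fun t => ⟨τ.getD t 0, hlt t⟩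
  have hσ : Function.Injective σ := by
    intro s t hst
    have h1 : τ.getD s 0 = τ.getD t 0 := congrArg Fin.val hst
    rw [hget, hget] at h1
    exact Fin.ext ((hnd.getElem_inj_iff).1 h1)
  let e : Equiv.Perm (Fin T) := Equiv.ofBijective σ (Finite.injective_iff_bijective.1 hσ)
  rintro ρ rfl
  refine ⟨e⁻¹, fun t => ?_, fun t => ?_⟩
  · have h1 : σ (e⁻¹ t) = t := e.apply_symm_apply t
    have h2 : τ.getD (e⁻¹ t : Fin T) 0 = (t : ℕ) := congrArg Fin.val h1
    simp only [h2]
  · have h1 : ((e⁻¹)⁻¹ t : Fin T) = σ t := by rw [inv_inv]; rfl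
    have h2 := hd t (τ.getD t 0) (by rw [hget]; exact List.getElem?_eq_getElem _)
    rw [h1]
    simp only [σ, inv_one, Equiv.Perm.coe_one, id]
    rw [abs_le]
    constructor <;> omega

/-- Dependent choice for `K` steps, along an invariant. -/
theorem exists_seq {α : Type*} {Inv : ℕ → α → Prop} {R : ℕ → α → α → Prop} {K : ℕ} {a : α}
    (h0 : Inv 0 a) (h : ∀ k < K, ∀ a, Inv k a → ∃ b, Inv (k + 1) b ∧ R k a b) :
    ∃ s : ℕ → α, s 0 = a ∧ ∀ k < K, R k (s k) (s (k + 1)) := by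
  classical
  let s : ℕ → α := fun k => Nat.rec a (fun k x =>
    if hk : k < K ∧ Inv k x then (h k hk.1 x hk.2).choose else x) k
  have hs : ∀ k ≤ K, Inv k (s k) := by
    intro k
    induction k with
    | zero => intro _; exact h0
    | succ k ih =>
      intro hk
      have hi := ih (by omega)
      have e : s (k + 1) = (h k hk (s k) hi).choose := by
        change (if hk : k < K ∧ Inv k (s k) then (h k hk.1 (s k) hk.2).choose else s k) = _
        rw [dif_pos ⟨hk, hi⟩]
      rw [e]
      exact (h k hk (s k) hi).choose_spec.1
  refine ⟨s, rfl, fun k hk => ?_⟩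
  have hi := hs k hk.le
  have e : s (k + 1) = (h k hk (s k) hi).choose := by
    change (if hk : k < K ∧ Inv k (s k) then (h k hk.1 (s k) hk.2).choose else s k) = _
    rw [dif_pos ⟨hk, hi⟩]
  rw [e]
  exact (h k hk (s k) hi).choose_spec.2

section Data

variable {P : DynamicProblem} {γ : ℝ} {u q n : ℕ → ℕ → ℕ} (red : LocalReduction P γ u q n)
  (C : ℕ) (I : GammaInstance γ) (blk : ℕ → List ℕ)

namespace LocalReduction

/-- The cyclic order of the update at position `i` of the block, and `0` for a query, which makes
unused queries be issued at once. -/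
noncomputable def orderAt (i : ℕ) : ℕ := match reqAt (red.blockOf I) i with
  | .update x => red.order I.n₁ I.n₂ x
  | .query _ => 0

/-- The places in the prediction of the requests, in the order in which they are issued when the
positions used in the rounds are `blk 0, blk 1, …`. -/
noncomputable def tagsOf : List ℕ :=
  schedule (red.blockOf I).length (red.orderAt I) blk I.n₃

/-- The position in the block of request number `t`. -/
noncomputable def posOf (t : ℕ) : ℕ := (red.tagsOf I blk).getD t 0 % (red.blockOf I).length

/-- The sequence of the requests issued. -/
noncomputable def requestsOf : List Request :=
  (red.tagsOf I blk).map fun x => reqAt (red.blockOf I) (x % (red.blockOf I).length)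

variable {C} {blk}

theorem orderAt_le (hC : ∀ n₂ : ℕ, 0 < n₂ → ∀ x : ℕ, Request.update x ∈ red.block (rows γ n₂) n₂ →
    red.order (rows γ n₂) n₂ x ≤ C) {i : ℕ} (hi : i < (red.blockOf I).length) :
    red.orderAt I i ≤ C := by
  have hm := reqAt_mem hi
  unfold orderAt
  split
  · rename_i x h
    rw [h] at hm
    exact hC I.n₂ I.pos₂ x hm
  · exact Nat.zero_le _

theorem tagsOf_perm (hnd : ∀ k < I.n₃, (blk k).Nodup)
    (hlt : ∀ k < I.n₃, ∀ i ∈ blk k, i < (red.blockOf I).length) :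
    (red.tagsOf I blk).Perm (List.range (I.n₃ * (red.blockOf I).length)) :=
  schedule_perm hnd hlt

theorem length_tagsOf (hnd : ∀ k < I.n₃, (blk k).Nodup)
    (hlt : ∀ k < I.n₃, ∀ i ∈ blk k, i < (red.blockOf I).length) :
    (red.tagsOf I blk).length = I.n₃ * (red.blockOf I).length := by
  rw [(red.tagsOf_perm I hnd hlt).length_eq, List.length_range]

theorem countP_requestsOf (hnd : ∀ k < I.n₃, (blk k).Nodup)
    (hlt : ∀ k < I.n₃, ∀ i ∈ blk k, i < (red.blockOf I).length)
    (p : Request → Bool) :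
    (red.requestsOf I blk).countP p = I.n₃ * (red.blockOf I).countP p := by
  rw [← countP_universal]
  exact ((red.tagsOf_perm I hnd hlt).map _).countP_eq p

theorem allowed_requestsOf (hnd : ∀ k < I.n₃, (blk k).Nodup)
    (hlt : ∀ k < I.n₃, ∀ i ∈ blk k, i < (red.blockOf I).length) :
    ∀ r ∈ red.requestsOf I blk, P.Allowed (red.startOf I) r := by
  intro r hr
  simp only [requestsOf, List.mem_map] at hr
  obtain ⟨x, hx, rfl⟩ := hr
  have hx := List.mem_range.1 ((red.tagsOf_perm I hnd hlt).subset hx)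
  have hL : 0 < (red.blockOf I).length := by
    by_contra h0
    rw [Nat.eq_zero_of_not_pos h0] at hx; omega
  exact red.start_allowed I.n₂ I.n₃ I.pos₂ I.pos₃ I.M _ (reqAt_mem (Nat.mod_lt _ hL))

/-- The requests that the reduction asks for are answered correctly if all requests are. -/
theorem correctAnswers_blocks
    (hlt : ∀ k < I.n₃, ∀ i ∈ blk k, i < (red.blockOf I).length) {o : ℕ → ℕ}
    (h : P.CorrectAnswers (red.startOf I) (red.requestsOf I blk)
      (answersFrom o 0 (red.requestsOf I blk))) :
    P.CorrectAnswers (red.startOf I)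
      ((List.range I.n₃).flatMap fun k => (blk k).map (reqAt (red.blockOf I)))
      ((List.range I.n₃).flatMap fun k => answersFrom o
        (roundStart (red.blockOf I).length (red.orderAt I) blk k)
        ((blk k).map (reqAt (red.blockOf I)))) := by
  set L := (red.blockOf I).length with hL
  set B := red.blockOf I with hB
  set od := red.orderAt I with hod
  let real : ℕ → List Request := fun k => (blk k).map (reqAt B)
  -- the groups issued at the end of round `k`
  let junk : ℕ → List Request := fun k => (List.range L).flatMap fun i =>
    List.replicate (flushCount od (blk k) (pending L od blk k) i) (reqAt B i)
  have hallowed : ∀ i < L, P.Allowed (red.startOf I) (reqAt B i) := fun i hi =>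
    red.start_allowed I.n₂ I.n₃ I.pos₂ I.pos₃ I.M _ (reqAt_mem hi)
  have hround : ∀ k < I.n₃, (roundTags L od blk k).map (fun x => reqAt B (x % L)) =
      real k ++ junk k := by
    intro k hk
    rw [roundTags, List.map_append, blockTags, List.map_map, List.map_flatMap]
    congr 1
    · refine List.map_congr_left fun i hi => ?_
      simp only [Function.comp]
      rw [Nat.mul_add_mod_self_right, Nat.mod_eq_of_lt (hlt k hk i hi)]
    · refine List.flatMap_congr fun i hi => ?_
      rw [flushTags, List.map_map, List.eq_replicate_iff]
      refine ⟨by simp, fun r hr => ?_⟩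
      simp only [List.mem_map, Function.comp] at hr
      obtain ⟨s, _, rfl⟩ := hr
      rw [Nat.mul_add_mod_self_right, Nat.mod_eq_of_lt (List.mem_range.1 hi)]
  have hissued : ∀ k ≤ I.n₃, (issuedTags L od blk k).map (fun x => reqAt B (x % L)) =
      (List.range k).flatMap fun k => real k ++ junk k := by
    intro k hk
    rw [issuedTags, List.map_flatMap]
    exact List.flatMap_congr fun j hj => hround j ((List.mem_range.1 hj).trans_le hk)
  -- The requests still pending at the end come after all those that matter.
  have hsplit : red.requestsOf I blk = ((List.range I.n₃).flatMap fun k => real k ++ junk k) ++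
      ((List.range L).flatMap (pendingTags L od blk I.n₃)).map (fun x => reqAt B (x % L)) := by
    rw [requestsOf, tagsOf, schedule, List.map_append, ← hL, ← hod, ← hB, hissued _ le_rfl]
  rw [hsplit] at h
  have h1 := (DynamicProblem.correctAnswers_of_append h).1
  have h2 := DynamicProblem.correctAnswers_real (real := real) (junk := junk) ?_ ?_ ?_ h1
  · convert h2 using 1
    refine List.flatMap_congr fun k hk => ?_
    rw [← hissued k (List.mem_range.1 hk).le, List.length_map]
    rfl
  · intro k hk r hr
    obtain ⟨i, hi, rfl⟩ := List.mem_map.1 hr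
    exact hallowed i (hlt k hk i hi)
  · intro k hk r hr
    simp only [junk, List.mem_flatMap, List.mem_range] at hr
    obtain ⟨i, hi, hr⟩ := hr
    rw [List.eq_of_mem_replicate hr]
    exact hallowed i hi
  · intro k hk
    refine DynamicProblem.neutral_flatMap (fun i hi r hr => ?_) fun i hi => ?_
    · rw [List.eq_of_mem_replicate hr]
      exact hallowed i (List.mem_range.1 hi)
    · have hi := List.mem_range.1 hi
      have hm := reqAt_mem (B := B) hi
      rcases flushCount_pending (L := L) (od := od) (blk := blk) k i with h0 | h0
      · rw [h0]; exact DynamicProblem.neutral_nil _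
      · rw [h0]
        cases hr : reqAt B i with
        | update x =>
          rw [hr] at hm
          have hc := red.cyclic I.n₂ I.n₃ I.pos₂ I.pos₃ I.M x hm
          have e : od i = red.order I.n₁ I.n₂ x := by simp only [hod, orderAt, ← hB, hr]
          have e2 : max 1 (od i) = red.order I.n₁ I.n₂ x := by
            rw [e]; exact max_eq_right hc.1
          rw [e2]
          exact DynamicProblem.HasCyclicOrder.neutral hc
        | query y =>
          have e : od i = 0 := by simp only [hod, orderAt, ← hB, hr]
          rw [e]
          exact DynamicProblem.neutral_query _ y

/-- The universal request sequence is a prediction for the sequence of the requests issued. -/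
theorem isDelayedPrediction (hC : ∀ n₂ : ℕ, 0 < n₂ → ∀ x : ℕ,
    Request.update x ∈ red.block (rows γ n₂) n₂ → red.order (rows γ n₂) n₂ x ≤ C)
    (hnd : ∀ k < I.n₃, (blk k).Nodup)
    (hlt : ∀ k < I.n₃, ∀ i ∈ blk k, i < (red.blockOf I).length) :
    IsDelayedPrediction ((1 + C) * (red.blockOf I).length)
      (universalRequests (red.blockOf I) I.n₃)
      {fun t : Fin _ => reqAt (red.blockOf I) (red.posOf I blk t)} :=
  isDelayedPrediction_of_perm (red.tagsOf I blk) (red.tagsOf_perm I hnd hlt)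
    (schedule_delay hnd hlt fun _ hi => red.orderAt_le I hC hi)
    fun x => reqAt (red.blockOf I) (x % (red.blockOf I).length)

end LocalReduction

end Data

/-! ### A run of the reduction -/

theorem bitWords_lt {R : ℕ} (ω : Fin R → Bool) : ∀ y ∈ bitWords ω, y < 2 := by
  intro y hy
  simp only [bitWords, List.mem_ofFn] at hy
  obtain ⟨i, rfl⟩ := hy
  cases ω i <;> decide

theorem matrixWords_lt {a b : ℕ} (M : Matrix (Fin a) (Fin b) Bool) : ∀ y ∈ matrixWords M, y < 2 := by
  intro y hy
  simp only [matrixWords, List.mem_flatten, List.mem_ofFn] at hy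
  obtain ⟨l, ⟨i, rfl⟩, hy⟩ := hy
  exact bitWords_lt _ y hy

theorem length_bitWords {R : ℕ} (ω : Fin R → Bool) : (bitWords ω).length = R := by
  simp [bitWords]

theorem length_matrixWords {a b : ℕ} (M : Matrix (Fin a) (Fin b) Bool) :
    (matrixWords M).length = a * b := by
  simp [matrixWords, List.length_flatten, List.map_ofFn, Function.comp_def, length_bitWords]

section Data

variable {P : DynamicProblem} {γ : ℝ} {u q n : ℕ → ℕ → ℕ} (red : LocalReduction P γ u q n)
  {C : ℕ} (I : GammaInstance γ) {blk : ℕ → List ℕ}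

/-- What the reduction provides for one instance when the algorithm with predictions gives the
answers `ans k` in round `k`: `R k` is the memory before round `k`, and `S k` that between `select`
and `decode`. -/
structure ReductionTrace (WR : ℕ) (blk ans : ℕ → List ℕ) (mR : Mem) (tR : ℕ) (R S : ℕ → Mem)
    (tS tD : ℕ → ℕ) : Prop where
  prep : Exec WR red.prep (Mem.init [[I.n₁, I.n₂, I.n₃], matrixWords I.M]) mR tR
  time_prep : tR ≤ (I.size + 2) ^ red.c
  output_prep : mR.output = P.encode (red.startOf I)
  zero : R 0 = mR
  select : ∀ k (hk : k < I.n₃), Exec WR red.select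
    ((R k).load 0 (bitWords (I.uv ⟨k, hk⟩).1 ++ bitWords (I.uv ⟨k, hk⟩).2)) (S k) (tS k)
  time_select : ∀ k < I.n₃, tS k ≤ red.c * (I.n₁ + I.n₂ + (red.blockOf I).length + 1)
  decode : ∀ k < I.n₃, Exec WR red.decode ((S k).load 0 (ans k)) (R (k + 1)) (tD k)
  time_decode : ∀ k < I.n₃, tD k ≤ red.c * ((red.blockOf I).length + 1)
  output_select : ∀ k < I.n₃, (S k).output = blk k

/-- The blocks do not depend on the answers, and the reduction runs whatever the answers are; its
results are the products if the answers are correct. -/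
theorem LocalReduction.exists_trace : ∃ blk : ℕ → List ℕ,
    (∀ k < I.n₃, (blk k).Nodup) ∧ (∀ k < I.n₃, ∀ i ∈ blk k, i < (red.blockOf I).length) ∧
    ∀ (V : ℕ) (ans : ℕ → List ℕ),
      (∀ k < I.n₃, (ans k).length =
        ((blk k).map (reqAt (red.blockOf I))).countP Request.isQuery ∧ ∀ a ∈ ans k, a ≤ V) →
      ∃ mR tR R S tS tD,
        ReductionTrace red I ((I.size + V + 2) ^ red.c) blk ans mR tR R S tS tD ∧
        (P.CorrectAnswers (red.startOf I)
          ((List.range I.n₃).flatMap fun k => (blk k).map (reqAt (red.blockOf I)))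
          ((List.range I.n₃).flatMap ans) →
        ∀ k (hk : k < I.n₃), R (k + 1) 1 1 =
          (boolForm (I.uv ⟨k, hk⟩).1 I.M (I.uv ⟨k, hk⟩).2).toNat) := by
  obtain ⟨blk0, hblk0, hsim⟩ := red.simulates I.n₂ I.n₃ I.pos₂ I.pos₃ I.M I.uv
  let blk : ℕ → List ℕ := fun k => if h : k < I.n₃ then blk0 ⟨k, h⟩ else []
  have hblk : ∀ k : Fin I.n₃, blk k = blk0 k := fun k => by simp [blk]
  have hlt : ∀ k < I.n₃, ∀ i ∈ blk k, i < (red.blockOf I).length := fun k hk i hi =>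
    (hblk0 ⟨k, hk⟩).2 i (by simpa [blk, hk] using hi)
  have hpick : ∀ k : Fin I.n₃, pick (red.block (rows γ I.n₂) I.n₂) (blk0 k) =
      (blk k).map (reqAt (red.blockOf I)) := fun k => by
    rw [hblk]; exact pick_eq_map (hblk0 k).2
  refine ⟨blk, fun k hk => ?_, hlt, fun V ans hans => ?_⟩
  · have := (hblk0 ⟨k, hk⟩).1
    rwa [← hblk] at this
  obtain ⟨m, t, rs, h1, h2, h3, h4, h5⟩ := hsim V (fun k => ans k) fun k => by
    rw [hpick]; exact hans k k.2
  obtain ⟨R, S, e1, e2, e3, e4⟩ := h4.exists_trace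
  have hlv : (vectorMessages I.uv).length = I.n₃ := by simp [vectorMessages]
  have hla : (List.ofFn fun k : Fin I.n₃ => ans k).length = I.n₃ := by simp
  have hsel : ∀ k, k < I.n₃ → ∃ t, t ≤ red.c * (I.n₁ + I.n₂ + (red.blockOf I).length + 1) ∧
      ∀ hk : k < I.n₃, Exec ((I.size + V + 2) ^ red.c) red.select
        ((R k).load 0 (bitWords (I.uv ⟨k, hk⟩).1 ++ bitWords (I.uv ⟨k, hk⟩).2)) (S k) t := by
    intro k hk
    obtain ⟨t, ht, h⟩ := (e2 k (hlv.symm ▸ hk) (hla.symm ▸ hk)).1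
    refine ⟨t, ?_, fun _ => ?_⟩
    · rw [red.length_blockOf, ← Nat.add_assoc]; exact ht
    · have e : I.size + V + 2 = rows γ I.n₂ + I.n₂ + I.n₃ + V + 2 := rfl
      rw [e]
      simpa [vectorMessages] using h
  have hdec : ∀ k, k < I.n₃ → ∃ t, t ≤ red.c * ((red.blockOf I).length + 1) ∧
      Exec ((I.size + V + 2) ^ red.c) red.decode ((S k).load 0 (ans k)) (R (k + 1)) t := by
    intro k hk
    obtain ⟨t, ht, h⟩ := (e2 k (hlv.symm ▸ hk) (hla.symm ▸ hk)).2
    refine ⟨t, ht.trans (Nat.mul_le_mul_left _ ?_), ?_⟩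
    · rw [red.length_blockOf]
      exact Nat.succ_le_succ (Nat.le_add_left _ _)
    · have e : I.size + V + 2 = rows γ I.n₂ + I.n₂ + I.n₃ + V + 2 := rfl
      rw [e]
      simpa using h
  choose! tS htS using hsel
  choose! tD htD using hdec
  refine ⟨m, t, R, S, tS, tD, ⟨h1, h2, h3, e1, fun k hk => (htS k hk).2 hk,
    fun k hk => (htS k hk).1, fun k hk => (htD k hk).2, fun k hk => (htD k hk).1, fun k hk => ?_⟩,
    fun hc k hk => ?_⟩
  · have h := congrArg (fun l => l[k]?) e3
    simp only [hlv] at h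
    rw [List.getElem?_map, List.getElem?_range hk] at h
    simp only [List.getElem?_ofFn, hk, dite_true, Option.map_some, Option.some.injEq] at h
    rw [← h, hblk ⟨k, hk⟩]
  · have hl1 : (List.ofFn fun k => pick (red.block (rows γ I.n₂) I.n₂) (blk0 k)).flatten =
        (List.range I.n₃).flatMap fun k => (blk k).map (reqAt (red.blockOf I)) := by
      rw [List.flatMap_def, ← ofFn_eq_map_range (fun k => (blk k).map (reqAt (red.blockOf I)))]
      congr 2
      funext k
      exact hpick k
    have hl2 : (List.ofFn fun k : Fin I.n₃ => ans k).flatten = (List.range I.n₃).flatMap ans := by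
      rw [List.flatMap_def, ← ofFn_eq_map_range ans]
    have hrs := h5 (by rw [hl1, hl2]; exact hc)
    have h := congrArg (fun l => l[k]?) (e4.symm.trans hrs)
    simp only [hlv] at h
    rw [List.getElem?_map, List.getElem?_range hk] at h
    simp only [productBits, List.getElem?_ofFn, hk, dite_true, Option.map_some,
      Option.some.injEq] at h
    have := Mem.of_output h 1 (by simp)
    simpa [cell] using this

end Data

/-! ### A run of the `γ`-OuMv solver -/

section Data

variable {P : DynamicProblem} {γ : ℝ} {u q n : ℕ → ℕ → ℕ} {red : LocalReduction P γ u q n}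
  {I : GammaInstance γ} {blk : ℕ → List ℕ}

namespace ReductionTrace

/-- The outputs of the reduction consist of words. -/
theorem cell_lt {WR : ℕ} {ans : ℕ → List ℕ} {mR : Mem} {tR : ℕ} {R S : ℕ → Mem} {tS tD : ℕ → ℕ}
    (h : ReductionTrace red I WR blk ans mR tR R S tS tD) (hW : 0 < WR) :
    (∀ k ≤ I.n₃, ∀ c, R k 1 c < WR) ∧ ∀ k < I.n₃, ∀ c, S k 1 c < WR := by
  have hS : ∀ k < I.n₃, (∀ c, R k 1 c < WR) → ∀ c, S k 1 c < WR := fun k hk hR c =>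
    (h.select k hk).cell_lt_of_lt le_rfl (by rw [Mem.load_of_ne _ _ (by norm_num)]; exact hR c)
  have hR : ∀ k ≤ I.n₃, ∀ c, R k 1 c < WR := by
    intro k
    induction k with
    | zero =>
      intro _ c
      rw [h.zero]
      refine h.prep.cell_lt_of_lt le_rfl ?_
      rw [Mem.init_zero _ _ (by norm_num)]
      exact hW
    | succ k ih =>
      intro hk c
      refine (h.decode k hk).cell_lt_of_lt le_rfl ?_
      rw [Mem.load_of_ne _ _ (by norm_num)]
      exact hS k hk (ih (by omega)) c
  exact ⟨hR, fun k hk => hS k hk (hR k hk.le)⟩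

/-- The state of the solver before round `k`. -/
structure Before (red : LocalReduction P γ u q n) (I : GammaInstance γ) (blk : ℕ → List ℕ)
    (mU : Mem) (R mems : ℕ → Mem) (k : ℕ) (σ : GState) : Prop where
  vU : σ.vU = mU
  len : σ.len = (red.blockOf I).length
  used : σ.used = fun _ => 0
  pend : σ.pend = pending (red.blockOf I).length (red.orderAt I) blk k
  vR : σ.vR = R k
  vA : σ.vA = mems (roundStart (red.blockOf I).length (red.orderAt I) blk k)

variable {W WA WR Y : ℕ} {astep : Prog} {mU mR : Mem} {tR : ℕ} {R S mems : ℕ → Mem}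
  {tS tD ts : ℕ → ℕ}

/-- One round of the solver. The time of the algorithm with predictions enters as the difference of
two partial sums, so that the bounds for all rounds add up to its total time. -/
theorem runs_round (hW : (Y + 2) ^ 40 ≤ W) (hA : WA ≤ W) (hR : WR ≤ W)
    (hnd : ∀ k < I.n₃, (blk k).Nodup)
    (hlt : ∀ k < I.n₃, ∀ i ∈ blk k, i < (red.blockOf I).length)
    (hUY : ∀ c, mU 1 c < Y) (hU : ∀ i < (red.blockOf I).length,
      (reqAt (red.blockOf I) i).words = [mU 1 (2 + 3 * i), mU 1 (3 + 3 * i)] ∧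
      mU 1 (4 + 3 * i) = red.orderAt I i)
    (hLY : (red.blockOf I).length < Y) (hn₃ : I.n₃ < Y) (hx : I.n₁ + I.n₂ + 1 < Y) (hY : 2 ≤ Y)
    (hM : ∀ t < I.n₃ * (red.blockOf I).length, Exec WA astep
      ((mems t).load 0 (reqAt (red.blockOf I) (red.posOf I blk t)).words) (mems (t + 1)) (ts t))
    (hmY : ∀ t < I.n₃ * (red.blockOf I).length, mems (t + 1) 1 1 < Y)
    (hT : ReductionTrace red I WR blk (fun k => answersFrom (fun t => mems (t + 1) 1 1)
      (roundStart (red.blockOf I).length (red.orderAt I) blk k)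
      ((blk k).map (reqAt (red.blockOf I)))) mR tR R S tS tD)
    (hRY : ∀ k ≤ I.n₃, ∀ c, R k 1 c < Y) (hSY : ∀ k < I.n₃, ∀ c, S k 1 c < Y)
    {k : ℕ} (hk : k < I.n₃) {σ : GState} (hσ : Before red I blk mU R mems k σ) :
    ∃ σ' : GState, Before red I blk mU R mems (k + 1) σ' ∧ ∃ t : ℕ,
      t ≤ (400 + 2 * red.c) * (I.n₁ + I.n₂ + (red.blockOf I).length + 1) +
        100 * ((∑ t ∈ Finset.range (roundStart (red.blockOf I).length (red.orderAt I) blk (k + 1)),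
            ts t) -
          ∑ t ∈ Finset.range (roundStart (red.blockOf I).length (red.orderAt I) blk k), ts t) ∧
      Exec W (gammaStep red.select red.decode astep)
        (σ.mem.load 0 (bitWords (I.uv ⟨k, hk⟩).1 ++ bitWords (I.uv ⟨k, hk⟩).2)) σ'.mem t ∧
      σ'.mem.output = [R (k + 1) 1 1] := by
  obtain ⟨e1, e2, e3, e4, e5, e6⟩ := hσ
  set B := red.blockOf I with hB
  set L := B.length with hL
  set od := red.orderAt I with hod
  set st := roundStart L od blk with hst
  -- beyond the block, the memory of `universal` need not agree with the orders
  let odT : ℕ → ℕ := fun j => σ.vU 1 (4 + 3 * j)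
  have hodT : ∀ i < L, odT i = od i := fun i hi => by
    simp only [odT, e1]; exact (hU i hi).2
  have hfl : ∀ i < L, flushCount odT (blk k) σ.pend i =
      flushCount od (blk k) (pending L od blk k) i := fun i hi => by
    simp only [flushCount, hodT i hi, e4]
  let off : ℕ → ℕ := fun i => (blk k).length +
    ∑ j ∈ Finset.range i, flushCount odT (blk k) σ.pend j
  have hoff : ∀ i ≤ L, off i = offset L od blk k i := fun i hi => by
    simp only [off, offset]
    congr 1
    exact Finset.sum_congr rfl fun j hj => hfl j (by have := Finset.mem_range.1 hj; omega)
  have hend : st k + off L = st (k + 1) := by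
    rw [hoff L le_rfl]; exact (roundStart_succ k).symm
  have hendT : st (k + 1) ≤ I.n₃ * L :=
    (roundStart_le hk).trans (roundStart_le_mul hnd hlt)
  have hblkL : (blk k).length ≤ off L := Nat.le_add_right _ _
  have hlenL : (blk k).length ≤ L := by
    have h := (hnd k hk).subperm (l₂ := List.range L)
      (fun i hi => List.mem_range.2 (hlt k hk i hi))
    simpa using h.length_le
  let pos : ℕ → ℕ := fun t => red.posOf I blk (st k + t)
  have hpos0 : ∀ r (hr : r < (blk k).length), pos r = (blk k)[r] := by
    intro r hr
    have h := schedule_getElem?_block (L := L) (od := od) hk hr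
    have hi := hlt k hk _ (List.getElem_mem hr)
    simp only [pos, LocalReduction.posOf, LocalReduction.tagsOf, List.getD_eq_getElem?_getD]
    rw [h, Option.getD_some, Nat.mul_add_mod_self_right, Nat.mod_eq_of_lt hi]
  have hpos : ∀ i < L, ∀ s < flushCount odT (blk k) σ.pend i, pos (off i + s) = i := by
    intro i hi s hs
    rw [hfl i hi] at hs
    have h := schedule_getElem?_flush (L := L) (od := od) hk hi hs
    simp only [pos, LocalReduction.posOf, LocalReduction.tagsOf, List.getD_eq_getElem?_getD]
    rw [hoff i hi.le, h, Option.getD_some, Nat.mul_add_mod_self_right, Nat.mod_eq_of_lt hi]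
  have hposlt : ∀ t < off L, pos t < L := by
    intro t ht
    refine Nat.mod_lt _ (Nat.pos_of_ne_zero fun h0 => ?_)
    have : st k + t < I.n₃ * L := by omega
    have h0 : L = 0 := h0
    rw [h0] at this; omega
  have hwords : ∀ i < L, (reqAt B i).words = [σ.vU 1 (2 + 3 * i), σ.vU 1 (3 + 3 * i)] :=
    fun i hi => by rw [e1]; exact (hU i hi).1
  have hans : answersUpTo (fun j => σ.vU 1 (2 + 3 * j) ≠ 0) pos
      (fun t => mems (st k + t + 1) 1 1) (blk k).length =
      answersFrom (fun t => mems (t + 1) 1 1) (st k) ((blk k).map (reqAt B)) := by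
    refine answersUpTo_eq _ pos (fun t => mems (t + 1) 1 1) (st k) (reqAt B) (blk k) hpos0
      fun i hi => ?_
    have h := hwords i (hlt k hk i hi)
    cases hr : reqAt B i <;> rw [hr] at h <;>
      simp only [Request.words, List.cons.injEq] at h <;> simp [Request.isQuery, ← h.1]
  have hx' : (bitWords (I.uv ⟨k, hk⟩).1 ++ bitWords (I.uv ⟨k, hk⟩).2).length = I.n₁ + I.n₂ := by
    rw [List.length_append, length_bitWords, length_bitWords]; rfl
  -- Beyond the run of the algorithm with predictions `ts` is arbitrary, and `max 1` makes it positive.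
  obtain ⟨σ', ⟨t, ht, hE⟩, o1, o2, o3, o4, o5, o6, o7⟩ :=
    runs_gammaStep (select := red.select) (decode := red.decode) (astep := astep) hW hA hR σ
    (fun c => by rw [e1]; exact hUY c) (by rw [e2]; exact hLY) e3
    (fun i => by rw [e4]; have := pending_le_self (L := L) (od := od) (blk := blk) k i; omega)
    (bitWords (I.uv ⟨k, hk⟩).1 ++ bitWords (I.uv ⟨k, hk⟩).2) (by rw [hx']; exact hx)
    (fun y hy => by
      rcases List.mem_append.1 hy with hy | hy <;> exact (bitWords_lt _ y hy).trans_le hY)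
    (S := S k) (R' := R (k + 1)) (tS := tS k) (tD := tD k) (by rw [e5]; exact hT.select k hk)
    (hSY k hk) (blk k) (hT.output_select k hk) (fun i hi => by rw [e2]; exact hlt k hk i hi)
    (by rw [e2]; exact hlenL) (fun t => mems (st k + t)) (fun t => max 1 (ts (st k + t)))
    (fun t => ∑ s ∈ Finset.range t, max 1 (ts (st k + s))) (fun t => Finset.sum_range_succ _ _)
    (fun t => by positivity) off pos e6.symm (by simp [off])
    (fun i => by simp only [off, Finset.sum_range_succ, Nat.add_assoc]; rfl) hpos0
    (by rw [e2]; exact hpos)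
    (fun t ht => by
      have ht : t < off L := by rw [← e2]; exact ht
      have h := hM (st k + t) (by omega)
      have hm : max 1 (ts (st k + t)) = ts (st k + t) := max_eq_right h.time_pos
      simp only [hm]
      rw [← hwords _ (hposlt t ht)]
      exact h)
    (fun t ht => hmY (st k + t) (by omega))
    (by have := hT.decode k hk
        rw [← hans] at this
        exact this) (hRY (k + 1) hk 1)
  rw [e2] at ht o2 o4 o7
  refine ⟨σ', ⟨o5.trans e1, o2, o3, ?_, o6, ?_⟩, t, ht.trans ?_, hE, o1⟩
  · rw [o4]
    funext j
    by_cases hj : j < L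
    · rw [if_pos hj, pending_succ hj]
      have := hodT j hj
      simp only [odT] at this
      simp only [nextPend, e4, this]
      rfl
    · rw [if_neg hj, e4, pending_of_le (not_lt.1 hj), pending_of_le (not_lt.1 hj)]
  · rw [o7, hend]
  · have hsum : (∑ s ∈ Finset.range (off L), max 1 (ts (st k + s))) =
        (∑ t ∈ Finset.range (st (k + 1)), ts t) - ∑ t ∈ Finset.range (st k), ts t := by
      rw [← hend, Finset.sum_range_add ts, Nat.add_sub_cancel_left]
      refine Finset.sum_congr rfl fun s hs => max_eq_right ?_
      have := Finset.mem_range.1 hs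
      exact (hM (st k + s) (by omega)).time_pos
    have h1 : tS k ≤ red.c * (I.n₁ + I.n₂ + L + 1) := hT.time_select k hk
    have h2 : tD k ≤ red.c * (L + 1) := hT.time_decode k hk
    have h3 : red.c * (L + 1) ≤ red.c * (I.n₁ + I.n₂ + L + 1) := Nat.mul_le_mul_left _ (by omega)
    rw [hx', hsum, Finset.range_zero, Finset.sum_empty, Nat.sub_zero]
    change _ ≤ (400 + 2 * red.c) * (I.n₁ + I.n₂ + L + 1) + _
    have h4 : (400 + 2 * red.c) * (I.n₁ + I.n₂ + L + 1) = 400 * (I.n₁ + I.n₂ + L + 1) +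
      red.c * (I.n₁ + I.n₂ + L + 1) + red.c * (I.n₁ + I.n₂ + L + 1) := by ring
    omega

end ReductionTrace

end Data

section Data

variable {P : DynamicProblem} {γ : ℝ} {u q n : ℕ → ℕ → ℕ} {red : LocalReduction P γ u q n}
  {I : GammaInstance γ} {blk : ℕ → List ℕ}

/-- All rounds of the solver. -/
theorem ReductionTrace.serve {W WA WR Y : ℕ} {astep : Prog} {mU mR : Mem} {tR : ℕ}
    {R S mems : ℕ → Mem} {tS tD ts : ℕ → ℕ} (hW : (Y + 2) ^ 40 ≤ W) (hA : WA ≤ W) (hR : WR ≤ W)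
    (hnd : ∀ k < I.n₃, (blk k).Nodup)
    (hlt : ∀ k < I.n₃, ∀ i ∈ blk k, i < (red.blockOf I).length)
    (hUY : ∀ c, mU 1 c < Y) (hU : ∀ i < (red.blockOf I).length,
      (reqAt (red.blockOf I) i).words = [mU 1 (2 + 3 * i), mU 1 (3 + 3 * i)] ∧
      mU 1 (4 + 3 * i) = red.orderAt I i)
    (hLY : (red.blockOf I).length < Y) (hn₃ : I.n₃ < Y) (hx : I.n₁ + I.n₂ + 1 < Y) (hY : 2 ≤ Y)
    (hM : ∀ t < I.n₃ * (red.blockOf I).length, Exec WA astep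
      ((mems t).load 0 (reqAt (red.blockOf I) (red.posOf I blk t)).words) (mems (t + 1)) (ts t))
    (hmY : ∀ t < I.n₃ * (red.blockOf I).length, mems (t + 1) 1 1 < Y)
    (hT : ReductionTrace red I WR blk (fun k => answersFrom (fun t => mems (t + 1) 1 1)
      (roundStart (red.blockOf I).length (red.orderAt I) blk k)
      ((blk k).map (reqAt (red.blockOf I)))) mR tR R S tS tD)
    (hRY : ∀ k ≤ I.n₃, ∀ c, R k 1 c < Y) (hSY : ∀ k < I.n₃, ∀ c, S k 1 c < Y)
    {σ₀ : GState} (hσ : Before red I blk mU R mems 0 σ₀) :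
    ∃ t ≤ I.n₃ * ((400 + 2 * red.c) * (I.n₁ + I.n₂ + (red.blockOf I).length + 1)) +
        100 * ∑ t ∈ Finset.range (I.n₃ * (red.blockOf I).length), ts t,
      Serve W (gammaStep red.select red.decode astep) σ₀.mem (vectorMessages I.uv)
        ((List.range I.n₃).map fun k => [R (k + 1) 1 1]) t := by
  obtain ⟨σ, hσ0, hσ⟩ := exists_seq hσ fun k hk σ hσ => by
    obtain ⟨σ', h1, h2⟩ := runs_round hW hA hR hnd hlt hUY hU hLY hn₃ hx hY hM hmY hT hRY hSY hk hσ
    exact ⟨σ', h1, show (fun k σ σ' => ∃ hk : k < I.n₃, ∃ t : ℕ,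
      t ≤ (400 + 2 * red.c) * (I.n₁ + I.n₂ + (red.blockOf I).length + 1) +
        100 * ((∑ t ∈ Finset.range (roundStart (red.blockOf I).length (red.orderAt I) blk (k + 1)),
            ts t) -
          ∑ t ∈ Finset.range (roundStart (red.blockOf I).length (red.orderAt I) blk k), ts t) ∧
      Exec W (gammaStep red.select red.decode astep)
        (GState.mem σ |>.load 0 (bitWords (I.uv ⟨k, hk⟩).1 ++ bitWords (I.uv ⟨k, hk⟩).2))
        (GState.mem σ') t ∧
      (GState.mem σ').output = [R (k + 1) 1 1]) k σ σ' from ⟨hk, h2⟩⟩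
  choose! hlt' t ht hE ho using hσ
  have hlv : (vectorMessages I.uv).length = I.n₃ := by simp [vectorMessages]
  have hS := Serve.of_trace (W := W) (s := gammaStep red.select red.decode astep)
    (vectorMessages I.uv) (fun k => (σ k).mem) t fun k hk => by
      have hk' : k < I.n₃ := hlv ▸ hk
      have := hE k hk'
      simpa [vectorMessages] using this
  rw [hlv, hσ0] at hS
  refine ⟨∑ k ∈ Finset.range I.n₃, t k, ?_, ?_⟩
  rotate_left
  · convert hS using 1
    refine List.map_congr_left fun k hk => (ho k (List.mem_range.1 hk)).symm
  · have key : ∀ K ≤ I.n₃, ∑ k ∈ Finset.range K, t k ≤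
        K * ((400 + 2 * red.c) * (I.n₁ + I.n₂ + (red.blockOf I).length + 1)) +
        100 * ∑ t ∈ Finset.range (roundStart (red.blockOf I).length (red.orderAt I) blk K), ts t := by
      intro K
      induction K with
      | zero => intro _; simp
      | succ K ih =>
        intro hK
        have h1 := ih (by omega)
        have h2 := ht K hK
        have h3 : ∑ t ∈ Finset.range (roundStart (red.blockOf I).length (red.orderAt I) blk K), ts t ≤
          ∑ t ∈ Finset.range (roundStart (red.blockOf I).length (red.orderAt I) blk (K + 1)), ts t :=
          Finset.sum_le_sum_of_subset (Finset.range_mono (le_of_step (fun k => roundStart_succ k)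
            (Nat.le_succ K)))
        rw [Finset.sum_range_succ, Nat.succ_mul]
        omega
    refine (key _ le_rfl).trans (Nat.add_le_add_left (Nat.mul_le_mul_left _ ?_) _)
    exact Finset.sum_le_sum_of_subset (Finset.range_mono (roundStart_le_mul hnd hlt))

namespace LocalReduction

variable (red I) in
/-- The request sequence, as a function. -/
noncomputable def requestFn (blk : ℕ → List ℕ) : Fin (I.n₃ * (red.blockOf I).length) → Request :=
  fun t => reqAt (red.blockOf I) (red.posOf I blk t)

theorem ofFn_requestFn (hnd : ∀ k < I.n₃, (blk k).Nodup)
    (hlt : ∀ k < I.n₃, ∀ i ∈ blk k, i < (red.blockOf I).length) :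
    List.ofFn (red.requestFn I blk) = red.requestsOf I blk := by
  have hl := red.length_tagsOf I hnd hlt
  apply List.ext_getElem
  · simp [requestsOf, hl]
  · intro i h1 h2
    have h3 : i < (red.tagsOf I blk).length := by simpa [requestsOf] using h2
    simp [requestFn, requestsOf, posOf, h3]

set_option maxHeartbeats 800000 in
/-- The run of the solver for `γ`-OuMv, given the run of the algorithm with predictions. -/
theorem exists_gamma_run {C : ℕ} (A : Algorithm) (V : ℕ) (hV : V = A.wordBound (red.measureOf C I))
    (hnd : ∀ k < I.n₃, (blk k).Nodup)
    (hlt : ∀ k < I.n₃, ∀ i ∈ blk k, i < (red.blockOf I).length)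
    (hred : ∀ (V : ℕ) (ans : ℕ → List ℕ),
      (∀ k < I.n₃, (ans k).length =
        ((blk k).map (reqAt (red.blockOf I))).countP Request.isQuery ∧ ∀ a ∈ ans k, a ≤ V) →
      ∃ mR tR R S tS tD,
        ReductionTrace red I ((I.size + V + 2) ^ red.c) blk ans mR tR R S tS tD ∧
        (P.CorrectAnswers (red.startOf I)
          ((List.range I.n₃).flatMap fun k => (blk k).map (reqAt (red.blockOf I)))
          ((List.range I.n₃).flatMap ans) →
        ∀ k (hk : k < I.n₃), R (k + 1) 1 1 =
          (boolForm (I.uv ⟨k, hk⟩).1 I.M (I.uv ⟨k, hk⟩).2).toNat))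
    {W Y D : ℕ} (hWD : (Y + 2) ^ D ≤ W) (h40 : 40 ≤ D) (hCD : C + 10 ≤ D)
    (hcD : 8 * A.coinExp + 2 ≤ D) (hVW : V ≤ W) (hRW : (I.size + V + 2) ^ red.c ≤ W)
    (hXW : (I.n₂ + 2) ^ red.c ≤ W) (hVY : V ≤ Y) (hRY : (I.size + V + 2) ^ red.c ≤ Y)
    (hXY : (I.size + 2) ^ red.c < Y) (hsq : (I.size + 2) * (I.size + 2) < Y)
    (hN : red.measureOf C I < Y) (bits : List ℕ) (hbits : ∀ y ∈ bits, y < 2)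
    (hbl : bits.length < Y) (hcoins : A.coins (red.measureOf C I) ≤ bits.length)
    {mA : Mem} {tA tB : ℕ} {ys : List (List ℕ)}
    (hprep : Exec V A.prep (Mem.init (red.inputsOf C I ++
      [bits.take (A.coins (red.measureOf C I))])) mA tA)
    (hserve : Serve V A.step mA (requestMessages (red.requestFn I blk)) ys tB) :
    ∃ m t₀ t₁ rs,
      Exec W (gammaPrep red.universal red.prep A.prep C A.coinExp)
        (Mem.init [[I.n₁, I.n₂, I.n₃], matrixWords I.M, bits]) m t₀ ∧
      Serve W (gammaStep red.select red.decode A.step) m (vectorMessages I.uv) rs t₁ ∧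
      t₀ ≤ 1100 * Y + 2 * (I.size + 2) ^ red.c + 10 * A.coinExp + tA ∧
      t₁ ≤ I.n₃ * ((400 + 2 * red.c) * (I.n₁ + I.n₂ + (red.blockOf I).length + 1)) + 100 * tB ∧
      ((∃ as, P.CorrectAnswers (red.startOf I) (red.requestsOf I blk) as ∧
        queryOutputs (red.requestsOf I blk) ys = as.map fun a => [a]) →
        rs = productBits I.M I.uv) := by
  have hW : (Y + 2) ^ 40 ≤ W := (Nat.pow_le_pow_right (by omega) h40).trans hWD
  have hX : 2 ≤ I.size + 2 := by omega
  have hsz : I.size = I.n₁ + I.n₂ + I.n₃ := rfl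
  have hsq' : (I.size + 2) * (I.size + 2) = I.size * I.size + 4 * I.size + 4 := by ring
  have h4Y : 4 < Y := by omega
  have hsY : I.size + 2 < Y := by omega
  obtain ⟨mems, ts, hm0, hm, hys, htB⟩ := hserve.exists_trace
  have hlr : (requestMessages (red.requestFn I blk)).length = I.n₃ * (red.blockOf I).length := by
    simp [requestMessages]
  rw [hlr] at hys htB
  have hM : ∀ t < I.n₃ * (red.blockOf I).length, Exec V A.step
      ((mems t).load 0 (reqAt (red.blockOf I) (red.posOf I blk t)).words) (mems (t + 1)) (ts t) := by
    intro t ht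
    have := hm t (by rw [hlr]; exact ht)
    simpa [requestMessages, requestFn] using this
  have hV0 : 0 < V := by rw [hV]; unfold Algorithm.wordBound; positivity
  have hmV : ∀ t ≤ I.n₃ * (red.blockOf I).length, mems t 1 1 < V := by
    intro t
    induction t with
    | zero =>
      intro _
      rw [hm0]
      refine hprep.cell_lt_of_lt le_rfl ?_
      rw [Mem.init_zero _ _ (by norm_num)]
      exact hV0
    | succ t ih =>
      intro ht
      refine (hM t ht).cell_lt_of_lt le_rfl ?_
      rw [Mem.load_of_ne _ _ (by norm_num)]
      exact ih (by omega)
  set st := roundStart (red.blockOf I).length (red.orderAt I) blk with hst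
  obtain ⟨mR, tR, R, S, tS, tD, hT, hcorrect⟩ := hred V (fun k =>
    answersFrom (fun t => mems (t + 1) 1 1) (st k) ((blk k).map (reqAt (red.blockOf I))))
    fun k hk => ⟨answersFrom_length _ _ _, fun a ha => by
      obtain ⟨t, ht, rfl⟩ := mem_answersFrom ha
      have h1 : st (k + 1) ≤ I.n₃ * (red.blockOf I).length :=
        (roundStart_le hk).trans (roundStart_le_mul hnd hlt)
      have h2 : st (k + 1) = st k + offset (red.blockOf I).length (red.orderAt I) blk k
        (red.blockOf I).length := roundStart_succ k
      have h3 : (blk k).length ≤ offset (red.blockOf I).length (red.orderAt I) blk k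
        (red.blockOf I).length := Nat.le_add_right _ _
      rw [List.length_map] at ht
      exact (hmV _ (by omega)).le⟩
  obtain ⟨hR1, hS1⟩ := hT.cell_lt (by positivity)
  obtain ⟨mU, tU, hUE, htU, hU0, hUlt, hUt⟩ := red.exists_table I
  have hnX : (I.n₂ + 2) ^ red.c ≤ (I.size + 2) ^ red.c := Nat.pow_le_pow_left (by omega) _
  have hUY : ∀ c, mU 1 c < Y := fun c => (hUlt c).trans_le (hnX.trans hXY.le)
  have hLY : (red.blockOf I).length < Y := by have := hUY 0; omega
  have hmw : (matrixWords I.M).length + 1 < Y := by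
    rw [length_matrixWords]
    change I.n₁ * I.n₂ + 1 < Y
    have : I.n₁ * I.n₂ ≤ I.size * I.size := Nat.mul_le_mul (by omega) (by omega)
    omega
  obtain ⟨r1, h1⟩ := runs_gammaPrepRed (univ := red.universal) (rprep := red.prep) hW hXW hRW
    I.n₁ I.n₂ I.n₃ (red.blockOf I).length (matrixWords I.M) bits (by omega) (by omega) (by omega)
    h4Y hmw (fun y hy => (matrixWords_lt _ y hy).trans (by omega)) hUE hU0 (hUY 0) hT.prep
  obtain ⟨he1, he2⟩ := red.encode_bounds I
  have henc : (P.encode (red.startOf I)).length + 1 < Y := by omega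
  obtain ⟨r2, c2, a2, h2⟩ := runs_gammaPrepAlg (C := C) (coinExp := A.coinExp) (aprep := A.prep)
    hW hWD hCD hcD hVW
    { GState.start [I.n₁, I.n₂, I.n₃] (matrixWords I.M) bits with
      r := r1, len := (red.blockOf I).length, vU := mU, vR := mR } I.n₃
    (P.encode (red.startOf I)) (red.reqsOf I) bits rfl (by omega) rfl hLY hT.output_prep
    (fun y hy => (he2 y hy).trans hXY) henc (length_reqs _ _)
    (fun y hy => (red.lt_of_mem_reqsOf I hy).trans_le (hnX.trans hXY.le))
    (fun k hk => by
      have hk' : k < 2 * (red.blockOf I).length * I.n₃ := by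
        rw [← length_reqs]; exact hk
      have hL : 0 < (red.blockOf I).length := by
        by_contra h0
        rw [Nat.eq_zero_of_not_pos h0] at hk'; omega
      have hc := cell_reqs (red.blockOf I) I.n₃ k hk'
      rw [(hUt _ (Nat.mod_lt _ hL)).1] at hc
      unfold reqsOf
      rw [hc]
      rcases Nat.mod_two_eq_zero_or_one k with h | h <;> rw [h]
      · rfl
      · change mU 1 (2 + 3 * (k / 2 % (red.blockOf I).length) + 1) =
          mU 1 (3 + 3 * (k / 2 % (red.blockOf I).length))
        congr 1; omega)
    hN rfl (fun y hy => (hbits y hy).trans (by omega)) hbl hcoins hprep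
  obtain ⟨t0, ht0, hE0⟩ := h1.seq h2
  rw [← GState.init_eq] at hE0
  obtain ⟨t1, ht1, hS⟩ := hT.serve (W := W) (astep := A.step) (mems := mems) (ts := ts) (mU := mU)
    hW hVW hRW hnd hlt hUY (fun i hi => hUt i hi) hLY (by omega) (by omega) (by omega) hM
    (fun t ht => (hmV _ ht).trans_le hVY)
    (fun k hk c => (hR1 k hk c).trans_le hRY) (fun k hk c => (hS1 k hk c).trans_le hRY)
    (σ₀ := { GState.start [I.n₁, I.n₂, I.n₃] (matrixWords I.M) bits with
      r := r2, cnt := c2, acc := a2, len := (red.blockOf I).length, vU := mU, vR := mR, vA := mA })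
    ⟨rfl, rfl, rfl, rfl, hT.zero.symm, hm0.symm⟩
  refine ⟨_, t0, t1, _, hE0, hS, ?_, ?_, ?_⟩
  · have := hT.time_prep
    omega
  · rw [htB]; exact ht1
  · rintro ⟨as, has, hq⟩
    have hlen : (red.requestsOf I blk).length = I.n₃ * (red.blockOf I).length := by
      simp [requestsOf, red.length_tagsOf I hnd hlt]
    have e : as = answersFrom (fun t => mems (t + 1) 1 1) 0 (red.requestsOf I blk) := by
      refine eq_answersFrom_of_queryOutputs (f := fun t => (mems (t + 1)).output) ?_ 0 _ as ?_
      · intro t a h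
        have := Mem.of_output h 1 (by simp)
        simpa [cell] using this
      · rw [hlen, ← List.range_eq_range', ← hys]; exact hq
    rw [e] at has
    have h3 := hcorrect (red.correctAnswers_blocks I hlt has)
    unfold productBits
    apply List.ext_getElem
    · simp
    · intro k hk1 hk2
      have hk : k < I.n₃ := by simpa using hk1
      simp [h3 k hk]

end LocalReduction

end Data

/-! ### From a local reduction to a solver for `γ`-OuMv -/

/-- A solver with predictions for `P` yields a solver for `γ`-OuMv: the reduction is run, and each
of its requests is issued as soon as it is needed, while the requests of the universal sequence
not needed are issued in groups without effect. -/
theorem exists_solvesGammaOuMv {P : DynamicProblem} {γ : ℝ} {u q n : ℕ → ℕ → ℕ}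
    (red : LocalReduction P γ u q n) {C : ℕ}
    (hC : ∀ n₂ : ℕ, 0 < n₂ → ∀ x : ℕ, Request.update x ∈ red.block (rows γ n₂) n₂ →
      red.order (rows γ n₂) n₂ x ≤ C)
    {A : Algorithm} {U Q : ℕ → ℕ}
    (hA : SolvesWithDelayedPredictions P
      (fun D d => ∃ n₁ n₂ : ℕ, 0 < n₂ ∧ n₁ = rows γ n₂ ∧
        P.size D = n n₁ n₂ ∧ d = (1 + C) * (u n₁ n₂ + q n₁ n₂)) A U Q) :
    ∃ (A' : Algorithm) (κ : ℕ), SolvesGammaOuMv γ A' fun n₂ n₃ =>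
      κ * (n₃ * (u (rows γ n₂) n₂ * U (n (rows γ n₂) n₂) + q (rows γ n₂) n₂ * Q (n (rows γ n₂) n₂)) +
        n₃ * (rows γ n₂ + n₂ + u (rows γ n₂) n₂ + q (rows γ n₂) n₂ + 1)) := by
  obtain ⟨cA, hA⟩ := hA
  let X : GammaInstance γ → ℕ := fun I => I.size + 2
  have hX : ∀ I, 2 ≤ X I := fun I => by simp only [X]; omega
  let N : GammaInstance γ → ℕ := fun I => red.measureOf C I
  have hN : PolyBounded X N := red.polyBounded_measureOf C
  have hN2 : PolyBounded X fun I => N I + 2 := hN.add hX (.const hX 2)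
  -- an exponent for the number of random bits
  obtain ⟨e₁, he₁⟩ := hN2.pow A.coinExp
  let V : GammaInstance γ → ℕ := fun I => A.wordBound (N I)
  have hV : PolyBounded X V := hN2.pow A.wordExp
  let WR : GammaInstance γ → ℕ := fun I => (I.size + V I + 2) ^ red.c
  have hWR : PolyBounded X WR := by
    refine ((PolyBounded.self.add hX hV).pow red.c).of_le fun I => ?_
    exact Nat.pow_le_pow_left (by simp only [X]; omega) _
  -- `Y I` exceeds all numbers that are stored; only intermediate results may be larger.
  let Y : GammaInstance γ → ℕ := fun I =>
    V I + WR I + X I ^ red.c + X I * X I + N I + X I ^ e₁ + 1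
  have hY : PolyBounded X Y :=
    (((((hV.add hX hWR).add hX (PolyBounded.self.pow _)).add hX
      (PolyBounded.self.mul .self)).add hX hN).add hX (PolyBounded.self.pow _)).add hX (.const hX 1)
  let D : ℕ := 40 + C + 8 * A.coinExp
  obtain ⟨e₂, he₂⟩ := ((((hY.add hX (.const hX 2)).pow D).add hX hV).add hX hWR).add hX
    (PolyBounded.self.pow red.c)
  obtain ⟨e₀, he₀⟩ := ((((PolyBounded.const hX 1100).mul hY).add hX
    ((PolyBounded.const hX 2).mul (PolyBounded.self.pow red.c))).add hX
      (.const hX (10 * A.coinExp))).add hX (hN2.pow cA)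
  let A' : Algorithm := ⟨gammaPrep red.universal red.prep A.prep C A.coinExp,
    gammaStep red.select red.decode A.step, e₂, e₁⟩
  refine ⟨A', 500 + 2 * red.c, e₀, fun I => ?_⟩
  obtain ⟨blk, hnd, hlt, hred⟩ := red.exists_trace I
  have hIn : ∃ n₁ n₂ : ℕ, 0 < n₂ ∧ n₁ = rows γ n₂ ∧ P.size (red.startOf I) = n n₁ n₂ ∧
      (1 + C) * (red.blockOf I).length = (1 + C) * (u n₁ n₂ + q n₁ n₂) :=
    ⟨I.n₁, I.n₂, I.pos₂, rfl, red.start_size I.n₂ I.n₃ I.pos₂ I.pos₃ I.M, by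
      rw [red.length_blockOf]⟩
  have hsize : P.size (red.startOf I) = n (rows γ I.n₂) I.n₂ :=
    red.start_size I.n₂ I.n₃ I.pos₂ I.pos₃ I.M
  -- The blocks do not depend on the answers, so that the request sequence is fixed in advance, as the
  -- error bound requires.
  obtain ⟨hrun, hprob⟩ := hA (red.startOf I) ((1 + C) * (red.blockOf I).length) hIn
    (I.n₃ * (red.blockOf I).length) {red.requestFn I blk} (universalRequests (red.blockOf I) I.n₃)
    (fun ρ hρ t => by
      rw [hρ]
      exact red.allowed_requestsOf I hnd hlt _ (by
        rw [← red.ofFn_requestFn hnd hlt]; exact List.mem_ofFn.2 ⟨t, rfl⟩))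
    (red.isDelayedPrediction I hC hnd hlt) (red.requestFn I blk) rfl
  have hcoins : A.coins (N I) ≤ A'.coins I.size := he₁ I
  -- The algorithm with predictions gets the first ones of the random bits.
  let f : Fin (A.coins (N I)) → Fin (A'.coins I.size) := Fin.castLE hcoins
  have htake : ∀ ω : Fin (A'.coins I.size) → Bool,
      (bitWords ω).take (A.coins (N I)) = bitWords (ω ∘ f) := by
    intro ω
    apply List.ext_getElem
    · simp [bitWords, hcoins]
    · intro i h1 h2
      simp [bitWords, f]
  have hcount : ∀ p : Request → Bool, (List.ofFn (red.requestFn I blk)).countP p =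
      I.n₃ * (red.blockOf I).countP p := fun p => by
    rw [red.ofFn_requestFn hnd hlt, red.countP_requestsOf I hnd hlt]
  have hWI : (Y I + 2) ^ D + V I + WR I + X I ^ red.c ≤ X I ^ e₂ := he₂ I
  have key : ∀ (ω : Fin (A'.coins I.size) → Bool) (ys : List (List ℕ)) (tA tB : ℕ),
      A.Run (N I) (red.inputsOf C I) (ω ∘ f) (requestMessages (red.requestFn I blk)) ys tA tB →
      ∃ rs t₀ t₁, A'.Run I.size [[I.n₁, I.n₂, I.n₃], matrixWords I.M] ω (vectorMessages I.uv)
          rs t₀ t₁ ∧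
        t₀ ≤ 1100 * Y I + 2 * (I.size + 2) ^ red.c + 10 * A.coinExp + tA ∧
        t₁ ≤ I.n₃ * ((400 + 2 * red.c) * (I.n₁ + I.n₂ + (red.blockOf I).length + 1)) + 100 * tB ∧
        ((∃ as, P.CorrectAnswers (red.startOf I) (red.requestsOf I blk) as ∧
          queryOutputs (red.requestsOf I blk) ys = as.map fun a => [a]) →
          rs = productBits I.M I.uv) := by
    rintro ω ys tA tB ⟨mA, hprep, hserve⟩
    have hXI : I.size + 2 = X I := rfl
    have hnc : (I.n₂ + 2) ^ red.c ≤ X I ^ red.c :=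
      Nat.pow_le_pow_left (by simp only [X, GammaInstance.size]; omega) _
    have hYI : Y I = V I + WR I + X I ^ red.c + X I * X I + N I + X I ^ e₁ + 1 := rfl
    have hWRI : (I.size + V I + 2) ^ red.c = WR I := rfl
    have hlen : (bitWords ω).length = X I ^ e₁ := length_bitWords ω
    obtain ⟨m, t₀, t₁, rs, h1, h2, h3, h4, h5⟩ := LocalReduction.exists_gamma_run (C := C) A (V I)
      rfl hnd hlt hred (W := X I ^ e₂) (Y := Y I) (D := D) (by omega) (by omega) (by omega)
      (by omega) (by omega) (by omega) (by omega) (by omega) (by omega) (by rw [hXI]; omega)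
      (by rw [hXI]; omega) (by change N I < Y I; omega) (bitWords ω) (bitWords_lt ω) (by omega)
      (by rw [length_bitWords]; exact hcoins)
      (by change Exec (V I) _ (Mem.init (_ ++ [(bitWords ω).take (A.coins (N I))])) _ _
          rw [htake]
          exact hprep) hserve
    exact ⟨rs, t₀, t₁, ⟨m, h1, h2⟩, h3, h4, h5⟩
  constructor
  · intro ω
    obtain ⟨ys, tA, tB, hR, hA1, hB1⟩ := hrun (ω ∘ f)
    obtain ⟨rs, t₀, t₁, h1, h2, h3, -⟩ := key ω ys tA tB hR
    refine ⟨rs, t₀, t₁, h1, ?_, h3.trans ?_⟩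
    · refine le_trans ?_ (he₀ I)
      have hA1 : tA ≤ (N I + 2) ^ cA := hA1
      exact h2.trans (Nat.add_le_add_left hA1 _)
    · rw [hcount, hcount, hsize] at hB1
      have hu : (red.blockOf I).countP Request.isUpdate = u (rows γ I.n₂) I.n₂ :=
        red.block_updates I.n₂ I.pos₂
      have hq : (red.blockOf I).countP Request.isQuery = q (rows γ I.n₂) I.n₂ :=
        red.block_queries I.n₂ I.pos₂
      rw [hu, hq] at hB1
      have hL := red.length_blockOf I
      have hn1 : I.n₁ = rows γ I.n₂ := rfl
      rw [hL, hn1]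
      refine (Nat.add_le_add_left (Nat.mul_le_mul_left 100 hB1) _).trans ?_
      beta_reduce
      set a := u (rows γ I.n₂) I.n₂
      set b := q (rows γ I.n₂) I.n₂
      set a' := U (n (rows γ I.n₂) I.n₂)
      set b' := Q (n (rows γ I.n₂) I.n₂)
      set z := rows γ I.n₂
      have e : (500 + 2 * red.c) * (I.n₃ * (a * a' + b * b') + I.n₃ * (z + I.n₂ + a + b + 1)) =
        (I.n₃ * ((400 + 2 * red.c) * (z + I.n₂ + (a + b) + 1)) + 100 * (I.n₃ * a * a' + I.n₃ * b * b'))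
        + ((400 + 2 * red.c) * (I.n₃ * (a * a' + b * b')) + 100 * (I.n₃ * (z + I.n₂ + a + b + 1))) := by
        ring
      rw [e]
      exact Nat.le_add_right _ _
  · refine le_trans ?_ hprob
    have hf : Function.Injective f := Fin.castLE_injective hcoins
    refine le_trans (failureProbability_mono ?_) (failureProbability_comp f hf _).le
    rintro ω ⟨ys, as, tA, tB, hR, has, hq⟩
    obtain ⟨rs, t₀, t₁, h1, -, -, h4⟩ := key ω ys tA tB hR
    rw [red.ofFn_requestFn hnd hlt] at has hq
    rw [h4 ⟨as, has, hq⟩] at h1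
    exact ⟨t₀, t₁, h1⟩

/-! ### Running many instances side by side -/

/-- A counting loop with an invariant, for the memory at the beginning of iteration `k`. -/
theorem Runs.forLoop_inv {W Y D : ℕ} (hW : (Y + 2) ^ D ≤ W) {r : ℕ} {cnt : Expr} {p : Prog}
    {m : Mem} (Inv : ℕ → Mem → Prop) (len : ℕ) (T : ℕ → ℕ)
    (hs : cnt.arith = true ∧ cnt.deg + 7 ≤ D) (hlen : len < Y) (h0 : Inv 0 (m.set r 0 0))
    (hI : ∀ k ≤ len, ∀ m, Inv k m → m r 0 = k ∧ cnt.ReadsLt Y m ∧ cnt.val m = len)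
    (hbody : ∀ k < len, ∀ m, Inv k m →
      ∃ m', Runs W p m m' (T k) ∧ m' r 0 = k ∧ Inv (k + 1) (m'.set r 0 (k + 1))) :
    ∃ m', Inv len m' ∧ Runs W (DelayedPredictions.forLoop r cnt p) m m'
      ((∑ k ∈ Finset.range len, T k) + (cnt.cost + 10) * (len + 1)) := by
  obtain ⟨S, hS0, hS⟩ := exists_seq (R := fun k m m' => Inv k m ∧ Inv (k + 1) m' ∧
    ∃ m₁, Runs W p m m₁ (T k) ∧ m₁ r 0 = k ∧ m₁.set r 0 (k + 1) = m') h0 fun k hk m hm => by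
      obtain ⟨m', h1, h2, h3⟩ := hbody k hk m hm
      exact ⟨_, h3, hm, h3, m', h1, h2, rfl⟩
  have hInv : ∀ k ≤ len, Inv k (S k) := by
    intro k hk
    cases k with
    | zero => rw [hS0]; exact h0
    | succ k => exact (hS k hk).2.1
  have hS' : ∀ k, ∃ m₁, k < len → Runs W p (S k) m₁ (T k) ∧ m₁ r 0 = k ∧
      m₁.set r 0 (k + 1) = S (k + 1) := by
    intro k
    by_cases hk : k < len
    · obtain ⟨m₁, h⟩ := (hS k hk).2.2
      exact ⟨m₁, fun _ => h⟩
    · exact ⟨m, fun h => absurd h hk⟩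
  choose S' hS' using hS'
  refine ⟨S len, hInv len le_rfl, Runs.forLoop hW S S' len T
    (fun k => (∑ i ∈ Finset.range k, T i) + (cnt.cost + 10) * k) hs hS0.symm hlen
    (fun k hk => (hI k hk _ (hInv k hk)).1) (fun k hk => (hS' k hk).2.1)
    (fun k hk => (hI k hk _ (hInv k hk)).2.1) (fun k hk => (hI k hk _ (hInv k hk)).2.2)
    (fun k hk => (hS' k hk).1) (fun k hk => (hS' k hk).2.2) (fun k _ => ?_) ?_⟩
  · rw [Finset.sum_range_succ, Nat.mul_succ]; omega
  · rw [Finset.sum_range_zero, Nat.mul_zero, Nat.mul_succ]; omega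

/-- The memories `inst 0, …, inst (G - 1)` in one: cell `i` of array `a` of `inst j` is cell
`i * G + j` of array `a`. -/
def interleave (G : ℕ) (inst : ℕ → Mem) : Mem := fun a c => inst (c % G) a (c / G)

theorem mul_add_mod_of_lt' {i j G : ℕ} (hj : j < G) : (i * G + j) % G = j := by
  rw [Nat.mul_add_mod_self_right, Nat.mod_eq_of_lt hj]

theorem mul_add_div_of_lt {i j G : ℕ} (hj : j < G) : (i * G + j) / G = i := by
  rw [Nat.add_comm, Nat.add_mul_div_right _ _ (by omega), Nat.div_eq_of_lt hj, Nat.zero_add]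

theorem interleave_apply {G j : ℕ} (hj : j < G) (inst : ℕ → Mem) (a i : ℕ) :
    interleave G inst a (i * G + j) = inst j a i := by
  rw [interleave, mul_add_mod_of_lt' hj, mul_add_div_of_lt hj]

/-- Writing to the part of instance `j` leaves the other instances alone. -/
theorem interleave_set {G j : ℕ} (hj : j < G) (inst : ℕ → Mem) (a i x : ℕ) :
    (interleave G inst).set a (i * G + j) x =
      interleave G (Function.update inst j ((inst j).set a i x)) := by
  funext b c
  simp only [Mem.set, interleave]
  by_cases hc : c % G = j
  · have h : c = i * G + j ↔ c / G = i := by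
      constructor
      · rintro rfl; exact mul_add_div_of_lt hj
      · rintro rfl
        rw [← hc]
        exact (Nat.div_add_mod' c G).symm
    rw [hc, Function.update_self]
    simp only [h]
    rfl
  · rw [Function.update_of_ne hc, if_neg]
    rintro ⟨-, rfl⟩
    exact hc (mul_add_mod_of_lt' hj)

theorem Expr.eval_op {W : ℕ} {m : Mem} {o : BinOp} {e f : Expr} {x y : ℕ} (he : e.eval W m = some x)
    (hf : f.eval W m = some y) (h : o.eval x y < W) :
    (Expr.op o e f).eval W m = some (o.eval x y) := by
  rw [Expr.eval, he, Option.bind_some, hf, Option.bind_some, fit_of_lt h]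

/-- The place of cell `e` of the instance whose number is in the register `6`, where the number
of instances is in cell `0` of array `12`. -/
abbrev instIdx (e : Expr) : Expr := .op .add (.op .mul e (.get 12 (.lit 0))) (reg 6)

namespace GState

/-- The state `σ`, with the memory of instance `j` replaced by `v`. -/
def withInst (σ : GState) (G : ℕ) (inst : ℕ → Mem) (j : ℕ) (v : Mem) : GState :=
  { σ with vA := interleave G (Function.update inst j v) }

/-- Instance `j` has its part in the interleaved memory. -/
theorem isHost_inst (σ : GState) {V W G j : ℕ} (inst : ℕ → Mem) (hG : σ.pend 0 = G) (hi : σ.i = j)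
    (hj : j < G) (hW : V * G + G + V ≤ W) :
    IsHost V W 6 fA instIdx (fun i => i * G + j) (fun v => (σ.withInst G inst j v).mem) where
  le := by omega
  get v a i := by
    rw [mem_fA]
    change interleave G (Function.update inst j v) a (i * G + j) = _
    rw [interleave_apply hj, Function.update_self]
  set v a i x := by
    rw [set_fA]
    change mem { σ with vA := Mem.set (interleave G (Function.update inst j v)) a (i * G + j) x } = _
    rw [interleave_set hj, Function.update_self, Function.update_idem]
    rfl
  eval v e i hiV he := by
    have h1 : i * G ≤ V * G := Nat.mul_le_mul_right _ hiV.le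
    have h2 : (0 : ℕ) < W := by omega
    have e1 : (Expr.get 12 (.lit 0)).eval W (σ.withInst G inst j v).mem = some G := by
      have : (σ.withInst G inst j v).mem 12 0 = G := hG
      simp only [Expr.eval, fit_of_lt h2, Option.bind_some, this]
      exact fit_of_lt (by omega)
    have e2 : (reg 6).eval W (σ.withInst G inst j v).mem = some j := by
      have : (σ.withInst G inst j v).mem 6 0 = j := hi
      simp only [Expr.eval, fit_of_lt h2, Option.bind_some, this]
      exact fit_of_lt (by omega)
    have h3 : (i + 1) * G ≤ V * G := Nat.mul_le_mul_right _ hiV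
    have h4 : (i + 1) * G = i * G + G := Nat.succ_mul _ _
    exact Expr.eval_op (Expr.eval_op he e1 (show i * G < W by omega)) e2
      (show i * G + j < W by omega)
  cost e := by simp only [Expr.cost]; omega

theorem runs_inst (σ : GState) {V W G j : ℕ} (inst : ℕ → Mem) (hG : σ.pend 0 = G) (hi : σ.i = j)
    (hj : j < G) (hW : V * G + G + V ≤ W) {p : Prog} {v v' : Mem} {t : ℕ} (h : Exec V p v v' t) :
    Runs W (p.embed fA instIdx) (σ.withInst G inst j v).mem (σ.withInst G inst j v').mem (7 * t) :=
  (σ.isHost_inst inst hG hi hj hW).exec_embed h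

/-- Writing to one cell of the memory of an instance. -/
theorem runs_put_inst (σ : GState) {Y W D G j : ℕ} (hW : (Y + 2) ^ D ≤ W) (inst : ℕ → Mem)
    (hG : σ.pend 0 = G) (hi : σ.i = j) (hj : j < G) (v : Mem) (a c x : ℕ) {e f : Expr} {T : ℕ}
    (hGY : G < Y)
    (he : e.val (σ.withInst G inst j v).mem = c) (hf : f.val (σ.withInst G inst j v).mem = x)
    (hr : e.ReadsLt Y (σ.withInst G inst j v).mem ∧ f.ReadsLt Y (σ.withInst G inst j v).mem)
    (hs : (e.arith = true ∧ e.deg + 6 ≤ D) ∧ (f.arith = true ∧ f.deg ≤ D))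
    (hc : e.cost + f.cost + 7 ≤ T) :
    Runs W (.put (fA a) (instIdx e) f) (σ.withInst G inst j v).mem
      (σ.withInst G inst j (v.set a c x)).mem T := by
  have h6 : (σ.withInst G inst j v).mem 6 0 = j := hi
  have h12 : (σ.withInst G inst j v).mem 12 0 = G := hG
  refine Runs.put hW ?_ ⟨⟨⟨hr.1, trivial, ?_⟩, trivial, ?_⟩, hr.2⟩ ⟨⟨?_, ?_⟩, hs.2⟩ ?_
  · simp only [Expr.val, BinOp.eval, he, hf, h6, h12]
    exact (σ.isHost_inst (V := 0) (W := G) inst hG hi hj (by omega)).set v a c x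
  · simp only [Expr.val, h12]; exact hGY
  · simp only [Expr.val, h6]; omega
  · simp [Expr.arith, BinOp.arith, hs.1.1]
  · have := hs.1.2
    simp only [Expr.deg]; omega
  · simp only [Expr.cost]; omega

/-- Filling a part of an array in the memory of an instance. -/
theorem runs_fill_inst (σ : GState) {Y W D G j : ℕ} (hW : (Y + 2) ^ D ≤ W) (inst : ℕ → Mem)
    (hG : σ.pend 0 = G) (hi : σ.i = j) (hj : j < G) (hGY : G < Y) (v : Mem) (a off : ℕ)
    (g : ℕ → ℕ) (len : ℕ) (hlen : len < Y) {cnt idx val : Expr} {T : ℕ}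
    (hs : cnt.arith = true ∧ cnt.deg + 7 ≤ D)
    (hsi : idx.arith = true ∧ idx.deg + 6 ≤ D) (hsv : val.arith = true ∧ val.deg ≤ D)
    (hcnt : ∀ k w, cnt.ReadsLt Y (mem { σ.withInst G inst j w with r := k }) ∧
      cnt.val (mem { σ.withInst G inst j w with r := k }) = len)
    (hidx : ∀ k w, k < len → idx.ReadsLt Y (mem { σ.withInst G inst j w with r := k }) ∧
      idx.val (mem { σ.withInst G inst j w with r := k }) = off + k)
    (hval : ∀ k w, k < len → val.ReadsLt Y (mem { σ.withInst G inst j w with r := k }) ∧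
      val.val (mem { σ.withInst G inst j w with r := k }) = g k)
    (hT : (idx.cost + val.cost + cnt.cost + 17) * (len + 1) ≤ T) :
    Runs W (fill 5 (fA a) cnt (instIdx idx) val) (σ.withInst G inst j v).mem
      (mem { σ.withInst G inst j (Function.update v a (fillArr (v a) off g len)) with r := len })
      T := by
  refine Runs.fill hW (fun k arr => mem { σ.withInst G inst j (Function.update v a arr) with r := k })
    (fun i => i * G + j) (v a) off g len ?_ hlen (fun _ _ => rfl) (fun _ _ _ => set_r _ _) ?_ hs
    (fun k arr => hcnt k _) ?_ ?_ hsv (fun k arr hk => hval k _ hk) ?_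
  · rw [set_r, Function.update_eq_self]
  · intro k arr i x
    have h := (GState.isHost_inst (V := 0) (W := G) { σ with r := k } inst hG hi hj (by omega)).set
      (Function.update v a arr) a i x
    rw [Mem.update_set] at h
    exact h
  · have := hsi.2
    exact ⟨by simp [Expr.arith, BinOp.arith, hsi.1], by simp only [Expr.deg]; omega⟩
  · intro k arr hk
    obtain ⟨h1, h2⟩ := hidx k (Function.update v a arr) hk
    have h6 : mem { σ.withInst G inst j (Function.update v a arr) with r := k } 6 0 = j := hi
    have h12 : mem { σ.withInst G inst j (Function.update v a arr) with r := k } 12 0 = G := hG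
    refine ⟨⟨⟨h1, trivial, ?_⟩, trivial, ?_⟩, ?_⟩
    · simp only [Expr.val, h12]; exact hGY
    · simp only [Expr.val, h6]; omega
    · simp only [Expr.val, BinOp.eval, h2, h6, h12]
  · refine le_trans (Nat.mul_le_mul_right _ ?_) hT
    simp only [Expr.cost]; omega

end GState

/-! ### Splitting an OuMv instance into `γ`-OuMv instances -/

/-- How an `n × n` matrix is split: there are `nb` blocks of `n₁` rows and `n₂` columns each, with
`nb₂` of them side by side, and each of them is treated by `rep` independent instances, which get
`coins` random bits each. -/
structure Layout where
  n₁ : ℕ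
  n₂ : ℕ
  nb₂ : ℕ
  rep : ℕ
  nb : ℕ
  n : ℕ
  coins : ℕ

namespace Layout

variable (l : Layout)

/-- The number of instances. -/
def num : ℕ := l.nb * l.rep

/-- The first row of the block that belongs to instance `j`. -/
def row (j : ℕ) : ℕ := j / l.rep / l.nb₂ * l.n₁

/-- The first column of the block that belongs to instance `j`. -/
def col (j : ℕ) : ℕ := j / l.rep % l.nb₂ * l.n₂

/-- The layout, as kept in the memory. -/
def params : ℕ → ℕ
  | 0 => l.num
  | 1 => l.n₁
  | 2 => l.n₂
  | 3 => l.nb₂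
  | 4 => l.rep
  | 5 => l.nb
  | 6 => l.n
  | 7 => l.coins
  | _ => 0

end Layout

/-- A parameter of the layout. -/
abbrev par (k : ℕ) : Expr := .get 12 (.lit k)

/-- Compute the first row and the first column of the block of the current instance. -/
def placeProg : Prog :=
  .put 7 (.lit 0) (.op .mul (.op .div (.op .div (reg 6) (par 4)) (par 3)) (par 1)) ;;
  .put 8 (.lit 0) (.op .mul (.op .mod (.op .div (reg 6) (par 4)) (par 3)) (par 2))

/-- Pass the parts of the two vectors on to the current instance, and run it. -/
def feedProg (astep : Prog) : Prog :=
  placeProg ;;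
  .put (fA 0) (instIdx (.lit 0)) (.op .add (par 1) (par 2)) ;;
  fill 5 (fA 0) (par 1) (instIdx (.op .add (.lit 1) (reg 5)))
    (.op .mul (.op .lt (.op .add (reg 7) (reg 5)) (par 6))
      (.get 0 (.op .add (.lit 1) (.op .add (reg 7) (reg 5))))) ;;
  fill 5 (fA 0) (par 2) (instIdx (.op .add (.op .add (.lit 1) (par 1)) (reg 5)))
    (.op .mul (.op .lt (.op .add (reg 8) (reg 5)) (par 6))
      (.get 0 (.op .add (.op .add (.lit 1) (par 6)) (.op .add (reg 8) (reg 5))))) ;;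
  astep.embed fA instIdx

/-- Prepare the input of the current instance, and run its preprocessing. -/
def prepareProg (aprep : Prog) : Prog :=
  placeProg ;;
  .put (fA 2) (instIdx (.lit 0)) (.lit 3) ;; .put (fA 2) (instIdx (.lit 1)) (par 1) ;;
  .put (fA 2) (instIdx (.lit 2)) (par 2) ;; .put (fA 2) (instIdx (.lit 3)) (par 6) ;;
  .put (fA 3) (instIdx (.lit 0)) (.op .mul (par 1) (par 2)) ;;
  fill 5 (fA 3) (.op .mul (par 1) (par 2)) (instIdx (.op .add (.lit 1) (reg 5)))
    (.op .mul (.op .mul (.op .lt (.op .add (reg 7) (.op .div (reg 5) (par 2))) (par 6))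
      (.op .lt (.op .add (reg 8) (.op .mod (reg 5) (par 2))) (par 6)))
      (.get 3 (.op .add (.lit 1) (.op .add
        (.op .mul (.op .add (reg 7) (.op .div (reg 5) (par 2))) (par 6))
        (.op .add (reg 8) (.op .mod (reg 5) (par 2))))))) ;;
  .put (fA 4) (instIdx (.lit 0)) (par 7) ;;
  fill 5 (fA 4) (par 7) (instIdx (.op .add (.lit 1) (reg 5)))
    (.get 4 (.op .add (.lit 1) (.op .add (.op .mul (reg 6) (par 7)) (reg 5)))) ;;
  aprep.embed fA instIdx

theorem cell_append_left {l l' : List ℕ} {k : ℕ} (hk : k < l.length) :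
    cell (l ++ l') (k + 1) = cell l (k + 1) := by
  simp [cell, List.getElem?_append_left hk]

theorem cell_append_right {l l' : List ℕ} (k : ℕ) :
    cell (l ++ l') (l.length + k + 1) = cell l' (k + 1) := by
  simp [cell, List.getElem?_append_right]

theorem fillArr_update_cell (l : List ℕ) (g : ℕ → ℕ) (hg : ∀ k < l.length, g k = cell l (k + 1)) :
    fillArr (Function.update (fun _ => 0) 0 l.length) 1 g l.length = cell l := by
  funext i
  rcases i with _ | i
  · rfl
  · unfold fillArr
    split
    · rw [hg _ (by omega)]; congr 1
    · rw [Function.update_of_ne (by omega)]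
      exact (cell_eq_zero (by omega)).symm

/-- Writing a list in two parts. -/
theorem Mem.load_append_eq_update (v : Mem) (a : ℕ) (l₁ l₂ : List ℕ) (g₁ g₂ : ℕ → ℕ)
    (h₁ : ∀ k < l₁.length, g₁ k = cell l₁ (k + 1)) (h₂ : ∀ k < l₂.length, g₂ k = cell l₂ (k + 1)) :
    Function.update v a (fillArr (fillArr (Function.update (v a) 0 (l₁.length + l₂.length))
      1 g₁ l₁.length) (1 + l₁.length) g₂ l₂.length) = v.load a (l₁ ++ l₂) := by
  funext b i
  by_cases hb : b = a
  · subst hb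
    simp only [Function.update_self, Mem.load, true_and, List.length_append, fillArr]
    rcases Nat.eq_zero_or_pos i with rfl | hi
    · rw [if_neg (by omega), if_neg (by omega), if_pos (by omega), Function.update_self, cell_zero,
        List.length_append]
    · obtain ⟨k, rfl⟩ := Nat.exists_eq_add_of_le' hi
      by_cases h1 : k < l₁.length
      · rw [if_neg (by omega), if_pos (by omega), if_pos (by omega), Nat.add_sub_cancel, h₁ k h1,
          cell_append_left h1]
      · by_cases h2 : k < l₁.length + l₂.length
        · obtain ⟨m, rfl⟩ := Nat.exists_eq_add_of_le (not_lt.1 h1)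
          rw [if_pos (by omega), if_pos (by omega), cell_append_right,
            show l₁.length + m + 1 - (1 + l₁.length) = m by omega, h₂ m (by omega)]
        · rw [if_neg (by omega), if_neg (by omega), if_neg (by omega),
            Function.update_of_ne (by omega)]
  · rw [Function.update_of_ne hb, Mem.load_of_ne _ _ hb]

namespace Layout

variable (l : Layout)

@[simp] theorem params_0 : l.params 0 = l.num := rfl
@[simp] theorem params_1 : l.params 1 = l.n₁ := rfl
@[simp] theorem params_2 : l.params 2 = l.n₂ := rfl
@[simp] theorem params_3 : l.params 3 = l.nb₂ := rfl
@[simp] theorem params_4 : l.params 4 = l.rep := rfl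
@[simp] theorem params_5 : l.params 5 = l.nb := rfl
@[simp] theorem params_6 : l.params 6 = l.n := rfl
@[simp] theorem params_7 : l.params 7 = l.coins := rfl

/-- All numbers in the layout are smaller than `Y`. -/
structure Bounded (Y : ℕ) : Prop where
  num : l.num < Y
  n₁ : l.n₁ < Y
  n₂ : l.n₂ < Y
  nb₂ : l.nb₂ < Y
  rep : l.rep < Y
  nb : l.nb < Y
  n : l.n < Y
  coins : l.coins < Y
  area : l.n₁ * l.n₂ < Y
  row : ∀ j < l.num, l.row j < Y
  col : ∀ j < l.num, l.col j < Y

end Layout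

section Runs

open GState

variable {W Y V : ℕ} {l : Layout} {σ : GState} {inst : ℕ → Mem} {j : ℕ}

section WithInst

variable (σ : GState) (G : ℕ) (inst : ℕ → Mem) (j : ℕ) (v : Mem)

@[simp] theorem GState.withInst_msg : (σ.withInst G inst j v).msg = σ.msg := rfl
@[simp] theorem GState.withInst_in3 : (σ.withInst G inst j v).in3 = σ.in3 := rfl
@[simp] theorem GState.withInst_in4 : (σ.withInst G inst j v).in4 = σ.in4 := rfl
@[simp] theorem GState.withInst_i : (σ.withInst G inst j v).i = σ.i := rfl
@[simp] theorem GState.withInst_s : (σ.withInst G inst j v).s = σ.s := rfl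
@[simp] theorem GState.withInst_cnt : (σ.withInst G inst j v).cnt = σ.cnt := rfl
@[simp] theorem GState.withInst_pend : (σ.withInst G inst j v).pend = σ.pend := rfl

end WithInst

theorem runs_placeProg (hW : (Y + 2) ^ 80 ≤ W) (hp : σ.pend = l.params) (hY : l.Bounded Y)
    (hi : σ.i = j) (hj : j < l.num) :
    Runs W placeProg σ.mem (mem { σ with s := l.row j, cnt := l.col j }) 28 := by
  have hjY : j < Y := hj.trans hY.num
  have e1 : σ.i / σ.pend 4 / σ.pend 3 * σ.pend 1 = l.row j := by rw [hi, hp]; rfl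
  have e2 : σ.i / σ.pend 4 % σ.pend 3 * σ.pend 2 = l.col j := by rw [hi, hp]; rfl
  refine Runs.seq (T := 14) (T' := 14) (m₁ := mem { σ with s := l.row j })
    (Runs.put hW ?_ ?_ (by decide) (by decide)) (Runs.put hW ?_ ?_ (by decide) (by decide))
  · simp only [Expr.val, BinOp.eval, mem_i, mem_pend, e1]
    exact set_s _ _
  · simp [Expr.ReadsLt, Expr.val, hp, hi, hjY, hY.n₁, hY.nb₂, hY.rep]
  · simp only [Expr.val, BinOp.eval, mem_i, mem_pend, e2]
    exact set_cnt _ _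
  · simp [Expr.ReadsLt, Expr.val, hp, hi, hjY, hY.n₂, hY.nb₂, hY.rep]

/-- Cells outside of the vectors are read as well, but multiplied by `0`; this pads the vectors with
zeros. -/
theorem runs_feedProg (hW : (Y + 2) ^ 80 ≤ W) (hp : σ.pend = l.params) (hY : l.Bounded Y)
    (hi : σ.i = j) (hj : j < l.num)
    (hvA : σ.vA = interleave l.num inst) (hmsg : ∀ c, σ.msg c < Y) (hV : V * l.num + l.num + V ≤ W)
    (y₁ y₂ : List ℕ) (hl₁ : y₁.length = l.n₁) (hl₂ : y₂.length = l.n₂)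
    (hy₁ : ∀ k < l.n₁, cell y₁ (k + 1) =
      (if l.row j + k < l.n then 1 else 0) * σ.msg (1 + (l.row j + k)))
    (hy₂ : ∀ k < l.n₂, cell y₂ (k + 1) =
      (if l.col j + k < l.n then 1 else 0) * σ.msg (1 + l.n + (l.col j + k)))
    {astep : Prog} {v' : Mem} {t : ℕ} (hE : Exec V astep ((inst j).load 0 (y₁ ++ y₂)) v' t) :
    Runs W (feedProg astep) σ.mem
      (mem { σ with r := l.n₂, s := l.row j, cnt := l.col j,
                    vA := interleave l.num (Function.update inst j v') })
      (100 * (l.n₁ + l.n₂ + 3) + 7 * t) := by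
  have hjY : j < Y := hj.trans hY.num
  have h1 := runs_placeProg hW hp hY hi hj
  obtain ⟨σ₁, hσ₁⟩ : ∃ σ₁ : GState, { σ with s := l.row j, cnt := l.col j } = σ₁ := ⟨_, rfl⟩
  have hp₁ : σ₁.pend = l.params := by rw [← hσ₁]; exact hp
  have hi₁ : σ₁.i = j := by rw [← hσ₁]; exact hi
  have hs₁ : σ₁.s = l.row j := by rw [← hσ₁]
  have hc₁ : σ₁.cnt = l.col j := by rw [← hσ₁]
  have hm₁ : σ₁.msg = σ.msg := by rw [← hσ₁]
  have hG : σ₁.pend 0 = l.num := by rw [hp₁]; rfl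
  have hrow := hY.row j hj
  have hcol := hY.col j hj
  have hn₁ := hY.n₁
  have hn₂ := hY.n₂
  have hn := hY.n
  have e1 : σ₁ = σ₁.withInst l.num inst j (inst j) := by
    rw [withInst, Function.update_eq_self, ← hvA, ← hσ₁]
  rw [hσ₁, e1] at h1
  have h2 : Runs W (.put (fA 0) (instIdx (.lit 0)) (.op .add (par 1) (par 2)))
      (σ₁.withInst l.num inst j (inst j)).mem
      (σ₁.withInst l.num inst j ((inst j).set 0 0 (l.n₁ + l.n₂))).mem 20 := by
    refine runs_put_inst σ₁ hW inst hG hi₁ hj (inst j) 0 0 (l.n₁ + l.n₂) hY.num rfl ?_ ?_ (by decide)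
      (by decide)
    · simp [Expr.val, BinOp.eval, hp₁]
    · simp [Expr.ReadsLt, Expr.val, hp₁, hn₁, hn₂]
  have h3 := runs_fill_inst σ₁ hW inst hG hi₁ hj hY.num ((inst j).set 0 0 (l.n₁ + l.n₂)) 0 1
    (fun k => (if l.row j + k < l.n then 1 else 0) * σ.msg (1 + (l.row j + k))) l.n₁ hn₁
    (cnt := par 1) (idx := .op .add (.lit 1) (reg 5))
    (val := .op .mul (.op .lt (.op .add (reg 7) (reg 5)) (par 6))
      (.get 0 (.op .add (.lit 1) (.op .add (reg 7) (reg 5)))))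
    (T := 100 * (l.n₁ + 1)) (by decide) (by decide) (by decide) ?_ ?_ ?_
    (Nat.mul_le_mul_right _ (by decide))
  rotate_left
  · intro k w
    simp [Expr.ReadsLt, Expr.val, hp₁, hn₁]
  · intro k w hk
    simp [Expr.ReadsLt, Expr.val, BinOp.eval]; omega
  · intro k w hk
    simp [Expr.ReadsLt, Expr.val, BinOp.eval, hp₁, hs₁, hm₁, hmsg, hn]; omega
  have h4 := runs_fill_inst { σ₁ with r := l.n₁ } hW inst hG hi₁ hj hY.num
    (Function.update ((inst j).set 0 0 (l.n₁ + l.n₂)) 0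
      (fillArr ((inst j).set 0 0 (l.n₁ + l.n₂) 0) 1
        (fun k => (if l.row j + k < l.n then 1 else 0) * σ.msg (1 + (l.row j + k))) l.n₁)) 0
    (1 + l.n₁)
    (fun k => (if l.col j + k < l.n then 1 else 0) * σ.msg (1 + l.n + (l.col j + k))) l.n₂ hn₂
    (cnt := par 2) (idx := .op .add (.op .add (.lit 1) (par 1)) (reg 5))
    (val := .op .mul (.op .lt (.op .add (reg 8) (reg 5)) (par 6))
        (.get 0 (.op .add (.op .add (.lit 1) (par 6)) (.op .add (reg 8) (reg 5)))))
    (T := 100 * (l.n₂ + 1)) (by decide) (by decide) (by decide) ?_ ?_ ?_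
    (Nat.mul_le_mul_right _ (by decide))
  rotate_left
  · intro k w
    simp [Expr.ReadsLt, Expr.val, hp₁, hn₂]
  · intro k w hk
    simp [Expr.ReadsLt, Expr.val, BinOp.eval, hp₁]; omega
  · intro k w hk
    simp [Expr.ReadsLt, Expr.val, BinOp.eval, hp₁, hc₁, hm₁, hmsg, hn]; omega
  have hload := Mem.load_append_eq_update (inst j) 0 y₁ y₂ _ _
    (fun k hk => (hy₁ k (hl₁ ▸ hk)).symm) (fun k hk => (hy₂ k (hl₂ ▸ hk)).symm)
  rw [hl₁, hl₂, ← set_same] at hload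
  have hset : Function.update ((inst j).set 0 0 (l.n₁ + l.n₂)) 0 = Function.update (inst j) 0 := by
    funext w b
    by_cases hb : b = 0
    · subst hb; simp
    · rw [Function.update_of_ne hb, Function.update_of_ne hb, set_other _ _ _ hb]
  rw [Function.update_idem, Function.update_self, hset, hload] at h4
  rw [hset] at h3
  have h5 := runs_inst { σ₁ with r := l.n₂ } inst hG hi₁ hj hV hE
  have h6 := (h1.seq (h2.seq (h3.seq (h4.seq h5)))).mono
    (T' := 100 * (l.n₁ + l.n₂ + 3) + 7 * t) (by omega)
  rw [← hσ₁] at h6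
  exact h6

/-- Cells outside of the matrix are read as well, but multiplied by `0`; this pads the matrix with
zeros. Instance `j` gets the random bits `j * coins, …, (j + 1) * coins - 1`. -/
theorem runs_prepareProg (hW : (Y + 2) ^ 80 ≤ W) (hp : σ.pend = l.params) (hY : l.Bounded Y)
    (hi : σ.i = j) (hj : j < l.num)
    (hvA : σ.vA = interleave l.num inst) (hin3 : ∀ c, σ.in3 c < Y) (hin4 : ∀ c, σ.in4 c < Y)
    (hV : V * l.num + l.num + V ≤ W) (hinst : inst j = fun _ _ => 0)
    (mw bits : List ℕ) (hl₁ : mw.length = l.n₁ * l.n₂) (hl₂ : bits.length = l.coins)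
    (hmw : ∀ k < l.n₁ * l.n₂, cell mw (k + 1) =
      ((if l.row j + k / l.n₂ < l.n then 1 else 0) * (if l.col j + k % l.n₂ < l.n then 1 else 0)) *
        σ.in3 (1 + ((l.row j + k / l.n₂) * l.n + (l.col j + k % l.n₂))))
    (hbits : ∀ k < l.coins, cell bits (k + 1) = σ.in4 (1 + (j * l.coins + k)))
    {aprep : Prog} {v' : Mem} {t : ℕ}
    (hE : Exec V aprep (Mem.init [[l.n₁, l.n₂, l.n], mw, bits]) v' t) :
    Runs W (prepareProg aprep) σ.mem
      (mem { σ with r := l.coins, s := l.row j, cnt := l.col j,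
                    vA := interleave l.num (Function.update inst j v') })
      (100 * (l.n₁ * l.n₂ + l.coins + 4) + 7 * t) := by
  have hjY : j < Y := hj.trans hY.num
  have h1 := runs_placeProg hW hp hY hi hj
  obtain ⟨σ₁, hσ₁⟩ : ∃ σ₁ : GState, { σ with s := l.row j, cnt := l.col j } = σ₁ := ⟨_, rfl⟩
  have hp₁ : σ₁.pend = l.params := by rw [← hσ₁]; exact hp
  have hi₁ : σ₁.i = j := by rw [← hσ₁]; exact hi
  have hs₁ : σ₁.s = l.row j := by rw [← hσ₁]
  have hc₁ : σ₁.cnt = l.col j := by rw [← hσ₁]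
  have hm₁ : σ₁.in3 = σ.in3 := by rw [← hσ₁]
  have hb₁ : σ₁.in4 = σ.in4 := by rw [← hσ₁]
  have hG : σ₁.pend 0 = l.num := by rw [hp₁]; rfl
  have hrow := hY.row j hj
  have hcol := hY.col j hj
  have hn₁ := hY.n₁
  have hn₂ := hY.n₂
  have hn := hY.n
  have hK := hY.coins
  have e1 : σ₁ = σ₁.withInst l.num inst j (inst j) := by
    rw [withInst, Function.update_eq_self, ← hvA, ← hσ₁]
  rw [hσ₁, e1] at h1
  have hput : ∀ (v : Mem) (a c x : ℕ) (e : Expr), e.val (σ₁.withInst l.num inst j v).mem = x →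
      e.ReadsLt Y (σ₁.withInst l.num inst j v).mem → (e.arith = true ∧ e.deg ≤ 80) → e.cost ≤ 5 →
      c < 4 → Runs W (.put (fA a) (instIdx (.lit c)) e) (σ₁.withInst l.num inst j v).mem
        (σ₁.withInst l.num inst j (v.set a c x)).mem 20 := by
    intro v a c x e hx hr hs hc hc4
    refine runs_put_inst σ₁ hW inst hG hi₁ hj v a c x hY.num rfl hx ⟨trivial, hr⟩
      ⟨⟨rfl, ?_⟩, hs⟩ ?_
    · simp only [Expr.deg]; omega
    · simp only [Expr.cost]; omega
  have a1 := hput (inst j) 2 0 3 (.lit 3) rfl trivial (by decide) (by decide) (by decide)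
  have a2 := hput ((inst j).set 2 0 3) 2 1 l.n₁ (par 1) (by simp [Expr.val, hp₁])
    (by simp [Expr.ReadsLt, Expr.val, hp₁, hn₁]) (by decide) (by decide) (by decide)
  have a3 := hput (((inst j).set 2 0 3).set 2 1 l.n₁) 2 2 l.n₂ (par 2) (by simp [Expr.val, hp₁])
    (by simp [Expr.ReadsLt, Expr.val, hp₁, hn₂]) (by decide) (by decide) (by decide)
  have a4 := hput ((((inst j).set 2 0 3).set 2 1 l.n₁).set 2 2 l.n₂) 2 3 l.n (par 6)
    (by simp [Expr.val, hp₁])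
    (by simp [Expr.ReadsLt, Expr.val, hp₁, hn]) (by decide) (by decide) (by decide)
  have a5 := hput (((((inst j).set 2 0 3).set 2 1 l.n₁).set 2 2 l.n₂).set 2 3 l.n) 3 0
    (l.n₁ * l.n₂) (.op .mul (par 1) (par 2)) (by simp [Expr.val, BinOp.eval, hp₁])
    (by simp [Expr.ReadsLt, Expr.val, hp₁, hn₁, hn₂]) (by decide) (by decide) (by decide)
  let v₁ : Mem := Function.update (Function.update (fun _ _ => 0) 2 (cell [l.n₁, l.n₂, l.n])) 3
    (Function.update (fun _ => 0) 0 (l.n₁ * l.n₂))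
  have hv₁ : (((((inst j).set 2 0 3).set 2 1 l.n₁).set 2 2 l.n₂).set 2 3 l.n).set 3 0
      (l.n₁ * l.n₂) = v₁ := by
    rw [hinst]
    funext a i
    by_cases h3 : a = 3
    · subst h3; simp [Mem.set, v₁, Function.update_apply]
    · by_cases h2 : a = 2
      · subst h2
        rcases i with _ | _ | _ | _ | i <;> simp [Mem.set, v₁, cell]
      · simp [Mem.set, v₁, h3, h2]
  rw [hv₁] at a5
  have hc9 : ∀ k, k < l.n₁ * l.n₂ → k < Y := fun k hk => hk.trans hY.area
  have a6 := runs_fill_inst σ₁ hW inst hG hi₁ hj hY.num v₁ 3 1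
    (fun k => ((if l.row j + k / l.n₂ < l.n then 1 else 0) *
      (if l.col j + k % l.n₂ < l.n then 1 else 0)) *
        σ.in3 (1 + ((l.row j + k / l.n₂) * l.n + (l.col j + k % l.n₂)))) (l.n₁ * l.n₂) hY.area
    (cnt := .op .mul (par 1) (par 2)) (idx := .op .add (.lit 1) (reg 5))
    (val := .op .mul (.op .mul (.op .lt (.op .add (reg 7) (.op .div (reg 5) (par 2))) (par 6))
      (.op .lt (.op .add (reg 8) (.op .mod (reg 5) (par 2))) (par 6)))
      (.get 3 (.op .add (.lit 1) (.op .add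
        (.op .mul (.op .add (reg 7) (.op .div (reg 5) (par 2))) (par 6))
        (.op .add (reg 8) (.op .mod (reg 5) (par 2)))))))
    (T := 100 * (l.n₁ * l.n₂ + 1)) (by decide) (by decide) (by decide) ?_ ?_ ?_
    (Nat.mul_le_mul_right _ (by decide))
  rotate_left
  · intro k w
    simp [Expr.ReadsLt, Expr.val, BinOp.eval, hp₁, hn₁, hn₂]
  · intro k w hk
    have := hc9 k hk
    simp [Expr.ReadsLt, Expr.val, BinOp.eval, this]
  · intro k w hk
    have := hc9 k hk
    simp [Expr.ReadsLt, Expr.val, BinOp.eval, hp₁, hs₁, hc₁, hm₁, hin3, hn, hn₂, this, hrow, hcol]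
  let v₂ : Mem := Function.update (Function.update (fun _ _ => 0) 2 (cell [l.n₁, l.n₂, l.n])) 3
    (cell mw)
  have hv₂ : Function.update v₁ 3 (fillArr (v₁ 3) 1 (fun k =>
      ((if l.row j + k / l.n₂ < l.n then 1 else 0) *
      (if l.col j + k % l.n₂ < l.n then 1 else 0)) *
        σ.in3 (1 + ((l.row j + k / l.n₂) * l.n + (l.col j + k % l.n₂)))) (l.n₁ * l.n₂)) = v₂ := by
    have e : v₁ 3 = Function.update (fun _ => 0) 0 mw.length := by simp [v₁, hl₁]
    rw [e, ← hl₁, fillArr_update_cell mw _ fun k hk => (hmw k (hl₁ ▸ hk)).symm]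
    exact Function.update_idem _ _ _
  rw [hv₂] at a6
  have a7 := runs_put_inst { σ₁ with r := l.n₁ * l.n₂ } hW inst hG hi₁ hj v₂ 4 0 l.coins hY.num
    (e := .lit 0) (f := par 7) (T := 20) rfl (by simp [Expr.val, hp₁])
    (by simp [Expr.ReadsLt, Expr.val, hp₁, hK]) (by decide) (by decide)
  have a8 := runs_fill_inst { σ₁ with r := l.n₁ * l.n₂ } hW inst hG hi₁ hj hY.num
    (v₂.set 4 0 l.coins) 4 1 (fun k => σ.in4 (1 + (j * l.coins + k))) l.coins hK
    (cnt := par 7) (idx := .op .add (.lit 1) (reg 5))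
    (val := .get 4 (.op .add (.lit 1) (.op .add (.op .mul (reg 6) (par 7)) (reg 5))))
    (T := 100 * (l.coins + 1)) (by decide) (by decide) (by decide) ?_ ?_ ?_
    (Nat.mul_le_mul_right _ (by decide))
  rotate_left
  · intro k w
    simp [Expr.ReadsLt, Expr.val, hp₁, hK]
  · intro k w hk
    simp [Expr.ReadsLt, Expr.val, BinOp.eval]; omega
  · intro k w hk
    simp [Expr.ReadsLt, Expr.val, BinOp.eval, hp₁, hb₁, hi₁, hin4, hK, hjY]; omega
  have hv₃ : Function.update (v₂.set 4 0 l.coins) 4 (fillArr (v₂.set 4 0 l.coins 4) 1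
      (fun k => σ.in4 (1 + (j * l.coins + k))) l.coins) =
      Mem.init [[l.n₁, l.n₂, l.n], mw, bits] := by
    have e : v₂.set 4 0 l.coins 4 = Function.update (fun _ => 0) 0 bits.length := by
      rw [set_same, hl₂]
      simp [v₂]
    have h := fillArr_update_cell bits _ fun k hk => (hbits k (hl₂ ▸ hk)).symm
    rw [hl₂] at e h
    rw [e, h]
    funext a
    by_cases h4 : a = 4
    · subst h4
      rw [Function.update_self]
      exact (Mem.init_apply [[l.n₁, l.n₂, l.n], mw, bits] 2).symm
    · rw [Function.update_of_ne h4, set_other _ _ _ h4]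
      by_cases h3 : a = 3
      · subst h3
        exact (Function.update_self _ _ _).trans
          (Mem.init_apply [[l.n₁, l.n₂, l.n], mw, bits] 1).symm
      · change Function.update _ 3 _ a = _
        rw [Function.update_of_ne h3]
        by_cases h2 : a = 2
        · subst h2
          rw [Function.update_self]
          exact (Mem.init_apply [[l.n₁, l.n₂, l.n], mw, bits] 0).symm
        · rw [Function.update_of_ne h2]
          by_cases h : a < 2
          · exact (Mem.init_zero _ _ h).symm
          · exact (Mem.init_of_le _ _ (by simp; omega)).symm
  rw [hv₃] at a8
  have a9 := runs_inst { σ₁ with r := l.coins } inst hG hi₁ hj hV hE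
  have h6 := (h1.seq (a1.seq (a2.seq (a3.seq (a4.seq (a5.seq (a6.seq (a7.seq (a8.seq
    a9))))))))).mono (T' := 100 * (l.n₁ * l.n₂ + l.coins + 4) + 7 * t) (by omega)
  rw [← hσ₁] at h6
  exact h6

end Runs

/-! ### Majorities over interleaved instances -/

/-- Count the instances with output `1` for each block, and the blocks with a majority of them;
output whether there is such a block. -/
def majorityProg : Prog :=
  .put 10 (.lit 0) (.lit 0) ;;
  forLoop 6 (par 5) (.put 7 (.lit 0) (.lit 0) ;;
    forLoop 5 (par 4) (.put 7 (.lit 0) (.op .add (reg 7)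
      (.op .eq (.get (fA 1) (.op .add (par 0) (.op .add (.op .mul (reg 6) (par 4)) (reg 5))))
        (.lit 1)))) ;;
    .put 10 (.lit 0) (.op .add (reg 10) (.op .lt (par 4) (.op .mul (.lit 2) (reg 7))))) ;;
  .put 1 (.lit 0) (.lit 1) ;; .put 1 (.lit 1) (.op .lt (.lit 0) (reg 10))

/-- The program for one round: run all instances, and combine their answers. -/
def splitStep (astep : Prog) : Prog := forLoop 6 (par 0) (feedProg astep) ;; majorityProg

/-- The number of instances with output `1` among those for block `b`. -/
def ones (rep : ℕ) (inst : ℕ → Mem) (b : ℕ) : ℕ :=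
  ∑ r ∈ Finset.range rep, if inst (b * rep + r) 1 1 = 1 then 1 else 0

/-- The number of blocks for which the majority of the instances has output `1`. -/
def majorities (rep : ℕ) (inst : ℕ → Mem) (nb : ℕ) : ℕ :=
  ∑ b ∈ Finset.range nb, if rep < 2 * ones rep inst b then 1 else 0

section Runs

open GState

variable {W Y V : ℕ} {l : Layout} {σ : GState} {inst inst' : ℕ → Mem}

/-- A loop over all instances that changes their memories one by one. -/
theorem runs_forInst (hW : (Y + 2) ^ 80 ≤ W) (hp : σ.pend = l.params) (hY : l.Bounded Y)
    (hvA : σ.vA = interleave l.num inst) (hge : ∀ j, l.num ≤ j → inst' j = inst j)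
    {p : Prog} (T : ℕ → ℕ)
    (h : ∀ j < l.num, ∀ (r s c : ℕ) (inst₀ : ℕ → Mem), inst₀ j = inst j → ∃ r' s' c',
      Runs W p (mem { σ with r := r, i := j, s := s, cnt := c, vA := interleave l.num inst₀ })
        (mem { σ with r := r', i := j, s := s', cnt := c'
                      vA := interleave l.num (Function.update inst₀ j (inst' j)) }) (T j)) :
    ∃ r s c, Runs W (forLoop 6 (par 0) p) σ.mem
      (mem { σ with r := r, i := l.num, s := s, cnt := c, vA := interleave l.num inst' })
      ((∑ j ∈ Finset.range l.num, T j) + 20 * (l.num + 1)) := by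
  let mix : ℕ → ℕ → Mem := fun k j => if j < k then inst' j else inst j
  have hmix : ∀ k, Function.update (mix k) k (inst' k) = mix (k + 1) := by
    intro k
    funext j
    by_cases hj : j = k
    · subst hj; simp [mix]
    · rw [Function.update_of_ne hj]
      simp only [mix, show j < k + 1 ↔ j < k by omega]
  have hend : mix l.num = inst' := by
    funext j
    by_cases hj : j < l.num
    · simp [mix, hj]
    · simp [mix, hj, hge j (not_lt.1 hj)]
  have h0 : mix 0 = inst := by funext j; simp [mix]
  obtain ⟨m', ⟨r, s, c, rfl⟩, hR⟩ := Runs.forLoop_inv (W := W) (D := 80) hW (r := 6) (cnt := par 0)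
    (p := p) (m := σ.mem) (fun k m => ∃ r s c, m = mem { σ with
      r := r, i := k, s := s, cnt := c, vA := interleave l.num (mix k) }) l.num T (by decide)
    hY.num ⟨σ.r, σ.s, σ.cnt, by rw [set_i, h0, ← hvA]⟩
    (by
      rintro k hk _ ⟨r, s, c, rfl⟩
      exact ⟨rfl, by simp [Expr.ReadsLt, Expr.val, hp, hY.num], by simp [Expr.val, hp]⟩)
    (by
      rintro k hk _ ⟨r, s, c, rfl⟩
      obtain ⟨r', s', c', h⟩ := h k hk r s c (mix k) (by simp [mix])
      exact ⟨_, h, rfl, r', s', c', by rw [set_i, hmix]⟩)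
  refine ⟨r, s, c, ?_⟩
  rw [hend] at hR
  refine hR.mono (Nat.add_le_add_left (Nat.mul_le_mul_right _ (by decide)) _)

theorem runs_count (hW : (Y + 2) ^ 80 ≤ W) (hp : σ.pend = l.params) (hY : l.Bounded Y)
    (hvA : σ.vA = interleave l.num inst) (hinst : ∀ j < l.num, inst j 1 1 < Y) (hi : σ.i < l.nb)
    (hs : σ.s = 0) :
    Runs W (forLoop 5 (par 4) (.put 7 (.lit 0) (.op .add (reg 7)
      (.op .eq (.get (fA 1) (.op .add (par 0) (.op .add (.op .mul (reg 6) (par 4)) (reg 5))))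
        (.lit 1))))) σ.mem (mem { σ with r := l.rep, s := ones l.rep inst σ.i })
        (40 * (l.rep + 1)) := by
  let f : ℕ → ℕ := fun k => ∑ r ∈ Finset.range k, if inst (σ.i * l.rep + r) 1 1 = 1 then 1 else 0
  have hf : ∀ k, f k ≤ k := by
    intro k
    refine (Finset.sum_le_card_nsmul _ _ 1 fun r _ => by split <;> omega).trans ?_
    simp
  have hlt : ∀ k < l.rep, σ.i * l.rep + k < l.num := by
    intro k hk
    have : (σ.i + 1) * l.rep ≤ l.nb * l.rep := Nat.mul_le_mul_right _ hi
    rw [Nat.succ_mul] at this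
    unfold Layout.num
    omega
  have hread : ∀ k < l.rep, σ.vA 1 (l.num + (σ.i * l.rep + k)) = inst (σ.i * l.rep + k) 1 1 := by
    intro k hk
    have := interleave_apply (hlt k hk) inst 1 1
    rw [one_mul] at this
    rw [hvA, this]
  have hrep := hY.rep
  have hnum := hY.num
  have hnb := hY.nb
  have := Runs.forLoop hW (r := 5) (cnt := par 4)
    (p := .put 7 (.lit 0) (.op .add (reg 7)
      (.op .eq (.get (fA 1) (.op .add (par 0) (.op .add (.op .mul (reg 6) (par 4)) (reg 5))))
        (.lit 1))))
    (m := σ.mem) (fun k => mem { σ with r := k, s := f k })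
    (fun k => mem { σ with r := k, s := f (k + 1) }) l.rep
    (fun _ => 20) (fun k => 40 * k) (by decide) ?_ hY.rep (fun _ _ => rfl) (fun _ _ => rfl)
    ?_ ?_ ?_ (fun r _ => set_r _ _) ?_ (T' := 40 * (l.rep + 1)) ?_
  · exact this
  · rw [set_r]
    simp [f, hs]
  · intro k _
    simp [Expr.ReadsLt, Expr.val, hp, hrep]
  · intro k _
    simp [Expr.val, hp]
  · intro k hk
    have h1 := hf k
    have h2 := hinst _ (hlt k hk)
    refine Runs.put hW ?_ ?_ (by decide) (by decide)
    · simp only [Expr.val, BinOp.eval, mem_s, mem_fA, mem_r, mem_i, mem_pend, hp, Layout.params_0,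
        Layout.params_4, hread k hk]
      rw [show f (k + 1) = f k + if inst (σ.i * l.rep + k) 1 1 = 1 then 1 else 0 from
        Finset.sum_range_succ _ _]
      exact set_s _ _
    · simp [Expr.ReadsLt, Expr.val, BinOp.eval, hp, hread k hk, h2, hrep, hnum]; omega
  · intro k _
    simp only [Expr.cost]; omega
  · simp only [Expr.cost]; omega

/-- The output of instance `j` is cell `1` of its array `1`, that is, cell `num + j` of array `1` of the
interleaved memory. -/
theorem runs_majorityProg (hW : (Y + 2) ^ 80 ≤ W) (hp : σ.pend = l.params) (hY : l.Bounded Y)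
    (hvA : σ.vA = interleave l.num inst) (hinst : ∀ j < l.num, inst j 1 1 < Y) :
    ∃ r i s c out, Runs W majorityProg σ.mem
        (mem { σ with r := r, i := i, s := s, acc := c, out := out })
        (200 * (l.num + l.nb + 1)) ∧
      out 0 = 1 ∧ out 1 = if 0 < majorities l.rep inst l.nb then 1 else 0 := by
  have hnb := hY.nb
  have hrep := hY.rep
  have hmaj : ∀ k, majorities l.rep inst k ≤ k := by
    intro k
    refine (Finset.sum_le_card_nsmul _ _ 1 fun r _ => by split <;> omega).trans ?_
    simp
  have hones : ∀ b, ones l.rep inst b ≤ l.rep := by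
    intro b
    refine (Finset.sum_le_card_nsmul _ _ 1 fun r _ => by split <;> omega).trans ?_
    simp
  have h1 : Runs W (.put 10 (.lit 0) (.lit 0)) σ.mem (mem { σ with acc := 0 }) 3 :=
    Runs.put hW (set_acc _ _) (by simp [Expr.ReadsLt]) (by decide) (by decide)
  obtain ⟨m', ⟨r, s, rfl⟩, hR⟩ := Runs.forLoop_inv (W := W) (D := 80) hW (r := 6) (cnt := par 5)
    (p := .put 7 (.lit 0) (.lit 0) ;;
      forLoop 5 (par 4) (.put 7 (.lit 0) (.op .add (reg 7)
        (.op .eq (.get (fA 1) (.op .add (par 0) (.op .add (.op .mul (reg 6) (par 4)) (reg 5))))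
          (.lit 1)))) ;;
      .put 10 (.lit 0) (.op .add (reg 10) (.op .lt (par 4) (.op .mul (.lit 2) (reg 7)))))
    (m := mem { σ with acc := 0 }) (fun k m => ∃ r s, m = mem { σ with
      r := r, i := k, s := s, acc := majorities l.rep inst k }) l.nb
    (fun _ => 40 * (l.rep + 1) + 20) (by decide)
    hY.nb ⟨σ.r, σ.s, by rw [set_i]; rfl⟩
    (by
      rintro k hk _ ⟨r, s, rfl⟩
      exact ⟨rfl, by simp [Expr.ReadsLt, Expr.val, hp, hnb], by simp [Expr.val, hp]⟩)
    (by
      rintro k hk _ ⟨r, s, rfl⟩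
      have b1 : Runs W (.put 7 (.lit 0) (.lit 0)) (mem { σ with
          r := r, i := k, s := s, acc := majorities l.rep inst k }) (mem { σ with
          r := r, i := k, s := 0, acc := majorities l.rep inst k }) 3 :=
        Runs.put hW (set_s _ _) (by simp [Expr.ReadsLt]) (by decide) (by decide)
      have b2 := runs_count (l := l) (inst := inst) (σ := { σ with
          r := r, i := k, s := 0, acc := majorities l.rep inst k }) hW hp hY hvA hinst hk rfl
      have b3 : Runs W (.put 10 (.lit 0) (.op .add (reg 10)
            (.op .lt (par 4) (.op .mul (.lit 2) (reg 7))))) (mem { σ with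
          r := l.rep, i := k, s := ones l.rep inst k, acc := majorities l.rep inst k }) (mem { σ with
          r := l.rep, i := k, s := ones l.rep inst k, acc := majorities l.rep inst (k + 1) }) 15 := by
        have := hmaj k
        have := hones k
        refine Runs.put hW ?_ ?_ (by decide) (by decide)
        · simp only [Expr.val, BinOp.eval, mem_s, mem_acc, mem_pend, hp, Layout.params_4]
          rw [show majorities l.rep inst (k + 1) = majorities l.rep inst k +
            if l.rep < 2 * ones l.rep inst k then 1 else 0 from Finset.sum_range_succ _ _]
          exact set_acc _ _
        · simp [Expr.ReadsLt, Expr.val, hp, hrep]; omega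
      exact ⟨_, (b1.seq (b2.seq b3)).mono (by omega), rfl, _, _, set_i _ _⟩)
  have h3 : Runs W (.put 1 (.lit 0) (.lit 1)) (mem { σ with
      r := r, i := l.nb, s := s, acc := majorities l.rep inst l.nb }) (mem { σ with
      r := r, i := l.nb, s := s, acc := majorities l.rep inst l.nb
      out := Function.update σ.out 0 1 }) 3 :=
    Runs.put hW (set_out _ _ _) (by simp [Expr.ReadsLt]) (by decide) (by decide)
  have h4 : Runs W (.put 1 (.lit 1) (.op .lt (.lit 0) (reg 10))) (mem { σ with
      r := r, i := l.nb, s := s, acc := majorities l.rep inst l.nb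
      out := Function.update σ.out 0 1 }) (mem { σ with
      r := r, i := l.nb, s := s, acc := majorities l.rep inst l.nb
      out := Function.update (Function.update σ.out 0 1) 1
        (if 0 < majorities l.rep inst l.nb then 1 else 0) }) 8 := by
    have := hmaj l.nb
    refine Runs.put hW ?_ ?_ (by decide) (by decide)
    · simp only [Expr.val, BinOp.eval, mem_acc]
      exact set_out _ _ _
    · simp [Expr.ReadsLt, Expr.val]; omega
  refine ⟨r, l.nb, s, _, _, (h1.seq (hR.seq (h3.seq h4))).mono ?_, by simp, by simp⟩
  have e : (∑ _ ∈ Finset.range l.nb, (40 * (l.rep + 1) + 20)) = 40 * l.num + 60 * l.nb := by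
    rw [Finset.sum_const, Finset.card_range, smul_eq_mul, Layout.num]; ring
  rw [e]
  simp only [Expr.cost]
  omega

theorem runs_splitStep (hW : (Y + 2) ^ 80 ≤ W) (hp : σ.pend = l.params) (hY : l.Bounded Y)
    (hvA : σ.vA = interleave l.num inst) (hge : ∀ j, l.num ≤ j → inst' j = inst j)
    (hV : V * l.num + l.num + V ≤ W) (hinst : ∀ j < l.num, inst' j 1 1 < Y)
    (x : List ℕ) (hx : x.length < Y) (hxY : ∀ y ∈ x, y < Y) (hxl : x.length = 2 * l.n)
    (hmsg : ∀ c, σ.msg c < Y) (y₁ y₂ : ℕ → List ℕ)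
    (hl₁ : ∀ j < l.num, (y₁ j).length = l.n₁) (hl₂ : ∀ j < l.num, (y₂ j).length = l.n₂)
    (hy₁ : ∀ j < l.num, ∀ k < l.n₁, cell (y₁ j) (k + 1) =
      if l.row j + k < l.n then cell x (l.row j + k + 1) else 0)
    (hy₂ : ∀ j < l.num, ∀ k < l.n₂, cell (y₂ j) (k + 1) =
      if l.col j + k < l.n then cell x (l.n + (l.col j + k) + 1) else 0)
    {astep : Prog} (t : ℕ → ℕ)
    (hE : ∀ j < l.num, Exec V astep ((inst j).load 0 (y₁ j ++ y₂ j)) (inst' j) (t j)) :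
    ∃ σ' : GState, Runs W (splitStep astep) (σ.mem.load 0 x) σ'.mem
        (600 * ((l.num + 1) * (l.n₁ + l.n₂ + 1) + l.nb) + 7 * ∑ j ∈ Finset.range l.num, t j) ∧
      σ'.mem.output = [if 0 < majorities l.rep inst' l.nb then 1 else 0] ∧
      σ'.pend = l.params ∧ σ'.vA = interleave l.num inst' ∧ ∀ c, σ'.msg c < Y := by
  rw [load_msg]
  obtain ⟨σ₁, hσ₁⟩ : ∃ σ₁ : GState, { σ with msg := fillArr σ.msg 0 (cell x) (x.length + 1) } = σ₁ :=
    ⟨_, rfl⟩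
  have hm₁ : ∀ c, c ≤ x.length → σ₁.msg c = cell x c := by
    intro c hc
    rw [← hσ₁]
    simp [fillArr]; omega
  have hmY : ∀ c, σ₁.msg c < Y := by
    intro c
    rw [← hσ₁]
    simp only [fillArr]
    split
    · exact cell_lt hx hxY _
    · exact hmsg _
  have hp₁ : σ₁.pend = l.params := by rw [← hσ₁]; exact hp
  have hvA₁ : σ₁.vA = interleave l.num inst := by rw [← hσ₁]; exact hvA
  rw [hσ₁]
  obtain ⟨r, s, c, h1⟩ := runs_forInst (p := feedProg astep) hW hp₁ hY hvA₁ hge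
    (fun j => 100 * (l.n₁ + l.n₂ + 3) + 7 * t j) fun j hj r s c inst₀ h0 =>
    ⟨_, _, _, runs_feedProg
      (σ := { σ₁ with r := r, i := j, s := s, cnt := c, vA := interleave l.num inst₀ })
      hW hp₁ hY rfl hj rfl hmY hV (y₁ j) (y₂ j) (hl₁ j hj) (hl₂ j hj)
      (fun k hk => by
        rw [hy₁ j hj k hk]
        split
        · rw [one_mul]
          exact ((hm₁ _ (by dsimp only; omega)).trans (by congr 1; dsimp only; omega)).symm
        · rw [zero_mul])
      (fun k hk => by
        rw [hy₂ j hj k hk]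
        split
        · rw [one_mul]
          exact ((hm₁ _ (by dsimp only; omega)).trans (by congr 1; dsimp only; omega)).symm
        · rw [zero_mul]) (by rw [h0]; exact hE j hj)⟩
  obtain ⟨r', i', s', c', out, h2, ho0, ho1⟩ := runs_majorityProg (inst := inst')
    (σ := { σ₁ with r := r, i := l.num, s := s, cnt := c, vA := interleave l.num inst' })
    hW hp₁ hY rfl hinst
  refine ⟨_, (h1.seq h2).mono ?_, Mem.output_of_single ho0 ho1, hp₁, rfl, hmY⟩
  rw [Finset.sum_add_distrib, Finset.sum_const, Finset.card_range, smul_eq_mul,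
    ← Finset.mul_sum (f := t)]
  have e : (l.num + 1) * (l.n₁ + l.n₂ + 1) = l.num * (l.n₁ + l.n₂) + l.num + l.n₁ + l.n₂ + 1 := by
    ring
  have e' : l.num * (100 * (l.n₁ + l.n₂ + 3)) = 100 * (l.num * (l.n₁ + l.n₂)) + 300 * l.num := by
    ring
  rw [e, e']
  omega

end Runs

/-! ### Computing the layout -/

/-- The largest `r ≥ 1` with `r ^ k ≤ n`, and `1` if there is none. -/
def rootFloor (k n : ℕ) : ℕ := max 1 (Nat.findGreatest (fun r => r ^ k ≤ n) n)

theorem rootFloor_pos (k n : ℕ) : 0 < rootFloor k n :=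
  Nat.lt_of_lt_of_le Nat.one_pos (le_max_left _ _)

/-- The test by which `layoutProg` decides whether to increase a candidate `r` for the root. -/
theorem succ_pow_lt_iff {k n r : ℕ} (hk : 0 < k) :
    (r + 1) ^ k < n + 1 ↔ r < Nat.findGreatest (fun r => r ^ k ≤ n) n := by
  rw [Nat.lt_succ_iff]
  constructor
  · intro h
    exact Nat.le_findGreatest ((Nat.le_self_pow hk.ne' _).trans h) h
  · intro h
    have h1 : (Nat.findGreatest (fun r => r ^ k ≤ n) n) ^ k ≤ n :=
      Nat.findGreatest_of_ne_zero (P := fun r => r ^ k ≤ n) rfl (by omega)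
    exact (Nat.pow_le_pow_left h k).trans h1

theorem rootFloor_pow_le {k n : ℕ} (hn : 0 < n) : rootFloor k n ^ k ≤ n := by
  unfold rootFloor
  rcases Nat.eq_zero_or_pos (Nat.findGreatest (fun r => r ^ k ≤ n) n) with h | h
  · rw [h]; simpa using Nat.succ_le_of_lt hn
  · rw [max_eq_right h]
    exact Nat.findGreatest_of_ne_zero (P := fun r => r ^ k ≤ n) rfl h.ne'

theorem lt_rootFloor_succ_pow {k n : ℕ} (hk : 0 < k) : n < (rootFloor k n + 1) ^ k := by
  by_contra! h
  have := (succ_pow_lt_iff hk).1 (Nat.lt_succ_of_le h)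
  unfold rootFloor at this
  omega

/-- The blocks for an `n × n` matrix have about `n ^ (1 / k)` columns. The number of copies is
logarithmic in `n`, so that in most cases the majority of the answers is correct for all blocks. -/
noncomputable def splitLayout (γ : ℝ) (k coinExp n : ℕ) : Layout :=
  let n₂ := rootFloor k n
  let n₁ := rows γ n₂
  let nb₂ := (n + (n₂ - 1)) / n₂
  { n₁ := n₁, n₂ := n₂, nb₂ := nb₂, rep := 24 * Nat.clog 2 (n + 2) + 24,
    nb := (n + (n₁ - 1)) / n₁ * nb₂, n := n, coins := (n₁ + n₂ + n + 2) ^ coinExp }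

/-- Compute the layout. -/
def layoutProg (univ : Prog) (k coinExp : ℕ) : Prog :=
  .put 12 (.lit 6) (.get 2 (.lit 1)) ;; .put 12 (.lit 2) (.lit 1) ;;
  forLoop 5 (par 6) (.put 12 (.lit 2) (.op .add (par 2)
    (.op .lt (powE (.op .add (par 2) (.lit 1)) k) (.op .add (par 6) (.lit 1))))) ;;
  .put (fU 2) (.lit 0) (.lit 1) ;; .put (fU 2) (.lit 1) (par 2) ;; univ.embed fU id ;;
  .put 12 (.lit 1) (.get (fU 1) (.lit 1)) ;;
  .put 12 (.lit 3) (.op .div (.op .add (par 6) (.op .sub (par 2) (.lit 1))) (par 2)) ;;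
  .put 12 (.lit 5) (.op .mul
    (.op .div (.op .add (par 6) (.op .sub (par 1) (.lit 1))) (par 1)) (par 3)) ;;
  .put 10 (.lit 0) (.lit 1) ;;
  forLoop 5 (.op .add (par 6) (.lit 2))
    (.put 9 (.lit 0) (.op .add (reg 9) (.op .lt (reg 10) (.op .add (par 6) (.lit 2)))) ;;
      .put 10 (.lit 0) (.op .mul (reg 10)
        (.op .add (.lit 1) (.op .lt (reg 10) (.op .add (par 6) (.lit 2)))))) ;;
  .put 12 (.lit 4) (.op .add (.op .mul (.lit 24) (reg 9)) (.lit 24)) ;;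
  .put 12 (.lit 0) (.op .mul (par 5) (par 4)) ;;
  .put 12 (.lit 7) (powE (.op .add (.op .add (.op .add (par 1) (par 2)) (par 6)) (.lit 2)) coinExp)

/-- The preprocessing program: split the matrix, and run the preprocessing of all instances. -/
def splitPrep (univ aprep : Prog) (k coinExp : ℕ) : Prog :=
  layoutProg univ k coinExp ;; forLoop 6 (par 0) (prepareProg aprep)

section Runs

open GState

variable {W Y D : ℕ}

/-- The parameters before the block is computed, with `r` columns. -/
def params₀ (n r : ℕ) : ℕ → ℕ := fun c => if c = 6 then n else if c = 2 then r else 0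

/-- The loop adds `1` to the candidate, beginning with `1`, as long as the root is not reached. It makes
`n` iterations in any case, the last of which have no effect. -/
theorem runs_rootLoop {k n : ℕ} (hD : 80 + 8 * k ≤ D) (hW : (Y + 2) ^ D ≤ W) (hk : 0 < k)
    (hn : n < Y) (σ : GState) (hp : σ.pend = params₀ n 1) :
    ∃ r, Runs W (forLoop 5 (par 6) (.put 12 (.lit 2) (.op .add (par 2)
      (.op .lt (powE (.op .add (par 2) (.lit 1)) k) (.op .add (par 6) (.lit 1)))))) σ.mem
      (mem { σ with r := r, pend := params₀ n (rootFloor k n) })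
      ((20 + 5 * k + 20) * (n + 1)) := by
  set R := Nat.findGreatest (fun r => r ^ k ≤ n) n with hR
  have hRn : R ≤ n := Nat.findGreatest_le n
  have hroot : rootFloor k n = max 1 R := rfl
  obtain ⟨m', rfl, h⟩ := Runs.forLoop_inv hW (r := 5) (cnt := par 6)
    (p := .put 12 (.lit 2) (.op .add (par 2)
      (.op .lt (powE (.op .add (par 2) (.lit 1)) k) (.op .add (par 6) (.lit 1)))))
    (m := σ.mem) (fun j m => m = mem { σ with r := j, pend := params₀ n (min (j + 1) (max 1 R)) })
    n (fun _ => 20 + 5 * k) ⟨rfl, by simp [Expr.deg]; omega⟩ hn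
    (by rw [set_r, show min (0 + 1) (max 1 R) = 1 by omega, ← hp])
    (by
      rintro j hj _ rfl
      exact ⟨rfl, by simp [Expr.ReadsLt, Expr.val, params₀, hn], by simp [Expr.val, params₀]⟩)
    (by
      rintro j hj _ rfl
      refine ⟨mem { σ with r := j, pend := params₀ n (min (j + 1 + 1) (max 1 R)) },
        Runs.put hW ?_ ⟨trivial, ?_, powE_readsLt ?_ _, ?_⟩
          ⟨⟨rfl, by simp [Expr.deg]; omega⟩, by simp [Expr.arith, BinOp.arith, powE_arith],
            by simp only [Expr.deg, powE_deg]; omega⟩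
          (by simp only [Expr.cost, powE_cost]; omega), rfl, set_r _ _⟩
      · simp only [Expr.val, BinOp.eval, powE_val, mem_pend, params₀]
        norm_num
        rw [set_pend]
        congr 2
        funext c
        by_cases hc : c = 2
        · subst hc
          have := succ_pow_lt_iff (k := k) (n := n) (r := min (j + 1) (max 1 R)) hk
          rw [← hR, Nat.lt_succ_iff] at this
          simp only [this, Function.update_self]
          rw [show params₀ n (min (j + 1 + 1) (max 1 R)) 2 = min (j + 1 + 1) (max 1 R) from rfl]
          split <;> omega
        · simp [params₀, hc]
      · simp [Expr.ReadsLt, Expr.val, params₀]; omega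
      · simp [Expr.ReadsLt, Expr.val, params₀]; omega
      · simp [Expr.ReadsLt, Expr.val, params₀, hn])
  rw [show min (n + 1) (max 1 R) = rootFloor k n by omega] at h
  refine ⟨n, h.mono ?_⟩
  rw [Finset.sum_const, Finset.card_range, smul_eq_mul]
  simp only [Expr.cost]
  nlinarith

/-- The loop doubles the register `10` and increases the register `9`, as long as the former is smaller
than `n + 2`. It makes `n + 2` iterations in any case, the last of which have no effect. -/
theorem runs_clogLoop {n : ℕ} (hW : (Y + 2) ^ 80 ≤ W) (hn : 2 * n + 8 < Y) (σ : GState)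
    (hp : σ.pend 6 = n) (hlen : σ.len = 0) (hacc : σ.acc = 1) :
    ∃ r a, Runs W (forLoop 5 (.op .add (par 6) (.lit 2))
      (.put 9 (.lit 0) (.op .add (reg 9) (.op .lt (reg 10) (.op .add (par 6) (.lit 2)))) ;;
      .put 10 (.lit 0) (.op .mul (reg 10)
        (.op .add (.lit 1) (.op .lt (reg 10) (.op .add (par 6) (.lit 2))))))) σ.mem
      (mem { σ with r := r, len := Nat.clog 2 (n + 2), acc := a }) (60 * (n + 3)) := by
  set L := Nat.clog 2 (n + 2) with hL
  have hL1 : L ≤ n + 2 := Nat.clog_le_of_le_pow (Nat.lt_two_pow_self).le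
  have hstep : ∀ j, (2 ^ min j L < n + 2 ↔ j < L) := by
    intro j
    rw [← Nat.lt_clog_iff_pow_lt (by norm_num), ← hL]
    omega
  have hpow : 2 ^ L < Y := by
    have : 2 ^ (L - 1) < n + 2 :=
      Nat.pow_pred_clog_lt_self (b := 2) (x := n + 2) (by norm_num) (by norm_num)
    have hLpos : 0 < L := Nat.clog_pos (by norm_num) (by omega)
    have e : 2 ^ L = 2 * 2 ^ (L - 1) := by rw [← pow_succ', Nat.sub_add_cancel hLpos]
    omega
  have hpow' : ∀ j, 2 ^ min j L < Y := fun j =>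
    (Nat.pow_le_pow_right (by norm_num) (min_le_right _ _)).trans_lt hpow
  obtain ⟨m', rfl, h⟩ := Runs.forLoop_inv hW (r := 5) (cnt := .op .add (par 6) (.lit 2))
    (p := .put 9 (.lit 0) (.op .add (reg 9) (.op .lt (reg 10) (.op .add (par 6) (.lit 2)))) ;;
      .put 10 (.lit 0) (.op .mul (reg 10)
        (.op .add (.lit 1) (.op .lt (reg 10) (.op .add (par 6) (.lit 2))))))
    (m := σ.mem) (fun j m => m = mem { σ with r := j, len := min j L, acc := 2 ^ min j L })
    (n + 2) (fun _ => 40) (by decide) (by omega)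
    (by
      rw [set_r]
      congr 1
      rw [← hlen]
      cases σ; simp_all)
    (by
      rintro j hj _ rfl
      exact ⟨rfl, by simp [Expr.ReadsLt, Expr.val, hp]; omega,
        by simp [Expr.val, BinOp.eval, hp]⟩)
    (by
      rintro j hj _ rfl
      have := hpow' j
      have h1 : Runs W (.put 9 (.lit 0) (.op .add (reg 9)
          (.op .lt (reg 10) (.op .add (par 6) (.lit 2)))))
          (mem { σ with r := j, len := min j L, acc := 2 ^ min j L })
          (mem { σ with r := j, len := min (j + 1) L, acc := 2 ^ min j L }) 12 := by
        refine Runs.put hW ?_ ?_ (by decide) (by decide)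
        · simp only [Expr.val, BinOp.eval, mem_len, mem_acc, mem_pend, hp, hstep]
          rw [show min (j + 1) L = min j L + if j < L then 1 else 0 by split <;> omega]
          exact set_len _ _
        · simp [Expr.ReadsLt, Expr.val, hp, this]; omega
      have h2 : Runs W (.put 10 (.lit 0) (.op .mul (reg 10)
          (.op .add (.lit 1) (.op .lt (reg 10) (.op .add (par 6) (.lit 2))))))
          (mem { σ with r := j, len := min (j + 1) L, acc := 2 ^ min j L })
          (mem { σ with r := j, len := min (j + 1) L, acc := 2 ^ min (j + 1) L }) 14 := by
        refine Runs.put hW ?_ ?_ (by decide) (by decide)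
        · simp only [Expr.val, BinOp.eval, mem_acc, mem_pend, hp, hstep]
          rw [show 2 ^ min (j + 1) L = 2 ^ min j L * (1 + if j < L then 1 else 0) by
            split
            · rw [show min (j + 1) L = min j L + 1 by omega, pow_succ]
            · rw [show min (j + 1) L = min j L by omega]; ring]
          exact set_acc _ _
        · simp [Expr.ReadsLt, Expr.val, hp, this]; omega
      exact ⟨_, (h1.seq h2).mono (by norm_num), rfl, set_r _ _⟩)
  rw [show min (n + 2) L = L by omega] at h
  refine ⟨n + 2, _, h.mono ?_⟩
  rw [Finset.sum_const, Finset.card_range, smul_eq_mul]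
  simp only [Expr.cost]
  omega

/-- The number of rows comes from the procedure `univ` of the reduction, since `γ` need not be computable
otherwise. -/
theorem runs_layoutProg {WU k coinExp n : ℕ} {γ : ℝ}
    (hD : 80 + 8 * k + 22 * coinExp ≤ D) (hW : (Y + 2) ^ D ≤ W) (hU : WU ≤ W) (hk : 0 < k)
    (hY : (splitLayout γ k coinExp n).Bounded Y) (hn : 2 * n + 8 < Y) (mw bits : List ℕ)
    {univ : Prog} {mU : Mem} {tU : ℕ} (hunivE : Exec WU univ (Mem.init [[rootFloor k n]]) mU tU)
    (hmU : mU 1 1 = rows γ (rootFloor k n)) :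
    ∃ r len acc, Runs W (layoutProg univ k coinExp) (start [n] mw bits).mem
      (mem { start [n] mw bits with
        r := r, len := len, acc := acc, vU := mU, pend := (splitLayout γ k coinExp n).params })
      ((200 + 20 * k + 10 * coinExp) * (n + 3) + tU) := by
  obtain ⟨l, hl⟩ : ∃ l, splitLayout γ k coinExp n = l := ⟨_, rfl⟩
  have hn₂ : rootFloor k n = l.n₂ := by rw [← hl]; rfl
  have hn₁ : rows γ (rootFloor k n) = l.n₁ := by rw [← hl]; rfl
  have hnb₂ : (n + (l.n₂ - 1)) / l.n₂ = l.nb₂ := by rw [← hl]; rfl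
  have hnb : (n + (l.n₁ - 1)) / l.n₁ * l.nb₂ = l.nb := by rw [← hl]; rfl
  have hrep : 24 * Nat.clog 2 (n + 2) + 24 = l.rep := by rw [← hl]; rfl
  have hcoins : (l.n₁ + l.n₂ + n + 2) ^ coinExp = l.coins := by rw [← hl]; rfl
  have hln : l.n = n := by rw [← hl]; rfl
  rw [hl] at hY ⊢
  rw [hn₁] at hmU
  obtain ⟨hY0, hY1, hY2, hY3, hY4, hY5, -, hY7, -, -, -⟩ := hY
  have hW80 : (Y + 2) ^ 80 ≤ W := (Nat.pow_le_pow_right (by omega) (by omega)).trans hW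
  set σ := start [n] mw bits with hσ
  have h1 : Runs W (.put 12 (.lit 6) (.get 2 (.lit 1))) σ.mem
      (mem { σ with pend := fun c => if c = 6 then n else 0 }) 4 := by
    refine Runs.put hW80 ?_ ?_ (by decide) (by decide)
    · rw [set_pend]
      congr 2
      funext c
      by_cases hc : c = 6
      · subst hc; simp [Expr.val, σ, start, cell]
      · simp [hc, σ, start, Expr.val]
    · simp [Expr.ReadsLt, Expr.val, σ, start, cell]; omega
  have h2 : Runs W (.put 12 (.lit 2) (.lit 1)) (mem { σ with pend := fun c => if c = 6 then n else 0 })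
      (mem { σ with pend := params₀ n 1 }) 3 := by
    refine Runs.put hW80 ?_ (by simp [Expr.ReadsLt]) (by decide) (by decide)
    rw [set_pend]
    congr 2
    funext c
    by_cases hc : c = 2
    · subst hc; simp [Expr.val, params₀]
    · simp [hc, params₀, Expr.val]
  obtain ⟨r, h3⟩ := runs_rootLoop (D := D) (by omega) hW hk (show n < Y by omega)
    { σ with pend := params₀ n 1 } rfl
  rw [hn₂] at h3 hunivE
  let p₀ := params₀ n l.n₂
  let p₁ := Function.update p₀ 1 l.n₁
  let p₃ := Function.update p₁ 3 l.nb₂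
  let p₅ := Function.update p₃ 5 l.nb
  let p₄ := Function.update p₅ 4 l.rep
  let p₆ := Function.update p₄ 0 l.num
  have hp₇ : Function.update p₆ 7 l.coins = l.params := by
    funext c
    rcases c with _ | _ | _ | _ | _ | _ | _ | _ | c <;>
      simp [p₆, p₄, p₅, p₃, p₁, p₀, params₀, Layout.params, hln]
  obtain ⟨σ₃, hσ₃⟩ : ∃ σ₃ : GState, { σ with r := r, pend := p₀ } = σ₃ := ⟨_, rfl⟩
  have h4 : Runs W (.put (fU 2) (.lit 0) (.lit 1)) (mem { σ with r := r, pend := p₀ })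
      (mem { σ with r := r, pend := p₀, vU := σ.vU.set 2 0 1 }) 3 :=
    Runs.put hW80 (set_fU _ _ _ _) (by simp [Expr.ReadsLt]) (by decide) (by decide)
  have h5 : Runs W (.put (fU 2) (.lit 1) (par 2))
      (mem { σ with r := r, pend := p₀, vU := σ.vU.set 2 0 1 })
      (mem { σ with r := r, pend := p₀, vU := Mem.init [[l.n₂]] }) 4 := by
    refine Runs.put hW80 ?_ ?_ (by decide) (by decide)
    · rw [set_fU]
      congr 2
      funext a i
      by_cases ha : a = 2
      · subst ha
        rw [Mem.init_apply _ 0]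
        rcases i with _ | _ | i <;> simp [Mem.set, Expr.val, cell, σ, start, p₀, params₀]
      · have : Mem.init [[l.n₂]] a = fun _ => 0 := by
          by_cases h : a < 2
          · exact Mem.init_zero _ _ h
          · exact Mem.init_of_le _ _ (by simp; omega)
        simp [Mem.set, ha, this, σ, start]
    · simpa [Expr.ReadsLt, Expr.val, p₀, params₀] using hY2
  have h6 : Runs W (univ.embed fU id) (mem { σ with r := r, pend := p₀, vU := Mem.init [[l.n₂]] })
      (mem { σ with r := r, pend := p₀, vU := mU }) tU :=
    runs_U { σ with r := r, pend := p₀, vU := Mem.init [[l.n₂]] } hU hunivE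
  have h7 : Runs W (.put 12 (.lit 1) (.get (fU 1) (.lit 1)))
      (mem { σ with r := r, pend := p₀, vU := mU })
      (mem { σ with r := r, pend := p₁, vU := mU }) 4 := by
    refine Runs.put hW80 ?_ ?_ (by decide) (by decide)
    · simp only [Expr.val, mem_fU, hmU]; exact set_pend _ _ _
    · simpa [Expr.ReadsLt, Expr.val, hmU] using hY1
  have h8 : Runs W (.put 12 (.lit 3) (.op .div (.op .add (par 6) (.op .sub (par 2) (.lit 1))) (par 2)))
      (mem { σ with r := r, pend := p₁, vU := mU })
      (mem { σ with r := r, pend := p₃, vU := mU }) 12 := by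
    refine Runs.put hW80 ?_ ?_ (by decide) (by decide)
    · simp only [p₃, ← hnb₂]; exact set_pend _ _ _
    · simp [Expr.ReadsLt, Expr.val, p₁, p₀, params₀]; omega
  have h9 : Runs W (.put 12 (.lit 5) (.op .mul
        (.op .div (.op .add (par 6) (.op .sub (par 1) (.lit 1))) (par 1)) (par 3)))
      (mem { σ with r := r, pend := p₃, vU := mU })
      (mem { σ with r := r, pend := p₅, vU := mU }) 15 := by
    refine Runs.put hW80 ?_ ?_ (by decide) (by decide)
    · simp only [p₅, ← hnb]; exact set_pend _ _ _
    · simp [Expr.ReadsLt, Expr.val, p₃, p₁, p₀, params₀]; omega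
  have h10 : Runs W (.put 10 (.lit 0) (.lit 1)) (mem { σ with r := r, pend := p₅, vU := mU })
      (mem { σ with r := r, pend := p₅, vU := mU, acc := 1 }) 3 :=
    Runs.put hW80 (set_acc _ _) (by simp [Expr.ReadsLt]) (by decide) (by decide)
  obtain ⟨r', a, h11⟩ := runs_clogLoop hW80 hn
    { σ with r := r, pend := p₅, vU := mU, acc := 1 } rfl rfl rfl
  obtain ⟨L, hL⟩ : ∃ L, Nat.clog 2 (n + 2) = L := ⟨_, rfl⟩
  rw [hL] at h11 hrep
  have h12 : Runs W (.put 12 (.lit 4) (.op .add (.op .mul (.lit 24) (reg 9)) (.lit 24)))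
      (mem { σ with r := r', pend := p₅, vU := mU, len := L, acc := a })
      (mem { σ with r := r', pend := p₄, vU := mU, len := L, acc := a }) 10 := by
    refine Runs.put hW80 ?_ ?_ (by decide) (by decide)
    · simp only [p₄, ← hrep]; exact set_pend _ _ _
    · simp [Expr.ReadsLt, Expr.val]; omega
  have h13 : Runs W (.put 12 (.lit 0) (.op .mul (par 5) (par 4)))
      (mem { σ with r := r', pend := p₄, vU := mU, len := L, acc := a })
      (mem { σ with r := r', pend := p₆, vU := mU, len := L, acc := a }) 8 := by
    refine Runs.put hW80 ?_ ?_ (by decide) (by decide)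
    · exact set_pend _ _ _
    · simp [Expr.ReadsLt, Expr.val, p₄, p₅, hY4, hY5]
  have h14 : Runs W (.put 12 (.lit 7)
        (powE (.op .add (.op .add (.op .add (par 1) (par 2)) (par 6)) (.lit 2)) coinExp))
      (mem { σ with r := r', pend := p₆, vU := mU, len := L, acc := a })
      (mem { σ with r := r', pend := l.params, vU := mU, len := L, acc := a })
      (10 + 11 * coinExp) := by
    refine Runs.put hW ?_ ⟨trivial, powE_readsLt ?_ _⟩ ⟨⟨rfl, by simp [Expr.deg]; omega⟩,
      ⟨powE_arith rfl _, ?_⟩⟩ ?_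
    · rw [powE_val, ← hp₇, ← hcoins]; exact set_pend _ _ _
    · simp [Expr.ReadsLt, Expr.val, p₆, p₄, p₅, p₃, p₁, p₀, params₀, hY1, hY2]; omega
    · rw [powE_deg]; simp [Expr.deg]; omega
    · rw [powE_cost]; simp [Expr.cost]; omega
  refine ⟨r', L, a, (h1.seq (h2.seq (h3.seq (h4.seq (h5.seq (h6.seq (h7.seq (h8.seq (h9.seq
    (h10.seq (h11.seq (h12.seq (h13.seq h14))))))))))))).mono ?_⟩
  nlinarith

end Runs

/-! ### A run of all instances -/

/-- The part of length `m` of a vector that begins at `r`, filled up with zeros. -/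
def subVec {n : ℕ} (u : Fin n → Bool) (r m : ℕ) : Fin m → Bool :=
  fun i => if h : r + i < n then u ⟨r + i, h⟩ else false

/-- The `m₁ × m₂` part of a matrix that begins at row `r` and column `c`, filled up with zeros. -/
def subMat {n : ℕ} (M : Matrix (Fin n) (Fin n) Bool) (r c m₁ m₂ : ℕ) :
    Matrix (Fin m₁) (Fin m₂) Bool :=
  fun i => if h : r + i < n then subVec (M ⟨r + i, h⟩) c m₂ else fun _ => false

theorem cell_bitWords {n : ℕ} (u : Fin n → Bool) {k : ℕ} (hk : k < n) :
    cell (bitWords u) (k + 1) = (u ⟨k, hk⟩).toNat := by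
  rw [cell_succ _ _ (by rwa [length_bitWords])]
  simp [bitWords]

theorem cell_matrixWords {m₁ m₂ : ℕ} (M : Matrix (Fin m₁) (Fin m₂) Bool) {a b : ℕ} (ha : a < m₁)
    (hb : b < m₂) : cell (matrixWords M) (a * m₂ + b + 1) = (M ⟨a, ha⟩ ⟨b, hb⟩).toNat := by
  have h := getElem?_flatMap_of_length (fun i => bitWords (M i)) m₂ (fun i => length_bitWords _)
    (List.finRange m₁) a b (by simpa using ha) hb
  have e : matrixWords M = (List.finRange m₁).flatMap fun i => bitWords (M i) := by
    rw [matrixWords, List.flatMap_def, List.ofFn_eq_map]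
  simp only [cell, Nat.add_sub_cancel, Nat.succ_ne_zero, if_false, List.getD_eq_getElem?_getD]
  rw [e, Nat.mul_comm, h]
  simp [bitWords, hb]

theorem cell_bitWords_subVec {n : ℕ} (u : Fin n → Bool) {r m k : ℕ} (hk : k < m) :
    cell (bitWords (subVec u r m)) (k + 1) =
      if r + k < n then cell (bitWords u) (r + k + 1) else 0 := by
  rw [cell_bitWords _ hk]
  unfold subVec
  by_cases h : r + k < n
  · simp [h, cell_bitWords u h]
  · simp [h]

theorem cell_matrixWords_subMat {n : ℕ} (M : Matrix (Fin n) (Fin n) Bool) {r c m₁ m₂ k : ℕ}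
    (hk : k < m₁ * m₂) :
    cell (matrixWords (subMat M r c m₁ m₂)) (k + 1) =
      ((if r + k / m₂ < n then 1 else 0) * (if c + k % m₂ < n then 1 else 0)) *
        cell (matrixWords M) (1 + ((r + k / m₂) * n + (c + k % m₂))) := by
  have hm : 0 < m₂ := Nat.pos_of_ne_zero fun h => by simp [h] at hk
  have ha : k / m₂ < m₁ := Nat.div_lt_of_lt_mul (by rwa [Nat.mul_comm])
  have hb : k % m₂ < m₂ := Nat.mod_lt _ hm
  have := cell_matrixWords (subMat M r c m₁ m₂) ha hb
  rw [Nat.div_add_mod'] at this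
  rw [this, Nat.add_comm 1]
  by_cases h1 : r + k / m₂ < n
  · by_cases h2 : c + k % m₂ < n
    · rw [cell_matrixWords M h1 h2]; simp [subMat, subVec, h1, h2]
    · simp [subMat, subVec, h1, h2]
  · simp [subMat, h1]

open GState in
/-- The run of the OuMv solver, given runs of all instances: `S j i` is the memory of instance `j`
before round `i`, with zero memory in place of instances that do not exist, and `bit j` are its
random bits. -/
theorem exists_split_run {γ : ℝ} {k coinExp n : ℕ} {l : Layout} (hl : splitLayout γ k coinExp n = l)
    {V W WU Y D : ℕ} (hD : 80 + 8 * k + 22 * coinExp ≤ D) (hW : (Y + 2) ^ D ≤ W) (hU : WU ≤ W)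
    (hk : 0 < k) (hY : l.Bounded Y) (hn : 2 * n + 8 < Y) (hnn : n * n < Y) (hV : V ≤ Y)
    (M : Matrix (Fin n) (Fin n) Bool) (uv : Fin n → (Fin n → Bool) × (Fin n → Bool))
    (bits : List ℕ) (hbits : ∀ y ∈ bits, y < 2) (hlen : bits.length < Y)
    {univ aprep astep : Prog} {mU : Mem} {tU : ℕ}
    (hunivE : Exec WU univ (Mem.init [[rootFloor k n]]) mU tU)
    (hmU : mU 1 1 = rows γ (rootFloor k n))
    (S : ℕ → ℕ → Mem) (tp : ℕ → ℕ) (ts : ℕ → ℕ → ℕ) (hS : ∀ j i, l.num ≤ j → S j i = fun _ _ => 0)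
    (bit : ℕ → List ℕ) (hbl : ∀ j, (bit j).length = l.coins)
    (hbc : ∀ j < l.num, ∀ i < l.coins, cell (bit j) (i + 1) = cell bits (1 + (j * l.coins + i)))
    (hprep : ∀ j < l.num, Exec V aprep (Mem.init
      [[l.n₁, l.n₂, l.n], matrixWords (subMat M (l.row j) (l.col j) l.n₁ l.n₂), bit j])
      (S j 0) (tp j))
    (hstep : ∀ j < l.num, ∀ i (hi : i < n), Exec V astep ((S j i).load 0
      (bitWords (subVec (uv ⟨i, hi⟩).1 (l.row j) l.n₁) ++
        bitWords (subVec (uv ⟨i, hi⟩).2 (l.col j) l.n₂))) (S j (i + 1)) (ts j i)) :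
    ∃ m t₀ t₁, Exec W (splitPrep univ aprep k coinExp) (Mem.init [[n], matrixWords M, bits]) m t₀ ∧
      Serve W (splitStep astep) m (vectorMessages uv) ((List.range n).map fun i =>
        [if 0 < majorities l.rep (fun j => S j (i + 1)) l.nb then 1 else 0]) t₁ ∧
      t₀ ≤ (200 + 20 * k + 10 * coinExp) * (n + 3) + tU +
        (l.num * (100 * (l.n₁ * l.n₂ + l.coins + 4)) + 7 * (∑ j ∈ Finset.range l.num, tp j) +
          20 * (l.num + 1)) ∧
      t₁ ≤ n * (600 * ((l.num + 1) * (l.n₁ + l.n₂ + 1) + l.nb)) +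
        7 * ∑ j ∈ Finset.range l.num, ∑ i ∈ Finset.range n, ts j i := by
  have hln : l.n = n := by rw [← hl]; rfl
  have hW80 : (Y + 2) ^ 80 ≤ W := (Nat.pow_le_pow_right (by omega) (by omega)).trans hW
  have hVW : V * l.num + l.num + V ≤ W := by
    have h1 : (Y + 2) ^ 2 ≤ W := (Nat.pow_le_pow_right (by omega) (by norm_num)).trans hW80
    have h2 : V * l.num ≤ Y * Y := Nat.mul_le_mul hV hY.num.le
    have h3 := hY.num
    have h4 : (Y + 2) ^ 2 = Y * Y + 4 * Y + 4 := by ring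
    omega
  obtain ⟨r, len, acc, h1⟩ := runs_layoutProg hD hW hU hk (hl ▸ hY) hn (matrixWords M) bits
    hunivE hmU
  rw [hl] at h1
  obtain ⟨σ, hσ⟩ : ∃ σ : GState, { start [n] (matrixWords M) bits with
      r := r, len := len, acc := acc, vU := mU, pend := l.params } = σ := ⟨_, rfl⟩
  have hσp : σ.pend = l.params := by rw [← hσ]
  have hσA : σ.vA = interleave l.num fun _ _ _ => 0 := by rw [← hσ]; rfl
  have hσ3 : σ.in3 = cell (matrixWords M) := by rw [← hσ]; rfl
  have hσ4 : σ.in4 = cell bits := by rw [← hσ]; rfl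
  have hσm : σ.msg = fun _ => 0 := by rw [← hσ]; rfl
  rw [hσ, ← init_eq] at h1
  have hc3 : ∀ c, σ.in3 c < Y := fun c => by
    rw [hσ3]
    exact cell_lt (by rw [length_matrixWords]; exact hnn)
      (fun y hy => (matrixWords_lt M y hy).trans (by omega)) c
  have hc4 : ∀ c, σ.in4 c < Y := fun c => by
    rw [hσ4]
    exact cell_lt hlen (fun y hy => (hbits y hy).trans (by omega)) c
  have hP : ∀ j < l.num, ∀ (r s c : ℕ) (inst₀ : ℕ → Mem), inst₀ j = (fun _ _ => 0) →
      Runs W (prepareProg aprep)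
        (mem { σ with r := r, i := j, s := s, cnt := c, vA := interleave l.num inst₀ })
        (mem { σ with r := l.coins, i := j, s := l.row j, cnt := l.col j
                      vA := interleave l.num (Function.update inst₀ j (S j 0)) })
        (100 * (l.n₁ * l.n₂ + l.coins + 4) + 7 * tp j) := by
    intro j hj r s c inst₀ h0
    refine runs_prepareProg
      (σ := { σ with r := r, i := j, s := s, cnt := c, vA := interleave l.num inst₀ })
      hW80 hσp hY rfl hj rfl hc3 hc4 hVW h0
      (matrixWords (subMat M (l.row j) (l.col j) l.n₁ l.n₂)) (bit j) (length_matrixWords _) (hbl j)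
      (fun i hi => ?_) (fun i hi => ?_) (hprep j hj)
    · rw [cell_matrixWords_subMat M hi, ← hσ3, hln]
    · rw [hbc j hj i hi, ← hσ4]
  obtain ⟨r', s', c', h2⟩ := runs_forInst (p := prepareProg aprep) (inst := fun _ _ _ => 0)
    (inst' := fun j => S j 0) hW80 hσp hY hσA
    (fun j hj => hS j 0 hj) (fun j => 100 * (l.n₁ * l.n₂ + l.coins + 4) + 7 * tp j)
    fun j hj r s c inst₀ h0 => ⟨_, _, _, hP j hj r s c inst₀ h0⟩
  obtain ⟨t₀, ht₀, hE₀⟩ := h1.seq h2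
  have hmsgs : (vectorMessages uv).length = n := by simp [vectorMessages]
  have h11 : ∀ j < l.num, ∀ i ≤ n, S j i 1 1 < Y := by
    intro j hj i
    induction i with
    | zero =>
      intro _
      refine (hprep j hj).cell_lt_of_lt hV ?_
      rw [Mem.init_zero _ _ (by norm_num)]
      exact Nat.zero_lt_of_lt hnn
    | succ i ih =>
      intro hi
      refine (hstep j hj i hi).cell_lt_of_lt hV ?_
      rw [Mem.load_of_ne _ _ (by norm_num)]
      exact ih (by omega)
  -- `Z i` is the state of the solver before round `i`.
  obtain ⟨Z, hZ0, hZ⟩ := exists_seq (K := n) (Inv := fun i σ₁ =>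
      σ₁.pend = l.params ∧ σ₁.vA = interleave l.num (fun j => S j i) ∧ ∀ c, σ₁.msg c < Y)
    (R := fun i (σ₁ σ₂ : GState) =>
      ∀ hi : i < n, Runs W (splitStep astep) (σ₁.mem.load 0
          (bitWords (uv ⟨i, hi⟩).1 ++ bitWords (uv ⟨i, hi⟩).2)) σ₂.mem
        (600 * ((l.num + 1) * (l.n₁ + l.n₂ + 1) + l.nb) + 7 * ∑ j ∈ Finset.range l.num, ts j i) ∧
        σ₂.mem.output = [if 0 < majorities l.rep (fun j => S j (i + 1)) l.nb then 1 else 0])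
    (a := { σ with r := r', i := l.num, s := s', cnt := c',
                    vA := interleave l.num fun j => S j 0 })
    ⟨hσp, rfl, fun c => by simp only [hσm]; omega⟩
    fun i hi σ₁ h => by
      have hx : (bitWords (uv ⟨i, hi⟩).1 ++ bitWords (uv ⟨i, hi⟩).2).length = 2 * n := by
        rw [List.length_append, length_bitWords, length_bitWords]; omega
      obtain ⟨σ₂, a1, a2, a3, a4, a5⟩ := runs_splitStep (inst' := fun j => S j (i + 1)) hW80 h.1 hY
        h.2.1 (fun j hj => by rw [hS _ _ hj, hS _ _ hj]) hVW (fun j hj => h11 j hj _ hi)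
        (bitWords (uv ⟨i, hi⟩).1 ++ bitWords (uv ⟨i, hi⟩).2) (by rw [hx]; omega)
        (fun y hy => by
          rcases List.mem_append.1 hy with hy | hy <;>
            exact (bitWords_lt _ y hy).trans (by omega)) (by rw [hx, hln]) h.2.2
        (fun j => bitWords (subVec (uv ⟨i, hi⟩).1 (l.row j) l.n₁))
        (fun j => bitWords (subVec (uv ⟨i, hi⟩).2 (l.col j) l.n₂))
        (fun j _ => length_bitWords _) (fun j _ => length_bitWords _)
        (fun j _ c hc => by
          rw [cell_bitWords_subVec _ hc, hln]
          by_cases h : l.row j + c < n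
          · rw [if_pos h, if_pos h, cell_append_left (by rwa [length_bitWords])]
          · rw [if_neg h, if_neg h])
        (fun j _ c hc => by
          rw [cell_bitWords_subVec _ hc, hln]
          by_cases h : l.col j + c < n
          · have := cell_append_right (l := bitWords (uv ⟨i, hi⟩).1)
              (l' := bitWords (uv ⟨i, hi⟩).2) (l.col j + c)
            rw [length_bitWords] at this
            rw [if_pos h, if_pos h, this]
          · rw [if_neg h, if_neg h])
        (fun j => ts j i) (fun j hj => hstep j hj i hi)
      exact ⟨σ₂, ⟨a3, a4, a5⟩, fun _ => ⟨a1, a2⟩⟩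
  have hZ' : ∀ i, ∃ t, ∀ hi : i < n,
      t ≤ 600 * ((l.num + 1) * (l.n₁ + l.n₂ + 1) + l.nb) +
        7 * ∑ j ∈ Finset.range l.num, ts j i ∧
      Exec W (splitStep astep) ((Z i).mem.load 0
        (bitWords (uv ⟨i, hi⟩).1 ++ bitWords (uv ⟨i, hi⟩).2)) (Z (i + 1)).mem t := by
    intro i
    by_cases hi : i < n
    · obtain ⟨⟨t, h1, h2⟩, -⟩ := hZ i hi hi
      exact ⟨t, fun _ => ⟨h1, h2⟩⟩
    · exact ⟨0, fun h => absurd h hi⟩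
  choose t ht using hZ'
  have hserve := Serve.of_trace (W := W) (s := splitStep astep) (vectorMessages uv)
    (fun i => (Z i).mem) t fun i hi => by
      have hi' : i < n := by rwa [hmsgs] at hi
      have e : (vectorMessages uv)[i] = bitWords (uv ⟨i, hi'⟩).1 ++ bitWords (uv ⟨i, hi'⟩).2 := by
        simp [vectorMessages]
      rw [e]
      exact (ht i hi').2
  rw [hmsgs] at hserve
  have hys : (List.range n).map (fun i => (Z (i + 1)).mem.output) = (List.range n).map fun i =>
      [if 0 < majorities l.rep (fun j => S j (i + 1)) l.nb then 1 else 0] :=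
    List.map_congr_left fun i hi => (hZ i (List.mem_range.1 hi) (List.mem_range.1 hi)).2
  rw [hys, hZ0] at hserve
  refine ⟨_, _, _, hE₀, hserve, ht₀.trans ?_, ?_⟩
  · rw [Finset.sum_add_distrib, Finset.sum_const, Finset.card_range, smul_eq_mul,
      ← Finset.mul_sum (f := tp)]
  · refine (Finset.sum_le_sum fun i hi => (ht i (Finset.mem_range.1 hi)).1).trans ?_
    rw [Finset.sum_add_distrib, Finset.sum_const, Finset.card_range, smul_eq_mul,
      ← Finset.mul_sum, Finset.sum_comm]

/-! ### Combining the answers of the instances -/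

theorem boolForm_eq_true_iff {n₁ n₂ : ℕ} (u : Fin n₁ → Bool) (M : Matrix (Fin n₁) (Fin n₂) Bool)
    (v : Fin n₂ → Bool) :
    boolForm u M v = true ↔ ∃ i j, u i = true ∧ M i j = true ∧ v j = true := by
  simp [boolForm, List.any_eq_true, and_assoc]

theorem subVec_eq_true_iff {n r m : ℕ} {u : Fin n → Bool} {i : Fin m} :
    subVec u r m i = true ↔ ∃ h : r + i < n, u ⟨r + i, h⟩ = true := by
  unfold subVec
  split <;> simp_all

theorem div_lt_ceil {n m i : ℕ} (hm : 0 < m) (hi : i < n) : i / m < (n + (m - 1)) / m := by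
  rw [Nat.lt_iff_add_one_le, Nat.le_div_iff_mul_le hm]
  have := Nat.div_mul_le_self i m
  rw [Nat.add_mul]
  omega

/-- The product is `1` if and only if it is `1` for one of the blocks. -/
theorem exists_boolForm_block {n n₁ n₂ : ℕ} (h₁ : 0 < n₁) (h₂ : 0 < n₂) (u : Fin n → Bool)
    (M : Matrix (Fin n) (Fin n) Bool) (v : Fin n → Bool) :
    (∃ b < (n + (n₁ - 1)) / n₁ * ((n + (n₂ - 1)) / n₂),
      boolForm (subVec u (b / ((n + (n₂ - 1)) / n₂) * n₁) n₁)
        (subMat M (b / ((n + (n₂ - 1)) / n₂) * n₁) (b % ((n + (n₂ - 1)) / n₂) * n₂) n₁ n₂)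
        (subVec v (b % ((n + (n₂ - 1)) / n₂) * n₂) n₂) = true) ↔ boolForm u M v = true := by
  constructor
  · rintro ⟨b, -, h⟩
    obtain ⟨i, j, hu, hM, hv⟩ := (boolForm_eq_true_iff _ _ _).1 h
    obtain ⟨hi, hu⟩ := subVec_eq_true_iff.1 hu
    obtain ⟨hj, hv⟩ := subVec_eq_true_iff.1 hv
    refine (boolForm_eq_true_iff _ _ _).2 ⟨_, _, hu, ?_, hv⟩
    simpa [subMat, subVec, hi, hj] using hM
  · intro h
    obtain ⟨i, j, hu, hM, hv⟩ := (boolForm_eq_true_iff _ _ _).1 h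
    have hj := div_lt_ceil h₂ j.2
    have hi := div_lt_ceil h₁ i.2
    have ei := Nat.div_add_mod' i n₁
    have ej := Nat.div_add_mod' j n₂
    refine ⟨i / n₁ * ((n + (n₂ - 1)) / n₂) + j / n₂, ?_, ?_⟩
    · calc _ < (i / n₁ + 1) * ((n + (n₂ - 1)) / n₂) := by rw [Nat.add_mul, Nat.one_mul]; omega
        _ ≤ _ := Nat.mul_le_mul_right _ hi
    · rw [mul_add_div_of_lt hj, mul_add_mod_of_lt' hj]
      refine (boolForm_eq_true_iff _ _ _).2
        ⟨⟨i % n₁, Nat.mod_lt _ h₁⟩, ⟨j % n₂, Nat.mod_lt _ h₂⟩, ?_, ?_, ?_⟩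
      · exact subVec_eq_true_iff.2 ⟨by simp only [ei]; exact i.2, by simpa only [ei] using hu⟩
      · simp only [subMat, ei, i.2, dif_pos]
        exact subVec_eq_true_iff.2 ⟨by simp only [ej]; exact j.2, by simpa only [ej] using hM⟩
      · exact subVec_eq_true_iff.2 ⟨by simp only [ej]; exact j.2, by simpa only [ej] using hv⟩

/-- If the majority of the instances is right for each block, then the combined answer is right. -/
theorem majorities_pos_iff {rep nb : ℕ} {inst : ℕ → Mem} {form : ℕ → Bool} (bad : ℕ → Prop)
    [DecidablePred bad]
    (hgood : ∀ b < nb, ∀ r < rep, ¬ bad (b * rep + r) → inst (b * rep + r) 1 1 = (form b).toNat)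
    (hbad : ∀ b < nb, 2 * ((Finset.range rep).filter fun r => bad (b * rep + r)).card < rep) :
    0 < majorities rep inst nb ↔ ∃ b < nb, form b = true := by
  have key : ∀ b < nb, (rep < 2 * ones rep inst b ↔ form b = true) := by
    intro b hb
    have h1 : ones rep inst b =
        ((Finset.range rep).filter fun r => inst (b * rep + r) 1 1 = 1).card :=
      (Finset.card_filter _ _).symm
    have h2 := hbad b hb
    cases hf : form b with
    | false =>
      simp only [Bool.false_eq_true, iff_false, not_lt]
      have : ((Finset.range rep).filter fun r => inst (b * rep + r) 1 1 = 1).card ≤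
          ((Finset.range rep).filter fun r => bad (b * rep + r)).card := by
        refine Finset.card_le_card fun r hr => ?_
        rw [Finset.mem_filter, Finset.mem_range] at hr ⊢
        refine ⟨hr.1, ?_⟩
        by_contra hc
        have := hgood b hb r hr.1 hc
        rw [hf, hr.2] at this
        exact absurd this (by decide)
      omega
    | true =>
      simp only [iff_true]
      have : ((Finset.range rep).filter fun r => ¬ bad (b * rep + r)).card ≤
          ((Finset.range rep).filter fun r => inst (b * rep + r) 1 1 = 1).card := by
        refine Finset.card_le_card fun r hr => ?_
        rw [Finset.mem_filter, Finset.mem_range] at hr ⊢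
        refine ⟨hr.1, ?_⟩
        rw [hgood b hb r hr.1 hr.2, hf]
        rfl
      have h3 := Finset.card_filter_add_card_filter_not (s := Finset.range rep)
        (fun r => bad (b * rep + r))
      rw [Finset.card_range] at h3
      omega
  unfold majorities
  rw [Nat.pos_iff_ne_zero, Ne, Finset.sum_eq_zero_iff]
  push Not
  simp only [Finset.mem_range]
  refine exists_congr fun b => and_congr_right fun hb => ?_
  rw [← key b hb]
  split <;> simp_all

/-! ### The probability that a majority is wrong -/

/-- Exponential moments: if at most a third of the elements of `Ω` is bad, then few of the
sequences of length `2 * h` have at least `h` bad elements. -/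
theorem card_half_bad_le {Ω : Type*} [Fintype Ω] (bad : Ω → Prop) [DecidablePred bad]
    (hbad : 3 * (Finset.univ.filter bad).card ≤ Fintype.card Ω) (h : ℕ) :
    (((Finset.univ : Finset (Fin (2 * h) → Ω)).filter fun x =>
      2 * h ≤ 2 * (Finset.univ.filter fun i => bad (x i)).card).card : ℝ) ≤
      (8 / 9) ^ h * (Fintype.card Ω : ℝ) ^ (2 * h) := by
  classical
  -- The sum of `2 ^ #bad` over all sequences factors, and each sequence with at least `h` bad elements
  -- contributes at least `2 ^ h` to it.
  have hsum : ∑ x : Fin (2 * h) → Ω, (2 : ℝ) ^ (Finset.univ.filter fun i => bad (x i)).card =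
      ((Fintype.card Ω : ℝ) + (Finset.univ.filter bad).card) ^ (2 * h) := by
    have h1 : ∀ x : Fin (2 * h) → Ω, (2 : ℝ) ^ (Finset.univ.filter fun i => bad (x i)).card =
        ∏ i, if bad (x i) then (2 : ℝ) else 1 := by
      intro x
      rw [Finset.prod_ite, Finset.prod_const, Finset.prod_const_one, mul_one]
    have h2 : ∑ ω : Ω, (if bad ω then (2 : ℝ) else 1) =
        (Fintype.card Ω : ℝ) + (Finset.univ.filter bad).card := by
      have : ∀ ω : Ω, (if bad ω then (2 : ℝ) else 1) = 1 + if bad ω then 1 else 0 := by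
        intro ω; split <;> norm_num
      simp only [this, Finset.sum_add_distrib, Finset.sum_const, Finset.sum_boole, Finset.card_univ]
      simp
    simp only [h1]
    rw [← h2, ← Fintype.piFinset_univ,
      ← Finset.prod_univ_sum (fun _ : Fin (2 * h) => Finset.univ)
        (fun _ ω => if bad ω then (2 : ℝ) else 1), Finset.prod_const, Finset.card_univ,
      Fintype.card_fin]
  have hle : (((Finset.univ : Finset (Fin (2 * h) → Ω)).filter fun x =>
      2 * h ≤ 2 * (Finset.univ.filter fun i => bad (x i)).card).card : ℝ) * 2 ^ h ≤
      ∑ x : Fin (2 * h) → Ω, (2 : ℝ) ^ (Finset.univ.filter fun i => bad (x i)).card := by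
    rw [← nsmul_eq_mul, ← Finset.sum_const]
    refine (Finset.sum_le_sum fun x hx => ?_).trans
      (Finset.sum_le_sum_of_subset_of_nonneg (Finset.filter_subset _ _) fun _ _ _ => by positivity)
    have := (Finset.mem_filter.1 hx).2
    exact pow_le_pow_right₀ (by norm_num) (by omega)
  have hb : (Fintype.card Ω : ℝ) + (Finset.univ.filter bad).card ≤ 4 / 3 * Fintype.card Ω := by
    have : (3 : ℝ) * (Finset.univ.filter bad).card ≤ Fintype.card Ω := by exact_mod_cast hbad
    linarith
  rw [hsum] at hle
  have h3 := hle.trans (pow_le_pow_left₀ (by positivity) hb _)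
  have h4 : (4 / 3 * (Fintype.card Ω : ℝ)) ^ (2 * h) =
      ((8 / 9) ^ h * (Fintype.card Ω : ℝ) ^ (2 * h)) * 2 ^ h := by
    rw [mul_pow, pow_mul (4 / 3 : ℝ), mul_right_comm, ← mul_pow]
    norm_num
  rw [h4] at h3
  exact le_of_mul_le_mul_right h3 (by positivity)

/-- The union bound. -/
theorem failureProbability_forall_le {R nb : ℕ} (p : ℕ → (Fin R → Bool) → Prop) :
    failureProbability R (fun ω => ∀ b < nb, p b ω) ≤
      ∑ b ∈ Finset.range nb, failureProbability R (p b) := by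
  unfold failureProbability
  rw [← Finset.sum_div]
  refine div_le_div_of_nonneg_right ?_ (by positivity)
  have e : {ω : Fin R → Bool | ¬ ∀ b < nb, p b ω} =
      ⋃ b ∈ Finset.range nb, {ω | ¬ p b ω} := by
    ext ω; simp
  rw [e]
  exact_mod_cast Finset.set_ncard_biUnion_le (Finset.range nb) fun b => {ω | ¬ p b ω}

theorem failureProbability_eq_card {R : ℕ} (p : (Fin R → Bool) → Prop)
    [DecidablePred fun ω => ¬ p ω] :
    failureProbability R p = ((Finset.univ.filter fun ω => ¬ p ω).card : ℝ) / 2 ^ R := by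
  unfold failureProbability
  congr 2
  rw [← Set.ncard_coe_finset]
  congr 1
  ext ω; simp

open Classical in
/-- The majority of `2 * h` instances, which use disjoint parts of the random bits, is wrong with
a probability that is exponentially small in `h`. -/
theorem failureProbability_majority_le {R K h b : ℕ} (hR : (b + 1) * (2 * h) * K ≤ R)
    (good : (Fin K → Bool) → Prop) (hgood : failureProbability K good ≤ 1 / 3) :
    failureProbability R (fun ω => 2 * ((Finset.range (2 * h)).filter fun r =>
      ¬ good (subVec ω ((b * (2 * h) + r) * K) K)).card < 2 * h) ≤ (8 / 9) ^ h := by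
  have hR' : b * (2 * h) * K + 2 * h * K ≤ R := by
    rw [← Nat.add_mul, ← Nat.succ_mul]; exact hR
  let f : Fin (2 * h * K) → Fin R := fun t => ⟨b * (2 * h) * K + t, by omega⟩
  have hf : Function.Injective f := fun t t' h => by
    have := congrArg Fin.val h
    simp only [f] at this
    exact Fin.ext (by omega)
  let e : (Fin (2 * h * K) → Bool) ≃ (Fin (2 * h) → Fin K → Bool) :=
    (Equiv.arrowCongr finProdFinEquiv.symm (Equiv.refl _)).trans (Equiv.curry _ _ _)
  have he : ∀ (ω : Fin R → Bool) (r : Fin (2 * h)), e (ω ∘ f) r =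
      subVec ω ((b * (2 * h) + r) * K) K := by
    intro ω r
    funext i
    have h1 : (r : ℕ) * K + i < 2 * h * K := by
      calc (r : ℕ) * K + i < (r + 1) * K := by have := Nat.add_mul (r : ℕ) 1 K; omega
        _ ≤ _ := Nat.mul_le_mul_right _ r.2
    have h2 : (b * (2 * h) + r) * K + i < R := by rw [Nat.add_mul]; omega
    rw [subVec, dif_pos h2]
    change ω (f (finProdFinEquiv (r, i))) = _
    congr 1
    apply Fin.ext
    simp only [f, finProdFinEquiv_apply_val]
    ring
  have hcount : ∀ ω : Fin R → Bool, ((Finset.range (2 * h)).filter fun r =>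
      ¬ good (subVec ω ((b * (2 * h) + r) * K) K)).card =
      ((Finset.univ : Finset (Fin (2 * h))).filter fun r => ¬ good (e (ω ∘ f) r)).card := by
    intro ω
    rw [Finset.card_filter, Finset.card_filter, Finset.sum_range]
    simp only [he]
  simp only [hcount]
  rw [failureProbability_comp f hf (fun ω => 2 * ((Finset.univ : Finset (Fin (2 * h))).filter
    fun r => ¬ good (e ω r)).card < 2 * h), failureProbability_eq_card]
  have hbad : 3 * (Finset.univ.filter fun ω => ¬ good ω).card ≤ Fintype.card (Fin K → Bool) := by
    rw [failureProbability_eq_card, div_le_iff₀ (by positivity)] at hgood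
    have h3 : (3 : ℝ) * (Finset.univ.filter fun ω => ¬ good ω).card ≤ 2 ^ K := by linarith
    simp only [Fintype.card_fun, Fintype.card_bool, Fintype.card_fin]
    exact_mod_cast h3
  have key := card_half_bad_le (fun ω => ¬ good ω) hbad h
  have hcard : (Finset.univ.filter fun ω : Fin (2 * h * K) → Bool => ¬ 2 *
      ((Finset.univ : Finset (Fin (2 * h))).filter fun r => ¬ good (e ω r)).card < 2 * h).card =
      ((Finset.univ : Finset (Fin (2 * h) → Fin K → Bool)).filter fun x =>
        2 * h ≤ 2 * (Finset.univ.filter fun i => ¬ good (x i)).card).card := by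
    refine Finset.card_equiv e fun ω => ?_
    simp only [Finset.mem_filter, Finset.mem_univ, true_and, not_lt]
  rw [hcard, div_le_iff₀ (by positivity)]
  refine key.trans (le_of_eq ?_)
  simp only [Fintype.card_fun, Fintype.card_bool, Fintype.card_fin]
  push_cast
  rw [← pow_mul, Nat.mul_comm K]

/-- With `24 * ⌈log₂ (n + 2)⌉ + 24` copies, majorities for `n ^ 2` blocks may be taken: already
`(8 / 9) ^ 12` is less than `1 / 4`. -/
theorem eight_ninths_pow_le (n : ℕ) :
    (8 / 9 : ℝ) ^ (12 * Nat.clog 2 (n + 2) + 12) * (n + 2) ^ 2 ≤ 1 / 3 := by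
  set L := Nat.clog 2 (n + 2)
  have h1 : (n + 2 : ℝ) ≤ 2 ^ L := by
    exact_mod_cast Nat.le_pow_clog (b := 2) (by norm_num) (n + 2)
  have h2 : (8 / 9 : ℝ) ^ (12 * L + 12) ≤ (1 / 4) ^ (L + 1) := by
    rw [show 12 * L + 12 = 12 * (L + 1) by ring, pow_mul]
    exact pow_le_pow_left₀ (by positivity) (by norm_num) _
  have h3 : (n + 2 : ℝ) ^ 2 ≤ 4 ^ L := by
    calc (n + 2 : ℝ) ^ 2 ≤ (2 ^ L) ^ 2 := pow_le_pow_left₀ (by positivity) h1 _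
      _ = 4 ^ L := by rw [← pow_mul, Nat.mul_comm, pow_mul]; norm_num
  calc _ ≤ (1 / 4 : ℝ) ^ (L + 1) * 4 ^ L := mul_le_mul h2 h3 (by positivity) (by positivity)
    _ = 1 / 4 := by rw [pow_succ, mul_right_comm, ← mul_pow]; norm_num
    _ ≤ _ := by norm_num

open Classical in
/-- With probability at least `2 / 3`, fewer than half of the instances fail for each block. -/
theorem failureProbability_majorities_le {R K n nb rep : ℕ}
    (hrep : rep = 24 * Nat.clog 2 (n + 2) + 24) (hR : nb * rep * K ≤ R) (hnb : nb ≤ n * n)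
    (good : ℕ → (Fin K → Bool) → Prop)
    (hgood : ∀ b < nb, failureProbability K (good b) ≤ 1 / 3) :
    failureProbability R (fun ω => ∀ b < nb, 2 * ((Finset.range rep).filter fun r =>
      ¬ good b (subVec ω ((b * rep + r) * K) K)).card < rep) ≤ 1 / 3 := by
  obtain ⟨h, hh⟩ : ∃ h, h = 12 * Nat.clog 2 (n + 2) + 12 := ⟨_, rfl⟩
  obtain rfl : rep = 2 * h := by omega
  refine (failureProbability_forall_le _).trans ?_
  refine (Finset.sum_le_card_nsmul _ _ ((8 / 9 : ℝ) ^ h) fun b hb => ?_).trans ?_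
  · have hb := Finset.mem_range.1 hb
    exact failureProbability_majority_le
      ((Nat.mul_le_mul_right _ (Nat.mul_le_mul_right _ hb)).trans hR) (good b) (hgood b hb)
  · refine le_trans ?_ (eight_ninths_pow_le n)
    rw [Finset.card_range, nsmul_eq_mul, mul_comm, hh]
    have : (nb : ℝ) ≤ (n + 2) ^ 2 := by
      have h1 : (nb : ℝ) ≤ n * n := by exact_mod_cast hnb
      nlinarith
    gcongr

/-! ### From `γ`-OuMv to OuMv -/

theorem rows_pos {γ : ℝ} (hγ : 0 ≤ γ) {n₂ : ℕ} (h : 0 < n₂) : 0 < rows γ n₂ := by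
  have h1 : (1 : ℝ) ≤ n₂ := by exact_mod_cast h
  exact Nat.floor_pos.2 (Real.one_le_rpow h1 hγ)

theorem rows_le_pow {γ : ℝ} {k n₂ : ℕ} (hk : γ ≤ k) (h : 0 < n₂) : rows γ n₂ ≤ n₂ ^ k := by
  have h1 : (1 : ℝ) ≤ n₂ := by exact_mod_cast h
  have h2 : (n₂ : ℝ) ^ γ ≤ (n₂ ^ k : ℕ) := by
    rw [Nat.cast_pow, ← Real.rpow_natCast]
    exact Real.rpow_le_rpow_of_exponent_le h1 hk
  exact Nat.floor_le_of_le h2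

theorem rootFloor_le (k n : ℕ) : rootFloor k n ≤ n + 1 := by
  have := Nat.findGreatest_le (P := fun r => r ^ k ≤ n) n
  unfold rootFloor
  omega

/-- The root is taken such that the blocks do not have more than `n` rows either, but for `n = 0`, where
they have one. -/
theorem rows_rootFloor_le {γ : ℝ} {k : ℕ} (hk : γ ≤ k) (n : ℕ) : rows γ (rootFloor k n) ≤ n + 1 := by
  refine (rows_le_pow hk (rootFloor_pos k n)).trans ?_
  rcases Nat.eq_zero_or_pos n with rfl | hn
  · simp [rootFloor]
  · exact (rootFloor_pow_le hn).trans (by omega)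

theorem ceil_le {n m : ℕ} (hm : 0 < m) : (n + (m - 1)) / m ≤ n := by
  rw [← Nat.lt_succ_iff, Nat.div_lt_iff_lt_mul hm, Nat.succ_mul]
  have : n * 1 ≤ n * m := Nat.mul_le_mul_left _ hm
  omega

/-- The `γ`-OuMv instance for block `b` of an OuMv instance. -/
noncomputable def blockInstance (γ : ℝ) (k coinExp : ℕ) {n : ℕ} (hn : 0 < n)
    (M : Matrix (Fin n) (Fin n) Bool) (uv : Fin n → (Fin n → Bool) × (Fin n → Bool)) (b : ℕ) :
    GammaInstance γ :=
  let l := splitLayout γ k coinExp n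
  { n₂ := rootFloor k n, n₃ := n, pos₂ := rootFloor_pos k n, pos₃ := hn
    M := subMat M (b / l.nb₂ * l.n₁) (b % l.nb₂ * l.n₂) _ _
    uv := fun i => (subVec (uv i).1 (b / l.nb₂ * l.n₁) _, subVec (uv i).2 (b % l.nb₂ * l.n₂) _) }

/-- The run of a `γ`-OuMv solver, with the memory `S i` before round `i`. -/
theorem GammaInstance.exists_trace {γ : ℝ} {A : Algorithm} (I : GammaInstance γ)
    {ω : Fin (A.coins I.size) → Bool} {ys : List (List ℕ)} {t₀ t₁ : ℕ}
    (h : A.Run I.size [[I.n₁, I.n₂, I.n₃], matrixWords I.M] ω (vectorMessages I.uv) ys t₀ t₁) :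
    ∃ (S : ℕ → Mem) (ts : ℕ → ℕ),
      Exec (A.wordBound I.size) A.prep
        (Mem.init [[I.n₁, I.n₂, I.n₃], matrixWords I.M, bitWords ω]) (S 0) t₀ ∧
      (∀ i (hi : i < I.n₃), Exec (A.wordBound I.size) A.step ((S i).load 0
        (bitWords (I.uv ⟨i, hi⟩).1 ++ bitWords (I.uv ⟨i, hi⟩).2)) (S (i + 1)) (ts i)) ∧
      t₁ = ∑ i ∈ Finset.range I.n₃, ts i ∧
      (ys = productBits I.M I.uv → ∀ i (hi : i < I.n₃),
        S (i + 1) 1 1 = (boolForm (I.uv ⟨i, hi⟩).1 I.M (I.uv ⟨i, hi⟩).2).toNat) := by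
  obtain ⟨m, hm, hs⟩ := h
  obtain ⟨S, ts, hS0, hS, hys, hts⟩ := hs.exists_trace
  have hl : (vectorMessages I.uv).length = I.n₃ := by simp [vectorMessages]
  rw [hl] at hys hts
  refine ⟨S, ts, hS0 ▸ hm, fun i hi => ?_, hts, fun h i hi => ?_⟩
  · have h1 := hS i (by rw [hl]; exact hi)
    have e : (vectorMessages I.uv)[i]'(by rw [hl]; exact hi) =
        bitWords (I.uv ⟨i, hi⟩).1 ++ bitWords (I.uv ⟨i, hi⟩).2 := by simp [vectorMessages]
    rwa [e] at h1
  · rw [h] at hys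
    have h2 := congrArg (fun l => l[i]?) hys
    simp only [productBits, List.getElem?_map, List.getElem?_range hi, Option.map_some,
      List.getElem?_ofFn, hi, dif_pos, Option.some.injEq] at h2
    exact Mem.of_output h2.symm 1 le_rfl

open Classical in
/-- A `γ`-OuMv solver, with logarithmically many independent copies for each block of an OuMv
instance, yields an OuMv solver. -/
theorem exists_solvesOuMv {P : DynamicProblem} {γ : ℝ} {u q n : ℕ → ℕ → ℕ}
    (red : LocalReduction P γ u q n) (hγ : 0 < γ) {k : ℕ} (hk : 0 < k) (hγk : γ ≤ k)
    {A : Algorithm} {τ : ℕ → ℕ → ℕ} (hA : SolvesGammaOuMv γ A τ) :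
    ∃ A' : Algorithm, SolvesOuMv A' fun n =>
      n * (600 * (((splitLayout γ k A.coinExp n).num + 1) *
        ((splitLayout γ k A.coinExp n).n₁ + (splitLayout γ k A.coinExp n).n₂ + 1) +
          (splitLayout γ k A.coinExp n).nb)) +
        7 * ((splitLayout γ k A.coinExp n).num * τ (rootFloor k n) n) := by
  obtain ⟨cA, hA⟩ := hA
  let X : ℕ → ℕ := fun n => n + 2
  have hX : ∀ n, 2 ≤ X n := fun n => by simp only [X]; omega
  let l : ℕ → Layout := fun n => splitLayout γ k A.coinExp n
  have hn₂ : ∀ n, (l n).n₂ ≤ n + 1 := fun n => rootFloor_le k n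
  have hn₁ : ∀ n, (l n).n₁ ≤ n + 1 := fun n => rows_rootFloor_le hγk n
  have hp₂ : ∀ n, 0 < (l n).n₂ := fun n => rootFloor_pos k n
  have hp₁ : ∀ n, 0 < (l n).n₁ := fun n => rows_pos hγ.le (rootFloor_pos k n)
  have hnb₂ : ∀ n, (l n).nb₂ ≤ n := fun n => ceil_le (hp₂ n)
  have hnb : ∀ n, (l n).nb ≤ n * n := fun n => Nat.mul_le_mul (ceil_le (hp₁ n)) (hnb₂ n)
  have bX : PolyBounded X fun n => n + 2 := .self
  have bn₁ : PolyBounded X fun n => (l n).n₁ := bX.of_le fun n => (hn₁ n).trans (by omega)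
  have bn₂ : PolyBounded X fun n => (l n).n₂ := bX.of_le fun n => (hn₂ n).trans (by omega)
  have bn : PolyBounded X fun n => n := bX.of_le fun n => by omega
  have bnb₂ : PolyBounded X fun n => (l n).nb₂ := bn.of_le hnb₂
  have bnb : PolyBounded X fun n => (l n).nb := (bn.mul bn).of_le hnb
  have brep : PolyBounded X fun n => (l n).rep := by
    refine (((PolyBounded.const hX 24).mul bX).add hX (.const hX 24)).of_le fun n => ?_
    exact Nat.add_le_add_right (Nat.mul_le_mul_left _
      (Nat.clog_le_of_le_pow (Nat.lt_two_pow_self).le)) _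
  have bnum : PolyBounded X fun n => (l n).num := bnb.mul brep
  -- the measure of an instance
  let N : ℕ → ℕ := fun n => (l n).n₁ + (l n).n₂ + n
  have bN : PolyBounded X fun n => N n + 2 := ((bn₁.add hX bn₂).add hX bn).add hX (.const hX 2)
  have bK : PolyBounded X fun n => (l n).coins := bN.pow A.coinExp
  have bV : PolyBounded X fun n => A.wordBound (N n) := bN.pow A.wordExp
  obtain ⟨e₁, he₁⟩ := bnum.mul bK
  have bR : PolyBounded X fun n => X n ^ e₁ := PolyBounded.self.pow e₁
  -- `Y n` exceeds all numbers that are stored.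
  let Y : ℕ → ℕ := fun n => (l n).num + (l n).n₁ + (l n).n₂ + (l n).nb₂ + (l n).rep + (l n).nb +
    (l n).coins + (l n).n₁ * (l n).n₂ + (l n).num * (l n).n₁ + (l n).num * (l n).n₂ +
    A.wordBound (N n) + X n ^ e₁ + 2 * n + n * n + 9
  have bY : PolyBounded X Y :=
    (((((((((((((((bnum.add hX bn₁).add hX bn₂).add hX bnb₂).add hX brep).add hX bnb).add hX
      bK).add hX (bn₁.mul bn₂)).add hX (bnum.mul bn₁)).add hX (bnum.mul bn₂)).add hX bV).add hX
      bR).add hX ((PolyBounded.const hX 2).mul bn)).add hX (bn.mul bn)).add hX (.const hX 9)))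
  let D : ℕ := 80 + 8 * k + 22 * A.coinExp
  have bU : PolyBounded X fun n => (rootFloor k n + 2) ^ red.c :=
    (bn₂.add hX (.const hX 2)).pow red.c
  obtain ⟨e₂, he₂⟩ := ((bY.add hX (.const hX 2)).pow D).add hX bU
  obtain ⟨e₀, he₀⟩ := (((PolyBounded.const hX (200 + 20 * k + 10 * A.coinExp)).mul
    (bn.add hX (.const hX 3))).add hX bU).add hX
    (((bnum.mul ((PolyBounded.const hX 100).mul
      (((bn₁.mul bn₂).add hX bK).add hX (.const hX 4)))).add hX
      ((PolyBounded.const hX 7).mul (bnum.mul (bN.pow cA)))).add hX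
      ((PolyBounded.const hX 20).mul (bnum.add hX (.const hX 1))))
  refine ⟨⟨splitPrep red.universal A.prep k A.coinExp, splitStep A.step, e₂, e₁⟩, e₀,
    fun n M uv => ?_⟩
  have hYB : (l n).Bounded (Y n) := by
    have hj : ∀ j < (l n).num, ∀ x y, (j / x / y) ≤ (l n).num ∧ j / x % y ≤ (l n).num :=
      fun j hj x y => ⟨((Nat.div_le_self _ _).trans (Nat.div_le_self _ _)).trans hj.le,
        ((Nat.mod_le _ _).trans (Nat.div_le_self _ _)).trans hj.le⟩
    refine ⟨?_, ?_, ?_, ?_, ?_, ?_, ?_, ?_, ?_, fun j h => ?_, fun j h => ?_⟩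
    · simp only [Y]; omega
    · simp only [Y]; omega
    · simp only [Y]; omega
    · simp only [Y]; omega
    · simp only [Y]; omega
    · simp only [Y]; omega
    · change n < Y n; simp only [Y]; omega
    · simp only [Y]; omega
    · simp only [Y]; omega
    · refine (Nat.mul_le_mul_right _ (hj j h _ _).1).trans_lt ?_
      simp only [Y]; omega
    · refine (Nat.mul_le_mul_right _ (hj j h _ _).2).trans_lt ?_
      simp only [Y]; omega
  have hn0 : ∀ j, j < (l n).num → 0 < n := by
    intro j hj
    rcases Nat.eq_zero_or_pos n with rfl | hn
    · have h1 : (l 0).nb = 0 := Nat.le_zero.1 (hnb 0)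
      rw [Layout.num, h1] at hj
      omega
    · exact hn
  have hrep : 0 < (l n).rep := Nat.lt_of_lt_of_le (by norm_num : 0 < 24) (Nat.le_add_left _ _)
  obtain ⟨mU, tU, hU, htU, hUo⟩ := red.universal_spec (rootFloor k n) (rootFloor_pos k n)
  have hmU : mU 1 1 = rows γ (rootFloor k n) := by
    exact Mem.of_output hUo 1 (by simp)
  let I : (hn : 0 < n) → ℕ → GammaInstance γ := fun hn b => blockInstance γ k A.coinExp hn M uv b
  let K := (l n).coins
  have hnumK : (l n).num * K ≤ X n ^ e₁ := he₁ n
  -- `good b ω`: with random bits `ω`, an instance for block `b` gives correct answers in all rounds.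
  -- For `n = 0` there are no blocks.
  obtain ⟨good, hgd⟩ : ∃ good : ℕ → (Fin K → Bool) → Prop, ∀ b ω, good b ω ↔ ∀ hn : 0 < n, ∃ t₀ t₁,
      A.Run (N n) [[(l n).n₁, (l n).n₂, n], matrixWords (I hn b).M] ω (vectorMessages (I hn b).uv)
        (productBits (I hn b).M (I hn b).uv) t₀ t₁ := ⟨_, fun _ _ => Iff.rfl⟩
  -- The time bounds hold for all random bits, and the answers are right if for each block fewer than
  -- half of the instances fail.
  have key : ∀ ω : Fin (X n ^ e₁) → Bool, ∃ ys t₀ t₁,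
      Algorithm.Run ⟨splitPrep red.universal A.prep k A.coinExp, splitStep A.step, e₂, e₁⟩ n
        [[n], matrixWords M] ω (vectorMessages uv) ys t₀ t₁ ∧ t₀ ≤ (n + 2) ^ e₀ ∧
      t₁ ≤ n * (600 * (((l n).num + 1) * ((l n).n₁ + (l n).n₂ + 1) + (l n).nb)) +
        7 * ((l n).num * τ (rootFloor k n) n) ∧
      ((∀ b < (l n).nb, 2 * ((Finset.range (l n).rep).filter fun r =>
        ¬ good b (subVec ω ((b * (l n).rep + r) * K) K)).card < (l n).rep) →
        ys = productBits M uv) := by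
    intro ω
    have hinst : ∀ j, ∃ (S : ℕ → Mem) (tp : ℕ) (ts : ℕ → ℕ),
        ((l n).num ≤ j → ∀ i, S i = fun _ _ => 0) ∧
        (j < (l n).num → Exec (A.wordBound (N n)) A.prep (Mem.init [[(l n).n₁, (l n).n₂, (l n).n],
            matrixWords (subMat M ((l n).row j) ((l n).col j) (l n).n₁ (l n).n₂),
            bitWords (subVec ω (j * K) K)]) (S 0) tp ∧ tp ≤ (N n + 2) ^ cA) ∧
        (j < (l n).num → ∀ i (hi : i < n), Exec (A.wordBound (N n)) A.step ((S i).load 0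
          (bitWords (subVec (uv ⟨i, hi⟩).1 ((l n).row j) (l n).n₁) ++
            bitWords (subVec (uv ⟨i, hi⟩).2 ((l n).col j) (l n).n₂))) (S (i + 1)) (ts i)) ∧
        (j < (l n).num → ∑ i ∈ Finset.range n, ts i ≤ τ (rootFloor k n) n) ∧
        (j < (l n).num → good (j / (l n).rep) (subVec ω (j * K) K) → ∀ i (hi : i < n),
          S (i + 1) 1 1 = (boolForm (subVec (uv ⟨i, hi⟩).1 ((l n).row j) (l n).n₁)
            (subMat M ((l n).row j) ((l n).col j) (l n).n₁ (l n).n₂)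
            (subVec (uv ⟨i, hi⟩).2 ((l n).col j) (l n).n₂)).toNat) := by
      intro j
      by_cases hj : j < (l n).num
      · have hn := hn0 j hj
        obtain ⟨ys, t₀, t₁, hr, ht₀, ht₁⟩ := (hA (I hn (j / (l n).rep))).1 (subVec ω (j * K) K)
        obtain ⟨S, ts, h1, h2, h3, h4⟩ := GammaInstance.exists_trace _ hr
        refine ⟨S, t₀, ts, fun h => absurd hj (by omega), fun _ => ⟨h1, ht₀⟩, fun _ => h2,
          fun _ => h3 ▸ ht₁, fun _ hg => h4 ?_⟩
        obtain ⟨t₀', t₁', hg⟩ := (hgd _ _).1 hg hn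
        -- The run with bounded time and the run with correct answers are the same.
        exact (hr.det hg).1
      · exact ⟨fun _ _ _ => 0, 0, fun _ => 0, fun _ _ => rfl, fun h => absurd h hj,
          fun h => absurd h hj, fun h => absurd h hj, fun h => absurd h hj⟩
    choose S tp ts hS hprep hstep hts hgood using hinst
    obtain ⟨m, t₀, t₁, h1, h2, h3, h4⟩ := exists_split_run (γ := γ) (k := k) (coinExp := A.coinExp)
      (n := n) (l := l n) rfl (V := A.wordBound (N n)) (W := (n + 2) ^ e₂)
      (WU := (rootFloor k n + 2) ^ red.c) (Y := Y n) (D := D) le_rfl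
      ((Nat.le_add_right _ _).trans (he₂ n)) ((Nat.le_add_left _ _).trans (he₂ n)) hk hYB
      (by simp only [Y]; omega) (by simp only [Y]; omega) (by simp only [Y]; omega) M uv
      (bitWords ω) (bitWords_lt ω) (by rw [length_bitWords]; simp only [Y]; omega) hU hmU S tp ts
      (fun j i h => hS j h i) (fun j => bitWords (subVec ω (j * K) K))
      (fun j => length_bitWords _)
      (fun j hj i hi => by
        rw [cell_bitWords_subVec _ hi, if_pos, Nat.add_comm 1]
        calc j * K + i < (j + 1) * K := by have := Nat.add_mul j 1 K; omega
          _ ≤ _ := (Nat.mul_le_mul_right _ hj).trans hnumK)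
      (fun j hj => (hprep j hj).1) hstep
    refine ⟨_, t₀, t₁, ⟨m, h1, h2⟩, h3.trans (le_trans ?_ (he₀ n)), h4.trans ?_, fun hmaj => ?_⟩
    · have : ∑ j ∈ Finset.range (l n).num, tp j ≤ (l n).num * (N n + 2) ^ cA := by
        refine (Finset.sum_le_card_nsmul _ _ _ fun j hj =>
          (hprep j (Finset.mem_range.1 hj)).2).trans ?_
        rw [Finset.card_range, smul_eq_mul]
      exact Nat.add_le_add (Nat.add_le_add_left htU _)
        (Nat.add_le_add_right (Nat.add_le_add_left (Nat.mul_le_mul_left 7 this) _) _)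
    · have : ∑ j ∈ Finset.range (l n).num, ∑ i ∈ Finset.range n, ts j i ≤
          (l n).num * τ (rootFloor k n) n := by
        refine (Finset.sum_le_card_nsmul _ _ _ fun j hj => hts j (Finset.mem_range.1 hj)).trans ?_
        rw [Finset.card_range, smul_eq_mul]
      exact Nat.add_le_add_left (Nat.mul_le_mul_left 7 this) _
    · apply List.ext_getElem
      · simp [productBits]
      · intro i hi _
        have hi : i < n := by simpa using hi
        simp only [productBits, List.getElem_map, List.getElem_range, List.getElem_ofFn]
        have hb := majorities_pos_iff (rep := (l n).rep) (nb := (l n).nb)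
          (inst := fun j => S j (i + 1)) (form := fun b =>
            boolForm (subVec (uv ⟨i, hi⟩).1 (b / (l n).nb₂ * (l n).n₁) (l n).n₁)
            (subMat M (b / (l n).nb₂ * (l n).n₁) (b % (l n).nb₂ * (l n).n₂) (l n).n₁ (l n).n₂)
            (subVec (uv ⟨i, hi⟩).2 (b % (l n).nb₂ * (l n).n₂) (l n).n₂))
          (fun j => ¬ good (j / (l n).rep) (subVec ω (j * K) K))
          (fun b hb r hr hg => by
            have hj : b * (l n).rep + r < (l n).num :=
              calc b * (l n).rep + r < (b + 1) * (l n).rep := by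
                    have := Nat.add_mul b 1 (l n).rep; omega
                _ ≤ _ := Nat.mul_le_mul_right _ hb
            have := hgood _ hj (not_not.1 hg) i hi
            rw [Layout.row, Layout.col, mul_add_div_of_lt hr] at this
            exact this)
          (fun b hb => by
            refine lt_of_le_of_lt ?_ (hmaj b hb)
            refine Nat.mul_le_mul_left _ (Finset.card_le_card fun r hr => ?_)
            rw [Finset.mem_filter, Finset.mem_range] at hr ⊢
            rw [mul_add_div_of_lt hr.1] at hr
            exact hr)
        have hb' := hb.trans (exists_boolForm_block (hp₁ n) (hp₂ n) (uv ⟨i, hi⟩).1 M (uv ⟨i, hi⟩).2)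
        by_cases hf : boolForm (uv ⟨i, hi⟩).1 M (uv ⟨i, hi⟩).2 = true
        · rw [if_pos (hb'.2 hf), hf]; rfl
        · rw [if_neg fun h => hf (hb'.1 h), Bool.eq_false_of_not_eq_true hf]; rfl
  constructor
  · intro ω
    obtain ⟨ys, t₀, t₁, h1, h2, h3, -⟩ := key ω
    exact ⟨ys, t₀, t₁, h1, h2, h3⟩
  · have hle : failureProbability (X n ^ e₁) (fun ω => ∀ b < (l n).nb,
        2 * ((Finset.range (l n).rep).filter fun r =>
          ¬ good b (subVec ω ((b * (l n).rep + r) * K) K)).card < (l n).rep) ≤ 1 / 3 := by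
      refine failureProbability_majorities_le
        (show (l n).rep = 24 * Nat.clog 2 (n + 2) + 24 from rfl) hnumK (hnb n) good fun b hb => ?_
      have hn : 0 < n := hn0 (b * (l n).rep) (Nat.mul_lt_mul_of_pos_right hb hrep)
      exact (failureProbability_mono fun ω h => (hgd b ω).2 fun _ => h).trans (hA (I hn b)).2
    refine (failureProbability_mono fun ω h => ?_).trans hle
    obtain ⟨ys, t₀, t₁, h1, -, -, h4⟩ := key ω
    rw [h4 h] at h1
    exact ⟨t₀, t₁, h1⟩

/-! ### The running time of the OuMv solver -/

theorem Serve.time_pos {W : ℕ} {s : Prog} {m : Mem} {xs ys : List (List ℕ)} {t : ℕ}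
    (h : Serve W s m xs ys t) (hx : xs ≠ []) : 0 < t := by
  cases h with
  | nil => exact absurd rfl hx
  | cons h _ => exact Nat.add_pos_left h.time_pos _

/-- Answering a request costs at least one step. -/
theorem LocalReduction.add_le_time {P : DynamicProblem} {γ : ℝ} {u q n : ℕ → ℕ → ℕ}
    (red : LocalReduction P γ u q n) {C : ℕ} {A : Algorithm} {U Q : ℕ → ℕ}
    (hA : SolvesWithDelayedPredictions P
      (fun D d => ∃ n₁ n₂ : ℕ, 0 < n₂ ∧ n₁ = rows γ n₂ ∧
        P.size D = n n₁ n₂ ∧ d = (1 + C) * (u n₁ n₂ + q n₁ n₂)) A U Q) {n₂ : ℕ} (h₂ : 0 < n₂) :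
    u (rows γ n₂) n₂ + q (rows γ n₂) n₂ ≤
      u (rows γ n₂) n₂ * U (n (rows γ n₂) n₂) + q (rows γ n₂) n₂ * Q (n (rows γ n₂) n₂) := by
  obtain ⟨c, hA⟩ := hA
  let D := red.start (rows γ n₂) n₂ 1 fun _ _ => false
  have hD : P.size D = n (rows γ n₂) n₂ := red.start_size n₂ 1 h₂ Nat.one_pos _
  -- Take the request `r` as a sequence of length one, predicted by itself.
  have key : ∀ r ∈ red.block (rows γ n₂) n₂,
      0 < (if r.isUpdate then 1 else 0) * U (n (rows γ n₂) n₂) +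
        (if r.isQuery then 1 else 0) * Q (n (rows γ n₂) n₂) := by
    intro r hr
    obtain ⟨h, -⟩ := hA D _ ⟨_, n₂, h₂, rfl, hD, rfl⟩ 1 {fun _ => r} (fun _ => r)
      (fun ρ hρ t => by rw [hρ]; exact red.start_allowed n₂ 1 h₂ Nat.one_pos _ r hr)
      (fun ρ hρ => ⟨1, fun t => by rw [hρ], fun t => by simpa using by positivity⟩) (fun _ => r) rfl
    obtain ⟨ys, t₀, t₁, ⟨m, -, hs⟩, -, ht⟩ := h fun _ => false
    have h1 := hs.time_pos (by simp [requestMessages])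
    rw [hD] at ht
    simp only [List.ofFn_succ, List.ofFn_zero, List.countP_cons, List.countP_nil] at ht
    simp only [Nat.zero_add] at ht
    omega
  clear hA
  rw [← red.block_updates n₂ h₂, ← red.block_queries n₂ h₂]
  refine Nat.add_le_add ?_ ?_
  · rcases Nat.eq_zero_or_pos ((red.block (rows γ n₂) n₂).countP Request.isUpdate) with h | h
    · rw [h]; exact Nat.zero_le _
    · obtain ⟨r, hr, hr'⟩ := List.countP_pos_iff.1 h
      have h' := key r hr
      cases r with
      | update x =>
        refine Nat.le_mul_of_pos_right _ ?_
        simpa [Request.isUpdate, Request.isQuery] using h'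
      | query y => exact absurd hr' Bool.false_ne_true
  · rcases Nat.eq_zero_or_pos ((red.block (rows γ n₂) n₂).countP Request.isQuery) with h | h
    · rw [h]; exact Nat.zero_le _
    · obtain ⟨r, hr, hr'⟩ := List.countP_pos_iff.1 h
      have h' := key r hr
      cases r with
      | update x => exact absurd hr' Bool.false_ne_true
      | query y =>
        refine Nat.le_mul_of_pos_right _ ?_
        simpa [Request.isUpdate, Request.isQuery] using h'

theorem ceil_mul_le {n m : ℕ} (hm : 0 < m) (h : m ≤ n) : (n + (m - 1)) / m * m ≤ 2 * n := by
  have := Nat.div_mul_le_self (n + (m - 1)) m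
  omega

/-- The padded blocks have area at most `4 * n ^ 2` in total, since none of them is longer or wider
than the matrix. -/
theorem splitLayout_num_mul_le {γ : ℝ} {k coinExp n : ℕ} (hγ : 0 < γ) (hγk : γ ≤ k)
    (hk : 0 < k) (hn : 0 < n) :
    (splitLayout γ k coinExp n).num * (rows γ (rootFloor k n) * rootFloor k n) ≤
      4 * n ^ 2 * (splitLayout γ k coinExp n).rep := by
  have h₂ : rootFloor k n ≤ n := (Nat.le_self_pow hk.ne' _).trans (rootFloor_pow_le hn)
  have h₁ : rows γ (rootFloor k n) ≤ n :=
    (rows_le_pow hγk (rootFloor_pos k n)).trans (rootFloor_pow_le hn)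
  have e₂ := ceil_mul_le (rootFloor_pos k n) h₂
  have e₁ := ceil_mul_le (rows_pos hγ.le (rootFloor_pos k n)) h₁
  have := Nat.mul_le_mul_right (splitLayout γ k coinExp n).rep (Nat.mul_le_mul e₁ e₂)
  refine le_trans (le_of_eq ?_) (this.trans (le_of_eq ?_))
  · change _ * _ * _ * _ = _
    ring
  · ring

theorem splitLayout_num_pos {γ : ℝ} {k coinExp n : ℕ} (hγ : 0 < γ) (hn : 0 < n) :
    0 < (splitLayout γ k coinExp n).num := by
  have h : ∀ m, 0 < m → 0 < (n + (m - 1)) / m := fun m hm => Nat.div_pos (by omega) hm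
  exact Nat.mul_pos (Nat.mul_pos (h _ (rows_pos hγ.le (rootFloor_pos k n)))
    (h _ (rootFloor_pos k n))) (Nat.lt_of_lt_of_le (by norm_num : 0 < 24) (Nat.le_add_left _ _))

/-- The number of copies grows more slowly than any power of `n`. -/
theorem exists_splitLayout_rep_le_rpow (γ : ℝ) (k coinExp : ℕ) {δ : ℝ} (hδ : 0 < δ) :
    ∃ c : ℝ, 0 < c ∧ ∀ n : ℕ, 0 < n → ((splitLayout γ k coinExp n).rep : ℝ) ≤ c * (n : ℝ) ^ δ := by
  have hl2 : 0 < Real.log 2 := Real.log_pos (by norm_num)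
  refine ⟨24 * (3 ^ δ / δ / Real.log 2) + 48, by positivity, fun n hn => ?_⟩
  have hn1 : (1 : ℝ) ≤ n := by exact_mod_cast hn
  have hnδ : 1 ≤ (n : ℝ) ^ δ := Real.one_le_rpow hn1 hδ.le
  set L := Nat.clog 2 (n + 2) with hL
  have h1 : 2 ^ (L - 1) < n + 2 :=
    Nat.pow_pred_clog_lt_self (b := 2) (x := n + 2) (by norm_num) (by omega)
  have h2 : ((L - 1 : ℕ) : ℝ) * Real.log 2 ≤ (n : ℝ) ^ δ * (3 ^ δ / δ) := by
    have h3 : ((2 : ℝ) ^ (L - 1)) ≤ 3 * n := by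
      have : ((2 ^ (L - 1) : ℕ) : ℝ) ≤ ((n + 2 : ℕ) : ℝ) := by exact_mod_cast h1.le
      push_cast at this
      linarith
    rw [← Real.log_pow]
    calc Real.log (2 ^ (L - 1)) ≤ Real.log (3 * n) := Real.log_le_log (by positivity) h3
      _ ≤ (3 * n : ℝ) ^ δ / δ := Real.log_le_rpow_div (by positivity) hδ
      _ = _ := by rw [Real.mul_rpow (by norm_num) (by positivity)]; ring
  have h4 : ((L - 1 : ℕ) : ℝ) ≤ (n : ℝ) ^ δ * (3 ^ δ / δ / Real.log 2) := by
    rw [← le_div_iff₀ hl2] at h2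
    refine h2.trans (le_of_eq ?_)
    ring
  have h5 : (L : ℝ) ≤ ((L - 1 : ℕ) : ℝ) + 1 := by
    exact_mod_cast (by omega : L ≤ L - 1 + 1)
  have h6 : ((splitLayout γ k coinExp n).rep : ℝ) = 24 * L + 24 := by
    change ((24 * L + 24 : ℕ) : ℝ) = _
    push_cast
    rfl
  rw [h6]
  nlinarith

/-- Both sides of the blocks grow at least like a power of `n`. -/
theorem exists_rpow_le_block {γ : ℝ} (hγ : 0 < γ) {k : ℕ} (hk : 0 < k) :
    ∃ β c : ℝ, 0 < β ∧ 0 < c ∧ ∀ n : ℕ, 0 < n →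
      c * (n : ℝ) ^ β ≤ rows γ (rootFloor k n) ∧ c * (n : ℝ) ^ β ≤ rootFloor k n := by
  have hk' : (0 : ℝ) < k := by exact_mod_cast hk
  let α : ℝ := (k : ℝ)⁻¹
  have hα : 0 < α := by positivity
  refine ⟨min α (α * γ), min (1 / 2) ((1 / 2) ^ γ / 2), lt_min hα (by positivity),
    lt_min (by norm_num) (by positivity), fun n hn => ?_⟩
  have hn1 : (1 : ℝ) ≤ n := by exact_mod_cast hn
  have h2 : 1 / 2 * (n : ℝ) ^ α ≤ rootFloor k n := by
    have h3 : (n : ℝ) ≤ ((rootFloor k n : ℝ) + 1) ^ k := by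
      exact_mod_cast (lt_rootFloor_succ_pow (n := n) hk).le
    have h4 : (n : ℝ) ^ α ≤ rootFloor k n + 1 := by
      refine (Real.rpow_le_rpow (by positivity) h3 hα.le).trans (le_of_eq ?_)
      exact Real.pow_rpow_inv_natCast (by positivity) hk.ne'
    have h5 : (1 : ℝ) ≤ rootFloor k n := by exact_mod_cast rootFloor_pos k n
    linarith
  have h1 : (1 / 2) ^ γ / 2 * (n : ℝ) ^ (α * γ) ≤ rows γ (rootFloor k n) := by
    have h3 : (1 / 2) ^ γ * (n : ℝ) ^ (α * γ) ≤ (rootFloor k n : ℝ) ^ γ := by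
      rw [Real.rpow_mul (by positivity), ← Real.mul_rpow (by norm_num) (by positivity)]
      exact Real.rpow_le_rpow (by positivity) h2 hγ.le
    have h4 : (rootFloor k n : ℝ) ^ γ < rows γ (rootFloor k n) + 1 := Nat.lt_floor_add_one _
    have h5 : (1 : ℝ) ≤ rows γ (rootFloor k n) := by
      exact_mod_cast rows_pos hγ.le (rootFloor_pos k n)
    linarith
  constructor
  · refine le_trans ?_ h1
    exact mul_le_mul (min_le_right _ _)
      (Real.rpow_le_rpow_of_exponent_le hn1 (min_le_right _ _)) (by positivity) (by positivity)
  · refine le_trans ?_ h2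
    exact mul_le_mul (min_le_left _ _)
      (Real.rpow_le_rpow_of_exponent_le hn1 (min_le_left _ _)) (by positivity) (by positivity)

/-- The time of the OuMv solver, up to a constant factor. -/
theorem split_time_le {γ : ℝ} {k coinExp n a s s' κ : ℕ} (hγ : 0 < γ) (hn : 0 < n)
    (ha : s + s' ≤ a) :
    n * (600 * (((splitLayout γ k coinExp n).num + 1) *
        ((splitLayout γ k coinExp n).n₁ + (splitLayout γ k coinExp n).n₂ + 1) +
          (splitLayout γ k coinExp n).nb)) +
        7 * ((splitLayout γ k coinExp n).num * (κ * (n * a +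
          n * (rows γ (rootFloor k n) + rootFloor k n + s + s' + 1)))) ≤
      (3000 + 14 * κ) * ((splitLayout γ k coinExp n).num *
        (n * a + n * (rows γ (rootFloor k n) + rootFloor k n))) := by
  have hnum := splitLayout_num_pos (γ := γ) (k := k) (coinExp := coinExp) hγ hn
  have hnb : (splitLayout γ k coinExp n).nb ≤ (splitLayout γ k coinExp n).num :=
    Nat.le_mul_of_pos_right _ (Nat.lt_of_lt_of_le (by norm_num : 0 < 24) (Nat.le_add_left _ _))
  have h₂ : 0 < rootFloor k n := rootFloor_pos k n
  change n * (600 * ((_ + 1) * (rows γ (rootFloor k n) + rootFloor k n + 1) + _)) + _ ≤ _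
  generalize (splitLayout γ k coinExp n).num = G at *
  generalize (splitLayout γ k coinExp n).nb = b at *
  obtain ⟨x, hx⟩ : ∃ x, rows γ (rootFloor k n) + rootFloor k n = x := ⟨_, rfl⟩
  rw [hx]
  have hx1 : 1 ≤ x := by omega
  have h1 : (G + 1) * (x + 1) + b ≤ 5 * (G * x) := by
    have e1 : (G + 1) * (x + 1) ≤ (2 * G) * (2 * x) := Nat.mul_le_mul (by omega) (by omega)
    have e2 : G ≤ G * x := Nat.le_mul_of_pos_right _ hx1
    have e3 : 2 * G * (2 * x) = 4 * (G * x) := by ring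
    omega
  have h2 : n * a + n * (x + s + s' + 1) ≤ 2 * (n * a + n * x) := by
    have e1 : n * (x + s + s' + 1) ≤ n * (2 * x + a) := Nat.mul_le_mul_left _ (by omega)
    have e2 : n * (2 * x + a) = 2 * (n * x) + n * a := by ring
    omega
  calc n * (600 * ((G + 1) * (x + 1) + b)) + 7 * (G * (κ * (n * a + n * (x + s + s' + 1))))
      ≤ n * (600 * (5 * (G * x))) + 7 * (G * (κ * (2 * (n * a + n * x)))) := by gcongr
    _ = 3000 * (G * (n * x)) + 14 * κ * (G * (n * a + n * x)) := by ring
    _ ≤ 3000 * (G * (n * a + n * x)) + 14 * κ * (G * (n * a + n * x)) := by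
      gcongr; exact Nat.le_add_left _ _
    _ = _ := by ring

/-- If the time per round is small on average for blocks of all large sizes, then the OuMv solver
takes time `O(n ^ (3 - δ))` for some `δ > 0`: the blocks have at least polynomial size, which makes
up for the logarithmic number of copies. -/
theorem exists_isBigO_of_isPolyLower {γ : ℝ} (hγ : 0 < γ) {k : ℕ} (hk : 0 < k) (hγk : γ ≤ k)
    (coinExp : ℕ) {a : ℕ → ℕ → ℕ}
    (ha : IsPolyLower (fun n₁ n₂ _ => n₁ = rows γ n₂) (fun n₁ n₂ n₃ => n₃ * a n₁ n₂) 1 1 1)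
    {t : ℕ → ℕ} {κ : ℕ} (ht : ∀ n, 0 < n → t n ≤ κ * ((splitLayout γ k coinExp n).num *
      (n * a (rows γ (rootFloor k n)) (rootFloor k n) +
        n * (rows γ (rootFloor k n) + rootFloor k n)))) :
    ∃ δ : ℝ, 0 < δ ∧ (fun n : ℕ => (t n : ℝ)) =O[atTop] fun n : ℕ => (n : ℝ) ^ (3 - δ) := by
  obtain ⟨ε₀, N, K, hε₀, hN, hK, ha⟩ := ha
  obtain ⟨β, c, hβ, hc, hblock⟩ := exists_rpow_le_block hγ hk
  -- The time for passing on the vectors saves only a factor `n₁` or `n₂`, hence `ε ≤ 1`.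
  let ε := min ε₀ 1
  have hε : 0 < ε := lt_min hε₀ one_pos
  have hδ : 0 < β * ε / 2 := by positivity
  obtain ⟨c', hc', hrep⟩ := exists_splitLayout_rep_le_rpow γ k coinExp hδ
  -- The saving is `n ^ (β * ε)`; one half of the exponent is spent on the number of copies.
  refine ⟨β * ε / 2, hδ, ?_⟩
  refine IsBigO.of_bound (κ * (4 * c' * ((3 * K + 2) * c ^ (-ε)))) ?_
  have hlarge : ∀ᶠ n : ℕ in atTop, N < c * (n : ℝ) ^ β ∧ N < (n : ℝ) := by
    have h1 : Tendsto (fun n : ℕ => c * (n : ℝ) ^ β) atTop atTop :=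
      ((tendsto_rpow_atTop hβ).comp tendsto_natCast_atTop_atTop).const_mul_atTop hc
    exact (h1.eventually_gt_atTop N).and (tendsto_natCast_atTop_atTop.eventually_gt_atTop N)
  filter_upwards [hlarge, eventually_gt_atTop 0] with n hlarge hn
  have hn1 : (1 : ℝ) ≤ n := by exact_mod_cast hn
  have hn0 : (0 : ℝ) < n := by linarith
  obtain ⟨hb₁, hb₂⟩ := hblock n hn
  obtain ⟨n₁, hn₁⟩ : ∃ n₁, rows γ (rootFloor k n) = n₁ := ⟨_, rfl⟩
  have hnum := splitLayout_num_mul_le (coinExp := coinExp) hγ hγk hk hn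
  have hn₁pos := rows_pos hγ.le (rootFloor_pos k n)
  have hn₂pos := rootFloor_pos k n
  have hn₂le : rootFloor k n ≤ n := (Nat.le_self_pow hk.ne' _).trans (rootFloor_pow_le hn)
  have ha' := ha n₁ (rootFloor k n) n hn₁.symm (by rw [← hn₁]; linarith) (by linarith) hlarge.2
  have ht := ht n hn
  have hrep := hrep n hn
  rw [hn₁] at hb₁ hnum hn₁pos ht
  generalize rootFloor k n = n₂ at *
  generalize (splitLayout γ k coinExp n).num = G at *
  generalize (splitLayout γ k coinExp n).rep = ρ at *
  set y := c * (n : ℝ) ^ β with hy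
  have hy0 : 0 < y := by positivity
  have h₁ : (1 : ℝ) ≤ n₁ := by exact_mod_cast hn₁pos
  have h₂ : (1 : ℝ) ≤ n₂ := by exact_mod_cast hn₂pos
  have hyn : y ≤ n := hb₂.trans (by exact_mod_cast hn₂le)
  -- All of `n₁`, `n₂` and `n` are at least `y`, so that a saving in any of them is a factor `y ^ (-ε)`.
  have hpow : ∀ x e : ℝ, 1 ≤ x → y ≤ x → ε ≤ e → x ^ (1 - e) ≤ x * y ^ (-ε) := by
    intro x e hx hyx he
    rw [sub_eq_add_neg, Real.rpow_add (by linarith), Real.rpow_one]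
    refine mul_le_mul_of_nonneg_left ?_ (by linarith)
    exact (Real.rpow_le_rpow_of_exponent_le hx (by linarith)).trans
      (Real.rpow_le_rpow_of_nonpos hy0 hyx (by linarith))
  have hone : ∀ x : ℝ, 1 ≤ x → y ≤ x → 1 ≤ x * y ^ (-ε) := by
    intro x hx hyx
    simpa using hpow x 1 hx hyx (min_le_right _ _)
  set z := y ^ (-ε) with hz
  have hz0 : 0 < z := by positivity
  -- The cost of the requests and the cost of passing on the vectors.
  have hA : (n : ℝ) * a n₁ n₂ ≤ 3 * K * (n₁ * n₂ * n * z) := by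
    simp only [Real.rpow_one] at ha'
    push_cast at ha'
    have e₁ := hpow n₁ ε₀ h₁ hb₁ (min_le_left _ _)
    have e₂ := hpow n₂ ε₀ h₂ hb₂ (min_le_left _ _)
    have e₃ := hpow n ε₀ hn1 hyn (min_le_left _ _)
    calc (n : ℝ) * a n₁ n₂ ≤ _ := ha'
      _ ≤ K * (n₁ * z * n₂ * n + n₁ * (n₂ * z) * n + n₁ * n₂ * (n * z)) := by gcongr
      _ = _ := by ring
  have hB : (n : ℝ) * (n₁ + n₂) ≤ 2 * (n₁ * n₂ * n * z) := by
    have e₁ := hone n₁ h₁ hb₁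
    have e₂ := hone n₂ h₂ hb₂
    calc (n : ℝ) * (n₁ + n₂) = n * (n₁ * 1 + 1 * n₂) := by ring
      _ ≤ n * (n₁ * (n₂ * z) + n₁ * z * n₂) := by gcongr
      _ = _ := by ring
  have hnum' : (G : ℝ) * (n₁ * n₂) ≤ 4 * n ^ 2 * ρ := by exact_mod_cast hnum
  have ht' : (t n : ℝ) ≤ κ * (G * (n * a n₁ n₂ + n * (n₁ + n₂))) := by exact_mod_cast ht
  have hexp : (n : ℝ) ^ 3 * (n : ℝ) ^ (β * ε / 2) * ((n : ℝ) ^ β) ^ (-ε) =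
      (n : ℝ) ^ (3 - β * ε / 2) := by
    rw [← Real.rpow_natCast, ← Real.rpow_mul hn0.le, ← Real.rpow_add hn0, ← Real.rpow_add hn0]
    congr 1
    push_cast
    ring
  rw [Real.norm_of_nonneg (by positivity), Real.norm_of_nonneg (by positivity)]
  calc (t n : ℝ) ≤ κ * (G * (n * a n₁ n₂ + n * (n₁ + n₂))) := ht'
    _ ≤ κ * (G * (3 * K * (n₁ * n₂ * n * z) + 2 * (n₁ * n₂ * n * z))) := by gcongr
    _ = κ * ((G * (n₁ * n₂)) * ((3 * K + 2) * (n * z))) := by ring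
    _ ≤ κ * ((4 * n ^ 2 * (c' * (n : ℝ) ^ (β * ε / 2))) * ((3 * K + 2) * (n * z))) := by
      have : (G : ℝ) * (n₁ * n₂) ≤ 4 * n ^ 2 * (c' * (n : ℝ) ^ (β * ε / 2)) :=
        hnum'.trans (by gcongr)
      gcongr
    _ = κ * (4 * c' * ((3 * K + 2) * c ^ (-ε))) *
        ((n : ℝ) ^ 3 * (n : ℝ) ^ (β * ε / 2) * ((n : ℝ) ^ β) ^ (-ε)) := by
      rw [hz, hy, Real.mul_rpow hc.le (by positivity)]; ring
    _ = _ := by rw [hexp]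

end DelayedPredictions

theorem mainTheorem1 (γ : ℝ) (hγ : 0 < γ) (u q n : ℕ → ℕ → ℕ)
    (P : DelayedPredictions.DynamicProblem)
    (red : DelayedPredictions.LocalReduction P γ u q n) (C : ℕ)
    (hC : ∀ n₂ : ℕ, 0 < n₂ → ∀ x : ℕ,
      DelayedPredictions.Request.update x ∈ red.block (DelayedPredictions.rows γ n₂) n₂ →
        red.order (DelayedPredictions.rows γ n₂) n₂ x ≤ C)
    (hOuMv : DelayedPredictions.OuMvConjecture) :
    ¬ ∃ (A : DelayedPredictions.Algorithm) (U Q : ℕ → ℕ),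
      DelayedPredictions.SolvesWithDelayedPredictions P
        (fun D d => ∃ n₁ n₂ : ℕ, 0 < n₂ ∧ n₁ = DelayedPredictions.rows γ n₂ ∧
          P.size D = n n₁ n₂ ∧ d = (1 + C) * (u n₁ n₂ + q n₁ n₂)) A U Q ∧
      DelayedPredictions.IsPolyLower (fun n₁ n₂ _ => n₁ = DelayedPredictions.rows γ n₂)
        (fun n₁ n₂ n₃ => n₃ * (u n₁ n₂ * U (n n₁ n₂) + q n₁ n₂ * Q (n n₁ n₂))) 1 1 1 := by
  rintro ⟨A, U, Q, hA, hlow⟩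
  obtain ⟨A₁, κ, hA₁⟩ := DelayedPredictions.exists_solvesGammaOuMv red hC hA
  have hk : 0 < ⌈γ⌉₊ := Nat.ceil_pos.2 hγ
  obtain ⟨A₂, hA₂⟩ := DelayedPredictions.exists_solvesOuMv red hγ hk (Nat.le_ceil γ) hA₁
  obtain ⟨δ, hδ, ht⟩ := DelayedPredictions.exists_isBigO_of_isPolyLower hγ hk (Nat.le_ceil γ)
    A₁.coinExp hlow fun m hm => DelayedPredictions.split_time_le (κ := κ) hγ hm
      (red.add_le_time hA (DelayedPredictions.rootFloor_pos _ m))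
  exact hOuMv δ hδ ⟨A₂, _, hA₂, ht⟩
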